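/- A *graph* is a finite connected CW complex $G$ of dimension exactly $1$ such that the closure of each edge ($1$-cell) is homeomorphic to a closed interval (multiple edges are allowed); the *degree* of a vertex is the number of edges whose closure contains it. A map from $G$ to $\mathbb{R}^k$ is *piecewise smooth* if it is continuous and, on each open cell, is smooth at every point outside some set of Lebesgue measure $0$; a *piecewise smooth embedding* is a piecewise smooth map which is a topological embedding. Let $\pi_{2,1}:\mathbb{R}^2\to\mathbb{R}$, $\pi_{2,1}(x_1,x_2)=x_1$. A piecewise smooth embedding $e:G\to\mathbb{R}^2$ is *M-generic with respect to $\pi_{2,1}$* if $\pi_{2,1}\circ e$ is a piecewise smooth embedding on each edge and, for every vertex $v$ of degree at least $2$ and every (arbitrarily small) neighborhood $N$ of $v$, the value $\pi_{2,1}(e(v))$ lies in the interior of $\pi_{2,1}(e(N))\subset\mathbb{R}$. **Theorem 1.** Let $G$ be a graph that admits a piecewise smooth embedding into $\mathbb{R}^2$ which is M-generic with respect to $\pi_{2,1}$. Then there exist 1. a non-empty open set $D\subset\mathbb{R}^2$ and circles $S_1,\dots,S_l$ ($l>0$) such that $\overline{D}\setminus D\subset\bigcup_j S_j$; $S_j\cap\overline{D}\neq\emptyset$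 for every $j$; whenever $S_i$ and $S_j$ with $i\ne j$ meet at a point of $\overline{D}$, non-zero tangent vectors of $S_i$ and $S_j$ there are linearly independent; and no three of the circles (with distinct indices) have a common point in $\overline{D}$; 2. real polynomials $f_1,\dots,f_l$ of degree $2$ in two variables with $S_j=\{f_j=0\}$ for all $j$ and $\overline{D}=\{x\mid f_j(x)\ge 0 \text{ for all } j\}$; 3. a positive integer $l'$, a surjection $m:\{1,\dots,l\}\to\{1,\dots,l'\}$ such that $m(i)\ne m(j)$ whenever $i\neq j$ and $S_i\cap S_j\cap\overline{D}\ne\emptyset$, and positive integers $I_1,\dots,I_{l'}$, such that the set $$M=\Bigl\{(x,y_1,\dots,y_{l'})\in\mathbb{R}^2\times\prod_{c=1}^{l'}\mathbb{R}^{I_c+1}\ \Bigm|\ \prod_{j:\,m(j)=c}f_j(x)=\|y_c\|^2\ \text{ for } c=1,\dots,l'\Bigr\}$$ has the following properties. It is non-empty, compact and connected, and it is a non-singular real algebraic manifold: the differential of the polynomial map defining it is surjective at each of its points. The projection $(x,y)\mapsto x$ maps $M$ onto $\overline{D}$. The real algebraic function $f:M\to\mathbb{R}$, $f(x,y)=\pi_{2,1}(x)$,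 is Morse–Bott: near each of its singular points it is the composition of a submersion onto an open subset of some $\mathbb{R}^k$ with a Morse function there. The function $f$ has only finitely many singular values, and its Reeb graph (the quotient space of $M$ obtained by collapsing each connected component of each level set of $f$ to a point) is homeomorphic to $G$. -/

import Mathlib

open Topology
open scoped ContDiff

namespace ReebPlanar

/-- The canonical projection `π_{2,1}` of the plane onto its first coordinate. -/
def proj21 (x : EuclideanSpace ℝ (Fin 2)) : ℝ := x 0

section Graphs

variable (G : Type*) [TopologicalSpace G] [CWComplex (Set.univ : Set G)]

/-- The vertices and the edges of `G`, indexed by the `0`-cells and the `1`-cells. -/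
abbrev Vert := RelCWComplex.cell (Set.univ : Set G) 0

/-- The index type of the edges of `G`. -/
abbrev Edge := RelCWComplex.cell (Set.univ : Set G) 1

/-- A graph: a finite connected CW complex of dimension exactly `1` in which the closure of every
edge is a closed interval (embedded by the characteristic map). Multiple edges are allowed. -/
structure IsGraph : Prop where
  finite_vert : Finite (Vert G)
  finite_edge : Finite (Edge G)
  no_higher_cell : ∀ n : ℕ, 2 ≤ n → IsEmpty (RelCWComplex.cell (Set.univ : Set G) n)
  exists_edge : Nonempty (Edge G)
  closed_edge : ∀ i : Edge G, Set.InjOn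
    (RelCWComplex.map (C := (Set.univ : Set G)) 1 i) (Metric.closedBall 0 1)
  connected : ConnectedSpace G

variable {G}

/-- The point of `G` given by a `0`-cell. -/
def vertexPoint (v : Vert G) : G := RelCWComplex.map (C := (Set.univ : Set G)) 0 v 0

/-- The degree of a vertex: the number of edges whose closure contains it. -/
noncomputable def degree (v : Vert G) : ℕ :=
  Set.ncard {i : Edge G | vertexPoint v ∈ RelCWComplex.closedCell (C := (Set.univ : Set G)) 1 i}

variable {Y : Type*} [NormedAddCommGroup Y] [NormedSpace ℝ Y]

/-- On the open cell `i` of dimension `n`, with the smooth structure of its characteristic map,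
`f` is smooth at all points outside a set of Lebesgue measure zero. -/
def PiecewiseSmoothOnCell (f : G → Y) (n : ℕ) (i : RelCWComplex.cell (Set.univ : Set G) n) : Prop :=
  ∃ N : Set (Fin n → ℝ), MeasureTheory.volume N = 0 ∧
    ∀ t ∈ Metric.ball (0 : Fin n → ℝ) 1 \ N,
      ContDiffAt ℝ ∞ (fun u => f (RelCWComplex.map (C := (Set.univ : Set G)) n i u)) t

/-- A piecewise smooth embedding: a topological embedding that is piecewise smooth. -/
structure IsPiecewiseSmoothEmbedding (f : G → Y) : Prop where
  isEmbedding : IsEmbedding f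
  smooth : ∀ (n : ℕ) (i : RelCWComplex.cell (Set.univ : Set G) n), PiecewiseSmoothOnCell f n i

/-- Genericity with respect to `π_{2,1}`: on every edge, `π_{2,1} ∘ e` is a piecewise smooth
embedding. -/
def IsGeneric (e : G → EuclideanSpace ℝ (Fin 2)) : Prop :=
  ∀ i : Edge G, PiecewiseSmoothOnCell (fun p => proj21 (e p)) 1 i ∧
    IsEmbedding ((RelCWComplex.openCell (C := (Set.univ : Set G)) 1 i).domRestrict
      (fun p => proj21 (e p)))

/-- M-genericity with respect to `π_{2,1}`: genericity, and at each vertex of degree at least `2`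
the image under `π_{2,1} ∘ e` of every (arbitrarily small) neighbourhood contains the value at the
vertex in its interior. -/
structure IsMGeneric (e : G → EuclideanSpace ℝ (Fin 2)) : Prop where
  generic : IsGeneric e
  interior : ∀ v : Vert G, 2 ≤ degree v → ∀ N ∈ 𝓝 (vertexPoint v),
    proj21 (e (vertexPoint v)) ∈ interior ((fun p => proj21 (e p)) '' N)

end Graphs

section Reeb

variable {X : Type*} [TopologicalSpace X]

/-- Two points are identified when they lie in the same connected component of the same level
set of `f`. -/
def reebSetoid (f : X → ℝ) : Setoid X where
  r x y := y ∈ connectedComponentIn (f ⁻¹' {f x}) x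
  iseqv := by
    have key : ∀ x y : X, y ∈ connectedComponentIn (f ⁻¹' {f x}) x →
        connectedComponentIn (f ⁻¹' {f y}) y = connectedComponentIn (f ⁻¹' {f x}) x := by
      intro x y h
      have hy : f y = f x := (connectedComponentIn_subset _ _ h : y ∈ f ⁻¹' {f x})
      rw [hy]
      exact (connectedComponentIn_eq h).symm
    refine ⟨fun x => mem_connectedComponentIn rfl, ?_, ?_⟩
    · intro x y h
      rw [key x y h]
      exact mem_connectedComponentIn rfl
    · intro x y z h h'
      rw [key x y h] at h'
      exact h'

/-- The Reeb space of `f`, with the quotient topology. -/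
def ReebSpace (f : X → ℝ) : Type _ := Quotient (reebSetoid f)

instance (f : X → ℝ) : TopologicalSpace (ReebSpace f) :=
  inferInstanceAs (TopologicalSpace (Quotient (reebSetoid f)))

end Reeb

section RealAlgebraic

variable {σ τ : Type*} [Fintype σ] [Fintype τ]

/-- The real polynomial map with components `P`. -/
noncomputable def polyMap (P : τ → MvPolynomial σ ℝ) (x : EuclideanSpace ℝ σ) :
    EuclideanSpace ℝ τ :=
  WithLp.toLp 2 (fun k => MvPolynomial.eval (fun i => x i) (P k))

/-- The zero set of the polynomial map with components `P`. -/
def zeroSet (P : τ → MvPolynomial σ ℝ) : Set (EuclideanSpace ℝ σ) := {x | polyMap P x = 0}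

/-- `M` is a real algebraic manifold with defining polynomial map `P`: it is a non-empty union of
connected components of the zero set of `P`, and the differential of `P` has full rank at every
point of the zero set. -/
structure IsRealAlgebraicManifold (P : τ → MvPolynomial σ ℝ) (M : Set (EuclideanSpace ℝ σ)) :
    Prop where
  nonempty : M.Nonempty
  subset : M ⊆ zeroSet P
  union_components : ∀ x ∈ M, connectedComponentIn (zeroSet P) x ⊆ M
  nonsingular : ∀ x ∈ zeroSet P, Function.Surjective (fderiv ℝ (polyMap P) x)

/-- The tangent space at `x` of a real algebraic manifold with defining polynomial map `P`. -/
noncomputable def tangentSpaceAt (P : τ → MvPolynomial σ ℝ) (x : EuclideanSpace ℝ σ) :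
    Submodule ℝ (EuclideanSpace ℝ σ) :=
  LinearMap.ker (fderiv ℝ (polyMap P) x).toLinearMap

/-- The singular points of the restriction to `M` of a smooth function `f`: the differential
vanishes on the tangent space. -/
def singularSet (P : τ → MvPolynomial σ ℝ) (M : Set (EuclideanSpace ℝ σ))
    (f : EuclideanSpace ℝ σ → ℝ) : Set (EuclideanSpace ℝ σ) :=
  {x | x ∈ M ∧ ∀ v ∈ tangentSpaceAt P x, fderiv ℝ f x v = 0}

/-- `g` is a Morse function on the open set `O ⊆ ℝᵏ`: it is smooth there, and around each singular
point `q` it equals `g q` plus a sum of squares with signs (negative on `J`) of all the coordinates,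
for suitable smooth local coordinates `φ` centred at `q`. -/
def IsMorseOn {k : ℕ} (g : EuclideanSpace ℝ (Fin k) → ℝ) (O : Set (EuclideanSpace ℝ (Fin k))) :
    Prop :=
  IsOpen O ∧ ContDiffOn ℝ ∞ g O ∧ ∀ q ∈ O, fderiv ℝ g q = 0 →
    ∃ (φ : OpenPartialHomeomorph (EuclideanSpace ℝ (Fin k)) (EuclideanSpace ℝ (Fin k)))
      (J : Finset (Fin k)),
      q ∈ φ.source ∧ φ.source ⊆ O ∧ φ q = 0 ∧
      ContDiffOn ℝ ∞ φ φ.source ∧ ContDiffOn ℝ ∞ φ.symm φ.target ∧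
      ∀ x ∈ φ.source, g x = g q + ∑ j ∈ Jᶜ, (φ x j) ^ 2 - ∑ j ∈ J, (φ x j) ^ 2

/-- The restriction of the smooth function `f` to the real algebraic manifold `M` is Morse-Bott:
around each of its singular points it is the composition of a submersion `s` from a neighbourhood
in `M` to some `ℝᵏ` with a Morse function `g`. -/
def IsMorseBott (P : τ → MvPolynomial σ ℝ) (M : Set (EuclideanSpace ℝ σ))
    (f : EuclideanSpace ℝ σ → ℝ) : Prop :=
  ContDiff ℝ ∞ f ∧ ∀ p ∈ singularSet P M f,
    ∃ (W : Set (EuclideanSpace ℝ σ)) (k : ℕ)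
      (s : EuclideanSpace ℝ σ → EuclideanSpace ℝ (Fin k))
      (O : Set (EuclideanSpace ℝ (Fin k))) (g : EuclideanSpace ℝ (Fin k) → ℝ),
      IsOpen W ∧ p ∈ W ∧ ContDiffOn ℝ ∞ s W ∧
      (∀ q ∈ M ∩ W, ∀ w : EuclideanSpace ℝ (Fin k),
        ∃ v ∈ tangentSpaceAt P q, fderiv ℝ s q v = w) ∧
      IsMorseOn g O ∧ (∀ q ∈ M ∩ W, s q ∈ O ∧ f q = g (s q))

end RealAlgebraic

/-- A region `D` of the plane bounded by circles `S j`, with the data that determine a real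
algebraic manifold over its closure: quadratic polynomials `f j` defining the circles, a colouring
of the circles, and a positive integer for each colour. -/
structure CircleRegion where
  /-- the region -/
  D : Set (EuclideanSpace ℝ (Fin 2))
  isOpen_D : IsOpen D
  nonempty_D : D.Nonempty
  /-- the number of circles -/
  l : ℕ
  l_pos : 0 < l
  /-- the centers of the circles -/
  center : Fin l → EuclideanSpace ℝ (Fin 2)
  /-- the radii of the circles -/
  radius : Fin l → ℝ
  radius_pos : ∀ j, 0 < radius j
  boundary_subset : closure D \ D ⊆ ⋃ j, Metric.sphere (center j) (radius j)
  circle_meets : ∀ j, (Metric.sphere (center j) (radius j) ∩ closure D).Nonempty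
  /-- two distinct circles that meet at a point of `closure D` have independent tangent vectors -/
  transverse : ∀ i j, i ≠ j →
    ∀ x ∈ Metric.sphere (center i) (radius i) ∩ Metric.sphere (center j) (radius j) ∩ closure D,
    ∀ v w : EuclideanSpace ℝ (Fin 2), v ≠ 0 → w ≠ 0 →
      inner ℝ (x - center i) v = 0 → inner ℝ (x - center j) w = 0 → LinearIndependent ℝ ![v, w]
  no_triple : ∀ i j k, i ≠ j → j ≠ k → i ≠ k →
    Metric.sphere (center i) (radius i) ∩ Metric.sphere (center j) (radius j) ∩
      Metric.sphere (center k) (radius k) ∩ closure D = ∅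
  /-- the number of colours -/
  l' : ℕ
  l'_pos : 0 < l'
  /-- the colour of each circle -/
  colour : Fin l → Fin l'
  colour_surjective : Function.Surjective colour
  colour_ne : ∀ i j, i ≠ j →
    (Metric.sphere (center i) (radius i) ∩ Metric.sphere (center j) (radius j) ∩
      closure D).Nonempty → colour i ≠ colour j
  /-- the dimension of the sphere associated with each colour -/
  dim : Fin l' → ℕ
  dim_pos : ∀ c, 0 < dim c
  /-- the quadratic polynomials defining the circles -/
  f : Fin l → MvPolynomial (Fin 2) ℝ
  degree_f : ∀ j, (f j).totalDegree = 2
  circle_eq : ∀ j, Metric.sphere (center j) (radius j) =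
    {x : EuclideanSpace ℝ (Fin 2) | MvPolynomial.eval (fun i => x i) (f j) = 0}
  closure_eq : closure D =
    {x : EuclideanSpace ℝ (Fin 2) | ∀ j, 0 ≤ MvPolynomial.eval (fun i => x i) (f j)}

namespace CircleRegion

variable (R : CircleRegion)

/-- The coordinates of `ℝ² × ∏ c, ℝ ^ (dim c + 1)`. -/
abbrev Coord : Type := Fin 2 ⊕ (Σ c : Fin R.l', Fin (R.dim c + 1))

/-- For each colour `c`, the polynomial `∏ f j (x) - ‖y c‖²`, the product running over the circles
`j` of colour `c`. -/
noncomputable def poly (c : Fin R.l') : MvPolynomial R.Coord ℝ :=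
  (∏ j with R.colour j = c, MvPolynomial.rename Sum.inl (R.f j)) -
    ∑ k : Fin (R.dim c + 1), MvPolynomial.X (Sum.inr ⟨c, k⟩) ^ 2

/-- The set `M` of all `(x, y)` with `∏ f j (x) = ‖y c‖²` for each colour `c`. -/
def manifold : Set (EuclideanSpace ℝ R.Coord) := zeroSet R.poly

/-- The canonical projection to the plane. -/
def proj (p : EuclideanSpace ℝ R.Coord) : EuclideanSpace ℝ (Fin 2) :=
  WithLp.toLp 2 (fun i => p (Sum.inl i))

/-- The composition of the canonical projection to the plane with `π_{2,1}`. -/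
def height (p : EuclideanSpace ℝ R.Coord) : ℝ := proj21 (R.proj p)

end CircleRegion

end ReebPlanar

/-!
The graph is realized by a region of the plane bounded by two large circles, whose discs contain the
region, and by many unit circles, whose discs are removed from it. The region is to be a thickened
drawing of the graph, such that its intersections with vertical lines have exactly one component for
each point of the graph on the line.

**From circles to manifolds.** Let circles bound a compact region such that within the region they
cross transversally, without triple points, and not at points of vertical tangents
(`CircleSystem.IsGeneric`). All circles get different colours, with circles as fibre spheres, so the
manifold consists of the points `(x, y)` with `f c (x) = ‖y c‖ ^ 2` for each circle `c`. It is
parametrized by the region and angles, hence compact, and connected over connected sets. Its height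
function is singular only over points of vertical tangents and over crossings. There, explicit
coordinates make it a constant plus a signed sum of squares of rescaled coordinates, to which the
inverse function theorem applies (`exists_isMorseOn_of_rescaled`). A continuous surjection from the
region to `G`, with connected fibres contained in vertical lines, identifies the Reeb space with `G`
(`CircleSystem.IsGeneric.exists_circleRegion`).

**Diagrams of discs.** The removed unit discs are centered on the integral columns of a large lens
(`Diagram`). Discs of adjacent columns whose heights differ little are linked: they overlap and form
walls. The walls bound bands, which are thickened edges. At a branching vertex a wall begins or
ends; at a vertex of degree one inside the lens, a wall splits in two and the band ends at the tip
of the overlap of two discs; the first and the last vertex are the corners of the lens. With the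
gaps of the columns labelled by edges and vertices (`Labelling`), the maps of the bands to the edges
glue to a map from the region to `G` (`Labelling.exists_circleRegion`).

**From embeddings to diagrams.** For an M-generic embedding, the edges are graphs of functions of
the first coordinate, and a vertex has edges on both sides or only one edge (`exists_drawing`).
Moving a vertical line from left to right gives the list of the edges that it meets, ordered by
height; at a vertex, the consecutive edges that end there are replaced by those that start there
(`Sweep`). By the intermediate value theorem the order of two edges never changes. At each vertex
discs are put at suitable heights, and between the vertices the heights are interpolated in small
steps (`Sweep.Heights.labelling`). Connectedness of the graph ensures that the line always meets an
edge.
-/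

namespace ReebPlanar

/-! ### Local diffeomorphisms and Morse charts -/

/-- The inverse function theorem for a map that is smooth on an open set, with the local inverse
smooth on its whole domain. -/
theorem exists_smooth_openPartialHomeomorph {E F : Type*} [NormedAddCommGroup E] [NormedSpace ℝ E]
    [CompleteSpace E] [NormedAddCommGroup F] [NormedSpace ℝ F] {U : Set E} (hU : IsOpen U) {a : E}
    (ha : a ∈ U) {φ : E → F} (hφ : ContDiffOn ℝ ∞ φ U) {φ' : E ≃L[ℝ] F}
    (hd : HasFDerivAt φ (φ' : E →L[ℝ] F) a) :
    ∃ Φ : OpenPartialHomeomorph E F, a ∈ Φ.source ∧ Φ.source ⊆ U ∧ (∀ x, Φ x = φ x) ∧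
      ContDiffOn ℝ ∞ Φ Φ.source ∧ ContDiffOn ℝ ∞ Φ.symm Φ.target := by
  have hat : ContDiffAt ℝ ∞ φ a := hφ.contDiffAt (hU.mem_nhds ha)
  have hn : (∞ : WithTop ℕ∞) ≠ 0 := by simp
  let Φ₀ := hat.toOpenPartialHomeomorph φ hd hn
  let V : Set E := U ∩ fderiv ℝ φ ⁻¹' Set.range ((↑) : (E ≃L[ℝ] F) → E →L[ℝ] F)
  have hV : IsOpen V :=
    (hφ.continuousOn_fderiv_of_isOpen hU (by simp)).isOpen_inter_preimage hU
      ContinuousLinearEquiv.isOpen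
  have haV : a ∈ V := ⟨ha, φ', hd.fderiv.symm⟩
  have hcoe : ∀ x, Φ₀ x = φ x := fun x => rfl
  let Φ := Φ₀.restrOpen V hV
  have hsrc : Φ.source = Φ₀.source ∩ V := Φ₀.restrOpen_source V hV
  have hΦ : ∀ x, Φ x = φ x := fun x => rfl
  refine ⟨Φ, ?_, ?_, hΦ, ?_, ?_⟩
  · rw [hsrc]
    exact ⟨hat.mem_toOpenPartialHomeomorph_source hd hn, haV⟩
  · rw [hsrc]
    exact fun x hx => hx.2.1
  · refine (hφ.mono ?_).congr fun x _ => hΦ x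
    rw [hsrc]
    exact fun x hx => hx.2.1
  · intro y hy
    have hx : Φ.symm y ∈ Φ.source := Φ.map_target hy
    have hx' := hx
    rw [hsrc] at hx'
    obtain ⟨-, hxU, e, he⟩ := hx'
    have hat' : ContDiffAt ℝ ∞ φ (Φ.symm y) := hφ.contDiffAt (hU.mem_nhds hxU)
    have hd' : HasFDerivAt φ (e : E →L[ℝ] F) (Φ.symm y) := by
      rw [he]
      exact (hat'.differentiableAt hn).hasFDerivAt
    exact (Φ.contDiffAt_symm hy (f₀' := e) hd' hat').contDiffWithinAt

/-- The Morse lemma in the form used here: a function that is a constant plus a signed sum of the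
squares of the coordinates, each rescaled by a positive smooth factor, is Morse near the origin. -/
theorem exists_isMorseOn_of_rescaled {k : ℕ} {O : Set (EuclideanSpace ℝ (Fin k))} (hO : IsOpen O)
    (h0 : (0 : EuclideanSpace ℝ (Fin k)) ∈ O) (κ : Fin k → EuclideanSpace ℝ (Fin k) → ℝ)
    (hκ : ∀ i, ContDiffOn ℝ ∞ (κ i) O) (hpos : ∀ i, ∀ z ∈ O, 0 < κ i z) (J : Finset (Fin k))
    (c : ℝ) (g : EuclideanSpace ℝ (Fin k) → ℝ)
    (hg : ∀ z ∈ O, g z = c + ∑ j ∈ Jᶜ, (z j * κ j z) ^ 2 - ∑ j ∈ J, (z j * κ j z) ^ 2) :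
    ∃ O' ⊆ O, (0 : EuclideanSpace ℝ (Fin k)) ∈ O' ∧ IsMorseOn g O' := by
  classical
  let φ : EuclideanSpace ℝ (Fin k) → EuclideanSpace ℝ (Fin k) :=
    fun z => WithLp.toLp 2 (fun i => z i * κ i z)
  have hcoord : ∀ i : Fin k, ContDiff ℝ ∞ (fun z : EuclideanSpace ℝ (Fin k) => z i) :=
    fun i => (EuclideanSpace.proj (𝕜 := ℝ) i).contDiff
  have hφ : ContDiffOn ℝ ∞ φ O := by
    rw [contDiffOn_euclidean]
    exact fun i => (hcoord i).contDiffOn.mul (hκ i)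
  have hgs : ContDiffOn ℝ ∞ g O := by
    have : ContDiffOn ℝ ∞
        (fun z => c + ∑ j ∈ Jᶜ, (z j * κ j z) ^ 2 - ∑ j ∈ J, (z j * κ j z) ^ 2) O :=
      ((contDiffOn_const.add (ContDiffOn.sum fun j _ =>
        ((hcoord j).contDiffOn.mul (hκ j)).pow 2))).sub
        (ContDiffOn.sum fun j _ => ((hcoord j).contDiffOn.mul (hκ j)).pow 2)
    exact this.congr hg
  let D : EuclideanSpace ℝ (Fin k) ≃L[ℝ] EuclideanSpace ℝ (Fin k) :=
    LinearEquiv.toContinuousLinearEquiv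
    { toFun := fun z => WithLp.toLp 2 (fun i => z i * κ i 0)
      invFun := fun z => WithLp.toLp 2 (fun i => z i * (κ i 0)⁻¹)
      map_add' := fun x y => by ext i; simp [add_mul]
      map_smul' := fun t x => by ext i; simp [mul_assoc]
      left_inv := fun z => by
        ext i
        simp [mul_assoc, mul_inv_cancel₀ (hpos i 0 h0).ne']
      right_inv := fun z => by
        ext i
        simp [mul_assoc, inv_mul_cancel₀ (hpos i 0 h0).ne'] }
  have hD : HasFDerivAt φ (D : EuclideanSpace ℝ (Fin k) →L[ℝ] EuclideanSpace ℝ (Fin k)) 0 := by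
    rw [← hasFDerivWithinAt_univ, hasFDerivWithinAt_euclidean]
    intro i
    have h1 : HasFDerivAt (fun z : EuclideanSpace ℝ (Fin k) => z i)
        (EuclideanSpace.proj (𝕜 := ℝ) i) 0 := (EuclideanSpace.proj (𝕜 := ℝ) i).hasFDerivAt
    have h2 := (((hκ i).contDiffAt (hO.mem_nhds h0)).differentiableAt (by simp)).hasFDerivAt
    rw [hasFDerivWithinAt_univ]
    refine (h1.mul h2).congr_fderiv ?_
    ext v
    simp [D, mul_comm]
  obtain ⟨Φ, h0Φ, hΦO, hΦ, hs, hs'⟩ := exists_smooth_openPartialHomeomorph hO h0 hφ hD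
  have hΦ0 : Φ 0 = 0 := by
    rw [hΦ]
    ext i
    simp [φ]
  have hgΦ : ∀ z ∈ Φ.source,
      g z = c + ∑ j ∈ Jᶜ, (Φ z j) ^ 2 - ∑ j ∈ J, (Φ z j) ^ 2 := by
    intro z hz
    rw [hg z (hΦO hz)]
    simp [hΦ, φ]
  refine ⟨Φ.source, hΦO, h0Φ, Φ.open_source, hgs.mono hΦO, ?_⟩
  intro q hq hdq
  -- In the chart the function is a nondegenerate quadratic form, critical at the origin only.
  have hq0 : Φ q = 0 := by
    have hqt : Φ q ∈ Φ.target := Φ.map_source hq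
    let Q : EuclideanSpace ℝ (Fin k) → ℝ := fun w => c + ∑ j ∈ Jᶜ, (w j) ^ 2 - ∑ j ∈ J, (w j) ^ 2
    have hQ : Q =ᶠ[𝓝 (Φ q)] g ∘ Φ.symm := by
      filter_upwards [Φ.open_target.mem_nhds hqt] with w hw
      simp only [Function.comp, Q]
      rw [hgΦ _ (Φ.map_target hw), Φ.right_inv hw]
    have hg' : HasFDerivAt g (0 : EuclideanSpace ℝ (Fin k) →L[ℝ] ℝ) (Φ.symm (Φ q)) := by
      rw [Φ.left_inv hq, ← hdq]
      exact ((hgs.contDiffAt (hO.mem_nhds (hΦO hq))).differentiableAt (by simp)).hasFDerivAt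
    have hsd := ((hs'.contDiffAt (Φ.open_target.mem_nhds hqt)).differentiableAt
      (by simp)).hasFDerivAt
    have hQ0 : HasFDerivAt Q (0 : EuclideanSpace ℝ (Fin k) →L[ℝ] ℝ) (Φ q) := by
      have := (hg'.comp (Φ q) hsd).congr_of_eventuallyEq hQ
      simpa using this
    have hcd : ∀ j, HasFDerivAt (fun w : EuclideanSpace ℝ (Fin k) => (w j) ^ 2)
        ((2 * Φ q j) • (EuclideanSpace.proj (𝕜 := ℝ) j : EuclideanSpace ℝ (Fin k) →L[ℝ] ℝ))
        (Φ q) := by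
      intro j
      have h1 : HasFDerivAt (fun z : EuclideanSpace ℝ (Fin k) => z j)
        (EuclideanSpace.proj (𝕜 := ℝ) j) (Φ q) := (EuclideanSpace.proj (𝕜 := ℝ) j).hasFDerivAt
      refine (h1.pow 2).congr_fderiv ?_
      ext v
      simp
    have hQ1 := ((HasFDerivAt.fun_sum (u := Jᶜ) fun j _ => hcd j).const_add c).sub
      (HasFDerivAt.fun_sum (u := J) fun j _ => hcd j)
    have heq := hQ0.unique hQ1
    ext i
    have := congrArg (fun L : EuclideanSpace ℝ (Fin k) →L[ℝ] ℝ => L (EuclideanSpace.single i 1)) heq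
    simp at this
    by_cases hi : i ∈ J
    · simpa [hi] using this
    · simpa [hi] using this
  have hgq : g q = c := by
    rw [hgΦ q hq, hq0]
    simp
  exact ⟨Φ, J, hq, subset_rfl, hq0, hs, hs', fun x hx => by rw [hgΦ x hx, hgq]⟩

/-! ### Systems of circles and the region they bound -/

/-- A finite family of circles in the plane, each with a sign: the sign `1` selects the closed
exterior of the circle and the sign `-1` the closed disc. -/
structure CircleSystem (l : ℕ) where
  /-- first coordinates of the centers -/
  cx : Fin l → ℝ
  /-- second coordinates of the centers -/
  cy : Fin l → ℝ
  /-- the radii -/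
  rad : Fin l → ℝ
  /-- the signs -/
  sgn : Fin l → ℝ
  rad_pos : ∀ j, 0 < rad j
  sgn_eq : ∀ j, sgn j = 1 ∨ sgn j = -1

namespace CircleSystem

variable {l : ℕ} (S : CircleSystem l)

/-- The signed quadratic function of the `j`-th circle. -/
def quad (j : Fin l) (x : EuclideanSpace ℝ (Fin 2)) : ℝ :=
  S.sgn j * ((x 0 - S.cx j) ^ 2 + (x 1 - S.cy j) ^ 2 - S.rad j ^ 2)

/-- The closed region on which all the quadratic functions are non-negative. -/
def region : Set (EuclideanSpace ℝ (Fin 2)) := {x | ∀ j, 0 ≤ S.quad j x}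

/-- The cross product of the radius vectors of two of the circles at `x`; it is non-zero when the
circles cross transversally at `x`. -/
def cross (i j : Fin l) (x : EuclideanSpace ℝ (Fin 2)) : ℝ :=
  (x 0 - S.cx i) * (x 1 - S.cy j) - (x 1 - S.cy i) * (x 0 - S.cx j)

/-- The circles of the system bound their region generically: the region is bounded, every circle
meets it, and within the region any two circles cross transversally at points where neither has a
vertical tangent, and no three circles meet. -/
structure IsGeneric : Prop where
  pos : 0 < l
  bounded : Bornology.IsBounded S.region
  meets : ∀ j, ∃ x ∈ S.region, S.quad j x = 0
  pair : ∀ i j, i ≠ j → ∀ x ∈ S.region, S.quad i x = 0 → S.quad j x = 0 →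
    S.cross i j x ≠ 0 ∧ x 1 ≠ S.cy i
  triple : ∀ i j k, i ≠ j → j ≠ k → i ≠ k → ∀ x ∈ S.region,
    S.quad i x = 0 → S.quad j x = 0 → S.quad k x = 0 → False

variable {S}

theorem sgn_ne_zero (j : Fin l) : S.sgn j ≠ 0 := by
  rcases S.sgn_eq j with h | h <;> rw [h] <;> norm_num

theorem sgn_sq (j : Fin l) : S.sgn j ^ 2 = 1 := by
  rcases S.sgn_eq j with h | h <;> rw [h] <;> norm_num

theorem quad_eq_zero_iff {j : Fin l} {x : EuclideanSpace ℝ (Fin 2)} :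
    S.quad j x = 0 ↔ (x 0 - S.cx j) ^ 2 + (x 1 - S.cy j) ^ 2 = S.rad j ^ 2 := by
  simp [quad, sgn_ne_zero, sub_eq_zero]

theorem contDiff_quad (j : Fin l) : ContDiff ℝ ∞ (S.quad j) := by
  have h : ∀ i : Fin 2, ContDiff ℝ ∞ (fun z : EuclideanSpace ℝ (Fin 2) => z i) :=
    fun i => (EuclideanSpace.proj (𝕜 := ℝ) i).contDiff
  unfold quad
  exact contDiff_const.mul (((((h 0).sub contDiff_const).pow 2).add
    (((h 1).sub contDiff_const).pow 2)).sub contDiff_const)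

theorem continuous_quad (j : Fin l) : Continuous (S.quad j) := (contDiff_quad j).continuous

theorem isClosed_region : IsClosed S.region := by
  have : S.region = ⋂ j, {x | 0 ≤ S.quad j x} := by
    ext x
    simp [region]
  rw [this]
  exact isClosed_iInter fun j => isClosed_le continuous_const (continuous_quad j)

theorem IsGeneric.isCompact_region (h : S.IsGeneric) : IsCompact S.region :=
  Metric.isCompact_of_isClosed_isBounded isClosed_region h.bounded

/-- The circles through a point of the region: none, one or two. -/
theorem IsGeneric.zero_cases (h : S.IsGeneric) {x : EuclideanSpace ℝ (Fin 2)} (hx : x ∈ S.region) :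
    (∀ c, S.quad c x ≠ 0) ∨ (∃ i, ∀ c, S.quad c x = 0 ↔ c = i) ∨
      ∃ i j, i ≠ j ∧ ∀ c, S.quad c x = 0 ↔ c = i ∨ c = j := by
  by_cases h0 : ∀ c, S.quad c x ≠ 0
  · exact Or.inl h0
  push Not at h0
  obtain ⟨i, hi⟩ := h0
  right
  by_cases h1 : ∀ c, S.quad c x = 0 → c = i
  · exact Or.inl ⟨i, fun c => ⟨h1 c, fun hc => hc ▸ hi⟩⟩
  push Not at h1
  obtain ⟨j, hj, hji⟩ := h1
  refine Or.inr ⟨i, j, hji.symm, fun c => ⟨fun hc => ?_, ?_⟩⟩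
  · by_contra hne
    push Not at hne
    exact h.triple i j c hji.symm hne.2.symm hne.1.symm x hx hi hj hc
  · rintro (rfl | rfl) <;> assumption

/-- Every prescribed list of first-order variations of the vanishing quadratic functions is realised
by some direction in the plane. -/
theorem IsGeneric.exists_direction (h : S.IsGeneric) {x : EuclideanSpace ℝ (Fin 2)}
    (hx : x ∈ S.region) (b : Fin l → ℝ) :
    ∃ ξ₀ ξ₁ : ℝ, ∀ c, S.quad c x = 0 →
      2 * S.sgn c * ((x 0 - S.cx c) * ξ₀ + (x 1 - S.cy c) * ξ₁) = b c := by
  rcases h.zero_cases hx with h0 | ⟨i, hi⟩ | ⟨i, j, hij, hc⟩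
  · exact ⟨0, 0, fun c hc => absurd hc (h0 c)⟩
  · have hz := quad_eq_zero_iff.1 ((hi i).2 rfl)
    have hr := S.rad_pos i
    have hs := sgn_sq (S := S) i
    refine ⟨S.sgn i * b i / (2 * S.rad i ^ 2) * (x 0 - S.cx i),
      S.sgn i * b i / (2 * S.rad i ^ 2) * (x 1 - S.cy i), fun c hc => ?_⟩
    obtain rfl := (hi c).1 hc
    have : 2 * S.sgn c * ((x 0 - S.cx c) * (S.sgn c * b c / (2 * S.rad c ^ 2) * (x 0 - S.cx c)) +
        (x 1 - S.cy c) * (S.sgn c * b c / (2 * S.rad c ^ 2) * (x 1 - S.cy c))) =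
        S.sgn c ^ 2 * b c / S.rad c ^ 2 * ((x 0 - S.cx c) ^ 2 + (x 1 - S.cy c) ^ 2) := by
      field_simp
    rw [this, hz, hs]
    field_simp
  · obtain ⟨hd, -⟩ := h.pair i j hij x hx ((hc i).2 (Or.inl rfl)) ((hc j).2 (Or.inr rfl))
    have hsi := sgn_sq (S := S) i
    have hsj := sgn_sq (S := S) j
    unfold cross at hd
    set d := (x 0 - S.cx i) * (x 1 - S.cy j) - (x 1 - S.cy i) * (x 0 - S.cx j) with hdd
    refine ⟨(S.sgn i * b i * (x 1 - S.cy j) - S.sgn j * b j * (x 1 - S.cy i)) / (2 * d),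
      (S.sgn j * b j * (x 0 - S.cx i) - S.sgn i * b i * (x 0 - S.cx j)) / (2 * d), fun c hc' => ?_⟩
    rcases (hc c).1 hc' with rfl | rfl
    · have : 2 * S.sgn c * ((x 0 - S.cx c) * ((S.sgn c * b c * (x 1 - S.cy j) -
          S.sgn j * b j * (x 1 - S.cy c)) / (2 * d)) + (x 1 - S.cy c) *
          ((S.sgn j * b j * (x 0 - S.cx c) - S.sgn c * b c * (x 0 - S.cx j)) / (2 * d))) =
          S.sgn c ^ 2 * b c * d / d := by
        rw [hdd]
        field_simp
        ring
      rw [this, hsi]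
      field_simp
    · have : 2 * S.sgn c * ((x 0 - S.cx c) * ((S.sgn i * b i * (x 1 - S.cy c) -
          S.sgn c * b c * (x 1 - S.cy i)) / (2 * d)) + (x 1 - S.cy c) *
          ((S.sgn c * b c * (x 0 - S.cx i) - S.sgn i * b i * (x 0 - S.cx c)) / (2 * d))) =
          S.sgn c ^ 2 * b c * d / d := by
        rw [hdd]
        field_simp
        ring
      rw [this, hsj]
      field_simp

/-- The region is the closure of the open set where all the quadratic functions are positive: at a
boundary point some direction increases all the vanishing ones. -/
theorem IsGeneric.closure_pos (h : S.IsGeneric) :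
    closure {x | ∀ j, 0 < S.quad j x} = S.region := by
  apply subset_antisymm
  · exact closure_minimal (fun x hx j => (hx j).le) isClosed_region
  intro x hx
  obtain ⟨ξ₀, ξ₁, hξ⟩ := h.exists_direction hx (fun _ => 1)
  let γ : ℝ → EuclideanSpace ℝ (Fin 2) := fun t => !₂[x 0 + t * ξ₀, x 1 + t * ξ₁]
  have hγ : Continuous γ := by
    refine (PiLp.continuous_toLp 2 _).comp (continuous_pi fun i => ?_)
    fin_cases i
    · exact (by fun_prop : Continuous fun t : ℝ => x 0 + t * ξ₀)
    · exact (by fun_prop : Continuous fun t : ℝ => x 1 + t * ξ₁)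
  have hγ0 : γ 0 = x := by
    ext i
    fin_cases i <;> simp [γ]
  have hlim : Filter.Tendsto γ (𝓝[>] 0) (𝓝 x) := by
    rw [← hγ0]
    exact hγ.continuousAt.tendsto.mono_left nhdsWithin_le_nhds
  refine mem_closure_of_tendsto hlim ?_
  refine Filter.eventually_all.2 fun c => ?_
  by_cases hc : S.quad c x = 0
  · have hform : ∀ t, S.quad c (γ t) = t * (1 + t * (S.sgn c * (ξ₀ ^ 2 + ξ₁ ^ 2))) := by
      intro t
      have h1 := hξ c hc
      have h2 : S.quad c (γ t) = S.quad c x +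
          t * (2 * S.sgn c * ((x 0 - S.cx c) * ξ₀ + (x 1 - S.cy c) * ξ₁)) +
          t ^ 2 * (S.sgn c * (ξ₀ ^ 2 + ξ₁ ^ 2)) := by
        simp only [quad, γ, Matrix.cons_val_zero, Matrix.cons_val_one]
        ring
      rw [h2, h1, hc]
      ring
    have hev : ∀ᶠ t in 𝓝 (0 : ℝ), 0 < 1 + t * (S.sgn c * (ξ₀ ^ 2 + ξ₁ ^ 2)) := by
      have : Continuous fun t : ℝ => 1 + t * (S.sgn c * (ξ₀ ^ 2 + ξ₁ ^ 2)) := by fun_prop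
      exact this.continuousAt.eventually (lt_mem_nhds (by simp))
    filter_upwards [nhdsWithin_le_nhds hev, self_mem_nhdsWithin] with t ht ht0
    rw [hform]
    exact mul_pos ht0 ht
  · have hpos : 0 < S.quad c (γ 0) := by
      rw [hγ0]
      exact lt_of_le_of_ne (hx c) (Ne.symm hc)
    exact nhdsWithin_le_nhds
      (((continuous_quad c).comp hγ).continuousAt.eventually (lt_mem_nhds hpos))

/-! ### The algebraic manifold over the region -/

variable (S) in
/-- The quadratic polynomial of the `j`-th circle. -/
noncomputable def quadPoly (j : Fin l) : MvPolynomial (Fin 2) ℝ :=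
  MvPolynomial.C (S.sgn j) * ((MvPolynomial.X 0 - MvPolynomial.C (S.cx j)) ^ 2 +
    (MvPolynomial.X 1 - MvPolynomial.C (S.cy j)) ^ 2 - MvPolynomial.C (S.rad j ^ 2))

theorem eval_quadPoly (j : Fin l) (x : EuclideanSpace ℝ (Fin 2)) :
    MvPolynomial.eval (fun i => x i) (S.quadPoly j) = S.quad j x := by
  simp [quadPoly, quad]

theorem totalDegree_quadPoly (j : Fin l) : (S.quadPoly j).totalDegree = 2 := by
  apply le_antisymm
  · have hX : ∀ (i : Fin 2) (a : ℝ),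
        ((MvPolynomial.X i - MvPolynomial.C a) ^ 2 : MvPolynomial (Fin 2) ℝ).totalDegree ≤ 2 := by
      intro i a
      refine (MvPolynomial.totalDegree_pow _ _).trans ?_
      have := MvPolynomial.totalDegree_sub (MvPolynomial.X i : MvPolynomial (Fin 2) ℝ)
        (MvPolynomial.C a)
      simp only [MvPolynomial.totalDegree_X, MvPolynomial.totalDegree_C] at this
      have h1 : max 1 0 = 1 := rfl
      omega
    refine (MvPolynomial.totalDegree_mul _ _).trans ?_
    rw [MvPolynomial.totalDegree_C, zero_add]
    refine (MvPolynomial.totalDegree_sub _ _).trans (max_le ?_ (by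
      rw [MvPolynomial.totalDegree_C]; norm_num))
    exact (MvPolynomial.totalDegree_add _ _).trans (max_le (hX _ _) (hX _ _))
  · have hexp : S.quadPoly j = MvPolynomial.C (S.sgn j) * MvPolynomial.X 0 ^ 2 +
        MvPolynomial.C (S.sgn j) * MvPolynomial.X 1 ^ 2 +
        MvPolynomial.C (-2 * S.sgn j * S.cx j) * MvPolynomial.X 0 +
        MvPolynomial.C (-2 * S.sgn j * S.cy j) * MvPolynomial.X 1 +
        MvPolynomial.C (S.sgn j * (S.cx j ^ 2 + S.cy j ^ 2 - S.rad j ^ 2)) := by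
      simp only [quadPoly, map_mul, map_sub, map_add, map_pow, map_neg, map_ofNat]
      ring
    have hco : MvPolynomial.coeff (Finsupp.single 0 2) (S.quadPoly j) = S.sgn j := by
      rw [hexp]
      simp only [MvPolynomial.coeff_add, MvPolynomial.coeff_C_mul, MvPolynomial.coeff_X_pow,
        MvPolynomial.coeff_X, MvPolynomial.coeff_C]
      simp [Finsupp.single_eq_single_iff, eq_comm]
    have hmem : Finsupp.single (0 : Fin 2) 2 ∈ (S.quadPoly j).support := by
      rw [MvPolynomial.mem_support_iff, hco]
      exact sgn_ne_zero j
    simpa using MvPolynomial.le_totalDegree hmem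

theorem sphere_eq (j : Fin l) : Metric.sphere (!₂[S.cx j, S.cy j] : EuclideanSpace ℝ (Fin 2))
    (S.rad j) = {x | S.quad j x = 0} := by
  ext x
  rw [Metric.mem_sphere, Set.mem_ofPred_eq, quad_eq_zero_iff, EuclideanSpace.dist_eq,
    Real.sqrt_eq_iff_eq_sq (by positivity) (S.rad_pos j).le]
  simp [Real.dist_eq, sq_abs]

theorem linearIndependent_of_cross_ne_zero {a b v w : EuclideanSpace ℝ (Fin 2)}
    (hab : a 0 * b 1 - a 1 * b 0 ≠ 0) (hv : v ≠ 0) (hw : w ≠ 0)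
    (hav : inner ℝ a v = 0) (hbw : inner ℝ b w = 0) : LinearIndependent ℝ ![v, w] := by
  rw [LinearIndependent.pair_iff]
  simp only [PiLp.inner_apply, Fin.sum_univ_two, RCLike.inner_apply, conj_trivial] at hav hbw
  have key : ∀ u : EuclideanSpace ℝ (Fin 2), u 0 * a 0 + u 1 * a 1 = 0 →
      u 0 * b 0 + u 1 * b 1 = 0 → u = 0 := by
    intro u h1 h2
    have e0 : u 0 * (a 0 * b 1 - a 1 * b 0) = 0 := by linear_combination b 1 * h1 - a 1 * h2
    have e1 : u 1 * (a 0 * b 1 - a 1 * b 0) = 0 := by linear_combination a 0 * h2 - b 0 * h1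
    ext i
    fin_cases i
    · simpa [hab] using e0
    · simpa [hab] using e1
  intro s t hst
  have h0 : s * v 0 + t * w 0 = 0 := by simpa using congrArg (fun u => u 0) hst
  have h1 : s * v 1 + t * w 1 = 0 := by simpa using congrArg (fun u => u 1) hst
  constructor
  · by_contra hs
    refine hv (key v hav ?_)
    have : s * (v 0 * b 0 + v 1 * b 1) = 0 := by
      linear_combination b 0 * h0 + b 1 * h1 - t * hbw
    simpa [hs] using this
  · by_contra ht
    refine hw (key w ?_ hbw)
    have : t * (w 0 * a 0 + w 1 * a 1) = 0 := by
      linear_combination a 0 * h0 + a 1 * h1 - s * hav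
    simpa [ht] using this

/-- The region with its circles, all of different colours and with a circle as the sphere of each
colour. -/
noncomputable abbrev toCircleRegion (h : S.IsGeneric) : CircleRegion where
  D := {x | ∀ j, 0 < S.quad j x}
  isOpen_D := by
    simp only [Set.ofPred_forall]
    exact isOpen_iInter_of_finite fun j => isOpen_lt continuous_const (continuous_quad j)
  nonempty_D := by
    obtain ⟨x, hx, -⟩ := h.meets ⟨0, h.pos⟩
    rw [← h.closure_pos] at hx
    exact closure_nonempty_iff.1 ⟨x, hx⟩
  l := l
  l_pos := h.pos
  center := fun j => !₂[S.cx j, S.cy j]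
  radius := S.rad
  radius_pos := S.rad_pos
  boundary_subset := by
    rintro x ⟨hx, hxD⟩
    rw [h.closure_pos] at hx
    simp only [Set.mem_ofPred_eq, not_forall, not_lt] at hxD
    obtain ⟨j, hj⟩ := hxD
    rw [Set.mem_iUnion]
    refine ⟨j, ?_⟩
    rw [sphere_eq]
    exact le_antisymm hj (hx j)
  circle_meets := by
    intro j
    obtain ⟨x, hx, hj⟩ := h.meets j
    rw [h.closure_pos, sphere_eq]
    exact ⟨x, hj, hx⟩
  transverse := by
    intro i j hij x hx v w hv hw hiv hjw
    rw [h.closure_pos, sphere_eq, sphere_eq] at hx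
    refine linearIndependent_of_cross_ne_zero ?_ hv hw hiv hjw
    have := (h.pair i j hij x hx.2 hx.1.1 hx.1.2).1
    simpa [cross] using this
  no_triple := by
    intro i j k hij hjk hik
    rw [h.closure_pos, sphere_eq, sphere_eq, sphere_eq, Set.eq_empty_iff_forall_notMem]
    rintro x ⟨⟨⟨hi, hj⟩, hk⟩, hx⟩
    exact h.triple i j k hij hjk hik x hx hi hj hk
  l' := l
  l'_pos := h.pos
  colour := id
  colour_surjective := Function.surjective_id
  colour_ne := fun i j hij _ => hij
  dim := fun _ => 1
  dim_pos := fun _ => one_pos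
  f := S.quadPoly
  degree_f := totalDegree_quadPoly
  circle_eq := by
    intro j
    rw [sphere_eq]
    ext x
    simp [eval_quadPoly]
  closure_eq := by
    rw [h.closure_pos]
    ext x
    simp [eval_quadPoly, region]

end CircleSystem

namespace CircleSystem

variable {l : ℕ} {S : CircleSystem l}

/-- The coordinates of the ambient space of the manifold: two for the plane, and two for each
circle. -/
abbrev Amb (l : ℕ) : Type := Fin 2 ⊕ (Σ _ : Fin l, Fin 2)

variable (S) in
/-- The defining polynomials `f c (x) - ‖y c‖²` of the manifold. -/
noncomputable def poly (c : Fin l) : MvPolynomial (Amb l) ℝ :=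
  MvPolynomial.rename Sum.inl (S.quadPoly c) - ∑ k : Fin 2, MvPolynomial.X (Sum.inr ⟨c, k⟩) ^ 2

theorem poly_toCircleRegion (h : S.IsGeneric) : (toCircleRegion h).poly = S.poly := by
  funext c
  simp only [CircleRegion.poly, poly]
  congr 1
  have : (Finset.univ.filter fun j : Fin l => id j = c) = {c} := by
    ext j
    simp
  exact (congrArg (fun s => ∏ j ∈ s, MvPolynomial.rename Sum.inl (S.quadPoly j)) this).trans
    (Finset.prod_singleton _ _)

/-- The projection of the ambient space to the plane. -/
noncomputable def toPlane (z : EuclideanSpace ℝ (Amb l)) : EuclideanSpace ℝ (Fin 2) :=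
  WithLp.toLp 2 (fun i => z (Sum.inl i))

theorem continuous_toPlane : Continuous (toPlane : EuclideanSpace ℝ (Amb l) → _) :=
  (PiLp.continuous_toLp 2 _).comp (continuous_pi fun i =>
    (EuclideanSpace.proj (𝕜 := ℝ) (Sum.inl i : Amb l)).continuous)

theorem polyMap_apply (z : EuclideanSpace ℝ (Amb l)) (c : Fin l) :
    polyMap S.poly z c = S.quad c (toPlane z) -
      (z (Sum.inr ⟨c, 0⟩) ^ 2 + z (Sum.inr ⟨c, 1⟩) ^ 2) := by
  have h : (fun i => z i) ∘ (Sum.inl : Fin 2 → Amb l) = fun i => toPlane z i := rfl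
  simp only [polyMap, poly, map_sub, MvPolynomial.eval_rename, h, eval_quadPoly, Fin.sum_univ_two,
    map_add, map_pow, MvPolynomial.eval_X]

theorem mem_zeroSet_iff {z : EuclideanSpace ℝ (Amb l)} : z ∈ zeroSet S.poly ↔
    ∀ c, S.quad c (toPlane z) = z (Sum.inr ⟨c, 0⟩) ^ 2 + z (Sum.inr ⟨c, 1⟩) ^ 2 := by
  constructor
  · intro h c
    have := congrArg (fun w : EuclideanSpace ℝ (Fin l) => w c) (show polyMap S.poly z = 0 from h)
    simp only [polyMap_apply, PiLp.zero_apply] at this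
    linarith
  · intro h
    show polyMap S.poly z = 0
    ext c
    rw [polyMap_apply, h c]
    simp

theorem toPlane_mem_region {z : EuclideanSpace ℝ (Amb l)} (hz : z ∈ zeroSet S.poly) :
    toPlane z ∈ S.region := by
  intro c
  rw [mem_zeroSet_iff.1 hz c]
  positivity

/-- The trigonometric parametrisation of the fibres of the manifold over the region. -/
noncomputable def param (S : CircleSystem l) (x : EuclideanSpace ℝ (Fin 2)) (θ : Fin l → ℝ) :
    EuclideanSpace ℝ (Amb l) :=
  WithLp.toLp 2 (Sum.elim (fun i => x i) (fun s => Real.sqrt (S.quad s.1 x) *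
    (if s.2 = 0 then Real.cos (θ s.1) else Real.sin (θ s.1))))

theorem toPlane_param (x : EuclideanSpace ℝ (Fin 2)) (θ : Fin l → ℝ) :
    toPlane (param S x θ) = x := by
  ext i
  rfl

theorem continuous_param :
    Continuous fun p : EuclideanSpace ℝ (Fin 2) × (Fin l → ℝ) => param S p.1 p.2 := by
  refine (PiLp.continuous_toLp 2 _).comp (continuous_pi fun s => ?_)
  rcases s with i | ⟨c, k⟩
  · exact (EuclideanSpace.proj (𝕜 := ℝ) i).continuous.comp continuous_fst
  · refine (((continuous_quad c).comp continuous_fst).sqrt).mul ?_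
    have hc : Continuous fun p : EuclideanSpace ℝ (Fin 2) × (Fin l → ℝ) => p.2 c :=
      (continuous_apply c).comp continuous_snd
    by_cases hk : k = 0
    · simp only [hk, if_true]
      exact Real.continuous_cos.comp hc
    · simp only [hk, if_false]
      exact Real.continuous_sin.comp hc

theorem param_mem_zeroSet {x : EuclideanSpace ℝ (Fin 2)} (hx : x ∈ S.region) (θ : Fin l → ℝ) :
    param S x θ ∈ zeroSet S.poly := by
  rw [mem_zeroSet_iff]
  intro c
  have h0 : param S x θ (Sum.inr ⟨c, 0⟩) = Real.sqrt (S.quad c x) * Real.cos (θ c) := by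
    simp [param]
  have h1 : param S x θ (Sum.inr ⟨c, 1⟩) = Real.sqrt (S.quad c x) * Real.sin (θ c) := by
    simp [param]
  rw [h0, h1, toPlane_param, mul_pow, mul_pow, Real.sq_sqrt (hx c), ← mul_add,
    Real.cos_sq_add_sin_sq, mul_one]

theorem exists_param {z : EuclideanSpace ℝ (Amb l)} (hz : z ∈ zeroSet S.poly) :
    ∃ θ ∈ Set.univ.pi (fun _ : Fin l => Set.Icc (-Real.pi) Real.pi),
      param S (toPlane z) θ = z := by
  let w : Fin l → ℂ := fun c => ⟨z (Sum.inr ⟨c, 0⟩), z (Sum.inr ⟨c, 1⟩)⟩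
  refine ⟨fun c => (w c).arg, fun c _ => ⟨(Complex.neg_pi_lt_arg _).le, Complex.arg_le_pi _⟩, ?_⟩
  have hn : ∀ c, Real.sqrt (S.quad c (toPlane z)) = ‖w c‖ := by
    intro c
    rw [mem_zeroSet_iff.1 hz c, Complex.norm_def, Complex.normSq_apply]
    congr 1
    simp only [w]
    ring
  ext s
  rcases s with i | ⟨c, k⟩
  · rfl
  · show Real.sqrt (S.quad c (toPlane z)) *
      (if k = 0 then Real.cos (w c).arg else Real.sin (w c).arg) = z (Sum.inr ⟨c, k⟩)
    rw [hn c]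
    fin_cases k
    · exact Complex.norm_mul_cos_arg (w c)
    · exact Complex.norm_mul_sin_arg (w c)

theorem zeroSet_inter_preimage (F : Set (EuclideanSpace ℝ (Fin 2))) (hF : F ⊆ S.region) :
    zeroSet S.poly ∩ toPlane ⁻¹' F =
      (fun p : EuclideanSpace ℝ (Fin 2) × (Fin l → ℝ) => param S p.1 p.2) '' (F ×ˢ Set.univ) := by
  ext z
  constructor
  · rintro ⟨hz, hzF⟩
    obtain ⟨θ, -, hθ⟩ := exists_param hz
    exact ⟨(toPlane z, θ), ⟨hzF, trivial⟩, hθ⟩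
  · rintro ⟨⟨x, θ⟩, ⟨hx, -⟩, rfl⟩
    exact ⟨param_mem_zeroSet (hF hx) θ, by
      rw [Set.mem_preimage, toPlane_param]
      exact hx⟩

/-- The part of the manifold over a connected subset of the region is connected. -/
theorem isPreconnected_preimage {F : Set (EuclideanSpace ℝ (Fin 2))} (hF : F ⊆ S.region)
    (hc : IsPreconnected F) : IsPreconnected (zeroSet S.poly ∩ toPlane ⁻¹' F) := by
  rw [zeroSet_inter_preimage F hF]
  exact (hc.prod isPreconnected_univ).image _ continuous_param.continuousOn

theorem IsGeneric.isCompact_zeroSet (h : S.IsGeneric) : IsCompact (zeroSet S.poly) := by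
  have : zeroSet S.poly = (fun p : EuclideanSpace ℝ (Fin 2) × (Fin l → ℝ) => param S p.1 p.2) ''
      (S.region ×ˢ Set.univ.pi (fun _ : Fin l => Set.Icc (-Real.pi) Real.pi)) := by
    ext z
    constructor
    · intro hz
      obtain ⟨θ, hθ, hz'⟩ := exists_param hz
      exact ⟨(toPlane z, θ), ⟨toPlane_mem_region hz, hθ⟩, hz'⟩
    · rintro ⟨⟨x, θ⟩, ⟨hx, -⟩, rfl⟩
      exact param_mem_zeroSet hx θ
  rw [this]
  exact (h.isCompact_region.prod (isCompact_univ_pi fun _ => isCompact_Icc)).image continuous_param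

theorem toPlane_image : toPlane '' zeroSet S.poly = S.region := by
  ext x
  constructor
  · rintro ⟨z, hz, rfl⟩
    exact toPlane_mem_region hz
  · intro hx
    exact ⟨param S x 0, param_mem_zeroSet hx 0, toPlane_param x 0⟩

/-! ### The differential of the defining map -/

/-- The differential of the `c`-th defining function at `z`. -/
noncomputable def dpoly (S : CircleSystem l) (z : EuclideanSpace ℝ (Amb l)) (c : Fin l) :
    EuclideanSpace ℝ (Amb l) →L[ℝ] ℝ :=
  (2 * S.sgn c * (z (Sum.inl 0) - S.cx c)) • EuclideanSpace.proj (Sum.inl 0) +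
    (2 * S.sgn c * (z (Sum.inl 1) - S.cy c)) • EuclideanSpace.proj (Sum.inl 1) -
    ((2 * z (Sum.inr ⟨c, 0⟩)) • EuclideanSpace.proj (Sum.inr ⟨c, 0⟩) +
      (2 * z (Sum.inr ⟨c, 1⟩)) • EuclideanSpace.proj (Sum.inr ⟨c, 1⟩))

theorem hasFDerivAt_polyMap (z : EuclideanSpace ℝ (Amb l)) : HasFDerivAt (polyMap S.poly)
    ((PiLp.continuousLinearEquiv 2 ℝ (fun _ : Fin l => ℝ)).symm.toContinuousLinearMap ∘L
      ContinuousLinearMap.pi (dpoly S z)) z := by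
  rw [← hasFDerivWithinAt_univ, hasFDerivWithinAt_euclidean]
  intro c
  rw [hasFDerivWithinAt_univ]
  have hfun : (fun w => polyMap S.poly w c) = fun w : EuclideanSpace ℝ (Amb l) =>
      S.sgn c * ((w (Sum.inl 0) - S.cx c) ^ 2 + (w (Sum.inl 1) - S.cy c) ^ 2 - S.rad c ^ 2) -
        (w (Sum.inr ⟨c, 0⟩) ^ 2 + w (Sum.inr ⟨c, 1⟩) ^ 2) := by
    funext w
    rw [polyMap_apply]
    rfl
  rw [hfun]
  have hp : ∀ s : Amb l, HasFDerivAt (fun w : EuclideanSpace ℝ (Amb l) => w s)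
      (EuclideanSpace.proj (𝕜 := ℝ) s) z := fun s => (EuclideanSpace.proj (𝕜 := ℝ) s).hasFDerivAt
  refine ((((((hp (Sum.inl 0)).sub_const (S.cx c)).pow 2).add
    (((hp (Sum.inl 1)).sub_const (S.cy c)).pow 2)).sub_const (S.rad c ^ 2)).const_mul
    (S.sgn c) |>.sub (((hp (Sum.inr ⟨c, 0⟩)).pow 2).add
    ((hp (Sum.inr ⟨c, 1⟩)).pow 2))).congr_fderiv ?_
  ext v
  simp [dpoly]
  ring

theorem fderiv_polyMap_apply (z v : EuclideanSpace ℝ (Amb l)) (c : Fin l) :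
    fderiv ℝ (polyMap S.poly) z v c =
      2 * S.sgn c * ((z (Sum.inl 0) - S.cx c) * v (Sum.inl 0) +
        (z (Sum.inl 1) - S.cy c) * v (Sum.inl 1)) -
      2 * (z (Sum.inr ⟨c, 0⟩) * v (Sum.inr ⟨c, 0⟩) + z (Sum.inr ⟨c, 1⟩) * v (Sum.inr ⟨c, 1⟩)) := by
  rw [(hasFDerivAt_polyMap z).fderiv]
  simp [dpoly]
  ring

/-- A direction in the plane together with admissible directions in some of the fibre factors
extends to the whole ambient space with prescribed first-order variations of the defining
functions: in the other factors one moves along the radius. -/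
theorem exists_tangent (z : EuclideanSpace ℝ (Amb l)) (A : Set (Fin l))
    (hA : ∀ c, c ∉ A → z (Sum.inr ⟨c, 0⟩) ^ 2 + z (Sum.inr ⟨c, 1⟩) ^ 2 ≠ 0) (ξ₀ ξ₁ : ℝ)
    (η : Fin l → Fin 2 → ℝ) (b : Fin l → ℝ)
    (hη : ∀ c ∈ A, 2 * S.sgn c * ((z (Sum.inl 0) - S.cx c) * ξ₀ + (z (Sum.inl 1) - S.cy c) * ξ₁) -
      2 * (z (Sum.inr ⟨c, 0⟩) * η c 0 + z (Sum.inr ⟨c, 1⟩) * η c 1) = b c) :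
    ∃ v : EuclideanSpace ℝ (Amb l), v (Sum.inl 0) = ξ₀ ∧ v (Sum.inl 1) = ξ₁ ∧
      (∀ c ∈ A, ∀ k, v (Sum.inr ⟨c, k⟩) = η c k) ∧
      ∀ c, fderiv ℝ (polyMap S.poly) z v c = b c := by
  classical
  let t : Fin l → ℝ := fun c => (2 * S.sgn c * ((z (Sum.inl 0) - S.cx c) * ξ₀ +
    (z (Sum.inl 1) - S.cy c) * ξ₁) - b c) /
      (2 * (z (Sum.inr ⟨c, 0⟩) ^ 2 + z (Sum.inr ⟨c, 1⟩) ^ 2))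
  refine ⟨WithLp.toLp 2 (Sum.elim ![ξ₀, ξ₁] fun s =>
    if s.1 ∈ A then η s.1 s.2 else t s.1 * z (Sum.inr ⟨s.1, s.2⟩)), rfl, rfl, ?_, ?_⟩
  · intro c hc k
    simp [hc]
  · intro c
    rw [fderiv_polyMap_apply]
    by_cases hc : c ∈ A
    · simp only [Sum.elim_inl, Sum.elim_inr, Matrix.cons_val_zero, Matrix.cons_val_one, hc, if_true]
      exact hη c hc
    · simp only [Sum.elim_inl, Sum.elim_inr, Matrix.cons_val_zero, Matrix.cons_val_one, hc,
        if_false]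
      have h0 := hA c hc
      have : 2 * (z (Sum.inr ⟨c, 0⟩) * (t c * z (Sum.inr ⟨c, 0⟩)) +
          z (Sum.inr ⟨c, 1⟩) * (t c * z (Sum.inr ⟨c, 1⟩))) =
          t c * (2 * (z (Sum.inr ⟨c, 0⟩) ^ 2 + z (Sum.inr ⟨c, 1⟩) ^ 2)) := by ring
      rw [this, div_mul_cancel₀ _ (mul_ne_zero two_ne_zero h0)]
      ring

theorem mem_tangentSpaceAt {z v : EuclideanSpace ℝ (Amb l)} :
    v ∈ tangentSpaceAt S.poly z ↔ ∀ c, fderiv ℝ (polyMap S.poly) z v c = 0 := by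
  constructor
  · intro h c
    have : fderiv ℝ (polyMap S.poly) z v = 0 := h
    rw [this]
    rfl
  · intro h
    show fderiv ℝ (polyMap S.poly) z v = 0
    ext c
    exact h c

theorem IsGeneric.surjective_fderiv (h : S.IsGeneric) {z : EuclideanSpace ℝ (Amb l)}
    (hz : z ∈ zeroSet S.poly) : Function.Surjective (fderiv ℝ (polyMap S.poly) z) := by
  intro b
  obtain ⟨ξ₀, ξ₁, hξ⟩ := h.exists_direction (toPlane_mem_region hz) (fun c => b c)
  obtain ⟨v, -, -, -, hv⟩ := exists_tangent (S := S) z {c | S.quad c (toPlane z) = 0}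
    (fun c hc => by
      rw [← mem_zeroSet_iff.1 hz c]
      exact hc) ξ₀ ξ₁ 0 (fun c => b c) (fun c hc => by
      simp only [Pi.zero_apply, mul_zero, add_zero, sub_zero]
      exact hξ c hc)
  exact ⟨v, by ext c; exact hv c⟩

theorem IsGeneric.isRealAlgebraicManifold (h : S.IsGeneric) :
    IsRealAlgebraicManifold S.poly (zeroSet S.poly) where
  nonempty := by
    obtain ⟨x, hx, -⟩ := h.meets ⟨0, h.pos⟩
    exact ⟨_, param_mem_zeroSet hx 0⟩
  subset := subset_rfl
  union_components := fun x _ => connectedComponentIn_subset _ _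
  nonsingular := fun _ hz => h.surjective_fderiv hz

end CircleSystem

/-- A signed form of `exists_isMorseOn_of_rescaled`. -/
theorem exists_isMorseOn_of_signs {k : ℕ} {O : Set (EuclideanSpace ℝ (Fin k))} (hO : IsOpen O)
    (h0 : (0 : EuclideanSpace ℝ (Fin k)) ∈ O) (κ : Fin k → EuclideanSpace ℝ (Fin k) → ℝ)
    (hκ : ∀ i, ContDiffOn ℝ ∞ (κ i) O) (hpos : ∀ i, ∀ z ∈ O, 0 < κ i z) (τ : Fin k → ℝ)
    (hτ : ∀ i, τ i = 1 ∨ τ i = -1) (c : ℝ) (g : EuclideanSpace ℝ (Fin k) → ℝ)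
    (hg : ∀ z ∈ O, g z = c + ∑ j, τ j * (z j * κ j z) ^ 2) :
    ∃ O' ⊆ O, (0 : EuclideanSpace ℝ (Fin k)) ∈ O' ∧ IsMorseOn g O' := by
  classical
  let J : Finset (Fin k) := Finset.univ.filter fun j => τ j = -1
  refine exists_isMorseOn_of_rescaled hO h0 κ hκ hpos J c g fun z hz => ?_
  rw [hg z hz, ← Finset.sum_compl_add_sum J]
  have h1 : ∑ j ∈ Jᶜ, τ j * (z j * κ j z) ^ 2 = ∑ j ∈ Jᶜ, (z j * κ j z) ^ 2 := by
    refine Finset.sum_congr rfl fun j hj => ?_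
    have : τ j = 1 := by
      simp only [J, Finset.mem_compl, Finset.mem_filter, Finset.mem_univ, true_and] at hj
      exact (hτ j).resolve_right hj
    rw [this, one_mul]
  have h2 : ∑ j ∈ J, τ j * (z j * κ j z) ^ 2 = - ∑ j ∈ J, (z j * κ j z) ^ 2 := by
    rw [← Finset.sum_neg_distrib]
    refine Finset.sum_congr rfl fun j hj => ?_
    have : τ j = -1 := by
      simpa [J] using hj
    rw [this]
    ring
  rw [h1, h2]
  ring

theorem exists_cramer {a b c d : ℝ} (h : a * d - b * c ≠ 0) (e f : ℝ) :
    ∃ x y : ℝ, a * x + b * y = e ∧ c * x + d * y = f := by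
  refine ⟨(e * d - b * f) / (a * d - b * c), (a * f - e * c) / (a * d - b * c), ?_, ?_⟩ <;>
  · rw [← mul_div_assoc, ← mul_div_assoc, ← add_div, div_eq_iff h]
    ring

theorem exists_sign {a : ℝ} (h : a ≠ 0) : ∃ τ : ℝ, (τ = 1 ∨ τ = -1) ∧ 0 < τ * a := by
  rcases lt_or_gt_of_ne h with h | h
  · exact ⟨-1, Or.inr rfl, by linarith⟩
  · exact ⟨1, Or.inl rfl, by linarith⟩

namespace CircleSystem

variable {l : ℕ} {S : CircleSystem l}

/-! ### The singular points of the height function -/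

/-- The height function on the ambient space. -/
def height (z : EuclideanSpace ℝ (Amb l)) : ℝ := z (Sum.inl 0)

theorem contDiff_coord (s : Amb l) :
    ContDiff ℝ ∞ (fun z : EuclideanSpace ℝ (Amb l) => z s) :=
  (EuclideanSpace.proj (𝕜 := ℝ) s).contDiff

theorem fderiv_height (z v : EuclideanSpace ℝ (Amb l)) :
    fderiv ℝ (height : EuclideanSpace ℝ (Amb l) → ℝ) z v = v (Sum.inl 0) := by
  have : HasFDerivAt (height : EuclideanSpace ℝ (Amb l) → ℝ)
      (EuclideanSpace.proj (𝕜 := ℝ) (Sum.inl 0)) z :=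
    (EuclideanSpace.proj (𝕜 := ℝ) (Sum.inl 0 : Amb l)).hasFDerivAt
  rw [this.fderiv]
  rfl

theorem fibre_eq_zero {z : EuclideanSpace ℝ (Amb l)} (hz : z ∈ zeroSet S.poly) {c : Fin l}
    (hc : S.quad c (toPlane z) = 0) (k : Fin 2) : z (Sum.inr ⟨c, k⟩) = 0 := by
  have h := mem_zeroSet_iff.1 hz c
  rw [hc] at h
  fin_cases k
  · simp only [Fin.zero_eta]
    nlinarith [sq_nonneg (z (Sum.inr ⟨c, 0⟩)), sq_nonneg (z (Sum.inr ⟨c, 1⟩))]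
  · simp only [Fin.mk_one]
    nlinarith [sq_nonneg (z (Sum.inr ⟨c, 0⟩)), sq_nonneg (z (Sum.inr ⟨c, 1⟩))]

/-- The singular points lie over the points where a circle of the boundary has a vertical tangent,
and over the corners. -/
theorem IsGeneric.singular_cases (h : S.IsGeneric) {z : EuclideanSpace ℝ (Amb l)}
    (hz : z ∈ singularSet S.poly (zeroSet S.poly) height) :
    (∃ i, (∀ c, S.quad c (toPlane z) = 0 ↔ c = i) ∧ z (Sum.inl 1) = S.cy i) ∨
      ∃ i j, i ≠ j ∧ ∀ c, S.quad c (toPlane z) = 0 ↔ c = i ∨ c = j := by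
  obtain ⟨hzM, hz'⟩ := hz
  rcases h.zero_cases (toPlane_mem_region hzM) with h0 | ⟨i, hi⟩ | h2
  · exfalso
    obtain ⟨v, hv0, -, -, hv⟩ := exists_tangent (S := S) z ∅ (fun c _ => by
      rw [← mem_zeroSet_iff.1 hzM c]
      exact h0 c) 1 0 0 0 (fun c hc => absurd hc (Set.notMem_empty c))
    have := hz' v (mem_tangentSpaceAt.2 hv)
    rw [fderiv_height, hv0] at this
    exact one_ne_zero this
  · refine Or.inl ⟨i, hi, ?_⟩
    by_contra hne
    have hne' : z (Sum.inl 1) - S.cy i ≠ 0 := sub_ne_zero.2 hne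
    obtain ⟨v, hv0, -, -, hv⟩ := exists_tangent (S := S) z {i} (fun c hc => by
      rw [← mem_zeroSet_iff.1 hzM c]
      exact fun h => hc ((hi c).1 h)) 1 (-(z (Sum.inl 0) - S.cx i) / (z (Sum.inl 1) - S.cy i)) 0 0
      (fun c hc => by
        rw [Set.mem_singleton_iff] at hc
        subst hc
        simp only [Pi.zero_apply, mul_zero, add_zero, sub_zero]
        field_simp
        ring)
    have := hz' v (mem_tangentSpaceAt.2 hv)
    rw [fderiv_height, hv0] at this
    exact one_ne_zero this
  · exact Or.inr h2

theorem finite_inter (S : CircleSystem l) {i j : Fin l} (hij : S.cx i ≠ S.cx j ∨ S.cy i ≠ S.cy j) :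
    {x | S.quad i x = 0 ∧ S.quad j x = 0}.Finite := by
  let ci : EuclideanSpace ℝ (Fin 2) := !₂[S.cx i, S.cy i]
  let cj : EuclideanSpace ℝ (Fin 2) := !₂[S.cx j, S.cy j]
  have hc : ci ≠ cj := by
    intro h
    rcases hij with h' | h'
    · exact h' (by simpa [ci, cj] using congrArg (fun v => v 0) h)
    · exact h' (by simpa [ci, cj] using congrArg (fun v => v 1) h)
  have hd : ∀ x, S.quad i x = 0 ∧ S.quad j x = 0 → dist x ci = S.rad i ∧ dist x cj = S.rad j := by
    rintro x ⟨h1, h2⟩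
    have e1 : x ∈ {x | S.quad i x = 0} := h1
    have e2 : x ∈ {x | S.quad j x = 0} := h2
    rw [← sphere_eq] at e1 e2
    exact ⟨e1, e2⟩
  by_cases hs : {x | S.quad i x = 0 ∧ S.quad j x = 0}.Subsingleton
  · exact hs.finite
  · rw [Set.not_subsingleton_iff] at hs
    obtain ⟨p₁, h₁, p₂, h₂, hne⟩ := hs
    refine (Set.toFinite {p₁, p₂}).subset fun x hx => ?_
    have hfr : Module.finrank ℝ (EuclideanSpace ℝ (Fin 2)) = 2 := by simp
    exact EuclideanGeometry.eq_of_dist_eq_of_dist_eq_of_finrank_eq_two hfr hc hne (hd _ h₁).1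
      (hd _ h₂).1 (hd _ hx).1 (hd _ h₁).2 (hd _ h₂).2 (hd _ hx).2

theorem IsGeneric.finite_singular_values (h : S.IsGeneric) :
    (height '' singularSet S.poly (zeroSet S.poly) height).Finite := by
  let A : Set ℝ := ⋃ i : Fin l, {S.cx i + S.rad i, S.cx i - S.rad i}
  let B : Set ℝ := ⋃ i : Fin l, ⋃ j : Fin l, (fun x : EuclideanSpace ℝ (Fin 2) => x 0) ''
    {x | S.quad i x = 0 ∧ S.quad j x = 0 ∧ (S.cx i ≠ S.cx j ∨ S.cy i ≠ S.cy j)}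
  have hA : A.Finite := Set.finite_iUnion fun i => Set.toFinite _
  have hB : B.Finite := by
    refine Set.finite_iUnion fun i => Set.finite_iUnion fun j => Set.Finite.image _ ?_
    by_cases hij : S.cx i ≠ S.cx j ∨ S.cy i ≠ S.cy j
    · exact (finite_inter S hij).subset fun x hx => ⟨hx.1, hx.2.1⟩
    · convert Set.finite_empty
      ext x
      simp only [Set.mem_ofPred_eq, Set.mem_empty_iff_false, iff_false]
      exact fun hx => hij hx.2.2
  refine (hA.union hB).subset ?_
  rintro _ ⟨z, hz, rfl⟩
  rcases h.singular_cases hz with ⟨i, hi, hy⟩ | ⟨i, j, hij, hc⟩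
  · left
    refine Set.mem_iUnion.2 ⟨i, ?_⟩
    have h1 := quad_eq_zero_iff.1 ((hi i).2 rfl)
    have h2 : (height z - S.cx i) ^ 2 = S.rad i ^ 2 := by
      have hy' : (toPlane z) 1 = S.cy i := hy
      rw [hy', sub_self] at h1
      exact (by simpa using h1 : ((toPlane z) 0 - S.cx i) ^ 2 = S.rad i ^ 2)
    rcases sq_eq_sq_iff_eq_or_eq_neg.1 h2 with h3 | h3
    · left
      linarith
    · right
      show height z = S.cx i - S.rad i
      linarith
  · right
    have hi := (hc i).2 (Or.inl rfl)
    have hj := (hc j).2 (Or.inr rfl)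
    refine Set.mem_iUnion.2 ⟨i, Set.mem_iUnion.2 ⟨j, toPlane z, ⟨hi, hj, ?_⟩, rfl⟩⟩
    by_contra hcon
    push Not at hcon
    apply (h.pair i j hij _ (toPlane_mem_region hz.1) hi hj).1
    rw [cross, hcon.1, hcon.2]
    ring

theorem isOpen_pos_of_ne (A : Set (Fin l)) :
    IsOpen {z : EuclideanSpace ℝ (Amb l) | ∀ c, c ∉ A → 0 < S.quad c (toPlane z)} := by
  simp only [Set.ofPred_forall]
  exact isOpen_iInter_of_finite fun c => isOpen_iInter_of_finite fun _ =>
    isOpen_lt continuous_const ((continuous_quad c).comp continuous_toPlane)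

/-- The linear map with prescribed coordinates. -/
noncomputable def coordMap {k : ℕ} (s : Fin k → Amb l) :
    EuclideanSpace ℝ (Amb l) →L[ℝ] EuclideanSpace ℝ (Fin k) :=
  (PiLp.continuousLinearEquiv 2 ℝ (fun _ : Fin k => ℝ)).symm.toContinuousLinearMap ∘L
    ContinuousLinearMap.pi fun i => EuclideanSpace.proj (s i)

theorem coordMap_apply {k : ℕ} (s : Fin k → Amb l) (z : EuclideanSpace ℝ (Amb l)) (i : Fin k) :
    coordMap s z i = z (s i) := rfl

/-- The condition of being Morse-Bott at one point. -/
def IsMorseBottAt (S : CircleSystem l) (p : EuclideanSpace ℝ (Amb l)) : Prop :=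
  ∃ (W : Set (EuclideanSpace ℝ (Amb l))) (k : ℕ)
      (s : EuclideanSpace ℝ (Amb l) → EuclideanSpace ℝ (Fin k))
      (O : Set (EuclideanSpace ℝ (Fin k))) (g : EuclideanSpace ℝ (Fin k) → ℝ),
      IsOpen W ∧ p ∈ W ∧ ContDiffOn ℝ ∞ s W ∧
      (∀ q ∈ zeroSet S.poly ∩ W, ∀ w : EuclideanSpace ℝ (Fin k),
        ∃ v ∈ tangentSpaceAt S.poly q, fderiv ℝ s q v = w) ∧
      IsMorseOn g O ∧ (∀ q ∈ zeroSet S.poly ∩ W, s q ∈ O ∧ height q = g (s q))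

/-- Near a point over a vertical tangent of the `i`-th circle, the height is the Morse function
`c ± √(r ^ 2 ± ‖y‖ ^ 2 - u ^ 2)` of the vertical coordinate `u` and the fibre coordinate `y`. -/
theorem isMorseBottAt_of_vertical {p : EuclideanSpace ℝ (Amb l)} (hp : p ∈ zeroSet S.poly)
    {i : Fin l} (hi : ∀ c, S.quad c (toPlane p) = 0 ↔ c = i) (hy : p (Sum.inl 1) = S.cy i) :
    IsMorseBottAt S p := by
  have hr := S.rad_pos i
  have hε := sgn_sq (S := S) i
  have hx : (p (Sum.inl 0) - S.cx i) ^ 2 = S.rad i ^ 2 := by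
    have h1 := quad_eq_zero_iff.1 ((hi i).2 rfl)
    have hy' : (toPlane p) 1 = S.cy i := hy
    rw [hy', sub_self] at h1
    simpa [toPlane] using h1
  have hx0 : p (Sum.inl 0) - S.cx i ≠ 0 := by
    intro h0
    rw [h0] at hx
    nlinarith
  obtain ⟨σ, hσ, hσp⟩ := exists_sign hx0
  have hσ2 : σ ^ 2 = 1 := by rcases hσ with h | h <;> rw [h] <;> norm_num
  set ε := S.sgn i with hεdef
  set ρ := S.rad i with hρdef
  let Q : EuclideanSpace ℝ (Fin 3) → ℝ := fun w => ε * (w 1 ^ 2 + w 2 ^ 2) - w 0 ^ 2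
  have hcoord : ∀ j : Fin 3, ContDiff ℝ ∞ (fun z : EuclideanSpace ℝ (Fin 3) => z j) :=
    fun j => (EuclideanSpace.proj (𝕜 := ℝ) j).contDiff
  have hQ : ContDiff ℝ ∞ Q :=
    (contDiff_const.mul (((hcoord 1).pow 2).add ((hcoord 2).pow 2))).sub ((hcoord 0).pow 2)
  let O : Set (EuclideanSpace ℝ (Fin 3)) := {w | 0 < ρ ^ 2 + Q w}
  have hO : IsOpen O := isOpen_lt continuous_const (continuous_const.add hQ.continuous)
  have h0O : (0 : EuclideanSpace ℝ (Fin 3)) ∈ O := by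
    show 0 < ρ ^ 2 + Q 0
    simp only [Q, PiLp.zero_apply]
    nlinarith
  let g : EuclideanSpace ℝ (Fin 3) → ℝ := fun w => S.cx i + σ * Real.sqrt (ρ ^ 2 + Q w)
  let κ : EuclideanSpace ℝ (Fin 3) → ℝ := fun w => (Real.sqrt (Real.sqrt (ρ ^ 2 + Q w) + ρ))⁻¹
  have hκ : ContDiffOn ℝ ∞ κ O := by
    have h1 : ContDiffOn ℝ ∞ (fun w => Real.sqrt (ρ ^ 2 + Q w)) O :=
      (contDiff_const.add hQ).contDiffOn.sqrt fun w hw => (show 0 < ρ ^ 2 + Q w from hw).ne'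
    refine ((h1.add contDiffOn_const).sqrt fun w hw => by positivity).inv fun w hw => ?_
    have : 0 < Real.sqrt (ρ ^ 2 + Q w) + ρ := by positivity
    exact (Real.sqrt_pos.2 this).ne'
  let τ : Fin 3 → ℝ := ![-σ, σ * ε, σ * ε]
  have hε' : ε = 1 ∨ ε = -1 := S.sgn_eq i
  have hτ : ∀ j, τ j = 1 ∨ τ j = -1 := by
    intro j
    have hσε : σ * ε = 1 ∨ σ * ε = -1 := by
      rcases hσ with h | h <;> rcases hε' with h' | h' <;> rw [h, h'] <;> norm_num
    have hσn : -σ = 1 ∨ -σ = -1 := by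
      rcases hσ with h | h <;> rw [h] <;> norm_num
    fin_cases j
    · exact hσn
    · exact hσε
    · exact hσε
  obtain ⟨O', hO'O, h0O', hO'⟩ := exists_isMorseOn_of_signs hO h0O (fun _ => κ) (fun _ => hκ)
    (fun _ w _ => by
      have : 0 < Real.sqrt (ρ ^ 2 + Q w) + ρ := by positivity
      exact inv_pos.2 (Real.sqrt_pos.2 this)) τ hτ (S.cx i + σ * ρ) g (fun w hw => by
      have hpos : 0 < Real.sqrt (ρ ^ 2 + Q w) + ρ := by positivity
      have hκ2 : κ w ^ 2 = (Real.sqrt (ρ ^ 2 + Q w) + ρ)⁻¹ := by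
        simp only [κ]
        rw [inv_pow, Real.sq_sqrt hpos.le]
      have hsq : Real.sqrt (ρ ^ 2 + Q w) ^ 2 = ρ ^ 2 + Q w :=
        Real.sq_sqrt (show 0 < ρ ^ 2 + Q w from hw).le
      have hsum : ∑ j, τ j * (w j * κ w) ^ 2 = σ * Q w * κ w ^ 2 := by
        rw [Fin.sum_univ_three]
        simp only [τ, Q, Matrix.cons_val_zero, Matrix.cons_val_one, Matrix.cons_val]
        ring
      rw [hsum, hκ2]
      simp only [g]
      have : Q w = (Real.sqrt (ρ ^ 2 + Q w) - ρ) * (Real.sqrt (ρ ^ 2 + Q w) + ρ) := by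
        linear_combination -hsq
      have h3 : σ * Q w * (Real.sqrt (ρ ^ 2 + Q w) + ρ)⁻¹ =
          σ * (Real.sqrt (ρ ^ 2 + Q w) - ρ) := by
        rw [mul_assoc, ← div_eq_mul_inv]
        congr 1
        rw [div_eq_iff hpos.ne']
        exact this
      rw [h3]
      ring)
  let L := coordMap (l := l) ![Sum.inl 1, Sum.inr ⟨i, 0⟩, Sum.inr ⟨i, 1⟩]
  let s : EuclideanSpace ℝ (Amb l) → EuclideanSpace ℝ (Fin 3) :=
    fun z => L z - !₂[S.cy i, 0, 0]
  have hs : ContDiff ℝ ∞ s := L.contDiff.sub contDiff_const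
  have hs0 : ∀ z, s z 0 = z (Sum.inl 1) - S.cy i := fun z => by simp [s, L, coordMap_apply]
  have hs1 : ∀ z, s z 1 = z (Sum.inr ⟨i, 0⟩) := fun z => by simp [s, L, coordMap_apply]
  have hs2 : ∀ z, s z 2 = z (Sum.inr ⟨i, 1⟩) := fun z => by simp [s, L, coordMap_apply]
  have hsd : ∀ z v, fderiv ℝ s z v = L v := by
    intro z v
    have : HasFDerivAt s L z := L.hasFDerivAt.sub_const _
    rw [this.fderiv]
  have hsp : s p = 0 := by
    ext j
    fin_cases j
    · simpa [hy] using hs0 p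
    · exact (hs1 p).trans (fibre_eq_zero hp ((hi i).2 rfl) 0)
    · exact (hs2 p).trans (fibre_eq_zero hp ((hi i).2 rfl) 1)
  refine ⟨({z | 0 < σ * (z (Sum.inl 0) - S.cx i)} ∩
    {z | ∀ c, c ∉ ({i} : Set (Fin l)) → 0 < S.quad c (toPlane z)}) ∩ s ⁻¹' O', 3, s, O', g,
    ?_, ?_, hs.contDiffOn, ?_, hO', ?_⟩
  · refine ((isOpen_lt continuous_const ?_).inter (isOpen_pos_of_ne {i})).inter
      (hO'.1.preimage hs.continuous)
    exact continuous_const.mul ((contDiff_coord (Sum.inl 0)).continuous.sub continuous_const)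
  · refine ⟨⟨hσp, fun c hc => ?_⟩, ?_⟩
    · exact lt_of_le_of_ne (toPlane_mem_region hp c) fun h => hc ((hi c).1 h.symm)
    · rw [Set.mem_preimage, hsp]
      exact h0O'
  · rintro q ⟨hq, ⟨hqσ, hqc⟩, -⟩ w
    have hq0 : q (Sum.inl 0) - S.cx i ≠ 0 := fun h => by
      rw [Set.mem_ofPred_eq, h, mul_zero] at hqσ
      exact lt_irrefl _ hqσ
    obtain ⟨v, -, hv1, hvi, hv⟩ := exists_tangent (S := S) q {i} (fun c hc => by
        rw [← mem_zeroSet_iff.1 hq c]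
        exact (hqc c hc).ne')
      ((ε * (q (Sum.inr ⟨i, 0⟩) * w 1 + q (Sum.inr ⟨i, 1⟩) * w 2) -
        (q (Sum.inl 1) - S.cy i) * w 0) / (q (Sum.inl 0) - S.cx i)) (w 0) (fun _ => ![w 1, w 2]) 0
      (fun c hc => by
        rw [Set.mem_singleton_iff] at hc
        subst hc
        simp only [Pi.zero_apply, Matrix.cons_val_zero, Matrix.cons_val_one]
        rw [mul_div_cancel₀ _ hq0, ← hεdef]
        linear_combination 2 * (q (Sum.inr ⟨c, 0⟩) * w 1 + q (Sum.inr ⟨c, 1⟩) * w 2) * hε)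
    refine ⟨v, mem_tangentSpaceAt.2 hv, ?_⟩
    rw [hsd]
    ext j
    fin_cases j
    · exact hv1
    · exact hvi i rfl 0
    · exact hvi i rfl 1
  · rintro q ⟨hq, ⟨hqσ, -⟩, hqO⟩
    refine ⟨hqO, ?_⟩
    have h1 := mem_zeroSet_iff.1 hq i
    have h2 : (q (Sum.inl 0) - S.cx i) ^ 2 = ρ ^ 2 + Q (s q) := by
      simp only [Q, hs0, hs1, hs2]
      have h1' : ε * ((q (Sum.inl 0) - S.cx i) ^ 2 + (q (Sum.inl 1) - S.cy i) ^ 2 - ρ ^ 2) =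
        q (Sum.inr ⟨i, 0⟩) ^ 2 + q (Sum.inr ⟨i, 1⟩) ^ 2 := h1
      rw [← h1']
      linear_combination -((q (Sum.inl 0) - S.cx i) ^ 2 + (q (Sum.inl 1) - S.cy i) ^ 2 - ρ ^ 2) * hε
    have h3 : Real.sqrt (ρ ^ 2 + Q (s q)) = σ * (q (Sum.inl 0) - S.cx i) := by
      rw [← h2, Real.sqrt_eq_iff_eq_sq (sq_nonneg _) (le_of_lt hqσ), mul_pow, hσ2, one_mul]
    simp only [g, height]
    rw [h3]
    linear_combination -(q (Sum.inl 0) - S.cx i) * hσ2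

end CircleSystem

namespace CircleSystem

variable {l : ℕ} {S : CircleSystem l}

/-- Near a point over a corner, the plane has the two quadratic functions as coordinates, and the
height is a smooth function of their values `‖y i‖ ^ 2` and `‖y j‖ ^ 2`. Since
`quad i x = ± (x - p) ⬝ (x + p - 2 a)` for the center `a`, Cramer's rule writes the height as a
combination of the two values with smooth non-vanishing coefficients. -/
theorem isMorseBottAt_of_corner {p : EuclideanSpace ℝ (Amb l)} (hp : p ∈ zeroSet S.poly)
    {i j : Fin l} (hij : i ≠ j) (hc : ∀ c, S.quad c (toPlane p) = 0 ↔ c = i ∨ c = j)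
    (hcr : S.cross i j (toPlane p) ≠ 0) (hyi : p (Sum.inl 1) ≠ S.cy i)
    (hyj : p (Sum.inl 1) ≠ S.cy j) : IsMorseBottAt S p := by
  have hi := (hc i).2 (Or.inl rfl)
  have hj := (hc j).2 (Or.inr rfl)
  set x₀ := toPlane p with hx₀
  have hy0 : x₀ 1 = p (Sum.inl 1) := rfl
  have hεi := sgn_sq (S := S) i
  have hεj := sgn_sq (S := S) j
  have hco : ∀ k : Fin 2, ContDiff ℝ ∞ (fun z : EuclideanSpace ℝ (Fin 2) => z k) :=
    fun k => (EuclideanSpace.proj (𝕜 := ℝ) k).contDiff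
  let α₀ : EuclideanSpace ℝ (Fin 2) → ℝ := fun x => x 0 + x₀ 0 - 2 * S.cx i
  let α₁ : EuclideanSpace ℝ (Fin 2) → ℝ := fun x => x 1 + x₀ 1 - 2 * S.cy i
  let β₀ : EuclideanSpace ℝ (Fin 2) → ℝ := fun x => x 0 + x₀ 0 - 2 * S.cx j
  let β₁ : EuclideanSpace ℝ (Fin 2) → ℝ := fun x => x 1 + x₀ 1 - 2 * S.cy j
  have hα₀ : ContDiff ℝ ∞ α₀ := ((hco 0).add contDiff_const).sub contDiff_const
  have hα₁ : ContDiff ℝ ∞ α₁ := ((hco 1).add contDiff_const).sub contDiff_const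
  have hβ₀ : ContDiff ℝ ∞ β₀ := ((hco 0).add contDiff_const).sub contDiff_const
  have hβ₁ : ContDiff ℝ ∞ β₁ := ((hco 1).add contDiff_const).sub contDiff_const
  let Δ : EuclideanSpace ℝ (Fin 2) → ℝ := fun x => α₀ x * β₁ x - α₁ x * β₀ x
  have hΔ : ContDiff ℝ ∞ Δ := (hα₀.mul hβ₁).sub (hα₁.mul hβ₀)
  have hqi : ∀ x, S.quad i x = S.sgn i * (α₀ x * (x 0 - x₀ 0) + α₁ x * (x 1 - x₀ 1)) := by
    intro x
    have := quad_eq_zero_iff.1 hi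
    simp only [quad, α₀, α₁]
    linear_combination S.sgn i * this
  have hqj : ∀ x, S.quad j x = S.sgn j * (β₀ x * (x 0 - x₀ 0) + β₁ x * (x 1 - x₀ 1)) := by
    intro x
    have := quad_eq_zero_iff.1 hj
    simp only [quad, β₀, β₁]
    linear_combination S.sgn j * this
  have hΔ0 : Δ x₀ = 4 * S.cross i j x₀ := by
    simp only [Δ, α₀, α₁, β₀, β₁, cross]
    ring
  have hΔne : Δ x₀ ≠ 0 := by
    rw [hΔ0]
    exact mul_ne_zero four_ne_zero hcr
  let A : EuclideanSpace ℝ (Fin 2) → ℝ := fun x => S.sgn i * β₁ x / Δ x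
  let B : EuclideanSpace ℝ (Fin 2) → ℝ := fun x => -(S.sgn j * α₁ x) / Δ x
  have hAB : ∀ x, Δ x ≠ 0 → x 0 = x₀ 0 + A x * S.quad i x + B x * S.quad j x := by
    intro x hx
    have h1 : x 0 - x₀ 0 = (A x * S.quad i x + B x * S.quad j x) := by
      rw [hqi, hqj]
      simp only [A, B]
      rw [div_mul_eq_mul_div, div_mul_eq_mul_div, ← add_div, eq_div_iff hx]
      simp only [Δ]
      linear_combination (-β₁ x * (α₀ x * (x 0 - x₀ 0) + α₁ x * (x 1 - x₀ 1))) * hεi +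
        (α₁ x * (β₀ x * (x 0 - x₀ 0) + β₁ x * (x 1 - x₀ 1))) * hεj
    linarith
  have hA0 : A x₀ ≠ 0 := by
    refine div_ne_zero (mul_ne_zero (sgn_ne_zero i) ?_) hΔne
    simp only [β₁]
    intro h
    apply hyj
    rw [← hy0]
    linarith
  have hB0 : B x₀ ≠ 0 := by
    refine div_ne_zero (neg_ne_zero.2 (mul_ne_zero (sgn_ne_zero j) ?_)) hΔne
    simp only [α₁]
    intro h
    apply hyi
    rw [← hy0]
    linarith
  obtain ⟨τA, hτA, hτA0⟩ := exists_sign hA0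
  obtain ⟨τB, hτB, hτB0⟩ := exists_sign hB0
  -- A neighbourhood of the corner on which everything stays non-degenerate.
  let U₀ : Set (EuclideanSpace ℝ (Fin 2)) := {x | Δ x ≠ 0}
  have hU₀ : IsOpen U₀ := isOpen_ne_fun hΔ.continuous continuous_const
  have hAU : ContDiffOn ℝ ∞ A U₀ :=
    (contDiff_const.mul hβ₁).contDiffOn.div hΔ.contDiffOn fun x hx => hx
  have hBU : ContDiffOn ℝ ∞ B U₀ :=
    (contDiff_const.mul hα₁).neg.contDiffOn.div hΔ.contDiffOn fun x hx => hx
  let U : Set (EuclideanSpace ℝ (Fin 2)) :=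
    ((U₀ ∩ (fun x => τA * A x) ⁻¹' Set.Ioi 0) ∩ (U₀ ∩ (fun x => τB * B x) ⁻¹' Set.Ioi 0)) ∩
      {x | S.cross i j x ≠ 0}
  have hcross : Continuous fun x => S.cross i j x := by
    unfold cross
    exact (((hco 0).continuous.sub continuous_const).mul ((hco 1).continuous.sub
      continuous_const)).sub (((hco 1).continuous.sub continuous_const).mul
      ((hco 0).continuous.sub continuous_const))
  have hU : IsOpen U := by
    refine IsOpen.inter (IsOpen.inter ?_ ?_) (isOpen_ne_fun hcross continuous_const)
    · exact (contDiffOn_const.mul hAU).continuousOn.isOpen_inter_preimage hU₀ isOpen_Ioi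
    · exact (contDiffOn_const.mul hBU).continuousOn.isOpen_inter_preimage hU₀ isOpen_Ioi
  have hx₀U : x₀ ∈ U := ⟨⟨⟨hΔne, hτA0⟩, hΔne, hτB0⟩, hcr⟩
  let ψ : EuclideanSpace ℝ (Fin 2) → EuclideanSpace ℝ (Fin 2) :=
    fun x => !₂[S.quad i x, S.quad j x]
  have hψ : ContDiff ℝ ∞ ψ := by
    rw [contDiff_euclidean]
    intro k
    fin_cases k
    · exact contDiff_quad i
    · exact contDiff_quad j
  have hquadD : ∀ c (v : EuclideanSpace ℝ (Fin 2)), fderiv ℝ (S.quad c) x₀ v =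
      2 * S.sgn c * ((x₀ 0 - S.cx c) * v 0 + (x₀ 1 - S.cy c) * v 1) := by
    intro c v
    have hpr : ∀ k : Fin 2, HasFDerivAt (fun w : EuclideanSpace ℝ (Fin 2) => w k)
        (EuclideanSpace.proj (𝕜 := ℝ) k) x₀ := fun k => (EuclideanSpace.proj (𝕜 := ℝ) k).hasFDerivAt
    have : HasFDerivAt (S.quad c) _ x₀ := ((((hpr 0).sub_const (S.cx c)).pow 2).add
      (((hpr 1).sub_const (S.cy c)).pow 2)).sub_const (S.rad c ^ 2) |>.const_mul (S.sgn c)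
    rw [this.fderiv]
    simp
    ring
  have hψ' : HasFDerivAt ψ (fderiv ℝ ψ x₀) x₀ := (hψ.differentiable (by simp) x₀).hasFDerivAt
  have hψD : ∀ v, fderiv ℝ ψ x₀ v = !₂[fderiv ℝ (S.quad i) x₀ v, fderiv ℝ (S.quad j) x₀ v] := by
    intro v
    have hk : ∀ k : Fin 2, HasFDerivAt (fun x => ψ x k)
        ((EuclideanSpace.proj (𝕜 := ℝ) k : EuclideanSpace ℝ (Fin 2) →L[ℝ] ℝ) ∘L fderiv ℝ ψ x₀) x₀ :=
      fun k => (EuclideanSpace.proj (𝕜 := ℝ) k : EuclideanSpace ℝ (Fin 2) →L[ℝ] ℝ).hasFDerivAt.comp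
        x₀ hψ'
    ext k
    fin_cases k
    · exact (congrArg (fun T : EuclideanSpace ℝ (Fin 2) →L[ℝ] ℝ => T v) (hk 0).fderiv).symm
    · exact (congrArg (fun T : EuclideanSpace ℝ (Fin 2) →L[ℝ] ℝ => T v) (hk 1).fderiv).symm
  have hinj : Function.Injective (fderiv ℝ ψ x₀).toLinearMap := by
    rw [← LinearMap.ker_eq_bot, LinearMap.ker_eq_bot']
    intro v hv
    have hv' : !₂[fderiv ℝ (S.quad i) x₀ v, fderiv ℝ (S.quad j) x₀ v] =
        (0 : EuclideanSpace ℝ (Fin 2)) := by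
      rw [← hψD]
      exact hv
    have h1 : fderiv ℝ (S.quad i) x₀ v = 0 := by simpa using congrArg (fun w => w 0) hv'
    have h2 : fderiv ℝ (S.quad j) x₀ v = 0 := by simpa using congrArg (fun w => w 1) hv'
    rw [hquadD, mul_eq_zero] at h1 h2
    have h1' := h1.resolve_left (mul_ne_zero two_ne_zero (sgn_ne_zero i))
    have h2' := h2.resolve_left (mul_ne_zero two_ne_zero (sgn_ne_zero j))
    have e0 : S.cross i j x₀ * v 0 = 0 := by
      simp only [cross]
      linear_combination (x₀ 1 - S.cy j) * h1' - (x₀ 1 - S.cy i) * h2'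
    have e1 : S.cross i j x₀ * v 1 = 0 := by
      simp only [cross]
      linear_combination (x₀ 0 - S.cx i) * h2' - (x₀ 0 - S.cx j) * h1'
    ext k
    fin_cases k
    · exact (mul_eq_zero.1 e0).resolve_left hcr
    · exact (mul_eq_zero.1 e1).resolve_left hcr
  let T : EuclideanSpace ℝ (Fin 2) ≃L[ℝ] EuclideanSpace ℝ (Fin 2) :=
    (LinearEquiv.ofInjectiveEndo _ hinj).toContinuousLinearEquiv
  have hT : HasFDerivAt ψ (T : EuclideanSpace ℝ (Fin 2) →L[ℝ] EuclideanSpace ℝ (Fin 2)) x₀ := by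
    have : (T : EuclideanSpace ℝ (Fin 2) →L[ℝ] EuclideanSpace ℝ (Fin 2)) = fderiv ℝ ψ x₀ := by
      ext v : 1
      rfl
    rw [this]
    exact hψ'
  obtain ⟨Ψ, hx₀Ψ, hΨU, hΨ, -, hΨs⟩ :=
    exists_smooth_openPartialHomeomorph hU hx₀U hψ.contDiffOn hT
  have hcoord : ∀ k : Fin 4, ContDiff ℝ ∞ (fun z : EuclideanSpace ℝ (Fin 4) => z k) :=
    fun k => (EuclideanSpace.proj (𝕜 := ℝ) k).contDiff
  let N : EuclideanSpace ℝ (Fin 4) → EuclideanSpace ℝ (Fin 2) :=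
    fun w => !₂[w 0 ^ 2 + w 1 ^ 2, w 2 ^ 2 + w 3 ^ 2]
  have hN : ContDiff ℝ ∞ N := by
    rw [contDiff_euclidean]
    intro k
    fin_cases k
    · exact ((hcoord 0).pow 2).add ((hcoord 1).pow 2)
    · exact ((hcoord 2).pow 2).add ((hcoord 3).pow 2)
  have hψx₀ : ψ x₀ = N 0 := by
    ext k
    fin_cases k
    · simp [ψ, N, hi]
    · simp [ψ, N, hj]
  let O : Set (EuclideanSpace ℝ (Fin 4)) := N ⁻¹' Ψ.target
  have hO : IsOpen O := Ψ.open_target.preimage hN.continuous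
  have h0O : (0 : EuclideanSpace ℝ (Fin 4)) ∈ O := by
    show N 0 ∈ Ψ.target
    rw [← hψx₀, ← hΨ]
    exact Ψ.map_source hx₀Ψ
  let ξ : EuclideanSpace ℝ (Fin 4) → EuclideanSpace ℝ (Fin 2) := fun w => Ψ.symm (N w)
  have hξ : ContDiffOn ℝ ∞ ξ O := hΨs.comp hN.contDiffOn fun w hw => hw
  have hξU : ∀ w ∈ O, ξ w ∈ U := fun w hw => hΨU (Ψ.map_target hw)
  have hψξ : ∀ w ∈ O, ψ (ξ w) = N w := fun w hw => by
    rw [← hΨ]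
    exact Ψ.right_inv hw
  let κA : EuclideanSpace ℝ (Fin 4) → ℝ := fun w => Real.sqrt (τA * A (ξ w))
  let κB : EuclideanSpace ℝ (Fin 4) → ℝ := fun w => Real.sqrt (τB * B (ξ w))
  have hκA : ContDiffOn ℝ ∞ κA O :=
    (contDiffOn_const.mul (hAU.comp hξ fun w hw => (hξU w hw).1.1.1)).sqrt
      fun w hw => (Set.mem_Ioi.1 (hξU w hw).1.1.2).ne'
  have hκB : ContDiffOn ℝ ∞ κB O :=
    (contDiffOn_const.mul (hBU.comp hξ fun w hw => (hξU w hw).1.1.1)).sqrt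
      fun w hw => (Set.mem_Ioi.1 (hξU w hw).1.2.2).ne'
  let g : EuclideanSpace ℝ (Fin 4) → ℝ := fun w => ξ w 0
  have hτA2 : τA ^ 2 = 1 := by rcases hτA with h | h <;> rw [h] <;> norm_num
  have hτB2 : τB ^ 2 = 1 := by rcases hτB with h | h <;> rw [h] <;> norm_num
  obtain ⟨O', hO'O, h0O', hO'⟩ := exists_isMorseOn_of_signs hO h0O ![κA, κA, κB, κB]
    (fun k => by fin_cases k <;> assumption)
    (fun k w hw => by
      have h1 : 0 < κA w := Real.sqrt_pos.2 (hξU w hw).1.1.2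
      have h2 : 0 < κB w := Real.sqrt_pos.2 (hξU w hw).1.2.2
      fin_cases k
      exacts [h1, h1, h2, h2])
    ![τA, τA, τB, τB] (fun k => by fin_cases k <;> assumption) (x₀ 0) g (fun w hw => by
      have hA2 : κA w ^ 2 = τA * A (ξ w) := Real.sq_sqrt (le_of_lt (hξU w hw).1.1.2)
      have hB2 : κB w ^ 2 = τB * B (ξ w) := Real.sq_sqrt (le_of_lt (hξU w hw).1.2.2)
      have hq1 : S.quad i (ξ w) = w 0 ^ 2 + w 1 ^ 2 := congrArg (fun v => v 0) (hψξ w hw)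
      have hq2 : S.quad j (ξ w) = w 2 ^ 2 + w 3 ^ 2 := congrArg (fun v => v 1) (hψξ w hw)
      have h := hAB (ξ w) (hξU w hw).1.1.1
      rw [hq1, hq2] at h
      show ξ w 0 = _
      rw [h, Fin.sum_univ_four]
      simp only [Matrix.cons_val_zero, Matrix.cons_val_one, Matrix.cons_val, mul_pow, hA2, hB2]
      linear_combination -(A (ξ w) * (w 0 ^ 2 + w 1 ^ 2)) * hτA2 -
        (B (ξ w) * (w 2 ^ 2 + w 3 ^ 2)) * hτB2)
  let s := coordMap (l := l) ![Sum.inr ⟨i, 0⟩, Sum.inr ⟨i, 1⟩, Sum.inr ⟨j, 0⟩, Sum.inr ⟨j, 1⟩]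
  have hsp : s p = 0 := by
    ext k
    fin_cases k
    · exact fibre_eq_zero hp hi 0
    · exact fibre_eq_zero hp hi 1
    · exact fibre_eq_zero hp hj 0
    · exact fibre_eq_zero hp hj 1
  refine ⟨(toPlane ⁻¹' Ψ.source ∩
    {z | ∀ c, c ∉ ({i, j} : Set (Fin l)) → 0 < S.quad c (toPlane z)}) ∩ s ⁻¹' O', 4, s, O', g,
    ?_, ?_, s.contDiff.contDiffOn, ?_, hO', ?_⟩
  · exact ((Ψ.open_source.preimage continuous_toPlane).inter (isOpen_pos_of_ne _)).inter
      (hO'.1.preimage s.continuous)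
  · refine ⟨⟨hx₀Ψ, fun c hcc => ?_⟩, ?_⟩
    · exact lt_of_le_of_ne (toPlane_mem_region hp c) fun h => hcc ((hc c).1 h.symm)
    · rw [Set.mem_preimage, hsp]
      exact h0O'
  · rintro q ⟨hq, ⟨hqΨ, hqc⟩, -⟩ w
    have hqcr : S.cross i j (toPlane q) ≠ 0 := (hΨU hqΨ).2
    obtain ⟨ξ₀, ξ₁, e1, e2⟩ := exists_cramer (a := q (Sum.inl 0) - S.cx i)
      (b := q (Sum.inl 1) - S.cy i) (c := q (Sum.inl 0) - S.cx j) (d := q (Sum.inl 1) - S.cy j)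
      hqcr (S.sgn i * (q (Sum.inr ⟨i, 0⟩) * w 0 + q (Sum.inr ⟨i, 1⟩) * w 1))
      (S.sgn j * (q (Sum.inr ⟨j, 0⟩) * w 2 + q (Sum.inr ⟨j, 1⟩) * w 3))
    obtain ⟨v, -, -, hvi, hv⟩ := exists_tangent (S := S) q {i, j} (fun c hcc => by
        rw [← mem_zeroSet_iff.1 hq c]
        exact (hqc c hcc).ne') ξ₀ ξ₁
      (fun c => if c = i then ![w 0, w 1] else ![w 2, w 3]) 0
      (fun c hcc => by
        rcases hcc with rfl | hcc
        · simp only [Pi.zero_apply, if_true, Matrix.cons_val_zero, Matrix.cons_val_one]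
          rw [e1]
          linear_combination 2 * (q (Sum.inr ⟨c, 0⟩) * w 0 + q (Sum.inr ⟨c, 1⟩) * w 1) * hεi
        · rw [Set.mem_singleton_iff] at hcc
          subst hcc
          simp only [Pi.zero_apply, if_neg hij.symm, Matrix.cons_val_zero, Matrix.cons_val_one]
          rw [e2]
          linear_combination 2 * (q (Sum.inr ⟨c, 0⟩) * w 2 + q (Sum.inr ⟨c, 1⟩) * w 3) * hεj)
    refine ⟨v, mem_tangentSpaceAt.2 hv, ?_⟩
    rw [s.fderiv]
    have hvi0 : ∀ k, v (Sum.inr ⟨i, k⟩) = ![w 0, w 1] k := fun k => by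
      rw [hvi i (Or.inl rfl) k, if_pos rfl]
    have hvj0 : ∀ k, v (Sum.inr ⟨j, k⟩) = ![w 2, w 3] k := fun k => by
      rw [hvi j (Or.inr rfl) k, if_neg hij.symm]
    ext k
    fin_cases k
    · exact hvi0 0
    · exact hvi0 1
    · exact hvj0 0
    · exact hvj0 1
  · rintro q ⟨hq, ⟨hqΨ, -⟩, hqO⟩
    refine ⟨hqO, ?_⟩
    have hψq : Ψ (toPlane q) = N (s q) := by
      rw [hΨ]
      ext k
      fin_cases k
      · exact mem_zeroSet_iff.1 hq i
      · exact mem_zeroSet_iff.1 hq j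
    show q (Sum.inl 0) = Ψ.symm (N (s q)) 0
    rw [← hψq, Ψ.left_inv hqΨ]
    rfl

theorem IsGeneric.isMorseBott (h : S.IsGeneric) :
    IsMorseBott S.poly (zeroSet S.poly) height := by
  refine ⟨contDiff_coord (Sum.inl 0), fun p hp => ?_⟩
  rcases h.singular_cases hp with ⟨i, hi, hy⟩ | ⟨i, j, hij, hc⟩
  · exact isMorseBottAt_of_vertical hp.1 hi hy
  · have hr := toPlane_mem_region hp.1
    have hi := (hc i).2 (Or.inl rfl)
    have hj := (hc j).2 (Or.inr rfl)
    obtain ⟨h1, h2⟩ := h.pair i j hij _ hr hi hj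
    exact isMorseBottAt_of_corner hp.1 hij hc h1 h2 (h.pair j i hij.symm _ hr hj hi).2

/-! ### The Reeb space -/

/-- If the region maps continuously onto `G` with connected fibres contained in vertical lines, and
each vertical line meets finitely many fibres, then the fibres are the components of the vertical
slices, and the Reeb space of the height function on the manifold is `G`. -/
theorem IsGeneric.nonempty_reebSpace_homeomorph (h : S.IsGeneric) {G : Type*} [TopologicalSpace G]
    [T2Space G] (r : EuclideanSpace ℝ (Fin 2) → G) (hr : ContinuousOn r S.region)
    (hsurj : ∀ g, ∃ x ∈ S.region, r x = g)
    (hfib : ∀ g, IsPreconnected {x | x ∈ S.region ∧ r x = g})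
    (hheight : ∀ x ∈ S.region, ∀ y ∈ S.region, r x = r y → x 0 = y 0)
    (hfin : ∀ t : ℝ, (r '' {x | x ∈ S.region ∧ x 0 = t}).Finite) :
    Nonempty
      (ReebSpace (fun p : zeroSet S.poly => height (p : EuclideanSpace ℝ (Amb l))) ≃ₜ G) := by
  let ρ : zeroSet S.poly → G := fun p => r (toPlane (p : EuclideanSpace ℝ (Amb l)))
  have hρ : Continuous ρ := by
    have : ContinuousOn (fun z => r (toPlane z)) (zeroSet S.poly) :=
      hr.comp continuous_toPlane.continuousOn fun z hz => toPlane_mem_region hz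
    exact continuousOn_iff_continuous_domRestrict.1 this
  have hρs : Function.Surjective ρ := by
    intro g
    obtain ⟨x, hx, hxg⟩ := hsurj g
    refine ⟨⟨param S x 0, param_mem_zeroSet hx 0⟩, ?_⟩
    simp only [ρ, toPlane_param]
    exact hxg
  have : CompactSpace (zeroSet S.poly) := isCompact_iff_compactSpace.1 h.isCompact_zeroSet
  have hq : IsQuotientMap ρ := hρ.isClosedMap.isQuotientMap hρ hρs
  have hfibM : ∀ g, IsPreconnected (ρ ⁻¹' {g}) := by
    intro g
    have h1 := isPreconnected_preimage (S := S) (fun x hx => hx.1) (hfib g)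
    rw [← Topology.IsInducing.subtypeVal.isPreconnected_image]
    convert h1 using 1
    ext z
    constructor
    · rintro ⟨⟨z, hz⟩, hzg, rfl⟩
      exact ⟨hz, toPlane_mem_region hz, hzg⟩
    · rintro ⟨hz, -, hzg⟩
      exact ⟨⟨z, hz⟩, hzg, rfl⟩
  have hset : ∀ p q : zeroSet S.poly,
      (reebSetoid (fun p : zeroSet S.poly => height (p : EuclideanSpace ℝ (Amb l)))) p q ↔
        ρ p = ρ q := by
    intro p q
    constructor
    · intro hpq
      have hpq' : q ∈ connectedComponentIn
        ((fun p : zeroSet S.poly => height (p : EuclideanSpace ℝ (Amb l))) ⁻¹'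
          {height p.1}) p := hpq
      set C := connectedComponentIn
        ((fun p : zeroSet S.poly => height (p : EuclideanSpace ℝ (Amb l))) ⁻¹'
          {height p.1}) p with hC
      have hCpre : IsPreconnected (ρ '' C) :=
        isPreconnected_connectedComponentIn.image _ hρ.continuousOn
      have hCfin : (ρ '' C).Finite := by
        refine (hfin (height p.1)).subset ?_
        rintro _ ⟨z, hz, rfl⟩
        refine ⟨toPlane z.1, ⟨toPlane_mem_region z.2, ?_⟩, rfl⟩
        exact (connectedComponentIn_subset _ _ hz : z ∈ (fun p : zeroSet S.poly =>
          height (p : EuclideanSpace ℝ (Amb l))) ⁻¹' {height p.1})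
      by_contra hne
      exact hCpre.infinite_of_nontrivial
        ⟨ρ p, ⟨p, mem_connectedComponentIn rfl, rfl⟩, ρ q, ⟨q, hpq', rfl⟩, hne⟩ hCfin
    · intro hpq
      have hsub : ρ ⁻¹' {ρ p} ⊆
          (fun p : zeroSet S.poly => height (p : EuclideanSpace ℝ (Amb l))) ⁻¹' {height p.1} := by
        intro z hz
        exact hheight _ (toPlane_mem_region z.2) _ (toPlane_mem_region p.2) hz
      exact (hfibM (ρ p)).subset_connectedComponentIn rfl hsub hpq.symm
  have hker : reebSetoid (fun p : zeroSet S.poly => height (p : EuclideanSpace ℝ (Amb l))) =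
      Setoid.ker ρ := Setoid.ext hset
  exact ⟨(Homeomorph.Quotient.congrRight fun p q => by rw [hker]).trans
    (IsQuotientMap.homeomorph (f := (⟨ρ, hρ⟩ : C(zeroSet S.poly, G))) hq)⟩

theorem IsGeneric.isPreconnected_zeroSet (h : S.IsGeneric) {G : Type*} [TopologicalSpace G]
    [T2Space G] [ConnectedSpace G] (r : EuclideanSpace ℝ (Fin 2) → G)
    (hr : ContinuousOn r S.region) (hsurj : ∀ g, ∃ x ∈ S.region, r x = g)
    (hfib : ∀ g, IsPreconnected {x | x ∈ S.region ∧ r x = g}) :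
    IsPreconnected (zeroSet S.poly) := by
  have : CompactSpace S.region := isCompact_iff_compactSpace.1 h.isCompact_region
  have hρ : Continuous (S.region.domRestrict r) := continuousOn_iff_continuous_domRestrict.1 hr
  have hρs : Function.Surjective (S.region.domRestrict r) := fun g => by
    obtain ⟨x, hx, hxg⟩ := hsurj g
    exact ⟨⟨x, hx⟩, hxg⟩
  have hq : IsQuotientMap (S.region.domRestrict r) := hρ.isClosedMap.isQuotientMap hρ hρs
  have hfib' : ∀ g, IsConnected (S.region.domRestrict r ⁻¹' {g}) := by
    intro g
    obtain ⟨x, hx⟩ := hρs g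
    refine ⟨⟨x, hx⟩, ?_⟩
    rw [← Topology.IsInducing.subtypeVal.isPreconnected_image]
    convert hfib g using 1
    ext z
    constructor
    · rintro ⟨⟨z, hz⟩, hzg, rfl⟩
      exact ⟨hz, hzg⟩
    · rintro ⟨hz, hzg⟩
      exact ⟨⟨z, hz⟩, hzg, rfl⟩
  have hconn : IsPreconnected (S.region) := by
    have h1 := hq.isCoinducing.isConnected_preimage_of_isClosed hfib' isClosed_univ
      isConnected_univ
    rw [Set.preimage_univ] at h1
    exact isPreconnected_iff_preconnectedSpace.2 ⟨h1.isPreconnected⟩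
  have := isPreconnected_preimage (S := S) subset_rfl hconn
  have hsub : zeroSet S.poly ⊆ toPlane ⁻¹' S.region := fun z hz => toPlane_mem_region hz
  rwa [Set.inter_eq_left.2 hsub] at this

/-- A generic system of circles whose region maps onto `G` with connected fibres contained in
vertical lines realizes `G` as a Reeb space. -/
theorem IsGeneric.exists_circleRegion (h : S.IsGeneric) {G : Type*} [TopologicalSpace G]
    [T2Space G] [ConnectedSpace G] (r : EuclideanSpace ℝ (Fin 2) → G)
    (hr : ContinuousOn r S.region) (hsurj : ∀ g, ∃ x ∈ S.region, r x = g)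
    (hfib : ∀ g, IsPreconnected {x | x ∈ S.region ∧ r x = g})
    (hheight : ∀ x ∈ S.region, ∀ y ∈ S.region, r x = r y → x 0 = y 0)
    (hfin : ∀ t : ℝ, (r '' {x | x ∈ S.region ∧ x 0 = t}).Finite) :
    ∃ R : CircleRegion,
      IsCompact R.manifold ∧ IsConnected R.manifold ∧
      IsRealAlgebraicManifold R.poly R.manifold ∧
      R.proj '' R.manifold = closure R.D ∧
      IsMorseBott R.poly R.manifold R.height ∧
      (R.height '' singularSet R.poly R.manifold R.height).Finite ∧
      Nonempty (ReebSpace (fun p : R.manifold => R.height p) ≃ₜ G) := by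
  refine ⟨toCircleRegion h, ?_⟩
  have hM : (toCircleRegion h).manifold = zeroSet S.poly := by
    unfold CircleRegion.manifold
    rw [poly_toCircleRegion]
  have hh : (toCircleRegion h).height = height := rfl
  have hp : (toCircleRegion h).proj = toPlane := rfl
  have hD : closure (toCircleRegion h).D = S.region := h.closure_pos
  rw [hM, hh, hp, hD, poly_toCircleRegion]
  exact ⟨h.isCompact_zeroSet,
    ⟨h.isRealAlgebraicManifold.nonempty, h.isPreconnected_zeroSet r hr hsurj hfib⟩,
    h.isRealAlgebraicManifold, toPlane_image, h.isMorseBott, h.finite_singular_values,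
    h.nonempty_reebSpace_homeomorph r hr hsurj hfib hheight hfin⟩

end CircleSystem

/-- A closed rectangle of the plane with a map from its horizontal side. A region covered by such
pieces is mapped to `G` by the maps of the horizontal coordinate. -/
structure Piece (G : Type*) [TopologicalSpace G] where
  /-- the horizontal side -/
  a : ℝ
  b : ℝ
  /-- the vertical side -/
  c : ℝ
  d : ℝ
  /-- the map of the horizontal coordinate -/
  s : ℝ → G
  continuousOn : ContinuousOn s (Set.Icc a b)

/-- The rectangle of a piece. -/
def Piece.rect {G : Type*} [TopologicalSpace G] (P : Piece G) : Set (EuclideanSpace ℝ (Fin 2)) :=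
  {z | z 0 ∈ Set.Icc P.a P.b ∧ z 1 ∈ Set.Icc P.c P.d}

theorem continuous_coord (k : Fin 2) : Continuous fun z : EuclideanSpace ℝ (Fin 2) => z k :=
  (EuclideanSpace.proj (𝕜 := ℝ) k).continuous

theorem Piece.isClosed_rect {G : Type*} [TopologicalSpace G] (P : Piece G) : IsClosed P.rect :=
  (isClosed_Icc.preimage (continuous_coord 0)).inter (isClosed_Icc.preimage (continuous_coord 1))

/-- The vertical segment between two points of equal first coordinate is preconnected in a set
that contains it. -/
theorem exists_isPreconnected_vertical {z w : EuclideanSpace ℝ (Fin 2)} (h0 : z 0 = w 0)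
    (h1 : z 1 ≤ w 1) {F : Set (EuclideanSpace ℝ (Fin 2))}
    (hF : ∀ y ∈ Set.Icc (z 1) (w 1), !₂[z 0, y] ∈ F) :
    ∃ t ⊆ F, z ∈ t ∧ w ∈ t ∧ IsPreconnected t := by
  have hc : Continuous fun y : ℝ => (!₂[z 0, y] : EuclideanSpace ℝ (Fin 2)) := by
    refine (PiLp.continuous_toLp 2 _).comp (continuous_pi fun k => ?_)
    fin_cases k
    · exact continuous_const
    · exact continuous_id
  refine ⟨(fun y : ℝ => (!₂[z 0, y] : EuclideanSpace ℝ (Fin 2))) '' Set.Icc (z 1) (w 1), ?_, ?_, ?_,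
    isPreconnected_Icc.image _ hc.continuousOn⟩
  · rintro _ ⟨y, hy, rfl⟩
    exact hF y hy
  · refine ⟨z 1, ⟨le_rfl, h1⟩, ?_⟩
    ext k
    fin_cases k <;> simp
  · refine ⟨w 1, ⟨h1, le_rfl⟩, ?_⟩
    ext k
    fin_cases k <;> simp [h0]

/-- Finitely many compatible pieces covering a closed region glue to a continuous map. If moreover
points with the same value lie in a common piece on the same vertical line, and the region is
vertically convex in each piece, then the fibres are preconnected. -/
theorem exists_map_of_pieces {G : Type*} [TopologicalSpace G] [Nonempty G]
    {X : Set (EuclideanSpace ℝ (Fin 2))} (hX : IsClosed X) {ι : Type*} [Finite ι]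
    (P : ι → Piece G) (cov : ∀ z ∈ X, ∃ i, z ∈ (P i).rect)
    (agree : ∀ z ∈ X, ∀ i j, z ∈ (P i).rect → z ∈ (P j).rect → (P i).s (z 0) = (P j).s (z 0))
    (sep : ∀ z ∈ X, ∀ w ∈ X, ∀ i j, z ∈ (P i).rect → w ∈ (P j).rect →
      (P i).s (z 0) = (P j).s (w 0) → z 0 = w 0 ∧ ∃ k, z ∈ (P k).rect ∧ w ∈ (P k).rect)
    (conv : ∀ i, ∀ z ∈ X, ∀ w ∈ X, z ∈ (P i).rect → w ∈ (P i).rect → z 0 = w 0 →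
      ∀ y ∈ Set.Icc (z 1) (w 1), !₂[z 0, y] ∈ X)
    (surj : ∀ g, ∃ z ∈ X, ∃ i, z ∈ (P i).rect ∧ (P i).s (z 0) = g) :
    ∃ r : EuclideanSpace ℝ (Fin 2) → G, ContinuousOn r X ∧ (∀ g, ∃ x ∈ X, r x = g) ∧
      (∀ g, IsPreconnected {x | x ∈ X ∧ r x = g}) ∧
      (∀ x ∈ X, ∀ y ∈ X, r x = r y → x 0 = y 0) ∧
      (∀ t : ℝ, (r '' {x | x ∈ X ∧ x 0 = t}).Finite) := by
  classical
  obtain ⟨-, -, i₀, -⟩ := surj (Classical.arbitrary G)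
  have : Nonempty ι := ⟨i₀⟩
  choose! i hi using cov
  let r : EuclideanSpace ℝ (Fin 2) → G := fun z =>
    if z ∈ X then (P (i z)).s (z 0) else Classical.arbitrary G
  have hr : ∀ z ∈ X, ∀ j, z ∈ (P j).rect → r z = (P j).s (z 0) := by
    intro z hz j hj
    simp only [r, if_pos hz]
    exact agree z hz _ _ (hi z hz) hj
  refine ⟨r, ?_, ?_, ?_, ?_, ?_⟩
  · have hU : X = ⋃ j, ((P j).rect ∩ X) := by
      ext z
      simp only [Set.mem_iUnion, Set.mem_inter_iff]
      exact ⟨fun hz => ⟨i z, hi z hz, hz⟩, fun ⟨_, _, hz⟩ => hz⟩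
    rw [hU]
    refine (locallyFinite_of_finite _).continuousOn_iUnion
      (fun j => (P j).isClosed_rect.inter hX) fun j => ?_
    have : ContinuousOn (fun z : EuclideanSpace ℝ (Fin 2) => (P j).s (z 0)) ((P j).rect ∩ X) :=
      (P j).continuousOn.comp (continuous_coord 0).continuousOn fun z hz => hz.1.1
    exact this.congr fun z hz => hr z hz.2 j hz.1
  · intro g
    obtain ⟨z, hz, j, hj, hg⟩ := surj g
    exact ⟨z, hz, (hr z hz j hj).trans hg⟩
  · intro g
    refine isPreconnected_of_forall_pair ?_
    have key : ∀ z, z ∈ X ∧ r z = g → ∀ w, w ∈ X ∧ r w = g → z 1 ≤ w 1 →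
        ∃ t ⊆ {x | x ∈ X ∧ r x = g}, z ∈ t ∧ w ∈ t ∧ IsPreconnected t := by
      rintro z ⟨hz, hzg⟩ w ⟨hw, hwg⟩ hzw
      have h := hzg.trans hwg.symm
      rw [hr z hz _ (hi z hz), hr w hw _ (hi w hw)] at h
      obtain ⟨h0, k, hzk, hwk⟩ := sep z hz w hw _ _ (hi z hz) (hi w hw) h
      refine exists_isPreconnected_vertical h0 hzw fun y hy => ?_
      have hX' := conv k z hz w hw hzk hwk h0 y hy
      refine ⟨hX', ?_⟩
      have hk : (!₂[z 0, y] : EuclideanSpace ℝ (Fin 2)) ∈ (P k).rect :=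
        ⟨hzk.1, hzk.2.1.trans hy.1, hy.2.trans hwk.2.2⟩
      rw [hr _ hX' k hk, ← hzg, hr z hz k hzk]
      rfl
    intro z hz w hw
    rcases le_total (z 1) (w 1) with h | h
    · exact key z hz w hw h
    · obtain ⟨t, h1, h2, h3, h4⟩ := key w hw z hz h
      exact ⟨t, h1, h3, h2, h4⟩
  · intro z hz w hw h
    rw [hr z hz _ (hi z hz), hr w hw _ (hi w hw)] at h
    exact (sep z hz w hw _ _ (hi z hz) (hi w hw) h).1
  · intro t
    refine (Set.finite_range fun j => (P j).s t).subset ?_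
    rintro _ ⟨z, ⟨hz, rfl⟩, rfl⟩
    exact ⟨i z, (hr z hz _ (hi z hz)).symm⟩

/-! ### Diagrams of unit discs -/

/-- A diagram of unit discs: for each integer `j` from `first` to `last`, discs centered at the
points `(j, p j k)` with `k ≤ N j`, in increasing order. Discs of adjacent columns are either linked
(heights differing by at most `7 / 8`) or disjoint (heights differing by at least `7 / 4`). Discs of
a column are disjoint, except that two consecutive ones at distance `3 / 2` may overlap; the
overlap has a tip that no disc of one of the neighbouring columns contains. The bottom discs are
near the height `0` and the top discs near the height `Y`. A disc of height `c` without link to the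
right has `c` divisible by `4`, and one without link to the left has `c` congruent to `2` modulo
`4`; hence one of two discs of equal height, two columns apart, is linked to a disc containing the
point where they touch. -/
structure Diagram where
  /-- the first column -/
  first : ℕ
  /-- the last column -/
  last : ℕ
  /-- the approximate height of the top discs -/
  Y : ℝ
  /-- the number of gaps between discs of a column -/
  N : ℕ → ℕ
  /-- the heights of the centers -/
  p : ℕ → ℕ → ℝ
  first_le_last : first ≤ last
  four_le_Y : 4 ≤ Y
  gap : ∀ j, first ≤ j → j ≤ last → ∀ k < N j,
    p j k + 5 / 2 ≤ p j (k + 1) ∨ p j (k + 1) = p j k + 3 / 2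
  bottom : ∀ j, first ≤ j → j ≤ last → -5 / 4 ≤ p j 0 ∧ p j 0 ≤ 0
  top : ∀ j, first ≤ j → j ≤ last → Y ≤ p j (N j) ∧ p j (N j) ≤ Y + 5 / 4
  step : ∀ j, first ≤ j → j < last → ∀ i ≤ N j, ∀ m ≤ N (j + 1),
    |p j i - p (j + 1) m| ≤ 7 / 8 ∨ 7 / 4 ≤ |p j i - p (j + 1) m|
  bottom_link : ∀ j, first ≤ j → j < last → |p j 0 - p (j + 1) 0| ≤ 7 / 8
  top_link : ∀ j, first ≤ j → j < last → |p j (N j) - p (j + 1) (N (j + 1))| ≤ 7 / 8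
  link_right : ∀ j, first ≤ j → j < last → ∀ i ≤ N j,
    (∃ m ≤ N (j + 1), |p j i - p (j + 1) m| ≤ 7 / 8) ∨ ∃ z : ℤ, p j i = 4 * z
  link_left : ∀ j, first ≤ j → j < last → ∀ m ≤ N (j + 1),
    (∃ i ≤ N j, |p j i - p (j + 1) m| ≤ 7 / 8) ∨ ∃ z : ℤ, p (j + 1) m = 4 * z + 2
  tip : ∀ j, first ≤ j → j ≤ last → ∀ k < N j, p j (k + 1) = p j k + 3 / 2 →
    0 ≤ p j k + 3 / 4 ∧ p j k + 3 / 4 ≤ Y ∧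
    ((∀ m ≤ N (j + 1), 1 ≤ |p j k + 3 / 4 - p (j + 1) m|) ∨
      ∀ m ≤ N (j - 1), 1 ≤ |p j k + 3 / 4 - p (j - 1) m|)
  first_col : N first = 1 ∧ p first 0 = -5 / 4 ∧ p first 1 = Y + 5 / 4
  last_col : N last = 1 ∧ p last 0 = -5 / 4 ∧ p last 1 = Y + 5 / 4

namespace Diagram

variable (D : Diagram)

/-- The height of the corners of the lens. -/
noncomputable def mid : ℝ := D.Y / 2

/-- The first coordinate of the centers of the lens. -/
noncomputable def ctr : ℝ := ((D.first : ℝ) + D.last) / 2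

/-- Over points at most `wid` away from `ctr`, the arcs of the lens are nearly horizontal. -/
noncomputable def wid : ℝ := ((D.last : ℝ) - D.first) / 2 + 1

/-- Half of the height of the lens, such that over the columns the arcs of the lens run through the
top and the bottom discs. -/
noncomputable def sag : ℝ := D.Y / 2 + 33 / 40

/-- The radius of the two large circles bounding the lens. -/
noncomputable def big : ℝ := 100 * (D.wid + D.Y) ^ 2

/-- Half of the width of the lens. -/
noncomputable def half : ℝ := Real.sqrt (2 * D.big * D.sag - D.sag ^ 2)

/-- The left corner of the lens. -/
noncomputable def xL : ℝ := D.ctr - D.half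

/-- The right corner of the lens. -/
noncomputable def xR : ℝ := D.ctr + D.half

/-- The signs `1` and `-1` of the circles with the upper and the lower arc of the lens. -/
def sg (b : Bool) : ℝ := if b then 1 else -1

theorem sg_sq (b : Bool) : sg b ^ 2 = 1 := by cases b <;> norm_num [sg]

theorem sg_cases (b : Bool) : sg b = 1 ∨ sg b = -1 := by cases b <;> norm_num [sg]

/-- Points of the lens, the intersection of two large discs. -/
def Lens (x y : ℝ) : Prop :=
  ∀ b, (x - D.ctr) ^ 2 + (y - (D.mid + sg b * (D.sag - D.big))) ^ 2 ≤ D.big ^ 2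

/-- Points outside the open unit discs. -/
def Free (x y : ℝ) : Prop :=
  ∀ j, D.first ≤ j → j ≤ D.last → ∀ k ≤ D.N j, 1 ≤ (x - j) ^ 2 + (y - D.p j k) ^ 2

theorem one_le_wid : 1 ≤ D.wid := by
  have : (D.first : ℝ) ≤ D.last := by exact_mod_cast D.first_le_last
  unfold wid
  linarith

theorem sag_le_big : 40 * D.sag ≤ D.big := by
  have h1 := D.one_le_wid
  have h2 := D.four_le_Y
  unfold sag big
  nlinarith

theorem wid_sq_le_big : 100 * D.wid ^ 2 ≤ D.big := by
  have h1 := D.one_le_wid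
  have h2 := D.four_le_Y
  unfold big
  nlinarith

theorem sag_pos : 2 < D.sag := by
  have h2 := D.four_le_Y
  unfold sag
  linarith

theorem wid_lt_half : D.wid < D.half := by
  have h1 := D.one_le_wid
  have h2 := D.sag_pos
  have h3 := D.sag_le_big
  have h4 := D.wid_sq_le_big
  unfold half
  apply Real.lt_sqrt_of_sq_lt
  nlinarith

theorem half_sq : D.half ^ 2 = 2 * D.big * D.sag - D.sag ^ 2 := by
  have h2 := D.sag_pos
  have h3 := D.sag_le_big
  exact Real.sq_sqrt (by nlinarith)

theorem xL_lt : D.xL < D.first - 1 := by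
  have := D.wid_lt_half
  unfold wid at this
  unfold xL ctr
  linarith

theorem lt_xR : (D.last : ℝ) + 1 < D.xR := by
  have := D.wid_lt_half
  unfold wid at this
  unfold xR ctr
  linarith

variable {D}

/-- In terms of the depth `w` below the summit of an arc, a point belongs to the disc when
`(x - ctr) ^ 2 + w * (w + 2 * big) ≤ 0`. -/
theorem sq_add_sq_eq (b : Bool) (x y : ℝ) :
    (x - D.ctr) ^ 2 + (y - (D.mid + sg b * (D.sag - D.big))) ^ 2 = (x - D.ctr) ^ 2 +
      (sg b * (y - D.mid) - D.sag) * (sg b * (y - D.mid) - D.sag + 2 * D.big) + D.big ^ 2 := by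
  have := sg_sq b
  linear_combination (-(y - D.mid) ^ 2 + (D.sag - D.big) ^ 2) * this

theorem Lens.le_sag {x y : ℝ} (h : D.Lens x y) (b : Bool) : sg b * (y - D.mid) ≤ D.sag := by
  have h1 := h b
  rw [sq_add_sq_eq] at h1
  have h2 := D.sag_pos
  have h3 := D.sag_le_big
  by_contra hlt
  push Not at hlt
  nlinarith [sq_nonneg (x - D.ctr), mul_pos (sub_pos.2 hlt)
    (by linarith : 0 < sg b * (y - D.mid) - D.sag + 2 * D.big)]

theorem Lens.bounds {x y : ℝ} (h : D.Lens x y) : -33 / 40 ≤ y ∧ y ≤ D.Y + 33 / 40 := by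
  have h1 := h.le_sag true
  have h2 := h.le_sag false
  simp only [sg, mid, sag] at h1 h2
  norm_num at h1 h2
  constructor <;> linarith

theorem lens_of_bounds {x y : ℝ} (hx : |x - D.ctr| ≤ D.wid) (hy : -1 / 4 ≤ y)
    (hy' : y ≤ D.Y + 1 / 4) : D.Lens x y := by
  intro b
  rw [sq_add_sq_eq]
  have h3 := D.sag_le_big
  have h4 := D.wid_sq_le_big
  have h5 := D.sag_pos
  have h6 : (x - D.ctr) ^ 2 ≤ D.wid ^ 2 := sq_le_sq' (abs_le.1 hx).1 (abs_le.1 hx).2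
  have h7 : sg b * (y - D.mid) - D.sag ≤ -(2 / 5) ∧ -(2 * D.sag) ≤ sg b * (y - D.mid) - D.sag := by
    rcases sg_cases b with h | h <;> rw [h] <;> unfold mid sag <;> constructor <;> linarith
  nlinarith

theorem Lens.arc {x y : ℝ} (h : D.Lens x y) (b : Bool) (hx : |x - D.ctr| ≤ D.wid)
    (hb : (x - D.ctr) ^ 2 + (y - (D.mid + sg b * (D.sag - D.big))) ^ 2 = D.big ^ 2) :
    D.sag - 2 / 5 ≤ sg b * (y - D.mid) := by
  rw [sq_add_sq_eq] at hb
  have h3 := D.sag_le_big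
  have h4 := D.wid_sq_le_big
  have h5 := D.sag_pos
  have h6 : (x - D.ctr) ^ 2 ≤ D.wid ^ 2 := sq_le_sq' (abs_le.1 hx).1 (abs_le.1 hx).2
  have h7 : -(2 * D.sag) ≤ sg b * (y - D.mid) - D.sag := by
    have := h.le_sag (!b)
    have hneg : sg (!b) = - sg b := by cases b <;> norm_num [sg]
    rw [hneg] at this
    linarith
  by_contra hlt
  push Not at hlt
  nlinarith

theorem Lens.sq_le {x y : ℝ} (h : D.Lens x y) : (x - D.ctr) ^ 2 ≤ D.half ^ 2 := by
  rw [D.half_sq]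
  have h3 := D.sag_le_big
  have h5 := D.sag_pos
  have key : ∀ b, 0 ≤ sg b * (y - D.mid) → (x - D.ctr) ^ 2 ≤ 2 * D.big * D.sag - D.sag ^ 2 := by
    intro b hb
    have h1 := h b
    rw [sq_add_sq_eq] at h1
    nlinarith
  rcases le_total 0 (y - D.mid) with h0 | h0
  · exact key true (by simpa [sg] using h0)
  · exact key false (by simpa [sg] using h0)

theorem Lens.mem_Icc {x y : ℝ} (h : D.Lens x y) : x ∈ Set.Icc D.xL D.xR := by
  have h1 := abs_le.1 (abs_le_of_sq_le_sq h.sq_le (Real.sqrt_nonneg _))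
  unfold xL xR
  constructor <;> linarith [h1.1, h1.2]

/-- The two circles of the lens meet only at the corners. -/
theorem corner_of_mem {x y : ℝ}
    (h : ∀ b, (x - D.ctr) ^ 2 + (y - (D.mid + sg b * (D.sag - D.big))) ^ 2 = D.big ^ 2) :
    y = D.mid ∧ (x - D.ctr) ^ 2 = D.half ^ 2 := by
  have h1 := h true
  have h2 := h false
  have h3 := D.sag_le_big
  have h5 := D.sag_pos
  simp only [sg, if_true, Bool.false_eq_true, if_false] at h1 h2
  have h6 : (y - D.mid) * (D.big - D.sag) = 0 := by linarith
  have h7 : y = D.mid := by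
    rcases mul_eq_zero.1 h6 with h | h <;> linarith
  subst h7
  refine ⟨rfl, ?_⟩
  rw [D.half_sq]
  linarith

theorem lens_mid {x : ℝ} (hx : x ∈ Set.Icc D.xL D.xR) : D.Lens x D.mid := by
  intro b
  have h1 : (x - D.ctr) ^ 2 ≤ D.half ^ 2 := by
    unfold xL xR at hx
    exact sq_le_sq' (by linarith [hx.1]) (by linarith [hx.2])
  rw [D.half_sq] at h1
  have := sg_sq b
  rw [sq_add_sq_eq]
  nlinarith

theorem Lens.convex {x y y₁ y₂ : ℝ} (h₁ : D.Lens x y₁) (h₂ : D.Lens x y₂) (hy : y ∈ Set.Icc y₁ y₂) :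
    D.Lens x y := by
  intro b
  have h1 := h₁ b
  have h2 := h₂ b
  rcases le_total y (D.mid + sg b * (D.sag - D.big)) with h | h
  · nlinarith [hy.1]
  · nlinarith [hy.2]

theorem abs_sub_ctr_le {x : ℝ} (h1 : (D.first : ℝ) - 1 ≤ x) (h2 : x ≤ D.last + 1) :
    |x - D.ctr| ≤ D.wid := by
  unfold ctr wid
  rw [abs_le]
  constructor <;> linarith

/-! ### Links -/

/-- Linked discs cover the part of the strip between them. -/
theorem link_cover {u y c c' : ℝ} (h : |c - c'| ≤ 7 / 8)
    (hy : c ≤ y ∧ y ≤ c' ∨ c' ≤ y ∧ y ≤ c) (h1 : 1 ≤ u ^ 2 + (y - c) ^ 2)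
    (h2 : 1 ≤ (u - 1) ^ 2 + (y - c') ^ 2) (hu : 0 ≤ u) (hu' : u ≤ 1) : False := by
  have h3 := abs_le.1 h
  rcases hy with ⟨ha, hb⟩ | ⟨ha, hb⟩
  · nlinarith [mul_nonneg (sub_nonneg.2 ha) (sub_nonneg.2 hb), mul_nonneg hu (sub_nonneg.2 hu')]
  · nlinarith [mul_nonneg (sub_nonneg.2 ha) (sub_nonneg.2 hb), mul_nonneg hu (sub_nonneg.2 hu')]

variable {x y : ℝ}

/-- Heights of linked discs of adjacent columns lie on the same side of a point of the region. -/
theorem Free.link_iff (h : D.Free x y) {j i m : ℕ} (h1 : D.first ≤ j) (h2 : j < D.last)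
    (hi : i ≤ D.N j) (hm : m ≤ D.N (j + 1)) (hl : |D.p j i - D.p (j + 1) m| ≤ 7 / 8)
    (hx : (j : ℝ) ≤ x) (hx' : x ≤ j + 1) : D.p j i ≤ y ↔ D.p (j + 1) m ≤ y := by
  have e1 := h j h1 h2.le i hi
  have e2 := h (j + 1) (by omega) (by omega) m hm
  push_cast at e2
  have e2' : 1 ≤ (x - j - 1) ^ 2 + (y - D.p (j + 1) m) ^ 2 := by
    have : x - j - 1 = x - (j + 1) := by ring
    rwa [this]
  constructor
  · intro hy
    by_contra hlt
    push Not at hlt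
    exact link_cover hl (Or.inl ⟨hy, hlt.le⟩) e1 e2' (by linarith) (by linarith)
  · intro hy
    by_contra hlt
    push Not at hlt
    exact link_cover hl (Or.inr ⟨hy, hlt.le⟩) e1 e2' (by linarith) (by linarith)

theorem lt_of_lt {j : ℕ} (h1 : D.first ≤ j) (h2 : j ≤ D.last) {i k : ℕ} (hik : i < k)
    (hk : k ≤ D.N j) : D.p j i + 3 / 2 ≤ D.p j k := by
  induction k, hik using Nat.le_induction with
  | base => rcases D.gap j h1 h2 i (by omega) with h | h <;> linarith
  | succ k hik ih =>
    have := ih (by omega)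
    rcases D.gap j h1 h2 k (by omega) with h | h <;> linarith

theorem p_le {j : ℕ} (h1 : D.first ≤ j) (h2 : j ≤ D.last) {i k : ℕ} (hik : i ≤ k)
    (hk : k ≤ D.N j) : D.p j i ≤ D.p j k := by
  rcases hik.eq_or_lt with h | h
  · rw [h]
  · linarith [lt_of_lt h1 h2 h hk]

theorem one_le_N {j : ℕ} (h1 : D.first ≤ j) (h2 : j ≤ D.last) : 1 ≤ D.N j := by
  by_contra h
  have h0 : D.N j = 0 := by omega
  have := (D.top j h1 h2).1
  rw [h0] at this
  linarith [(D.bottom j h1 h2).2, D.four_le_Y]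

/-- A point between the bottom disc and the top disc of a column lies in one of its gaps. -/
theorem exists_gap {j : ℕ} (hy : D.p j 0 ≤ y)
    (hy' : y < D.p j (D.N j)) : ∃ k < D.N j, D.p j k ≤ y ∧ y < D.p j (k + 1) := by
  classical
  have hex : ∃ k, y < D.p j k := ⟨_, hy'⟩
  obtain ⟨k, hk⟩ : ∃ k, Nat.find hex = k + 1 := by
    refine Nat.exists_eq_succ_of_ne_zero fun h0 => ?_
    have := Nat.find_spec hex
    rw [h0] at this
    linarith
  have h3 := Nat.find_spec hex
  rw [hk] at h3
  refine ⟨k, ?_, ?_, h3⟩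
  · have := Nat.find_min' hex hy'
    omega
  · have := Nat.find_min hex (m := k) (by omega)
    linarith

/-- Within a column of the diagram, points of the region lie above the bottom disc. -/
theorem bottom_lt (hl : D.Lens x y) (hf : D.Free x y) {j : ℕ} (h1 : D.first ≤ j) (h2 : j ≤ D.last)
    (hx : |x - j| ≤ 1 / 2) : D.p j 0 < y := by
  have h3 := hf j h1 h2 0 (Nat.zero_le _)
  have h4 := D.bottom j h1 h2
  have h5 := hl.bounds
  have h6 : (x - j) ^ 2 ≤ (1 / 2) ^ 2 := sq_le_sq' (by linarith [(abs_le.1 hx).1]) (abs_le.1 hx).2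
  by_contra hlt
  push Not at hlt
  nlinarith

theorem lt_top (hl : D.Lens x y) (hf : D.Free x y) {j : ℕ} (h1 : D.first ≤ j) (h2 : j ≤ D.last)
    (hx : |x - j| ≤ 1 / 2) : y < D.p j (D.N j) := by
  have h3 := hf j h1 h2 _ le_rfl
  have h4 := D.top j h1 h2
  have h5 := hl.bounds
  have h6 : (x - j) ^ 2 ≤ (1 / 2) ^ 2 := sq_le_sq' (by linarith [(abs_le.1 hx).1]) (abs_le.1 hx).2
  by_contra hlt
  push Not at hlt
  nlinarith

/-- A point of the region between two columns lies in a gap of both. -/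
theorem between (hl : D.Lens x y) (hf : D.Free x y) {j : ℕ} (h1 : D.first ≤ j) (h2 : j < D.last)
    (hx : (j : ℝ) ≤ x) (hx' : x ≤ j + 1) :
    (D.p j 0 ≤ y ∧ y < D.p j (D.N j)) ∧
      (D.p (j + 1) 0 ≤ y ∧ y < D.p (j + 1) (D.N (j + 1))) := by
  have hb := hf.link_iff h1 h2 (Nat.zero_le _) (Nat.zero_le _) (D.bottom_link j h1 h2) hx hx'
  have ht := hf.link_iff h1 h2 le_rfl le_rfl (D.top_link j h1 h2) hx hx'
  rcases le_total x (j + 1 / 2) with h | h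
  · have hxj : |x - j| ≤ 1 / 2 := by
      rw [abs_le]
      constructor <;> linarith
    have e1 := bottom_lt hl hf h1 h2.le hxj
    have e2 := lt_top hl hf h1 h2.le hxj
    exact ⟨⟨e1.le, e2⟩, hb.1 e1.le, not_le.1 fun h => absurd (ht.2 h) (not_le.2 e2)⟩
  · have hxj : |x - ((j + 1 : ℕ) : ℝ)| ≤ 1 / 2 := by
      push_cast
      rw [abs_le]
      constructor <;> linarith
    have e1 := bottom_lt hl hf (j := j + 1) (by omega) (by omega) hxj
    have e2 := lt_top hl hf (j := j + 1) (by omega) (by omega) hxj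
    exact ⟨⟨hb.2 e1.le, not_le.1 fun h => absurd (ht.1 h) (not_le.2 e2)⟩, e1.le, e2⟩

end Diagram

namespace Diagram

variable {D : Diagram} {x y : ℝ}

/-! ### Crossings of the circles of a diagram -/

theorem free_of_near (h : ∀ j, D.first ≤ j → j ≤ D.last → |x - j| < 1 → ∀ k ≤ D.N j,
    1 ≤ (x - j) ^ 2 + (y - D.p j k) ^ 2) : D.Free x y := by
  intro j h1 h2 k hk
  rcases lt_or_ge |x - j| 1 with hx | hx
  · exact h j h1 h2 hx k hk
  · have : 1 ≤ (x - j) ^ 2 := by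
      rw [← sq_abs]
      nlinarith
    nlinarith [sq_nonneg (y - D.p j k)]

theorem eq_of_abs_lt {i j : ℕ} (h : |(i : ℝ) - j| < 1) : j = i := by
  rw [abs_lt] at h
  have h1 : (i : ℝ) < j + 1 := by linarith [h.2]
  have h2 : (j : ℝ) < i + 1 := by linarith [h.1]
  have h1' : i < j + 1 := by exact_mod_cast h1
  have h2' : j < i + 1 := by exact_mod_cast h2
  omega

/-- A point above a column is outside the discs when it is far from those of the column. -/
theorem free_of_column {j : ℕ} (h : ∀ k ≤ D.N j, 1 ≤ |y - D.p j k|) : D.Free j y := by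
  refine free_of_near fun i _ _ hx k hk => ?_
  obtain rfl := eq_of_abs_lt hx
  have := h k hk
  rw [← sq_abs (y - _)]
  nlinarith [sq_nonneg ((i : ℝ) - i)]

theorem sq_sqrt_seven : (Real.sqrt 7 / 4) ^ 2 = 7 / 16 := by
  rw [div_pow, Real.sq_sqrt (by norm_num)]
  norm_num

theorem sqrt_seven_bounds : 66 / 100 < Real.sqrt 7 / 4 ∧ Real.sqrt 7 / 4 < 67 / 100 := by
  have h := sq_sqrt_seven
  have h0 : 0 ≤ Real.sqrt 7 / 4 := by positivity
  constructor <;> nlinarith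

theorem column_eq {j : ℕ} (h1 : D.first ≤ j) (h2 : j ≤ D.last) {i k : ℕ} (hi : i ≤ D.N j)
    (hk : k ≤ D.N j) (h : D.p j i < D.p j k + 3 / 2) (h' : D.p j k < D.p j i + 3 / 2) : i = k := by
  rcases lt_trichotomy i k with hik | hik | hik
  · linarith [lt_of_lt h1 h2 hik hk]
  · exact hik
  · linarith [lt_of_lt h1 h2 hik hi]

/-- Two discs of a column whose circles meet are at distance `3 / 2`. -/
theorem same_column {j : ℕ} (h1 : D.first ≤ j) (h2 : j ≤ D.last) {k k' : ℕ} (hkk : k < k')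
    (hk' : k' ≤ D.N j) (e1 : (x - j) ^ 2 + (y - D.p j k) ^ 2 = 1)
    (e2 : (x - j) ^ 2 + (y - D.p j k') ^ 2 = 1) :
    k' = k + 1 ∧ D.p j k' = D.p j k + 3 / 2 ∧ y = D.p j k + 3 / 4 ∧ (x - j) ^ 2 = 7 / 16 := by
  have h3 := lt_of_lt h1 h2 hkk hk'
  have h4 : (D.p j k' - D.p j k) * (2 * y - D.p j k - D.p j k') = 0 := by linarith
  have h5 : 2 * y - D.p j k - D.p j k' = 0 :=
    (mul_eq_zero.1 h4).resolve_left (by linarith)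
  have hy : y = (D.p j k + D.p j k') / 2 := by linarith
  have h6 : D.p j k' - D.p j k ≤ 2 := by
    rw [hy] at e1
    nlinarith [sq_nonneg (x - j)]
  have hk1 : k' = k + 1 := by
    by_contra hne
    have := lt_of_lt h1 h2 (show k < k + 1 by omega) (by omega)
    have := lt_of_lt h1 h2 (show k + 1 < k' by omega) hk'
    linarith
  subst hk1
  have h7 : D.p j (k + 1) = D.p j k + 3 / 2 := by
    rcases D.gap j h1 h2 k (by omega) with h | h
    · linarith
    · exact h
  have hy' : y = D.p j k + 3 / 4 := by linarith
  refine ⟨rfl, h7, hy', ?_⟩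
  rw [hy'] at e1
  linarith

/-- Circles of adjacent columns that meet cross transversally, at points without vertical
tangents. -/
theorem adjacent_column {j : ℕ} (h1 : D.first ≤ j) (h2 : j < D.last) {k m : ℕ}
    (hk : k ≤ D.N j) (hm : m ≤ D.N (j + 1)) (e1 : (x - j) ^ 2 + (y - D.p j k) ^ 2 = 1)
    (e2 : (x - (j + 1)) ^ 2 + (y - D.p (j + 1) m) ^ 2 = 1) :
    (x - j) * (y - D.p (j + 1) m) - (y - D.p j k) * (x - (j + 1)) ≠ 0 ∧
      y ≠ D.p j k ∧ y ≠ D.p (j + 1) m := by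
  have hd : (D.p j k - D.p (j + 1) m) ^ 2 ≤ 49 / 64 := by
    rcases D.step j h1 h2 k hk m hm with h | h
    · rw [← sq_abs]
      nlinarith [abs_nonneg (D.p j k - D.p (j + 1) m)]
    · have h3 : 49 / 16 ≤ (D.p j k - D.p (j + 1) m) ^ 2 := by
        rw [← sq_abs]
        nlinarith
      nlinarith [sq_nonneg (x - j + (x - (j + 1))),
        sq_nonneg (y - D.p j k + (y - D.p (j + 1) m))]
  refine ⟨fun h0 => ?_, fun h0 => ?_, fun h0 => ?_⟩
  · have h3 : ((x - j) * (x - (j + 1)) + (y - D.p j k) * (y - D.p (j + 1) m)) ^ 2 = 1 := by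
      have : ((x - j) * (x - (j + 1)) + (y - D.p j k) * (y - D.p (j + 1) m)) ^ 2 =
          ((x - j) ^ 2 + (y - D.p j k) ^ 2) *
            ((x - (j + 1)) ^ 2 + (y - D.p (j + 1) m) ^ 2) -
          ((x - j) * (y - D.p (j + 1) m) - (y - D.p j k) * (x - (j + 1))) ^ 2 := by ring
      rw [this, e1, e2, h0]
      norm_num
    have h4 : (x - j) * (x - (j + 1)) + (y - D.p j k) * (y - D.p (j + 1) m) =
        (1 - (D.p j k - D.p (j + 1) m) ^ 2) / 2 := by linarith
    rw [h4] at h3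
    nlinarith [sq_nonneg (D.p j k - D.p (j + 1) m)]
  · rw [h0] at e1 e2
    nlinarith
  · rw [h0] at e1 e2
    nlinarith

/-- Circles of columns that are not adjacent do not meet within the region: the point where they
would touch lies in a disc linked to one of them. -/
theorem far_column (hf : D.Free x y) {j j' : ℕ} (h1 : D.first ≤ j) (h2 : j' ≤ D.last)
    (hjj : j + 2 ≤ j') {k m : ℕ} (hk : k ≤ D.N j) (hm : m ≤ D.N j')
    (e1 : (x - j) ^ 2 + (y - D.p j k) ^ 2 = 1)
    (e2 : (x - j') ^ 2 + (y - D.p j' m) ^ 2 = 1) : False := by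
  have hx1 : x - j ≤ 1 := by nlinarith [sq_nonneg (y - D.p j k)]
  have hx2 : -1 ≤ x - j' := by nlinarith [sq_nonneg (y - D.p j' m)]
  have hj' : j' = j + 2 := by
    have : (j' : ℝ) < j + 3 := by linarith
    have : j' < j + 3 := by exact_mod_cast this
    omega
  subst hj'
  push_cast at hx2 e2
  have hx : x = j + 1 := by linarith
  have hy1 : y = D.p j k := by
    have : (y - D.p j k) ^ 2 = 0 := by
      rw [hx] at e1
      linarith
    linarith [pow_eq_zero_iff (two_ne_zero) |>.1 this]
  have hy2 : y = D.p (j + 2) m := by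
    have : (y - D.p (j + 2) m) ^ 2 = 0 := by
      rw [hx] at e2
      linarith
    linarith [pow_eq_zero_iff (two_ne_zero) |>.1 this]
  have hcol : ∀ i ≤ D.N (j + 1), 1 ≤ (y - D.p (j + 1) i) ^ 2 := by
    intro i hi
    have := hf (j + 1) (by omega) (by omega) i hi
    push_cast at this
    rw [hx] at this
    linarith
  rcases D.link_right j h1 (by omega) k hk with ⟨i, hi, hl⟩ | ⟨z, hz⟩
  · have h3 := hcol i hi
    rw [hy1, ← sq_abs] at h3
    nlinarith [abs_nonneg (D.p j k - D.p (j + 1) i)]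
  rcases D.link_left (j + 1) (by omega) (by omega) m hm with ⟨i, hi, hl⟩ | ⟨z', hz'⟩
  · have h3 := hcol i hi
    rw [hy2, ← sq_abs, abs_sub_comm] at h3
    nlinarith [abs_nonneg (D.p (j + 1) i - D.p (j + 1 + 1) m)]
  have h4 : (4 * z : ℝ) = 4 * z' + 2 := by
    rw [← hz, ← hz']
    linarith
  have h5 : 4 * z = 4 * z' + 2 := by exact_mod_cast h4
  omega

/-- At the tip of two overlapping discs at distance `3 / 2`, a third unit circle from the adjacent
column would have its center about `0.94` above or below, hence at about `1.69` from one of the two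
centers, which is excluded in a diagram. -/
theorem no_third_aux (u e : ℝ) (hu : 66 / 100 < u) (hu' : u < 67 / 100) (hu2 : u ^ 2 = 7 / 16)
    (he : (u - 1) ^ 2 + e ^ 2 = 1) (h3 : |e + 3 / 4| ≤ 7 / 8 ∨ 7 / 4 ≤ |e + 3 / 4|)
    (h4 : |e - 3 / 4| ≤ 7 / 8 ∨ 7 / 4 ≤ |e - 3 / 4|) : False := by
  have he2 : e ^ 2 = 2 * u - 7 / 16 := by linear_combination he - hu2
  rcases le_total 0 e with h0 | h0
  · have h5 : 92 / 100 < e ∧ e < 96 / 100 := by constructor <;> nlinarith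
    rw [abs_of_nonneg (by linarith)] at h3
    rcases h3 with h3 | h3 <;> linarith
  · have h5 : e < -(92 / 100) ∧ -(96 / 100) < e := by constructor <;> nlinarith
    rw [abs_of_nonpos (by linarith)] at h4
    rcases h4 with h4 | h4 <;> linarith

/-- No third circle passes through the crossing of two circles of a column. -/
theorem no_third {j j' : ℕ} (h1 : D.first ≤ j) (h2 : j ≤ D.last) (h1' : D.first ≤ j')
    (h2' : j' ≤ D.last) {k k' m : ℕ} (hkk : k < k') (hk' : k' ≤ D.N j) (hm : m ≤ D.N j')
    (hne : j = j' → m ≠ k ∧ m ≠ k') (e1 : (x - j) ^ 2 + (y - D.p j k) ^ 2 = 1)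
    (e2 : (x - j) ^ 2 + (y - D.p j k') ^ 2 = 1)
    (e3 : (x - j') ^ 2 + (y - D.p j' m) ^ 2 = 1) : False := by
  obtain ⟨rfl, hp, hy, hx⟩ := same_column h1 h2 hkk hk' e1 e2
  have hxb : |x - j| < 67 / 100 ∧ 66 / 100 < |x - j| := by
    rw [← sq_abs] at hx
    constructor <;> nlinarith [abs_nonneg (x - j)]
  have hx3 : |x - j'| ≤ 1 := by
    rw [← sq_abs] at e3
    nlinarith [sq_nonneg (y - D.p j' m), abs_nonneg (x - j')]
  have hx3' := abs_le.1 hx3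
  have hx4 := abs_lt.1 hxb.1
  have hj1 : (j' : ℝ) < j + 2 := by linarith
  have hj2 : (j : ℝ) < j' + 2 := by linarith
  have hj1' : j' < j + 2 := by exact_mod_cast hj1
  have hj2' : j < j' + 2 := by exact_mod_cast hj2
  rcases (by omega : j' = j ∨ j' = j + 1 ∨ j = j' + 1) with rfl | rfl | rfl
  · have h6 : (y - D.p j' m) ^ 2 = (3 / 4) ^ 2 := by linarith
    rcases sq_eq_sq_iff_eq_or_eq_neg.1 h6 with h7 | h7
    · exact (hne rfl).1 (column_eq h1 h2 hm (by omega) (by linarith) (by linarith))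
    · exact (hne rfl).2 (column_eq h1 h2 hm hk' (by linarith) (by linarith))
  · push_cast at e3 hx3'
    have hpos : 0 ≤ x - j := by linarith
    rw [abs_of_nonneg hpos] at hxb
    have s1 := D.step j h1 (by omega) k (by omega) m hm
    have s2 := D.step j h1 (by omega) (k + 1) hk' m hm
    refine no_third_aux (x - j) (y - D.p (j + 1) m) hxb.2 hxb.1 hx (by linarith) ?_ ?_
    · rwa [hp, show D.p j k + 3 / 2 - D.p (j + 1) m = y - D.p (j + 1) m + 3 / 4 by linarith] at s2
    · rwa [show D.p j k - D.p (j + 1) m = y - D.p (j + 1) m - 3 / 4 by linarith] at s1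
  · push_cast at hx hxb hx4
    have hpos : x - (j' + 1) ≤ 0 := by linarith
    rw [abs_of_nonpos hpos] at hxb
    have s1 := D.step j' h1' (by omega) m hm k (by omega)
    have s2 := D.step j' h1' (by omega) m hm (k + 1) hk'
    refine no_third_aux (-(x - (j' + 1))) (D.p j' m - y) hxb.2 hxb.1 (by linarith) (by linarith)
      ?_ ?_
    · rwa [show D.p j' m - D.p (j' + 1) k = D.p j' m - y + 3 / 4 by linarith] at s1
    · rwa [hp, show D.p j' m - (D.p (j' + 1) k + 3 / 2) = D.p j' m - y - 3 / 4 by linarith] at s2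

theorem exists_nearest (h1 : (D.first : ℝ) - 1 / 2 ≤ x) (h2 : x ≤ D.last + 1 / 2) :
    ∃ j, D.first ≤ j ∧ j ≤ D.last ∧ |x - j| ≤ 1 / 2 := by
  have hfl : (D.first : ℝ) ≤ D.last := by exact_mod_cast D.first_le_last
  rcases le_total x D.first with h | h
  · exact ⟨D.first, le_rfl, D.first_le_last, abs_le.2 ⟨by linarith, by linarith⟩⟩
  rcases le_total (D.last : ℝ) x with h' | h'
  · exact ⟨D.last, D.first_le_last, le_rfl, abs_le.2 ⟨by linarith, by linarith⟩⟩
  have h0 : 0 ≤ x := le_trans (Nat.cast_nonneg _) h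
  have h3 := Nat.floor_le h0
  have h4 := Nat.lt_floor_add_one x
  have h5 : D.first ≤ ⌊x⌋₊ := Nat.le_floor h
  rcases le_total x (⌊x⌋₊ + 1 / 2) with h6 | h6
  · refine ⟨⌊x⌋₊, h5, ?_, abs_le.2 ⟨by linarith, by linarith⟩⟩
    have : (⌊x⌋₊ : ℝ) ≤ D.last := by linarith
    exact_mod_cast this
  · refine ⟨⌊x⌋₊ + 1, by omega, ?_, ?_⟩
    · have : (⌊x⌋₊ : ℝ) < D.last := by linarith
      exact_mod_cast this
    · push_cast
      exact abs_le.2 ⟨by linarith, by linarith⟩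

/-- The point lies on the large circle of sign `b`. -/
def OnBig (D : Diagram) (b : Bool) (x y : ℝ) : Prop :=
  (x - D.ctr) ^ 2 + (y - (D.mid + sg b * (D.sag - D.big))) ^ 2 = D.big ^ 2

theorem sg_arc (b : Bool) (h : D.sag - 2 / 5 ≤ sg b * (y - D.mid)) :
    b = true ∧ D.Y + 17 / 40 ≤ y ∨ b = false ∧ y ≤ -17 / 40 := by
  cases b
  · right
    simp only [sg, mid, sag, Bool.false_eq_true, if_false] at h
    exact ⟨rfl, by linarith⟩
  · left
    simp only [sg, mid, sag, if_true] at h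
    exact ⟨rfl, by linarith⟩

/-- The large circles meet the region only beyond the first and the last column. -/
theorem onBig_outside (hl : D.Lens x y) (hf : D.Free x y) {b : Bool} (hb : D.OnBig b x y) :
    x < D.first - 1 / 2 ∨ D.last + 1 / 2 < x := by
  by_contra h
  push Not at h
  obtain ⟨j, h1, h2, hx⟩ := exists_nearest h.1 h.2
  have harc := hl.arc b (abs_sub_ctr_le (by linarith) (by linarith)) hb
  have h6 : (x - j) ^ 2 ≤ (1 / 2) ^ 2 := sq_le_sq' (by linarith [(abs_le.1 hx).1]) (abs_le.1 hx).2
  rcases sg_arc b harc with ⟨-, hy⟩ | ⟨-, hy⟩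
  · have h3 := lt_top hl hf h1 h2 hx
    have h4 := hf j h1 h2 _ le_rfl
    have h5 := D.top j h1 h2
    nlinarith
  · have h3 := bottom_lt hl hf h1 h2 hx
    have h4 := hf j h1 h2 0 (Nat.zero_le _)
    have h5 := D.bottom j h1 h2
    nlinarith

/-- A large circle meets a unit circle within the region only if the latter bounds the top or the
bottom disc of the first or the last column, and the crossing is transverse. -/
theorem onBig_disc (hl : D.Lens x y) (hf : D.Free x y) {b : Bool} (hb : D.OnBig b x y) {j k : ℕ}
    (h1 : D.first ≤ j) (h2 : j ≤ D.last) (hk : k ≤ D.N j)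
    (e : (x - j) ^ 2 + (y - D.p j k) ^ 2 = 1) :
    (x < D.first ∧ j = D.first ∨ D.last < x ∧ j = D.last) ∧ (k = if b then 1 else 0) ∧
    (x - D.ctr) * (y - D.p j k) - (y - (D.mid + sg b * (D.sag - D.big))) * (x - j) ≠ 0 ∧
    y ≠ D.mid + sg b * (D.sag - D.big) ∧ y ≠ D.p j k := by
  have hfl : (D.first : ℝ) ≤ D.last := by exact_mod_cast D.first_le_last
  have hx1 : |x - j| ≤ 1 := by
    rw [← sq_abs] at e
    nlinarith [sq_nonneg (y - D.p j k), abs_nonneg (x - j)]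
  have hx1' := abs_le.1 hx1
  have h1r : (D.first : ℝ) ≤ j := by exact_mod_cast h1
  have h2r : (j : ℝ) ≤ D.last := by exact_mod_cast h2
  have hside : (x < D.first ∧ j = D.first ∨ D.last < x ∧ j = D.last) ∧ 1 / 2 < |x - j| := by
    rcases onBig_outside hl hf hb with h | h
    · have hj : j = D.first := by
        have : (j : ℝ) < D.first + 1 := by linarith
        have : j < D.first + 1 := by exact_mod_cast this
        omega
      subst hj
      exact ⟨Or.inl ⟨by linarith, rfl⟩, lt_abs.2 (Or.inr (by linarith))⟩
    · have hj : j = D.last := by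
        have : (D.last : ℝ) < j + 1 := by linarith
        have : D.last < j + 1 := by exact_mod_cast this
        omega
      subst hj
      exact ⟨Or.inr ⟨by linarith, rfl⟩, lt_abs.2 (Or.inl (by linarith))⟩
  have hcol : D.N j = 1 ∧ D.p j 0 = -5 / 4 ∧ D.p j 1 = D.Y + 5 / 4 := by
    rcases hside.1 with ⟨-, h⟩ | ⟨-, h⟩ <;> rw [h]
    exacts [D.first_col, D.last_col]
  have hwid := abs_sub_ctr_le (D := D) (x := x) (by linarith) (by linarith)
  have harc := hl.arc b hwid hb
  have hbd := hl.bounds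
  have hY := D.four_le_Y
  have hye : |y - D.p j k| ≤ 1 := by
    rw [← sq_abs (y - _)] at e
    nlinarith [sq_nonneg (x - j), abs_nonneg (y - D.p j k)]
  have hye' := abs_le.1 hye
  have hk2 : k = (if b then 1 else 0) ∧ y ≠ D.p j k := by
    rcases sg_arc b harc with ⟨rfl, hy⟩ | ⟨rfl, hy⟩
    · rcases (by omega : k = 0 ∨ k = 1) with rfl | rfl
      · rw [hcol.2.1] at hye'
        linarith
      · rw [hcol.2.2]
        exact ⟨rfl, by linarith⟩
    · rcases (by omega : k = 0 ∨ k = 1) with rfl | rfl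
      · rw [hcol.2.1]
        exact ⟨rfl, by linarith⟩
      · rw [hcol.2.2] at hye'
        linarith
  have h3 := D.sag_le_big
  have h4 := D.wid_sq_le_big
  have h5 := D.sag_pos
  have h6 := D.one_le_wid
  have hbig : D.big - 2 / 5 ≤ |y - (D.mid + sg b * (D.sag - D.big))| := by
    have h7 : D.big - 2 / 5 ≤ sg b * (y - (D.mid + sg b * (D.sag - D.big))) := by
      have := sg_sq b
      linear_combination harc + (D.sag - D.big) * this
    refine h7.trans ((le_abs_self _).trans ?_)
    rw [abs_mul]
    rcases sg_cases b with h | h <;> simp [h]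
  refine ⟨hside.1, hk2.1, fun h0 => ?_, fun h0 => ?_, hk2.2⟩
  · have h8 : |x - D.ctr| * |y - D.p j k| =
        |y - (D.mid + sg b * (D.sag - D.big))| * |x - j| := by
      rw [← abs_mul, ← abs_mul, sub_eq_zero.1 h0]
    have h9 : |x - D.ctr| * |y - D.p j k| ≤ D.wid * 1 :=
      mul_le_mul hwid hye (abs_nonneg _) (by linarith)
    have h10 : (D.big - 2 / 5) * (1 / 2) ≤
        |y - (D.mid + sg b * (D.sag - D.big))| * |x - j| :=
      mul_le_mul hbig hside.2.le (by norm_num) (abs_nonneg _)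
    nlinarith
  · rw [h0, sub_self, abs_zero] at hbig
    nlinarith

/-- The tip of the overlap of two discs of a column belongs to the region. -/
theorem exists_tip {j k : ℕ} (h1 : D.first ≤ j) (h2 : j ≤ D.last) (hk : k < D.N j)
    (hp : D.p j (k + 1) = D.p j k + 3 / 2) : ∃ x y, D.Lens x y ∧ D.Free x y ∧
      (x - j) ^ 2 + (y - D.p j k) ^ 2 = 1 ∧ (x - j) ^ 2 + (y - D.p j (k + 1)) ^ 2 = 1 := by
  obtain ⟨h3, h4, h5⟩ := D.tip j h1 h2 k hk hp
  have h1r : (D.first : ℝ) ≤ j := by exact_mod_cast h1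
  have h2r : (j : ℝ) ≤ D.last := by exact_mod_cast h2
  have hs := sq_sqrt_seven
  have hb := sqrt_seven_bounds
  have hown : ∀ x : ℝ, (x - j) ^ 2 = 7 / 16 → ∀ m ≤ D.N j,
      1 ≤ (x - j) ^ 2 + (D.p j k + 3 / 4 - D.p j m) ^ 2 := by
    intro x hx m hm
    rw [hx]
    rcases le_or_gt m k with h | h
    · have := p_le h1 h2 h hk.le
      nlinarith
    · have := p_le h1 h2 (show k + 1 ≤ m from h) hm
      nlinarith
  rcases h5 with h5 | h5
  · refine ⟨j + Real.sqrt 7 / 4, D.p j k + 3 / 4, lens_of_bounds (abs_sub_ctr_le (by linarith)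
      (by linarith)) (by linarith) (by linarith), free_of_near fun i hi hi' hx m hm => ?_, ?_, ?_⟩
    · have hx' := abs_lt.1 hx
      have e1 : (i : ℝ) < j + 2 := by linarith
      have e2 : (j : ℝ) < i + 1 := by linarith
      have e1' : i < j + 2 := by exact_mod_cast e1
      have e2' : j < i + 1 := by exact_mod_cast e2
      rcases (by omega : i = j ∨ i = j + 1) with rfl | rfl
      · exact hown _ (by rw [add_sub_cancel_left]; exact hs) m hm
      · have := h5 m hm
        rw [← sq_abs (D.p j k + 3 / 4 - _)]
        nlinarith [sq_nonneg (↑j + Real.sqrt 7 / 4 - ((j + 1 : ℕ) : ℝ))]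
    · rw [add_sub_cancel_left, hs]
      norm_num
    · rw [add_sub_cancel_left, hs, hp]
      ring
  · refine ⟨j - Real.sqrt 7 / 4, D.p j k + 3 / 4, lens_of_bounds (abs_sub_ctr_le (by linarith)
      (by linarith)) (by linarith) (by linarith), free_of_near fun i hi hi' hx m hm => ?_, ?_, ?_⟩
    · have hx' := abs_lt.1 hx
      have e1 : (i : ℝ) < j + 1 := by linarith
      have e2 : (j : ℝ) < i + 2 := by linarith
      have e1' : i < j + 1 := by exact_mod_cast e1
      have e2' : j < i + 2 := by exact_mod_cast e2
      rcases (by omega : i = j ∨ j = i + 1) with rfl | rfl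
      · exact hown _ (by rw [sub_sub_cancel_left, neg_sq]; exact hs) m hm
      · have := h5 m (by simpa using hm)
        rw [Nat.add_sub_cancel] at this
        rw [← sq_abs (D.p (i + 1) k + 3 / 4 - _)]
        nlinarith [sq_nonneg (((i + 1 : ℕ) : ℝ) - Real.sqrt 7 / 4 - (i : ℝ))]
    · rw [sub_sub_cancel_left, neg_sq, hs]
      norm_num
    · rw [sub_sub_cancel_left, neg_sq, hs, hp]
      ring

/-- Every unit circle of the diagram meets the region. -/
theorem exists_mem_disc {j k : ℕ} (h1 : D.first ≤ j) (h2 : j ≤ D.last) (hk : k ≤ D.N j) :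
    ∃ x y, D.Lens x y ∧ D.Free x y ∧ (x - j) ^ 2 + (y - D.p j k) ^ 2 = 1 := by
  have h1r : (D.first : ℝ) ≤ j := by exact_mod_cast h1
  have h2r : (j : ℝ) ≤ D.last := by exact_mod_cast h2
  have hctr := abs_sub_ctr_le (D := D) (x := j) (by linarith) (by linarith)
  have hbot := D.bottom j h1 h2
  have htop := D.top j h1 h2
  rcases hk.eq_or_lt with rfl | hk'
  · obtain ⟨i, hi⟩ : ∃ i, D.N j = i + 1 := ⟨D.N j - 1, by have := one_le_N h1 h2; omega⟩
    rcases D.gap j h1 h2 i (by omega) with h | h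
    · rw [← hi] at h
      refine ⟨j, D.p j (D.N j) - 1, lens_of_bounds hctr ?_ ?_, free_of_column fun m hm => ?_, ?_⟩
      · have := D.four_le_Y
        linarith
      · linarith
      · rcases hm.eq_or_lt with rfl | hm'
        · norm_num
        · have := p_le h1 h2 (show m ≤ i by omega) (by omega)
          rw [le_abs]
          left
          linarith
      · ring
    · obtain ⟨x, y, hl, hf, -, e⟩ := exists_tip h1 h2 (by omega) h
      rw [← hi] at e
      exact ⟨x, y, hl, hf, e⟩
  · rcases D.gap j h1 h2 k hk' with h | h
    · refine ⟨j, D.p j k + 1, lens_of_bounds hctr ?_ ?_, free_of_column fun m hm => ?_, ?_⟩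
      · linarith [p_le h1 h2 (Nat.zero_le k) hk]
      · linarith [p_le h1 h2 (show k + 1 ≤ D.N j from hk') le_rfl]
      · rcases le_or_gt m k with hm' | hm'
        · have := p_le h1 h2 hm' hk
          rw [le_abs]
          left
          linarith
        · have := p_le h1 h2 (show k + 1 ≤ m from hm') hm
          rw [le_abs]
          right
          linarith
      · ring
    · obtain ⟨x, y, hl, hf, e, -⟩ := exists_tip h1 h2 hk' h
      exact ⟨x, y, hl, hf, e⟩

theorem corner_mem (D : Diagram) : D.Lens D.xL D.mid ∧ D.Free D.xL D.mid ∧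
    ∀ b, D.OnBig b D.xL D.mid := by
  have h := D.xL_lt
  refine ⟨lens_mid ⟨le_rfl, ?_⟩, free_of_near fun j h1 h2 hx => ?_, fun b => ?_⟩
  · have := D.lt_xR
    have hfl : (D.first : ℝ) ≤ D.last := by exact_mod_cast D.first_le_last
    linarith
  · have h1r : (D.first : ℝ) ≤ j := by exact_mod_cast h1
    linarith [(abs_lt.1 hx).1]
  · have := D.half_sq
    have h2 := sg_sq b
    unfold OnBig xL
    linear_combination this + (D.sag - D.big) ^ 2 * h2

end Diagram

namespace Diagram

variable (D : Diagram)

/-! ### The system of circles of a diagram -/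

/-- The discs of a diagram, as pairs of a column and a position in it. -/
abbrev Disc : Type := {q : ℕ × ℕ // D.first ≤ q.1 ∧ q.1 ≤ D.last ∧ q.2 ≤ D.N q.1}

instance : Finite D.Disc := by
  refine Finite.of_injective (β := Σ j : Fin (D.last + 1), Fin (D.N j + 1))
    (fun q => ⟨⟨q.1.1, by have := q.2.2.1; omega⟩,
      ⟨q.1.2, by have := q.2.2.2; simp only; omega⟩⟩) ?_
  rintro ⟨⟨a, b⟩, h⟩ ⟨⟨a', b'⟩, h'⟩ e
  simp only [Sigma.mk.injEq, Fin.mk.injEq] at e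
  obtain ⟨rfl, e⟩ := e
  simpa using e

/-- The circles of a diagram: two large ones bounding the lens, and the unit circles. -/
abbrev Circ : Type := Bool ⊕ D.Disc

noncomputable instance : Fintype D.Circ := Fintype.ofFinite _

/-- The first coordinates of the centers. -/
noncomputable def ccx : D.Circ → ℝ := Sum.elim (fun _ => D.ctr) fun q => q.1.1

/-- The second coordinates of the centers. -/
noncomputable def ccy : D.Circ → ℝ :=
  Sum.elim (fun b => D.mid + sg b * (D.sag - D.big)) fun q => D.p q.1.1 q.1.2

/-- The radii. -/
noncomputable def crad : D.Circ → ℝ := Sum.elim (fun _ => D.big) fun _ => 1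

/-- The signs: the region lies inside the large circles and outside the unit circles. -/
noncomputable def csgn : D.Circ → ℝ := Sum.elim (fun _ => -1) fun _ => 1

/-- The system of circles of a diagram. -/
noncomputable def system : CircleSystem (Fintype.card D.Circ) where
  cx i := D.ccx ((Fintype.equivFin _).symm i)
  cy i := D.ccy ((Fintype.equivFin _).symm i)
  rad i := D.crad ((Fintype.equivFin _).symm i)
  sgn i := D.csgn ((Fintype.equivFin _).symm i)
  rad_pos i := by
    rcases (Fintype.equivFin _).symm i with b | q
    · have := D.sag_le_big
      have := D.sag_pos
      simp only [crad, Sum.elim_inl]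
      linarith
    · simp [crad]
  sgn_eq i := by
    rcases (Fintype.equivFin _).symm i with b | q <;> simp [csgn]

/-- The point `(x, y)` lies on the circle. -/
def On (c : D.Circ) (x y : ℝ) : Prop := (x - D.ccx c) ^ 2 + (y - D.ccy c) ^ 2 = D.crad c ^ 2

variable {D} {x y : ℝ}

theorem mem_region_system {z : EuclideanSpace ℝ (Fin 2)} :
    z ∈ D.system.region ↔ D.Lens (z 0) (z 1) ∧ D.Free (z 0) (z 1) := by
  constructor
  · intro h
    constructor
    · intro b
      have := h (Fintype.equivFin _ (Sum.inl b))
      simp only [CircleSystem.quad, system, Equiv.symm_apply_apply, ccx, ccy, crad, csgn,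
        Sum.elim_inl] at this
      linarith
    · intro j h1 h2 k hk
      have := h (Fintype.equivFin _ (Sum.inr ⟨(j, k), h1, h2, hk⟩))
      simp only [CircleSystem.quad, system, Equiv.symm_apply_apply, ccx, ccy, crad, csgn,
        Sum.elim_inr] at this
      linarith
  · rintro ⟨hl, hf⟩ i
    obtain ⟨c, rfl⟩ := (Fintype.equivFin _).surjective i
    simp only [CircleSystem.quad, system, Equiv.symm_apply_apply]
    rcases c with b | ⟨⟨j, k⟩, h1, h2, hk⟩
    · have := hl b
      simp only [ccx, ccy, crad, csgn, Sum.elim_inl]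
      linarith
    · have := hf j h1 h2 k hk
      simp only [ccx, ccy, crad, csgn, Sum.elim_inr]
      linarith

theorem quad_system_eq_zero {c : D.Circ} {z : EuclideanSpace ℝ (Fin 2)} :
    D.system.quad (Fintype.equivFin _ c) z = 0 ↔ D.On c (z 0) (z 1) := by
  rw [CircleSystem.quad_eq_zero_iff]
  simp only [system, Equiv.symm_apply_apply]
  rfl

/-- The circles cross transversally and not at points of vertical tangents. -/
def Transverse (c c' : D.Circ) (x y : ℝ) : Prop :=
  (x - D.ccx c) * (y - D.ccy c') - (y - D.ccy c) * (x - D.ccx c') ≠ 0 ∧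
    y ≠ D.ccy c ∧ y ≠ D.ccy c'

theorem Transverse.symm {c c' : D.Circ} (h : Transverse c c' x y) : Transverse c' c x y := by
  refine ⟨fun h0 => h.1 ?_, h.2.2, h.2.1⟩
  linarith

theorem on_disc {j k : ℕ} {h : D.first ≤ j ∧ j ≤ D.last ∧ k ≤ D.N j}
    (e : D.On (Sum.inr ⟨(j, k), h⟩) x y) : (x - j) ^ 2 + (y - D.p j k) ^ 2 = 1 := by
  simpa [On, ccx, ccy, crad] using e

theorem on_big {b : Bool} (e : D.On (Sum.inl b) x y) : D.OnBig b x y := e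

theorem transverse_disc_of_le (hf : D.Free x y) {j k j' k' : ℕ}
    {h : D.first ≤ j ∧ j ≤ D.last ∧ k ≤ D.N j} {h' : D.first ≤ j' ∧ j' ≤ D.last ∧ k' ≤ D.N j'}
    (hjj : j < j' ∨ j = j' ∧ k < k')
    (e : D.On (Sum.inr ⟨(j, k), h⟩) x y) (e' : D.On (Sum.inr ⟨(j', k'), h'⟩) x y) :
    Transverse (D := D) (Sum.inr ⟨(j, k), h⟩) (Sum.inr ⟨(j', k'), h'⟩) x y := by
  have e1 := on_disc e
  have e2 := on_disc e'
  simp only [Transverse, ccx, ccy, Sum.elim_inr]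
  rcases hjj with hjj | ⟨rfl, hkk⟩
  · rcases (show j + 1 ≤ j' from hjj).eq_or_lt with rfl | hj2
    · push_cast at e2 ⊢
      exact adjacent_column h.1 (by omega) h.2.2 h'.2.2 e1 e2
    · exact (far_column hf h.1 h'.2.1 hj2 h.2.2 h'.2.2 e1 e2).elim
  · obtain ⟨rfl, h3, h4, h5⟩ := same_column h.1 h.2.1 hkk h'.2.2 e1 e2
    refine ⟨fun h0 => ?_, by linarith, by linarith⟩
    have h6 : (x - j) * (3 / 2) = 0 := by
      rw [h3, h4] at h0
      linarith
    have h7 : x - j = 0 := by linarith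
    rw [h7] at h5
    norm_num at h5

theorem transverse_of_on (hl : D.Lens x y) (hf : D.Free x y) {c c' : D.Circ} (hne : c ≠ c')
    (e : D.On c x y) (e' : D.On c' x y) : Transverse c c' x y := by
  have hbd : ∀ (b : Bool) (q : D.Disc), D.On (Sum.inl b) x y → D.On (Sum.inr q) x y →
      Transverse (D := D) (Sum.inl b) (Sum.inr q) x y := by
    rintro b ⟨⟨j, k⟩, h⟩ e e'
    exact (onBig_disc hl hf (on_big e) h.1 h.2.1 h.2.2 (on_disc e')).2.2
  rcases c with b | ⟨⟨j, k⟩, h⟩ <;> rcases c' with b' | ⟨⟨j', k'⟩, h'⟩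
  · have hbb : ∀ b₀, D.OnBig b₀ x y := by
      intro b₀
      have h1 : b ≠ b' := fun h => hne (by rw [h])
      rcases (by cases b <;> cases b' <;> cases b₀ <;> simp_all : b₀ = b ∨ b₀ = b') with rfl | rfl
      exacts [e, e']
    obtain ⟨h2, h3⟩ := corner_of_mem hbb
    have h4 := D.sag_le_big
    have h5 := D.sag_pos
    have h6 := D.wid_lt_half
    have h7 := D.one_le_wid
    have hx : x - D.ctr ≠ 0 := by
      intro h0
      rw [h0] at h3
      nlinarith
    have hy : ∀ b₀, y - (D.mid + sg b₀ * (D.sag - D.big)) ≠ 0 := by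
      intro b₀ h0
      rcases sg_cases b₀ with h | h <;> rw [h] at h0 <;> linarith
    refine ⟨?_, fun h0 => hy b (sub_eq_zero.2 h0), fun h0 => hy b' (sub_eq_zero.2 h0)⟩
    simp only [ccx, ccy, Sum.elim_inl]
    have : (x - D.ctr) * (y - (D.mid + sg b' * (D.sag - D.big))) -
        (y - (D.mid + sg b * (D.sag - D.big))) * (x - D.ctr) =
        (x - D.ctr) * ((sg b - sg b') * (D.sag - D.big)) := by ring
    rw [this]
    refine mul_ne_zero hx (mul_ne_zero ?_ (by linarith))
    cases b <;> cases b' <;> simp_all [sg]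
    all_goals norm_num
  · exact hbd _ _ e e'
  · exact (hbd _ _ e' e).symm
  · rcases lt_trichotomy j j' with hj | rfl | hj
    · exact transverse_disc_of_le hf (Or.inl hj) e e'
    · rcases lt_trichotomy k k' with hk | rfl | hk
      · exact transverse_disc_of_le hf (Or.inr ⟨rfl, hk⟩) e e'
      · exact absurd rfl hne
      · exact (transverse_disc_of_le hf (Or.inr ⟨rfl, hk⟩) e' e).symm
    · exact (transverse_disc_of_le hf (Or.inl hj) e' e).symm

/-- Three distinct unit circles of a diagram do not meet within the region: two of them would belong
to one column, or to columns that are not adjacent. -/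
theorem no_triple_disc (hf : D.Free x y) {q q' q'' : D.Disc} (h1 : q ≠ q') (h2 : q' ≠ q'')
    (h3 : q ≠ q'') (e : D.On (Sum.inr q) x y) (e' : D.On (Sum.inr q') x y)
    (e'' : D.On (Sum.inr q'') x y) : False := by
  have far : ∀ q q' : D.Disc, D.On (Sum.inr q) x y → D.On (Sum.inr q') x y →
      q.1.1 + 2 ≤ q'.1.1 → False := by
    rintro ⟨⟨j, k⟩, h⟩ ⟨⟨j', k'⟩, h'⟩ e e' hj
    exact far_column hf h.1 h'.2.1 hj h.2.2 h'.2.2 (on_disc e) (on_disc e')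
  have same : ∀ q q' q'' : D.Disc, q ≠ q' → q' ≠ q'' → q ≠ q'' → D.On (Sum.inr q) x y →
      D.On (Sum.inr q') x y → D.On (Sum.inr q'') x y → q.1.1 = q'.1.1 → False := by
    rintro ⟨⟨j, k⟩, h⟩ ⟨⟨j', k'⟩, h'⟩ ⟨⟨j'', k''⟩, h''⟩ n1 n2 n3 e e' e'' hj
    obtain rfl : j = j' := hj
    have hn1 : k ≠ k' := fun h0 => n1 (by subst h0; rfl)
    have hn2 : j = j'' → k' ≠ k'' := fun hj h0 => n2 (by subst hj; subst h0; rfl)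
    have hn3 : j = j'' → k ≠ k'' := fun hj h0 => n3 (by subst hj; subst h0; rfl)
    rcases lt_or_gt_of_ne hn1 with hk | hk
    · exact no_third h.1 h.2.1 h''.1 h''.2.1 hk h'.2.2 h''.2.2
        (fun hj => ⟨(hn3 hj).symm, (hn2 hj).symm⟩) (on_disc e) (on_disc e') (on_disc e'')
    · exact no_third h.1 h.2.1 h''.1 h''.2.1 hk h.2.2 h''.2.2
        (fun hj => ⟨(hn2 hj).symm, (hn3 hj).symm⟩) (on_disc e') (on_disc e) (on_disc e'')
  by_cases c1 : q.1.1 = q'.1.1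
  · exact same q q' q'' h1 h2 h3 e e' e'' c1
  by_cases c2 : q'.1.1 = q''.1.1
  · exact same q' q'' q h2 h3.symm h1.symm e' e'' e c2
  by_cases c3 : q.1.1 = q''.1.1
  · exact same q q'' q' h3 h2.symm h1 e e'' e' c3
  rcases (by omega : q.1.1 + 2 ≤ q'.1.1 ∨ q'.1.1 + 2 ≤ q.1.1 ∨ q'.1.1 + 2 ≤ q''.1.1 ∨
      q''.1.1 + 2 ≤ q'.1.1 ∨ q.1.1 + 2 ≤ q''.1.1 ∨ q''.1.1 + 2 ≤ q.1.1) with h | h | h | h | h | h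
  exacts [far _ _ e e' h, far _ _ e' e h, far _ _ e' e'' h, far _ _ e'' e' h, far _ _ e e'' h,
    far _ _ e'' e h]

theorem no_triple_of_on (hl : D.Lens x y) (hf : D.Free x y) {c c' c'' : D.Circ} (h1 : c ≠ c')
    (h2 : c' ≠ c'') (h3 : c ≠ c'') (e : D.On c x y) (e' : D.On c' x y) (e'' : D.On c'' x y) :
    False := by
  have hbb : ∀ (b b' : Bool) (q : D.Disc), b ≠ b' → D.On (Sum.inl b) x y →
      D.On (Sum.inl b') x y → D.On (Sum.inr q) x y → False := by
    rintro b b' ⟨⟨j, k⟩, h⟩ hne e e' e''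
    obtain ⟨s1, s2, -⟩ := onBig_disc hl hf (on_big e) h.1 h.2.1 h.2.2 (on_disc e'')
    obtain ⟨s1', s2', -⟩ := onBig_disc hl hf (on_big e') h.1 h.2.1 h.2.2 (on_disc e'')
    rw [s2] at s2'
    cases b <;> cases b' <;> simp_all
  have hbd : ∀ (b : Bool) (q q' : D.Disc), q ≠ q' → D.On (Sum.inl b) x y →
      D.On (Sum.inr q) x y → D.On (Sum.inr q') x y → False := by
    rintro b ⟨⟨j, k⟩, h⟩ ⟨⟨j', k'⟩, h'⟩ hne e e' e''
    obtain ⟨s1, s2, -⟩ := onBig_disc hl hf (on_big e) h.1 h.2.1 h.2.2 (on_disc e')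
    obtain ⟨s1', s2', -⟩ := onBig_disc hl hf (on_big e) h'.1 h'.2.1 h'.2.2 (on_disc e'')
    have hfl : (D.first : ℝ) ≤ D.last := by exact_mod_cast D.first_le_last
    apply hne
    have hj : j = j' := by
      rcases s1 with ⟨s, t⟩ | ⟨s, t⟩ <;> rcases s1' with ⟨s', t'⟩ | ⟨s', t'⟩
      · omega
      · linarith
      · linarith
      · omega
    subst hj
    subst s2'
    subst s2
    rfl
  rcases c with b | q <;> rcases c' with b' | q' <;> rcases c'' with b'' | q''
  · have n1 : b ≠ b' := fun h => h1 (by rw [h])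
    have n2 : b' ≠ b'' := fun h => h2 (by rw [h])
    have n3 : b ≠ b'' := fun h => h3 (by rw [h])
    revert n1 n2 n3
    cases b <;> cases b' <;> cases b'' <;> simp
  · exact hbb b b' q'' (fun h => h1 (by rw [h])) e e' e''
  · exact hbb b b'' q' (fun h => h3 (by rw [h])) e e'' e'
  · exact hbd b q' q'' (fun h => h2 (by rw [h])) e e' e''
  · exact hbb b' b'' q (fun h => h2 (by rw [h])) e' e'' e
  · exact hbd b' q q'' (fun h => h3 (by rw [h])) e' e e''
  · exact hbd b'' q q' (fun h => h1 (by rw [h])) e'' e e'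
  · exact no_triple_disc hf (fun h => h1 (by rw [h])) (fun h => h2 (by rw [h]))
      (fun h => h3 (by rw [h])) e e' e''

theorem isGeneric_system (D : Diagram) : D.system.IsGeneric := by
  have hc : ∀ i : Fin (Fintype.card D.Circ), ∃ c, i = Fintype.equivFin _ c := fun i =>
    ⟨(Fintype.equivFin _).symm i, by simp⟩
  refine ⟨Fintype.card_pos_iff.2 ⟨Sum.inl true⟩, ?_, ?_, ?_, ?_⟩
  · refine (Metric.isBounded_closedBall
      (x := (!₂[D.ctr, D.mid + sg true * (D.sag - D.big)] : EuclideanSpace ℝ (Fin 2)))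
      (r := D.big)).subset fun z hz => ?_
    have h1 := (mem_region_system.1 hz).1 true
    rw [Metric.mem_closedBall, EuclideanSpace.dist_eq, Fin.sum_univ_two]
    refine Real.sqrt_le_iff.2 ⟨?_, ?_⟩
    · have := D.sag_le_big
      have := D.sag_pos
      linarith
    · simpa [Real.dist_eq, sq_abs] using h1
  · intro i
    obtain ⟨c, rfl⟩ := hc i
    have key : ∃ x y, D.Lens x y ∧ D.Free x y ∧ D.On c x y := by
      rcases c with b | ⟨⟨j, k⟩, h⟩
      · exact ⟨_, _, D.corner_mem.1, D.corner_mem.2.1, D.corner_mem.2.2 b⟩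
      · obtain ⟨x, y, h1, h2, h3⟩ := exists_mem_disc h.1 h.2.1 h.2.2
        exact ⟨x, y, h1, h2, by simpa [On, ccx, ccy, crad] using h3⟩
    obtain ⟨x, y, h1, h2, h3⟩ := key
    exact ⟨!₂[x, y], mem_region_system.2 ⟨h1, h2⟩, quad_system_eq_zero.2 h3⟩
  · intro i i' hne z hz e e'
    obtain ⟨c, rfl⟩ := hc i
    obtain ⟨c', rfl⟩ := hc i'
    obtain ⟨hl, hf⟩ := mem_region_system.1 hz
    obtain ⟨t1, t2, -⟩ := transverse_of_on hl hf (fun h => hne (by rw [h]))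
      (quad_system_eq_zero.1 e) (quad_system_eq_zero.1 e')
    simp only [CircleSystem.cross, system, Equiv.symm_apply_apply]
    exact ⟨t1, t2⟩
  · intro i i' i'' h1 h2 h3 z hz e e' e''
    obtain ⟨c, rfl⟩ := hc i
    obtain ⟨c', rfl⟩ := hc i'
    obtain ⟨c'', rfl⟩ := hc i''
    obtain ⟨hl, hf⟩ := mem_region_system.1 hz
    exact no_triple_of_on hl hf (fun h => h1 (by rw [h])) (fun h => h2 (by rw [h]))
      (fun h => h3 (by rw [h])) (quad_system_eq_zero.1 e) (quad_system_eq_zero.1 e')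
      (quad_system_eq_zero.1 e'')

end Diagram

/-! ### Labelled diagrams -/

/-- The gaps `k` of column `j` and `k'` of column `j + 1` are compatible when each pair of linked
discs lies on the same side of them. -/
def Diagram.Compat (D : Diagram) (j k k' : ℕ) : Prop :=
  ∀ i ≤ D.N j, ∀ m ≤ D.N (j + 1), |D.p j i - D.p (j + 1) m| ≤ 7 / 8 → (i ≤ k ↔ m ≤ k')

/-- A labelling of the gaps of a diagram by the edges and the vertices of a graph drawn without
vertical tangents: the edge `a` is a path `s a` over the interval from `pos (vl a)` to
`pos (vr a)`. The vertex `v` labels a gap of the column `ev v`; it is at this column, or at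
the tip of an overlap of discs, or at a corner of the lens. Compatible gaps of adjacent columns have
labels that are the same edge, or an edge and one of its end points. -/
structure Labelling (D : Diagram) (G : Type*) [TopologicalSpace G] (V E : Type*) where
  /-- the left end point of an edge -/
  vl : E → V
  /-- the right end point of an edge -/
  vr : E → V
  /-- the horizontal position of a vertex -/
  pos : V → ℝ
  /-- the column of a vertex -/
  ev : V → ℕ
  /-- the point of the graph given by a vertex -/
  vx : V → G
  /-- the edges as paths parametrized by the horizontal coordinate -/
  s : E → ℝ → G
  continuousOn_s : ∀ a, ContinuousOn (s a) (Set.Icc (pos (vl a)) (pos (vr a)))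
  s_left : ∀ a, s a (pos (vl a)) = vx (vl a)
  s_right : ∀ a, s a (pos (vr a)) = vx (vr a)
  s_inj : ∀ a a' x x', x ∈ Set.Icc (pos (vl a)) (pos (vr a)) →
    x' ∈ Set.Icc (pos (vl a')) (pos (vr a')) → s a x = s a' x' → x = x' ∧
      (a = a' ∨ ∃ v, x = pos v ∧ (v = vl a ∨ v = vr a) ∧ (v = vl a' ∨ v = vr a'))
  s_surj : ∀ g, ∃ a, ∃ x ∈ Set.Icc (pos (vl a)) (pos (vr a)), s a x = g
  exists_edge : ∀ v, ∃ a, v = vl a ∨ v = vr a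
  ev_inj : Function.Injective ev
  ev_ne : ∀ v w, ev v ≠ ev w + 1
  pos_lt : ∀ a, pos (vl a) < pos (vr a)
  /-- the labels of the gaps -/
  lab : ℕ → ℕ → E ⊕ V
  edge_time : ∀ j, D.first ≤ j → j ≤ D.last → ∀ k < D.N j, ∀ a, lab j k = Sum.inl a →
    ev (vl a) < j ∧ j < ev (vr a)
  vert_time : ∀ j, D.first ≤ j → j ≤ D.last → ∀ k < D.N j, ∀ v, lab j k = Sum.inr v → ev v = j
  lab_inj : ∀ j, D.first ≤ j → j ≤ D.last → ∀ k < D.N j, ∀ k' < D.N j, lab j k = lab j k' → k = k'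
  exists_lab_edge : ∀ j, D.first ≤ j → j ≤ D.last → ∀ a, ev (vl a) < j → j < ev (vr a) →
    ∃ k < D.N j, lab j k = Sum.inl a
  exists_lab_vert : ∀ v, D.first ≤ ev v → ev v ≤ D.last → ∃ k < D.N (ev v), lab (ev v) k = Sum.inr v
  compat_iff : ∀ j, D.first ≤ j → j < D.last → ∀ k < D.N j, ∀ k' < D.N (j + 1),
    D.Compat j k k' ↔ ∃ a, (lab j k = Sum.inl a ∨ lab j k = Sum.inr (vl a)) ∧
      (lab (j + 1) k' = Sum.inl a ∨ lab (j + 1) k' = Sum.inr (vr a))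
  first_lt_last : D.first < D.last
  /-- the first edge -/
  e₀ : E
  /-- the last edge -/
  e₁ : E
  lab_first : lab D.first 0 = Sum.inl e₀
  lab_last : lab D.last 0 = Sum.inl e₁
  eq_first : ∀ a, ev (vl a) < D.first → a = e₀
  eq_last : ∀ a, D.last < ev (vr a) → a = e₁
  pos_spec : ∀ v, (D.first ≤ ev v ∧ ev v ≤ D.last ∧ pos v = ev v) ∨
    (∀ a a', (v = vl a ∨ v = vr a) → (v = vl a' ∨ v = vr a') → a = a') ∧
    ((D.first ≤ ev v ∧ ev v < D.last ∧ pos v = ev v + Real.sqrt 7 / 4 ∧ (∀ a, vr a ≠ v) ∧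
        ∀ k < D.N (ev v), lab (ev v) k = Sum.inr v → D.p (ev v) (k + 1) = D.p (ev v) k + 3 / 2) ∨
      (D.first < ev v ∧ ev v ≤ D.last ∧ pos v = ev v - Real.sqrt 7 / 4 ∧ (∀ a, vl a ≠ v) ∧
        ∀ k < D.N (ev v), lab (ev v) k = Sum.inr v → D.p (ev v) (k + 1) = D.p (ev v) k + 3 / 2) ∨
      (ev v < D.first ∧ pos v = D.xL ∧ ∀ a, vr a ≠ v) ∨
      (D.last < ev v ∧ pos v = D.xR ∧ ∀ a, vl a ≠ v))
  room : ∀ j, D.first ≤ j → j < D.last → ∀ k < D.N j, ∀ k' < D.N (j + 1), D.Compat j k k' →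
    max (D.p j k) (D.p (j + 1) k') + 2 ≤ min (D.p j (k + 1)) (D.p (j + 1) (k' + 1)) ∨
    (D.p j (k + 1) = D.p j k + 3 / 2 ∧ D.p (j + 1) k' + 1 ≤ D.p j k + 3 / 4 ∧
      D.p j k + 3 / 4 + 1 ≤ D.p (j + 1) (k' + 1) ∧
      ∃ v, lab j k = Sum.inr v ∧ pos v = j + Real.sqrt 7 / 4) ∨
    (D.p (j + 1) (k' + 1) = D.p (j + 1) k' + 3 / 2 ∧ D.p j k + 1 ≤ D.p (j + 1) k' + 3 / 4 ∧
      D.p (j + 1) k' + 3 / 4 + 1 ≤ D.p j (k + 1) ∧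
      ∃ v, lab (j + 1) k' = Sum.inr v ∧ pos v = (j + 1 : ℕ) - Real.sqrt 7 / 4)

namespace Diagram

variable {D : Diagram} {x y : ℝ}

theorem Free.ne_p (hf : D.Free x y) {j k : ℕ} (h1 : D.first ≤ j) (h2 : j ≤ D.last) (hk : k ≤ D.N j)
    (hx : |x - j| < 1) : y ≠ D.p j k := by
  intro h
  have := hf j h1 h2 k hk
  rw [h, ← sq_abs] at this
  nlinarith [abs_nonneg (x - j)]

theorem gap_unique {j : ℕ} (h1 : D.first ≤ j) (h2 : j ≤ D.last) {k k' : ℕ} (hk : k < D.N j)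
    (hk' : k' < D.N j) (hy : D.p j k < y) (hy' : y < D.p j (k + 1)) (hz : D.p j k' < y)
    (hz' : y < D.p j (k' + 1)) : k = k' := by
  rcases lt_trichotomy k k' with h | h | h
  · linarith [p_le h1 h2 (show k + 1 ≤ k' from h) hk'.le]
  · exact h
  · linarith [p_le h1 h2 (show k' + 1 ≤ k from h) hk.le]

/-- The region is vertically convex away from the centers of nearby discs. -/
theorem convex_of_near {y₁ y₂ : ℝ} (hl₁ : D.Lens x y₁) (hl₂ : D.Lens x y₂) (hf₁ : D.Free x y₁)
    (hf₂ : D.Free x y₂) (hy : y ∈ Set.Icc y₁ y₂)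
    (h : ∀ j, D.first ≤ j → j ≤ D.last → |x - j| < 1 → ∀ k ≤ D.N j,
      D.p j k ≤ y₁ ∨ y₂ ≤ D.p j k) : D.Lens x y ∧ D.Free x y := by
  refine ⟨hl₁.convex hl₂ hy, free_of_near fun j h1 h2 hx k hk => ?_⟩
  rcases h j h1 h2 hx k hk with h3 | h3
  · have := hf₁ j h1 h2 k hk
    nlinarith [hy.1]
  · have := hf₂ j h1 h2 k hk
    nlinarith [hy.2]

theorem column_cases {i j : ℕ} (hx : (j : ℝ) ≤ x) (hx' : x ≤ j + 1) (h : |x - i| < 1) :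
    i = j ∨ i = j + 1 := by
  have h' := abs_lt.1 h
  have h1 : (i : ℝ) < j + 2 := by linarith
  have h2 : (j : ℝ) < i + 1 := by linarith
  have h1' : i < j + 2 := by exact_mod_cast h1
  have h2' : j < i + 1 := by exact_mod_cast h2
  omega

/-- Heights of a column lie below the bottom or above the top of a gap. -/
theorem le_or_le_gap {j : ℕ} (h1 : D.first ≤ j) (h2 : j ≤ D.last) {k i : ℕ} (hk : k < D.N j)
    (hi : i ≤ D.N j) : D.p j i ≤ D.p j k ∨ D.p j (k + 1) ≤ D.p j i := by
  rcases le_or_gt i k with h | h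
  · exact Or.inl (p_le h1 h2 h hk.le)
  · exact Or.inr (p_le h1 h2 (show k + 1 ≤ i from h) hi)

/-- A point of the region over a column lies in the interior of a gap of this column, of height
greater than `3 / 2`. -/
theorem exists_column_gap {j : ℕ} (h1 : D.first ≤ j) (h2 : j ≤ D.last) (hl : D.Lens j y)
    (hf : D.Free j y) : ∃ k < D.N j, D.p j k < y ∧ y < D.p j (k + 1) ∧
      D.p j (k + 1) ≠ D.p j k + 3 / 2 := by
  have hx : |(j : ℝ) - j| ≤ 1 / 2 := by norm_num
  obtain ⟨k, hk, h3, h4⟩ := exists_gap (bottom_lt hl hf h1 h2 hx).le (lt_top hl hf h1 h2 hx)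
  refine ⟨k, hk, lt_of_le_of_ne h3 (hf.ne_p h1 h2 hk.le (by norm_num)).symm, h4, fun h => ?_⟩
  have e1 := hf j h1 h2 k hk.le
  have e2 := hf j h1 h2 (k + 1) hk
  rw [sub_self] at e1 e2
  have e3 : 1 ≤ y - D.p j k := by nlinarith
  have e4 : 1 ≤ D.p j (k + 1) - y := by nlinarith
  linarith

end Diagram

namespace Labelling

open Diagram

variable {D : Diagram} {G : Type*} [TopologicalSpace G] {V E : Type*} (Λ : Labelling D G V E)

theorem pos_lt_of_ev_lt {v : V} {j : ℕ} (h1 : D.first ≤ j) (h2 : j ≤ D.last) (h : Λ.ev v < j) :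
    Λ.pos v < j := by
  have hb := sqrt_seven_bounds
  have h1r : (D.first : ℝ) ≤ j := by exact_mod_cast h1
  have hr : (Λ.ev v : ℝ) + 1 ≤ j := by exact_mod_cast h
  rcases Λ.pos_spec v with ⟨-, -, h3⟩ | ⟨-, ⟨-, -, h3, -⟩ | ⟨-, -, h3, -⟩ | ⟨-, h3, -⟩ | ⟨h3, -⟩⟩
  · linarith
  · linarith
  · linarith
  · linarith [D.xL_lt]
  · omega

theorem lt_pos_of_lt_ev {v : V} {j : ℕ} (h1 : D.first ≤ j) (h2 : j ≤ D.last) (h : j < Λ.ev v) :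
    j < Λ.pos v := by
  have hb := sqrt_seven_bounds
  have h2r : (j : ℝ) ≤ D.last := by exact_mod_cast h2
  have hr : (j : ℝ) + 1 ≤ Λ.ev v := by exact_mod_cast h
  rcases Λ.pos_spec v with ⟨-, -, h3⟩ | ⟨-, ⟨-, -, h3, -⟩ | ⟨-, -, h3, -⟩ | ⟨h3, -⟩ | ⟨-, h3, -⟩⟩
  · linarith
  · linarith
  · linarith
  · omega
  · linarith [D.lt_xR]

theorem ev_vl_le {a : E} {j : ℕ} (h1 : D.first ≤ j) (h : Λ.pos (Λ.vl a) < j + 1) :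
    Λ.ev (Λ.vl a) ≤ j := by
  have hb := sqrt_seven_bounds
  have key : (Λ.ev (Λ.vl a) : ℝ) < j + 1 → Λ.ev (Λ.vl a) ≤ j := fun h => by
    have : Λ.ev (Λ.vl a) < j + 1 := by exact_mod_cast h
    omega
  rcases Λ.pos_spec (Λ.vl a) with ⟨-, -, h3⟩ | ⟨-, ⟨-, -, h3, -⟩ | ⟨-, -, -, h3, -⟩ | ⟨h3, -⟩ |
    ⟨-, -, h3⟩⟩
  · exact key (by linarith)
  · exact key (by linarith)
  · exact absurd rfl (h3 a)
  · omega
  · exact absurd rfl (h3 a)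

theorem lt_ev_vr {a : E} {j : ℕ} (h2 : j ≤ D.last) (h : j < Λ.pos (Λ.vr a)) :
    j < Λ.ev (Λ.vr a) := by
  have hb := sqrt_seven_bounds
  have key : (j : ℝ) < Λ.ev (Λ.vr a) → j < Λ.ev (Λ.vr a) := fun h => by exact_mod_cast h
  rcases Λ.pos_spec (Λ.vr a) with ⟨-, -, h3⟩ | ⟨-, ⟨-, -, -, h3, -⟩ | ⟨-, -, h3, -⟩ | ⟨-, -, h3⟩ |
    ⟨h3, -⟩⟩
  · exact key (by linarith)
  · exact absurd rfl (h3 a)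
  · exact key (by linarith)
  · exact absurd rfl (h3 a)
  · omega

theorem edge_pos {j k : ℕ} {a : E} (h1 : D.first ≤ j) (h2 : j ≤ D.last) (hk : k < D.N j)
    (h : Λ.lab j k = Sum.inl a) : Λ.pos (Λ.vl a) < j ∧ j < Λ.pos (Λ.vr a) := by
  obtain ⟨h3, h4⟩ := Λ.edge_time j h1 h2 k hk a h
  exact ⟨Λ.pos_lt_of_ev_lt h1 h2 h3, Λ.lt_pos_of_lt_ev h1 h2 h4⟩

/-- In a gap that the region meets, a vertex label is positioned at the column. -/
theorem vert_pos {j k : ℕ} {v : V} (h1 : D.first ≤ j) (h2 : j ≤ D.last) (hk : k < D.N j)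
    (h : Λ.lab j k = Sum.inr v) (hp : D.p j (k + 1) ≠ D.p j k + 3 / 2) : Λ.pos v = j := by
  have hev := Λ.vert_time j h1 h2 k hk v h
  subst hev
  rcases Λ.pos_spec v with ⟨-, -, h3⟩ | ⟨-, ⟨-, -, -, -, h3⟩ | ⟨-, -, -, -, h3⟩ | ⟨h3, -⟩ | ⟨h3, -⟩⟩
  · exact h3
  · exact absurd (h3 k hk h) hp
  · exact absurd (h3 k hk h) hp
  · omega
  · omega

theorem first_edge : Λ.pos (Λ.vl Λ.e₀) = D.xL ∧ (D.first : ℝ) < Λ.pos (Λ.vr Λ.e₀) := by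
  have hN : 0 < D.N D.first := by rw [D.first_col.1]; exact one_pos
  have h1 := Λ.edge_time _ le_rfl D.first_le_last 0 hN _ Λ.lab_first
  have hfl := D.first_le_last
  refine ⟨?_, (Λ.edge_pos le_rfl D.first_le_last hN Λ.lab_first).2⟩
  rcases Λ.pos_spec (Λ.vl Λ.e₀) with ⟨h3, -⟩ | ⟨-, ⟨h3, -⟩ | ⟨h3, -⟩ | ⟨-, h3, -⟩ | ⟨h3, -⟩⟩
  · omega
  · omega
  · omega
  · exact h3
  · omega

theorem last_edge : Λ.pos (Λ.vr Λ.e₁) = D.xR ∧ Λ.pos (Λ.vl Λ.e₁) < (D.last : ℝ) := by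
  have hN : 0 < D.N D.last := by rw [D.last_col.1]; exact one_pos
  have h1 := Λ.edge_time _ D.first_le_last le_rfl 0 hN _ Λ.lab_last
  have hfl := D.first_le_last
  refine ⟨?_, (Λ.edge_pos D.first_le_last le_rfl hN Λ.lab_last).1⟩
  rcases Λ.pos_spec (Λ.vr Λ.e₁) with ⟨-, h3, -⟩ | ⟨-, ⟨-, h3, -⟩ | ⟨-, h3, -⟩ | ⟨h3, -⟩ |
    ⟨-, h3, -⟩⟩
  · omega
  · omega
  · omega
  · omega
  · exact h3

/-! ### The pieces of the region of a labelled diagram -/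

/-- The gaps of the columns of a diagram. -/
abbrev Gap (D : Diagram) : Type := {q : ℕ × ℕ // D.first ≤ q.1 ∧ q.1 ≤ D.last ∧ q.2 < D.N q.1}

instance (D : Diagram) : Finite (Gap D) :=
  Finite.of_injective (β := D.Disc) (fun q => ⟨q.1, q.2.1, q.2.2.1, q.2.2.2.le⟩)
    fun _ _ h => Subtype.ext (Subtype.mk.inj h)

/-- The bands of a labelled diagram: pairs of compatible gaps of adjacent columns, with the
edge labelling them. -/
abbrev Band : Type _ := {q : Gap D × Gap D × E // q.2.1.1.1 = q.1.1.1 + 1 ∧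
  D.Compat q.1.1.1 q.1.1.2 q.2.1.1.2 ∧
  (Λ.lab q.1.1.1 q.1.1.2 = Sum.inl q.2.2 ∨ Λ.lab q.1.1.1 q.1.1.2 = Sum.inr (Λ.vl q.2.2)) ∧
  (Λ.lab (q.1.1.1 + 1) q.2.1.1.2 = Sum.inl q.2.2 ∨
    Λ.lab (q.1.1.1 + 1) q.2.1.1.2 = Sum.inr (Λ.vr q.2.2))}

/-- The value of a gap. -/
def val (j k : ℕ) : G := Sum.elim (fun a => Λ.s a j) Λ.vx (Λ.lab j k)

/-- The pieces: the strips to the left of the first column and to the right of the last column, the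
gaps, and the bands. -/
noncomputable def piece : Bool ⊕ Gap D ⊕ Λ.Band → Piece G
  | Sum.inl true =>
    { a := D.xL
      b := D.first
      c := -1
      d := D.Y + 1
      s := Λ.s Λ.e₀
      continuousOn := (Λ.continuousOn_s Λ.e₀).mono
        (Set.Icc_subset_Icc Λ.first_edge.1.le Λ.first_edge.2.le) }
  | Sum.inl false =>
    { a := D.last
      b := D.xR
      c := -1
      d := D.Y + 1
      s := Λ.s Λ.e₁
      continuousOn := (Λ.continuousOn_s Λ.e₁).mono
        (Set.Icc_subset_Icc Λ.last_edge.2.le Λ.last_edge.1.ge) }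
  | Sum.inr (Sum.inl q) =>
    { a := q.1.1
      b := q.1.1
      c := D.p q.1.1 q.1.2
      d := D.p q.1.1 (q.1.2 + 1)
      s := fun _ => Λ.val q.1.1 q.1.2
      continuousOn := continuousOn_const }
  | Sum.inr (Sum.inr q) =>
    { a := max q.1.1.1.1 (Λ.pos (Λ.vl q.1.2.2))
      b := min (q.1.1.1.1 + 1) (Λ.pos (Λ.vr q.1.2.2))
      c := max (D.p q.1.1.1.1 q.1.1.1.2) (D.p (q.1.1.1.1 + 1) q.1.2.1.1.2)
      d := min (D.p q.1.1.1.1 (q.1.1.1.2 + 1)) (D.p (q.1.1.1.1 + 1) (q.1.2.1.1.2 + 1))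
      s := Λ.s q.1.2.2
      continuousOn := (Λ.continuousOn_s q.1.2.2).mono
        (Set.Icc_subset_Icc (le_max_right _ _) (min_le_right _ _)) }

variable {Λ}

/-- A point of the plane in a band, spelled out. -/
structure InBand (Λ : Labelling D G V E) (j k k' : ℕ) (a : E) (x y : ℝ) : Prop where
  first_le : D.first ≤ j
  lt_last : j < D.last
  lt_N : k < D.N j
  lt_N' : k' < D.N (j + 1)
  compat : D.Compat j k k'
  lab_left : Λ.lab j k = Sum.inl a ∨ Λ.lab j k = Sum.inr (Λ.vl a)
  lab_right : Λ.lab (j + 1) k' = Sum.inl a ∨ Λ.lab (j + 1) k' = Sum.inr (Λ.vr a)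
  le_x : (j : ℝ) ≤ x
  x_le : x ≤ j + 1
  pos_le : Λ.pos (Λ.vl a) ≤ x
  le_pos : x ≤ Λ.pos (Λ.vr a)
  le_y : D.p j k ≤ y
  y_le : y ≤ D.p j (k + 1)
  le_y' : D.p (j + 1) k' ≤ y
  y_le' : y ≤ D.p (j + 1) (k' + 1)

theorem InBand.exists_piece {j k k' : ℕ} {a : E} {z : EuclideanSpace ℝ (Fin 2)}
    (h : InBand Λ j k k' a (z 0) (z 1)) : ∃ i, z ∈ (Λ.piece i).rect ∧ (Λ.piece i).s = Λ.s a := by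
  have h1 := h.lt_last
  have h2 := h.first_le
  refine ⟨Sum.inr (Sum.inr ⟨(⟨(j, k), h.first_le, h.lt_last.le, h.lt_N⟩,
    ⟨(j + 1, k'), by omega, by simp only; omega, h.lt_N'⟩, a), rfl, h.compat, h.lab_left,
    h.lab_right⟩), ?_, rfl⟩
  exact ⟨⟨max_le h.le_x h.pos_le, le_min h.x_le h.le_pos⟩, max_le h.le_y h.le_y',
    le_min h.y_le h.y_le'⟩

theorem inBand_of_mem {z : EuclideanSpace ℝ (Fin 2)} {q : Λ.Band}
    (h : z ∈ (Λ.piece (Sum.inr (Sum.inr q))).rect) :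
    InBand Λ q.1.1.1.1 q.1.1.1.2 q.1.2.1.1.2 q.1.2.2 (z 0) (z 1) := by
  obtain ⟨⟨⟨⟨j, k⟩, g1, g2, g3⟩, ⟨⟨j', k'⟩, g4, g5, g6⟩, a⟩, q1, q2, q3, q4⟩ := q
  simp only at q1 g1 g2 g3 g4 g5 g6 q2 q3 q4
  subst q1
  obtain ⟨⟨h1, h2⟩, h3, h4⟩ := h
  simp only [piece, max_le_iff, le_min_iff] at h1 h2 h3 h4
  exact ⟨g1, by simp only; omega, g3, g6, q2, q3, q4, h1.1, h2.1, h1.2, h2.2, h3.1, h4.1, h3.2,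
    h4.2⟩

/-- The edge labelling a band is determined by the gaps. -/
theorem InBand.edge_eq {j k k' : ℕ} {a a' : E} {x y x' y' : ℝ} (h : InBand Λ j k k' a x y)
    (h' : InBand Λ j k k' a' x' y') : a = a' := by
  rcases h.lab_left with e | e <;> rcases h'.lab_left with e' | e' <;> rw [e] at e'
  · exact Sum.inl_injective e'
  · exact absurd e' (by simp)
  · exact absurd e' (by simp)
  · rcases h.lab_right with f | f <;> rcases h'.lab_right with f' | f'
    · rw [f] at f'
      exact Sum.inl_injective f'
    · rw [f] at f'
      exact absurd f' (by simp)
    · rw [f] at f'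
      exact absurd f' (by simp)
    · have h1 := Λ.vert_time j h.first_le h.lt_last.le k h.lt_N _ e
      have h2 := Λ.vert_time (j + 1) (by have := h.first_le; omega) h.lt_last k' h.lt_N' _ f
      exact absurd (h2.trans (by rw [h1])) (Λ.ev_ne _ _)

/-- The gaps of a band are determined by the edge and the columns. -/
theorem InBand.gap_eq {j k k' i i' : ℕ} {a : E} {x y x' y' : ℝ} (h : InBand Λ j k k' a x y)
    (h' : InBand Λ j i i' a x' y') : k = i ∧ k' = i' := by
  have h1 := h.first_le
  have h2 := h.lt_last
  constructor
  · apply Λ.lab_inj j h1 h2.le k h.lt_N i h'.lt_N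
    rcases h.lab_left with e | e <;> rcases h'.lab_left with e' | e'
    · rw [e, e']
    · have := Λ.edge_time j h1 h2.le k h.lt_N _ e
      have := Λ.vert_time j h1 h2.le i h'.lt_N _ e'
      omega
    · have := Λ.edge_time j h1 h2.le i h'.lt_N _ e'
      have := Λ.vert_time j h1 h2.le k h.lt_N _ e
      omega
    · rw [e, e']
  · apply Λ.lab_inj (j + 1) (by omega) h2 k' h.lt_N' i' h'.lt_N'
    rcases h.lab_right with e | e <;> rcases h'.lab_right with e' | e'
    · rw [e, e']
    · have := Λ.edge_time (j + 1) (by omega) h2 k' h.lt_N' _ e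
      have := Λ.vert_time (j + 1) (by omega) h2 i' h'.lt_N' _ e'
      omega
    · have := Λ.edge_time (j + 1) (by omega) h2 i' h'.lt_N' _ e'
      have := Λ.vert_time (j + 1) (by omega) h2 k' h.lt_N' _ e
      omega
    · rw [e, e']

end Labelling

namespace Labelling

open Diagram

variable {D : Diagram} {G : Type*} [TopologicalSpace G] {V E : Type*} {Λ : Labelling D G V E}
  {z w : EuclideanSpace ℝ (Fin 2)}

theorem mem_iff : z ∈ D.system.region ↔ D.Lens (z 0) (z 1) ∧ D.Free (z 0) (z 1) :=
  mem_region_system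

theorem mem_strip_left (hz : z ∈ D.system.region) (h : z 0 ≤ D.first) :
    z ∈ (Λ.piece (Sum.inl true)).rect := by
  have h1 := (mem_iff.1 hz).1
  have h2 := h1.bounds
  exact ⟨⟨h1.mem_Icc.1, h⟩, (by linarith : (-1 : ℝ) ≤ _), (by linarith : _ ≤ D.Y + 1)⟩

theorem mem_strip_right (hz : z ∈ D.system.region) (h : D.last ≤ z 0) :
    z ∈ (Λ.piece (Sum.inl false)).rect := by
  have h1 := (mem_iff.1 hz).1
  have h2 := h1.bounds
  exact ⟨⟨h, h1.mem_Icc.2⟩, (by linarith : (-1 : ℝ) ≤ _), (by linarith : _ ≤ D.Y + 1)⟩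

/-- A point of the region in the gap of a vertex and to the right of its column lies beyond the
vertex. -/
theorem pos_le_of_gap {x y : ℝ} (hf : D.Free x y) {j k : ℕ} {a : E} (h1 : D.first ≤ j)
    (h2 : j ≤ D.last) (hk : k < D.N j) (h : Λ.lab j k = Sum.inr (Λ.vl a)) (hx : (j : ℝ) ≤ x)
    (hy : D.p j k ≤ y) (hy' : y ≤ D.p j (k + 1)) : Λ.pos (Λ.vl a) ≤ x := by
  have hv := Λ.vert_time j h1 h2 k hk _ h
  rcases Λ.pos_spec (Λ.vl a) with ⟨-, -, h3⟩ | ⟨-, ⟨-, -, h3, -, h4⟩ | ⟨-, -, -, h3, -⟩ | ⟨h3, -⟩ |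
    ⟨-, -, h3⟩⟩
  · rw [h3, hv]
    exact hx
  · rw [hv] at h3 h4
    have h5 := h4 k hk h
    have e1 := hf j h1 h2 k hk.le
    have e2 := hf j h1 h2 (k + 1) hk
    have hs := sq_sqrt_seven
    have h6 : (Real.sqrt 7 / 4) ^ 2 ≤ (x - j) ^ 2 := by
      rw [hs]
      rcases le_total y (D.p j k + 3 / 4) with h | h <;> nlinarith
    have h7 := abs_le_of_sq_le_sq h6 (sub_nonneg.2 hx)
    linarith [(le_abs_self _).trans h7]
  · exact absurd rfl (h3 a)
  · omega
  · exact absurd rfl (h3 a)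

/-- A point of the region in the gap of a vertex and to the left of its column lies before the
vertex. -/
theorem le_pos_of_gap {x y : ℝ} (hf : D.Free x y) {j k : ℕ} {a : E} (h1 : D.first ≤ j)
    (h2 : j ≤ D.last) (hk : k < D.N j) (h : Λ.lab j k = Sum.inr (Λ.vr a)) (hx : x ≤ j)
    (hy : D.p j k ≤ y) (hy' : y ≤ D.p j (k + 1)) : x ≤ Λ.pos (Λ.vr a) := by
  have hv := Λ.vert_time j h1 h2 k hk _ h
  rcases Λ.pos_spec (Λ.vr a) with ⟨-, -, h3⟩ | ⟨-, ⟨-, -, -, h3, -⟩ | ⟨-, -, h3, -, h4⟩ |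
    ⟨-, -, h3⟩ | ⟨h3, -⟩⟩
  · rw [h3, hv]
    exact hx
  · exact absurd rfl (h3 a)
  · rw [hv] at h3 h4
    have h5 := h4 k hk h
    have e1 := hf j h1 h2 k hk.le
    have e2 := hf j h1 h2 (k + 1) hk
    have hs := sq_sqrt_seven
    have h6 : (Real.sqrt 7 / 4) ^ 2 ≤ (j - x) ^ 2 := by
      rw [hs]
      rcases le_total y (D.p j k + 3 / 4) with h | h <;> nlinarith
    have h7 := abs_le_of_sq_le_sq h6 (sub_nonneg.2 hx)
    linarith [(le_abs_self _).trans h7]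
  · exact absurd rfl (h3 a)
  · omega

/-- A point of the region strictly between two adjacent columns lies in a band. -/
theorem exists_inBand (hz : z ∈ D.system.region) {j : ℕ} (h1 : D.first ≤ j) (h2 : j < D.last)
    (hx : (j : ℝ) < z 0) (hx' : z 0 < j + 1) : ∃ k k' a, InBand Λ j k k' a (z 0) (z 1) := by
  obtain ⟨hl, hf⟩ := mem_iff.1 hz
  obtain ⟨⟨e1, e2⟩, e3, e4⟩ := between hl hf h1 h2 hx.le hx'.le
  obtain ⟨k, hk, k1, k2⟩ := exists_gap e1 e2
  obtain ⟨k', hk', k1', k2'⟩ := exists_gap e3 e4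
  have hc : D.Compat j k k' := by
    intro i hi m hm hl
    have h3 := hf.link_iff h1 h2 hi hm hl hx.le hx'.le
    have h4 : i ≤ k ↔ D.p j i ≤ z 1 := by
      constructor
      · intro h
        exact (p_le h1 h2.le h hk.le).trans k1
      · intro h
        by_contra hlt
        linarith [p_le h1 h2.le (show k + 1 ≤ i by omega) hi]
    have h5 : m ≤ k' ↔ D.p (j + 1) m ≤ z 1 := by
      constructor
      · intro h
        exact (p_le (j := j + 1) (by omega) h2 h hk'.le).trans k1'
      · intro h
        by_contra hlt
        linarith [p_le (j := j + 1) (by omega) h2 (show k' + 1 ≤ m by omega) hm]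
    rw [h4, h5, h3]
  obtain ⟨a, ha, ha'⟩ := (Λ.compat_iff j h1 h2 k hk k' hk').1 hc
  refine ⟨k, k', a, h1, h2, hk, hk', hc, ha, ha', hx.le, hx'.le, ?_, ?_, k1, k2.le, k1', k2'.le⟩
  · rcases ha with h | h
    · exact ((Λ.edge_pos h1 h2.le hk h).1.trans hx).le
    · exact pos_le_of_gap hf h1 h2.le hk h hx.le k1 k2.le
  · rcases ha' with h | h
    · have h3 := (Λ.edge_pos (j := j + 1) (by omega) h2 hk' h).2
      push_cast at h3
      exact (hx'.trans h3).le
    · refine le_pos_of_gap hf (j := j + 1) (by omega) h2 hk' h ?_ k1' k2'.le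
      push_cast
      exact hx'.le

/-- The strips, the columns and the spaces between adjacent columns cover the line. -/
theorem x_cases (D : Diagram) (x : ℝ) : x < D.first ∨ D.last < x ∨
    (∃ j : ℕ, D.first ≤ j ∧ j ≤ D.last ∧ x = j) ∨
    ∃ j : ℕ, D.first ≤ j ∧ j < D.last ∧ (j : ℝ) < x ∧ x < j + 1 := by
  rcases lt_or_ge x D.first with h | h
  · exact Or.inl h
  rcases lt_or_ge (D.last : ℝ) x with h' | h'
  · exact Or.inr (Or.inl h')
  right; right
  have h0 : 0 ≤ x := le_trans (Nat.cast_nonneg _) h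
  have h3 := Nat.floor_le h0
  have h4 := Nat.lt_floor_add_one x
  have h5 : D.first ≤ ⌊x⌋₊ := Nat.le_floor h
  rcases h3.eq_or_lt with h6 | h6
  · refine Or.inl ⟨⌊x⌋₊, h5, ?_, h6.symm⟩
    rw [← h6] at h'
    exact_mod_cast h'
  · refine Or.inr ⟨⌊x⌋₊, h5, ?_, h6, h4⟩
    have : (⌊x⌋₊ : ℝ) < D.last := by linarith
    exact_mod_cast this

/-- Over a column, all pieces have the value of the gap. -/
theorem piece_eq_val (hz : z ∈ D.system.region) {j k : ℕ} (h1 : D.first ≤ j) (h2 : j ≤ D.last)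
    (hx : z 0 = j) (hk : k < D.N j) (hy : D.p j k < z 1) (hy' : z 1 < D.p j (k + 1))
    (hp : D.p j (k + 1) ≠ D.p j k + 3 / 2) (i) (hi : z ∈ (Λ.piece i).rect) :
    (Λ.piece i).s (z 0) = Λ.val j k := by
  obtain ⟨hl, hf⟩ := mem_iff.1 hz
  have hne : ∀ m ≤ D.N j, z 1 ≠ D.p j m := fun m hm => by
    refine hf.ne_p h1 h2 hm ?_
    rw [hx]
    norm_num
  rcases i with (_ | _) | q | q
  · have h3 : (D.last : ℝ) ≤ z 0 := hi.1.1
    rw [hx] at h3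
    have h4 : D.last ≤ j := by exact_mod_cast h3
    obtain rfl : j = D.last := le_antisymm h2 h4
    obtain rfl : k = 0 := by rw [D.last_col.1] at hk; omega
    show Λ.s Λ.e₁ (z 0) = _
    rw [val, Λ.lab_last, hx]
    rfl
  · have h3 : z 0 ≤ (D.first : ℝ) := hi.1.2
    rw [hx] at h3
    have h4 : j ≤ D.first := Nat.cast_le.1 h3
    obtain rfl : j = D.first := le_antisymm h4 h1
    obtain rfl : k = 0 := by rw [D.first_col.1] at hk; omega
    show Λ.s Λ.e₀ (z 0) = _
    rw [val, Λ.lab_first, hx]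
    rfl
  · obtain ⟨⟨j', k'⟩, g1, g2, g3⟩ := q
    obtain ⟨⟨h3, h4⟩, h5, h6⟩ := hi
    simp only [piece] at h3 h4 h5 h6
    have hj : j' = j := by
      have : (j' : ℝ) = j := by linarith
      exact_mod_cast this
    subst hj
    have hkk := gap_unique h1 h2 g3 hk (lt_of_le_of_ne h5 (hne _ g3.le).symm)
      (lt_of_le_of_ne h6 (hne _ g3)) hy hy'
    simp only at hkk
    subst hkk
    rfl
  · have hb := inBand_of_mem hi
    show Λ.s q.1.2.2 (z 0) = _
    generalize q.1.1.1.1 = j', q.1.1.1.2 = k₁, q.1.2.1.1.2 = k₂, q.1.2.2 = a at hb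
    have h3 := hb.le_x
    have h4 := hb.x_le
    rw [hx] at h3 h4
    have h3' : j' ≤ j := by exact_mod_cast h3
    have h4' : j ≤ j' + 1 := by exact_mod_cast h4
    rcases (by omega : j = j' ∨ j = j' + 1) with rfl | rfl
    · have hkk := gap_unique h1 h2 hb.lt_N hk (lt_of_le_of_ne hb.le_y (hne _ hb.lt_N.le).symm)
        (lt_of_le_of_ne hb.y_le (hne _ hb.lt_N)) hy hy'
      subst hkk
      rcases hb.lab_left with e | e
      · rw [val, e, hx]
        rfl
      · rw [val, e, hx, ← Λ.vert_pos h1 h2 hk e hp, Λ.s_left]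
        rfl
    · have hkk := gap_unique h1 h2 hb.lt_N' hk (lt_of_le_of_ne hb.le_y' (hne _ hb.lt_N'.le).symm)
        (lt_of_le_of_ne hb.y_le' (hne _ hb.lt_N')) hy hy'
      subst hkk
      rcases hb.lab_right with e | e
      · rw [val, e, hx]
        rfl
      · rw [val, e, hx, ← Λ.vert_pos h1 h2 hk e hp, Λ.s_right]
        rfl

/-- Strictly between two columns, the pieces at a point are bands between these columns. -/
theorem piece_between {j : ℕ} (h1 : D.first ≤ j) (h2 : j < D.last) (hx : (j : ℝ) < z 0)
    (hx' : z 0 < j + 1) (i) (hi : z ∈ (Λ.piece i).rect) :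
    ∃ k k' a, InBand Λ j k k' a (z 0) (z 1) ∧ (Λ.piece i).s = Λ.s a := by
  have h1r : (D.first : ℝ) ≤ j := by exact_mod_cast h1
  have h2r : (j : ℝ) + 1 ≤ D.last := by exact_mod_cast h2
  rcases i with (_ | _) | q | q
  · have h3 : (D.last : ℝ) ≤ z 0 := hi.1.1
    linarith
  · have h3 : z 0 ≤ (D.first : ℝ) := hi.1.2
    linarith
  · have h3 : (q.1.1 : ℝ) ≤ z 0 := hi.1.1
    have h4 : z 0 ≤ (q.1.1 : ℝ) := hi.1.2
    have h5 : (j : ℝ) < q.1.1 := by linarith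
    have h6 : (q.1.1 : ℝ) < j + 1 := by linarith
    have h5' : j < q.1.1 := by exact_mod_cast h5
    have h6' : q.1.1 < j + 1 := by exact_mod_cast h6
    omega
  · have hb := inBand_of_mem hi
    have h3 := hb.le_x
    have h4 := hb.x_le
    have h5 : (q.1.1.1.1 : ℝ) < j + 1 := by linarith
    have h6 : (j : ℝ) < q.1.1.1.1 + 1 := by linarith
    have h5' : q.1.1.1.1 < j + 1 := by exact_mod_cast h5
    have h6' : j < q.1.1.1.1 + 1 := by exact_mod_cast h6
    have hj : q.1.1.1.1 = j := by omega
    rw [hj] at hb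
    exact ⟨_, _, _, hb, rfl⟩

/-- To the left of the first column there is only the left strip. -/
theorem piece_left (h : z 0 < D.first) (i) (hi : z ∈ (Λ.piece i).rect) : i = Sum.inl true := by
  have hfl : (D.first : ℝ) ≤ D.last := by exact_mod_cast D.first_le_last
  rcases i with (_ | _) | q | q
  · have h3 : (D.last : ℝ) ≤ z 0 := hi.1.1
    linarith
  · rfl
  · have h3 : (q.1.1 : ℝ) ≤ z 0 := hi.1.1
    have h4 : (D.first : ℝ) ≤ q.1.1 := by exact_mod_cast q.2.1
    linarith
  · have hb := inBand_of_mem hi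
    have h3 := hb.le_x
    have h4 : (D.first : ℝ) ≤ q.1.1.1.1 := by exact_mod_cast hb.first_le
    linarith

theorem piece_right (h : D.last < z 0) (i) (hi : z ∈ (Λ.piece i).rect) : i = Sum.inl false := by
  have hfl : (D.first : ℝ) ≤ D.last := by exact_mod_cast D.first_le_last
  rcases i with (_ | _) | q | q
  · rfl
  · have h3 : z 0 ≤ D.first := hi.1.2
    linarith
  · have h3 : z 0 ≤ (q.1.1 : ℝ) := hi.1.2
    have h4 : (q.1.1 : ℝ) ≤ D.last := by exact_mod_cast q.2.2.1
    linarith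
  · have hb := inBand_of_mem hi
    have h3 := hb.x_le
    have h4 : (q.1.1.1.1 : ℝ) + 1 ≤ D.last := by exact_mod_cast hb.lt_last
    linarith

theorem InBand.ne {j k k' : ℕ} {a : E} {x y : ℝ} (h : InBand Λ j k k' a x y) (hf : D.Free x y)
    (hx : (j : ℝ) < x) (hx' : x < j + 1) : (D.p j k < y ∧ y < D.p j (k + 1)) ∧
      (D.p (j + 1) k' < y ∧ y < D.p (j + 1) (k' + 1)) := by
  have h1 := h.first_le
  have e1 : ∀ m ≤ D.N j, y ≠ D.p j m := fun m hm =>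
    hf.ne_p h1 h.lt_last.le hm (abs_lt.2 ⟨by linarith, by linarith⟩)
  have e2 : ∀ m ≤ D.N (j + 1), y ≠ D.p (j + 1) m := fun m hm =>
    hf.ne_p (by omega) h.lt_last hm (abs_lt.2 ⟨by push_cast; linarith, by push_cast; linarith⟩)
  exact ⟨⟨lt_of_le_of_ne h.le_y (e1 _ h.lt_N.le).symm, lt_of_le_of_ne h.y_le (e1 _ h.lt_N)⟩,
    lt_of_le_of_ne h.le_y' (e2 _ h.lt_N'.le).symm, lt_of_le_of_ne h.y_le' (e2 _ h.lt_N')⟩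

theorem exists_piece (hz : z ∈ D.system.region) : ∃ i, z ∈ (Λ.piece i).rect := by
  obtain ⟨hl, hf⟩ := mem_iff.1 hz
  rcases x_cases D (z 0) with h | h | ⟨j, h1, h2, hx⟩ | ⟨j, h1, h2, hx, hx'⟩
  · exact ⟨_, mem_strip_left hz h.le⟩
  · exact ⟨_, mem_strip_right hz h.le⟩
  · rw [hx] at hl hf
    obtain ⟨k, hk, h3, h4, -⟩ := exists_column_gap h1 h2 hl hf
    exact ⟨Sum.inr (Sum.inl ⟨(j, k), h1, h2, hk⟩), ⟨hx.ge, hx.le⟩, h3.le, h4.le⟩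
  · obtain ⟨k, k', a, h⟩ := exists_inBand (Λ := Λ) hz h1 h2 hx hx'
    obtain ⟨i, hi, -⟩ := h.exists_piece
    exact ⟨i, hi⟩

theorem piece_agree (hz : z ∈ D.system.region) (i i') (hi : z ∈ (Λ.piece i).rect)
    (hi' : z ∈ (Λ.piece i').rect) : (Λ.piece i).s (z 0) = (Λ.piece i').s (z 0) := by
  obtain ⟨hl, hf⟩ := mem_iff.1 hz
  rcases x_cases D (z 0) with h | h | ⟨j, h1, h2, hx⟩ | ⟨j, h1, h2, hx, hx'⟩
  · rw [piece_left h i hi, piece_left h i' hi']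
  · rw [piece_right h i hi, piece_right h i' hi']
  · have hl' := hl
    have hf' := hf
    rw [hx] at hl' hf'
    obtain ⟨k, hk, h3, h4, h5⟩ := exists_column_gap h1 h2 hl' hf'
    rw [piece_eq_val hz h1 h2 hx hk h3 h4 h5 i hi, piece_eq_val hz h1 h2 hx hk h3 h4 h5 i' hi']
  · obtain ⟨k₁, k₁', a, hb, hs⟩ := piece_between h1 h2 hx hx' i hi
    obtain ⟨k₂, k₂', a', hb', hs'⟩ := piece_between h1 h2 hx hx' i' hi'
    have e1 := hb.ne hf hx hx'
    have e2 := hb'.ne hf hx hx'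
    have g1 := gap_unique h1 h2.le hb.lt_N hb'.lt_N e1.1.1 e1.1.2 e2.1.1 e2.1.2
    have g2 := gap_unique (j := j + 1) (by omega) h2 hb.lt_N' hb'.lt_N' e1.2.1 e1.2.2 e2.2.1 e2.2.2
    subst g1
    subst g2
    rw [hs, hs', hb.edge_eq hb']

/-- The value of a gap that the region meets is the value of an edge at the column. -/
theorem exists_val_eq {j k : ℕ} (h1 : D.first ≤ j) (h2 : j ≤ D.last) (hk : k < D.N j)
    (hp : D.p j (k + 1) ≠ D.p j k + 3 / 2) :
    ∃ a, (j : ℝ) ∈ Set.Icc (Λ.pos (Λ.vl a)) (Λ.pos (Λ.vr a)) ∧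
      Λ.s a j = Λ.val j k ∧
      (Λ.lab j k = Sum.inl a ∨ Λ.lab j k = Sum.inr (Λ.vl a) ∨ Λ.lab j k = Sum.inr (Λ.vr a)) := by
  rcases h : Λ.lab j k with a | v
  · have h3 := Λ.edge_pos h1 h2 hk h
    refine ⟨a, ⟨h3.1.le, h3.2.le⟩, ?_, Or.inl rfl⟩
    rw [val, h]
    rfl
  · have h3 := Λ.vert_pos h1 h2 hk h hp
    obtain ⟨a, rfl | rfl⟩ := Λ.exists_edge v
    · refine ⟨a, ⟨h3.le, ?_⟩, ?_, Or.inr (Or.inl rfl)⟩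
      · rw [← h3]
        exact (Λ.pos_lt a).le
      · rw [val, h, ← h3, Λ.s_left]
        rfl
    · refine ⟨a, ⟨?_, h3.ge⟩, ?_, Or.inr (Or.inr rfl)⟩
      · rw [← h3]
        exact (Λ.pos_lt a).le
      · rw [val, h, ← h3, Λ.s_right]
        rfl

/-- The value of a piece at a point of the region is the value of an edge. -/
theorem exists_piece_eq (hz : z ∈ D.system.region) (i) (hi : z ∈ (Λ.piece i).rect) :
    ∃ a, z 0 ∈ Set.Icc (Λ.pos (Λ.vl a)) (Λ.pos (Λ.vr a)) ∧ (Λ.piece i).s (z 0) = Λ.s a (z 0) := by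
  obtain ⟨hl, hf⟩ := mem_iff.1 hz
  have hfl : (D.first : ℝ) < D.last := by exact_mod_cast Λ.first_lt_last
  rcases x_cases D (z 0) with h | h | ⟨j, h1, h2, hx⟩ | ⟨j, h1, h2, hx, hx'⟩
  · obtain rfl := piece_left h i hi
    exact ⟨Λ.e₀, ⟨Λ.first_edge.1.trans_le hi.1.1, h.le.trans Λ.first_edge.2.le⟩, rfl⟩
  · obtain rfl := piece_right h i hi
    exact ⟨Λ.e₁, ⟨Λ.last_edge.2.le.trans h.le, hi.1.2.trans Λ.last_edge.1.ge⟩, rfl⟩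
  · have hl' := hl
    have hf' := hf
    rw [hx] at hl' hf'
    obtain ⟨k, hk, h3, h4, h5⟩ := exists_column_gap h1 h2 hl' hf'
    obtain ⟨a, ha, hs, -⟩ := exists_val_eq (Λ := Λ) h1 h2 hk h5
    refine ⟨a, by rwa [hx], ?_⟩
    rw [piece_eq_val hz h1 h2 hx hk h3 h4 h5 i hi, ← hs, hx]
  · obtain ⟨k₁, k₁', a, hb, hs⟩ := piece_between h1 h2 hx hx' i hi
    exact ⟨a, ⟨hb.pos_le, hb.le_pos⟩, by rw [hs]⟩

end Labelling

namespace Labelling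

open Diagram

variable {D : Diagram} {G : Type*} [TopologicalSpace G] {V E : Type*} {Λ : Labelling D G V E}
  {z w : EuclideanSpace ℝ (Fin 2)}

/-- Edges labelling gaps of a column that the region meets, with equal values, have the same
label. -/
theorem gap_eq_of_val_eq {j k k' : ℕ} (h1 : D.first ≤ j) (h2 : j ≤ D.last) (hk : k < D.N j)
    (hk' : k' < D.N j) (hp : D.p j (k + 1) ≠ D.p j k + 3 / 2)
    (hp' : D.p j (k' + 1) ≠ D.p j k' + 3 / 2) (h : Λ.val j k = Λ.val j k') : k = k' := by
  obtain ⟨a, ha, hs, hla⟩ := exists_val_eq (Λ := Λ) h1 h2 hk hp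
  obtain ⟨b, hb, hs', hlb⟩ := exists_val_eq (Λ := Λ) h1 h2 hk' hp'
  have hinj := (Λ.s_inj a b j j ha hb (by rw [hs, hs', h])).2
  apply Λ.lab_inj j h1 h2 k hk k' hk'
  -- An edge label has no end point at the column.
  have hmid : ∀ k < D.N j, ∀ a, Λ.lab j k = Sum.inl a → ∀ v, (v = Λ.vl a ∨ v = Λ.vr a) →
      (j : ℝ) ≠ Λ.pos v := by
    rintro k hk a h v hv hj
    have := Λ.edge_pos h1 h2 hk h
    rcases hv with rfl | rfl <;> linarith
  have hvert : ∀ k < D.N j, ∀ v, D.p j (k + 1) ≠ D.p j k + 3 / 2 → Λ.lab j k = Sum.inr v →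
      (j : ℝ) = Λ.pos v := fun k hk v hp h => (Λ.vert_pos h1 h2 hk h hp).symm
  rcases e : Λ.lab j k with a' | v <;> rcases e' : Λ.lab j k' with b' | v'
  · rw [e] at hla
    rw [e'] at hlb
    obtain rfl : a' = a := by simpa using hla
    obtain rfl : b' = b := by simpa using hlb
    rcases hinj with rfl | ⟨v, hv, hva, -⟩
    · rfl
    · exact absurd hv (hmid k hk a' e v hva)
  · rw [e] at hla
    rw [e'] at hlb
    obtain rfl : a' = a := by simpa using hla
    have hv' : v' = Λ.vl b ∨ v' = Λ.vr b := by simpa using hlb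
    rcases hinj with rfl | ⟨v, hv, hva, -⟩
    · exact absurd (hvert k' hk' v' hp' e') (hmid k hk a' e v' hv')
    · exact absurd hv (hmid k hk a' e v hva)
  · rw [e] at hla
    rw [e'] at hlb
    obtain rfl : b' = b := by simpa using hlb
    have hv' : v = Λ.vl a ∨ v = Λ.vr a := by simpa using hla
    rcases hinj with rfl | ⟨v', hv, -, hva⟩
    · exact absurd (hvert k hk v hp e) (hmid k' hk' a e' v hv')
    · exact absurd hv (hmid k' hk' b' e' v' hva)
  · have h3 := Λ.vert_time j h1 h2 k hk v e
    have h4 := Λ.vert_time j h1 h2 k' hk' v' e'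
    rw [Λ.ev_inj (h3.trans h4.symm)]

theorem pos_eq_nat_of_pair {v : V} {a b : E} (hab : a ≠ b) (ha : v = Λ.vl a ∨ v = Λ.vr a)
    (hb : v = Λ.vl b ∨ v = Λ.vr b) : ∃ j : ℕ, Λ.pos v = j := by
  rcases Λ.pos_spec v with ⟨-, -, h⟩ | ⟨h, -⟩
  · exact ⟨_, h⟩
  · exact absurd (h a b ha hb) hab

theorem piece_sep (hz : z ∈ D.system.region) (hw : w ∈ D.system.region) (i i')
    (hi : z ∈ (Λ.piece i).rect) (hi' : w ∈ (Λ.piece i').rect)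
    (h : (Λ.piece i).s (z 0) = (Λ.piece i').s (w 0)) :
    z 0 = w 0 ∧ ∃ k, z ∈ (Λ.piece k).rect ∧ w ∈ (Λ.piece k).rect := by
  obtain ⟨hl, hf⟩ := mem_iff.1 hz
  obtain ⟨hl', hf'⟩ := mem_iff.1 hw
  have h0 : z 0 = w 0 := by
    obtain ⟨a, ha, e⟩ := exists_piece_eq hz i hi
    obtain ⟨b, hb, e'⟩ := exists_piece_eq hw i' hi'
    exact (Λ.s_inj a b _ _ ha hb (by rw [← e, ← e', h])).1
  refine ⟨h0, ?_⟩
  rcases x_cases D (z 0) with hx | hx | ⟨j, h1, h2, hx⟩ | ⟨j, h1, h2, hx, hx'⟩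
  · exact ⟨_, mem_strip_left hz hx.le, mem_strip_left hw (h0 ▸ hx.le)⟩
  · exact ⟨_, mem_strip_right hz hx.le, mem_strip_right hw (h0 ▸ hx.le)⟩
  · have hwx : w 0 = j := h0 ▸ hx
    rw [hx] at hl hf
    rw [hwx] at hl' hf'
    obtain ⟨k, hk, e1, e2, e3⟩ := exists_column_gap h1 h2 hl hf
    obtain ⟨k', hk', e1', e2', e3'⟩ := exists_column_gap h1 h2 hl' hf'
    rw [piece_eq_val hz h1 h2 hx hk e1 e2 e3 i hi,
      piece_eq_val hw h1 h2 hwx hk' e1' e2' e3' i' hi'] at h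
    obtain rfl := gap_eq_of_val_eq h1 h2 hk hk' e3 e3' h
    exact ⟨Sum.inr (Sum.inl ⟨(j, k), h1, h2, hk⟩), ⟨⟨hx.ge, hx.le⟩, e1.le, e2.le⟩,
      ⟨hwx.ge, hwx.le⟩, e1'.le, e2'.le⟩
  · obtain ⟨k₁, k₁', a, hb, hs⟩ := piece_between h1 h2 hx hx' i hi
    have hwx : (j : ℝ) < w 0 := h0 ▸ hx
    have hwx' : w 0 < j + 1 := h0 ▸ hx'
    obtain ⟨k₂, k₂', b, hb', hs'⟩ := piece_between h1 h2 hwx hwx' i' hi'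
    have hab : a = b := by
      rw [hs, hs'] at h
      obtain ⟨-, e | ⟨v, hv, hva, hvb⟩⟩ :=
        Λ.s_inj a b _ _ ⟨hb.pos_le, hb.le_pos⟩ ⟨hb'.pos_le, hb'.le_pos⟩ h
      · exact e
      · by_contra hne
        obtain ⟨m, hm⟩ := pos_eq_nat_of_pair hne hva hvb
        rw [hm] at hv
        rw [hv] at hx hx'
        have g1 : j < m := by exact_mod_cast hx
        have g2 : m < j + 1 := by exact_mod_cast hx'
        omega
    subst hab
    obtain ⟨rfl, rfl⟩ := hb.gap_eq hb'
    have g1 := hb.lt_last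
    have g2 := hb.first_le
    refine ⟨Sum.inr (Sum.inr ⟨(⟨(j, k₁), hb.first_le, hb.lt_last.le, hb.lt_N⟩,
      ⟨(j + 1, k₁'), by omega, by simp only; omega, hb.lt_N'⟩, a), rfl, hb.compat, hb.lab_left,
      hb.lab_right⟩), ?_, ?_⟩
    · exact ⟨⟨max_le hb.le_x hb.pos_le, le_min hb.x_le hb.le_pos⟩, max_le hb.le_y hb.le_y',
        le_min hb.y_le hb.y_le'⟩
    · exact ⟨⟨max_le hb'.le_x hb'.pos_le, le_min hb'.x_le hb'.le_pos⟩, max_le hb'.le_y hb'.le_y',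
        le_min hb'.y_le hb'.y_le'⟩

/-- The region is vertically convex in each piece. -/
theorem piece_conv (i) (hz : z ∈ D.system.region) (hw : w ∈ D.system.region)
    (hi : z ∈ (Λ.piece i).rect) (hi' : w ∈ (Λ.piece i).rect) (h0 : z 0 = w 0) (y : ℝ)
    (hy : y ∈ Set.Icc (z 1) (w 1)) : !₂[z 0, y] ∈ D.system.region := by
  obtain ⟨hl, hf⟩ := mem_iff.1 hz
  obtain ⟨hl', hf'⟩ := mem_iff.1 hw
  rw [← h0] at hl' hf'
  have hfl : (D.first : ℝ) ≤ D.last := by exact_mod_cast D.first_le_last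
  refine mem_iff.2 (convex_of_near hl hl' hf hf' hy fun j h1 h2 hx k hk => ?_)
  have h1r : (D.first : ℝ) ≤ j := by exact_mod_cast h1
  have h2r : (j : ℝ) ≤ D.last := by exact_mod_cast h2
  change |z 0 - j| < 1 at hx
  have hx' := abs_lt.1 hx
  have hbd := hl.bounds
  have hbd' := hl'.bounds
  -- In the strips, the lens lies between the bottom and the top disc.
  have strip : ∀ j k, D.N j = 1 → D.p j 0 = -5 / 4 → D.p j 1 = D.Y + 5 / 4 → k ≤ D.N j →
      D.p j k ≤ z 1 ∨ w 1 ≤ D.p j k := by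
    intro j k hN hp hp' hk
    rcases (by omega : k = 0 ∨ k = 1) with rfl | rfl
    · left
      linarith
    · right
      linarith
  rcases i with (_ | _) | q | q
  · have h3 : (D.last : ℝ) ≤ z 0 := hi.1.1
    have h4 : (D.last : ℝ) < j + 1 := by linarith
    have h5 : D.last < j + 1 := by exact_mod_cast h4
    obtain rfl : j = D.last := by omega
    exact strip _ k D.last_col.1 D.last_col.2.1 D.last_col.2.2 hk
  · have h3 : z 0 ≤ (D.first : ℝ) := hi.1.2
    have h4 : (j : ℝ) < D.first + 1 := by linarith
    have h5 : j < D.first + 1 := by exact_mod_cast h4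
    obtain rfl : j = D.first := by omega
    exact strip _ k D.first_col.1 D.first_col.2.1 D.first_col.2.2 hk
  · obtain ⟨⟨j', k'⟩, g1, g2, g3⟩ := q
    obtain ⟨⟨h3, h4⟩, h5, -⟩ := hi
    obtain ⟨-, -, h6⟩ := hi'
    simp only [piece] at h3 h4 h5 h6
    obtain rfl : j = j' := by
      rw [le_antisymm h4 h3] at hx
      exact eq_of_abs_lt hx
    rcases le_or_le_gap h1 h2 g3 hk with h | h
    · exact Or.inl (h.trans h5)
    · exact Or.inr (h6.trans h)
  · have hb := inBand_of_mem hi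
    have hb' := inBand_of_mem hi'
    rcases column_cases hb.le_x hb.x_le hx with rfl | rfl
    · rcases le_or_le_gap h1 h2 hb.lt_N hk with h | h
      · exact Or.inl (h.trans hb.le_y)
      · exact Or.inr (hb'.y_le.trans h)
    · rcases le_or_le_gap h1 h2 hb.lt_N' hk with h | h
      · exact Or.inl (h.trans hb.le_y')
      · exact Or.inr (hb'.y_le'.trans h)

theorem one_le_sq_add_of_le {u t c : ℝ} (h : c ≤ t - 1 ∨ t + 1 ≤ c) : 1 ≤ u ^ 2 + (t - c) ^ 2 := by
  rcases h with h | h <;> nlinarith [sq_nonneg u]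

/-- Bands contain points of the region over all admissible horizontal coordinates. -/
theorem exists_mem_band {j k k' : ℕ} {a : E} (h1 : D.first ≤ j) (h2 : j < D.last) (hk : k < D.N j)
    (hk' : k' < D.N (j + 1)) (hc : D.Compat j k k')
    (hla : Λ.lab j k = Sum.inl a ∨ Λ.lab j k = Sum.inr (Λ.vl a))
    (hra : Λ.lab (j + 1) k' = Sum.inl a ∨ Λ.lab (j + 1) k' = Sum.inr (Λ.vr a)) {x : ℝ}
    (hx : (j : ℝ) ≤ x) (hx' : x ≤ j + 1) (hax : Λ.pos (Λ.vl a) ≤ x) (hxa : x ≤ Λ.pos (Λ.vr a)) :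
    ∃ y, D.Lens x y ∧ D.Free x y ∧ InBand Λ j k k' a x y := by
  have h1r : (D.first : ℝ) ≤ j := by exact_mod_cast h1
  have h2r : (j : ℝ) + 1 ≤ D.last := by exact_mod_cast h2
  have hctr := abs_sub_ctr_le (D := D) (x := x) (by linarith) (by linarith)
  have hlow : ∀ k ≤ D.N j, -5 / 4 ≤ D.p j k ∧ D.p j k ≤ D.Y + 5 / 4 := fun k hk =>
    ⟨(D.bottom j h1 h2.le).1.trans (p_le h1 h2.le (Nat.zero_le k) hk),
      (p_le h1 h2.le hk le_rfl).trans (D.top j h1 h2.le).2⟩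
  have hlow' : ∀ k ≤ D.N (j + 1), -5 / 4 ≤ D.p (j + 1) k ∧ D.p (j + 1) k ≤ D.Y + 5 / 4 :=
    fun k hk => ⟨(D.bottom (j + 1) (by omega) h2).1.trans (p_le (by omega) h2 (Nat.zero_le k) hk),
      (p_le (by omega) h2 hk le_rfl).trans (D.top (j + 1) (by omega) h2).2⟩
  have free : ∀ y, (∀ i ≤ D.N j, 1 ≤ (x - j) ^ 2 + (y - D.p j i) ^ 2) →
      (∀ i ≤ D.N (j + 1), 1 ≤ (x - (j + 1)) ^ 2 + (y - D.p (j + 1) i) ^ 2) → D.Free x y := by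
    intro y e1 e2
    refine free_of_near fun i hi hi' hxi m hm => ?_
    rcases column_cases hx hx' hxi with rfl | rfl
    · exact e1 m hm
    · push_cast
      exact e2 m hm
  have far : ∀ y, D.p j k + 1 ≤ y → y + 1 ≤ D.p j (k + 1) → ∀ i ≤ D.N j,
      1 ≤ (x - j) ^ 2 + (y - D.p j i) ^ 2 := by
    intro y e1 e2 i hi
    apply one_le_sq_add_of_le
    rcases le_or_le_gap h1 h2.le hk hi with h | h
    · left; linarith
    · right; linarith
  have far' : ∀ y, D.p (j + 1) k' + 1 ≤ y → y + 1 ≤ D.p (j + 1) (k' + 1) → ∀ i ≤ D.N (j + 1),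
      1 ≤ (x - (j + 1)) ^ 2 + (y - D.p (j + 1) i) ^ 2 := by
    intro y e1 e2 i hi
    apply one_le_sq_add_of_le
    rcases le_or_le_gap (j := j + 1) (by omega) h2 hk' hi with h | h
    · left; linarith
    · right; linarith
  have tip : ∀ (i k : ℕ) (x' : ℝ), D.first ≤ i → i ≤ D.last → k < D.N i →
      D.p i (k + 1) = D.p i k + 3 / 2 → 7 / 16 ≤ x' ^ 2 → ∀ m ≤ D.N i,
      1 ≤ x' ^ 2 + (D.p i k + 3 / 4 - D.p i m) ^ 2 := by
    intro i k x' g1 g2 g3 hp hx m hm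
    rcases le_or_le_gap g1 g2 g3 hm with h | h <;> nlinarith
  have hs := sq_sqrt_seven
  have hb := sqrt_seven_bounds
  rcases Λ.room j h1 h2 k hk k' hk' hc with h | ⟨e1, e2, e3, v, e4, e5⟩ | ⟨e1, e2, e3, v, e4, e5⟩
  · set A := max (D.p j k) (D.p (j + 1) k')
    set B := min (D.p j (k + 1)) (D.p (j + 1) (k' + 1))
    have a1 : D.p j k ≤ A := le_max_left _ _
    have a2 : D.p (j + 1) k' ≤ A := le_max_right _ _
    have a3 : B ≤ D.p j (k + 1) := min_le_left _ _
    have a4 : B ≤ D.p (j + 1) (k' + 1) := min_le_right _ _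
    have b1 := (hlow k hk.le).1
    have b2 := (hlow (k + 1) hk).2
    refine ⟨(A + B) / 2, lens_of_bounds hctr (by linarith) (by linarith),
      free _ (far _ (by linarith) (by linarith)) (far' _ (by linarith) (by linarith)),
      h1, h2, hk, hk', hc, hla, hra, hx, hx', hax, hxa, by linarith, by linarith, by linarith,
      by linarith⟩
  · have hv : Λ.pos (Λ.vl a) = j + Real.sqrt 7 / 4 := by
      rcases hla with h | h <;> rw [e4] at h
      · exact absurd h (by simp)
      · rw [← Sum.inr_injective h, e5]
    have hx7 : 7 / 16 ≤ (x - j) ^ 2 := by nlinarith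
    have b1 := (hlow' k' hk'.le).1
    have b2 := (hlow' (k' + 1) hk').2
    refine ⟨D.p j k + 3 / 4, lens_of_bounds hctr (by linarith) (by linarith),
      free _ (tip j k _ h1 h2.le hk e1 hx7) (far' _ (by linarith) (by linarith)),
      h1, h2, hk, hk', hc, hla, hra, hx, hx', hax, hxa, by linarith, by linarith, by linarith,
      by linarith⟩
  · have hv : Λ.pos (Λ.vr a) = j + 1 - Real.sqrt 7 / 4 := by
      rcases hra with h | h <;> rw [e4] at h
      · exact absurd h (by simp)
      · rw [← Sum.inr_injective h, e5]
        push_cast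
        rfl
    have hx7 : 7 / 16 ≤ (x - (j + 1)) ^ 2 := by nlinarith
    have b1 := (hlow k hk.le).1
    have b2 := (hlow (k + 1) hk).2
    refine ⟨D.p (j + 1) k' + 3 / 4, lens_of_bounds hctr (by linarith) (by linarith),
      free _ (far _ (by linarith) (by linarith)) (tip (j + 1) k' _ (by omega) h2 hk' e1 hx7),
      h1, h2, hk, hk', hc, hla, hra, hx, hx', hax, hxa, by linarith, by linarith, by linarith,
      by linarith⟩

/-- An edge with a point not to the right of the first column is the first edge. -/
theorem eq_first_of_pos_le {a : E} (h : Λ.pos (Λ.vl a) ≤ D.first) : a = Λ.e₀ := by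
  have hb := sqrt_seven_bounds
  have hfl : (D.first : ℝ) ≤ D.last := by exact_mod_cast D.first_le_last
  apply Λ.eq_first
  rcases Λ.pos_spec (Λ.vl a) with ⟨h1, h2, h3⟩ | ⟨-, ⟨h1, -, h3, -⟩ | ⟨-, -, -, h3, -⟩ | ⟨h3, -⟩ |
    ⟨-, -, h3⟩⟩
  · rw [h3] at h
    have h4 : Λ.ev (Λ.vl a) ≤ D.first := Nat.cast_le.1 h
    have h5 : Λ.ev (Λ.vl a) = D.first := le_antisymm h4 h1
    obtain ⟨k, hk, hlab⟩ := Λ.exists_lab_vert _ h1 h2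
    rw [h5, D.first_col.1] at hk
    obtain rfl : k = 0 := by omega
    rw [h5, Λ.lab_first] at hlab
    exact absurd hlab (by simp)
  · have h1r : (D.first : ℝ) ≤ Λ.ev (Λ.vl a) := by exact_mod_cast h1
    linarith
  · exact absurd rfl (h3 a)
  · exact h3
  · exact absurd rfl (h3 a)

theorem eq_last_of_le_pos {a : E} (h : D.last ≤ Λ.pos (Λ.vr a)) : a = Λ.e₁ := by
  have hb := sqrt_seven_bounds
  have hfl : (D.first : ℝ) ≤ D.last := by exact_mod_cast D.first_le_last
  apply Λ.eq_last
  rcases Λ.pos_spec (Λ.vr a) with ⟨h1, h2, h3⟩ | ⟨-, ⟨-, -, -, h3, -⟩ | ⟨-, h1, h3, -⟩ |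
    ⟨-, -, h3⟩ |
    ⟨h3, -⟩⟩
  · rw [h3] at h
    have h4 : D.last ≤ Λ.ev (Λ.vr a) := Nat.cast_le.1 h
    have h5 : Λ.ev (Λ.vr a) = D.last := le_antisymm h2 h4
    obtain ⟨k, hk, hlab⟩ := Λ.exists_lab_vert _ h1 h2
    rw [h5, D.last_col.1] at hk
    obtain rfl : k = 0 := by omega
    rw [h5, Λ.lab_last] at hlab
    exact absurd hlab (by simp)
  · exact absurd rfl (h3 a)
  · have h1r : (Λ.ev (Λ.vr a) : ℝ) ≤ D.last := by exact_mod_cast h1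
    linarith
  · exact absurd rfl (h3 a)
  · exact h3

/-- In the strips, the points at the height of the corners belong to the region. -/
theorem free_mid {x : ℝ} (h : x < D.first ∨ x = D.first ∨ x = D.last ∨ D.last < x) :
    D.Free x D.mid := by
  have hY := D.four_le_Y
  have col : ∀ j k, D.N j = 1 → D.p j 0 = -5 / 4 → D.p j 1 = D.Y + 5 / 4 → k ≤ D.N j →
      1 ≤ (x - j) ^ 2 + (D.mid - D.p j k) ^ 2 := by
    intro j k hN hp hp' hk
    apply one_le_sq_add_of_le
    unfold mid
    rcases (by omega : k = 0 ∨ k = 1) with rfl | rfl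
    · left
      linarith
    · right
      linarith
  refine free_of_near fun j h1 h2 hx k hk => ?_
  have h1r : (D.first : ℝ) ≤ j := by exact_mod_cast h1
  have h2r : (j : ℝ) ≤ D.last := by exact_mod_cast h2
  have hx' := abs_lt.1 hx
  rcases (by tauto : (x < D.first ∨ x = D.first) ∨ x = D.last ∨ D.last < x) with h | h
  · have h4 : (j : ℝ) < D.first + 1 := by rcases h with h | h <;> linarith
    have h5 : j < D.first + 1 := by exact_mod_cast h4
    obtain rfl : j = D.first := by omega
    exact col _ k D.first_col.1 D.first_col.2.1 D.first_col.2.2 hk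
  · have h4 : (D.last : ℝ) < j + 1 := by rcases h with h | h <;> linarith
    have h5 : D.last < j + 1 := by exact_mod_cast h4
    obtain rfl : j = D.last := by omega
    exact col _ k D.last_col.1 D.last_col.2.1 D.last_col.2.2 hk

theorem xL_le_pos (v : V) : D.xL ≤ Λ.pos v ∧ Λ.pos v ≤ D.xR := by
  have hb := sqrt_seven_bounds
  have hfl : (D.first : ℝ) ≤ D.last := by exact_mod_cast D.first_le_last
  have h1 := D.xL_lt
  have h2 := D.lt_xR
  rcases Λ.pos_spec v with ⟨h3, h4, h5⟩ | ⟨-, ⟨h3, h4, h5, -⟩ | ⟨h3, h4, h5, -⟩ | ⟨-, h5, -⟩ |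
    ⟨-, h5, -⟩⟩
  · have : (D.first : ℝ) ≤ Λ.ev v := by exact_mod_cast h3
    have : (Λ.ev v : ℝ) ≤ D.last := by exact_mod_cast h4
    constructor <;> linarith
  · have : (D.first : ℝ) ≤ Λ.ev v := by exact_mod_cast h3
    have : (Λ.ev v : ℝ) ≤ D.last := by exact_mod_cast h4.le
    constructor <;> linarith
  · have : (D.first : ℝ) ≤ Λ.ev v := by exact_mod_cast h3.le
    have : (Λ.ev v : ℝ) ≤ D.last := by exact_mod_cast h4
    constructor <;> linarith
  · constructor <;> linarith
  · constructor <;> linarith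

theorem piece_surj (g : G) : ∃ z ∈ D.system.region, ∃ i, z ∈ (Λ.piece i).rect ∧
    (Λ.piece i).s (z 0) = g := by
  obtain ⟨a, x, ⟨hax, hxa⟩, rfl⟩ := Λ.s_surj g
  have hX : x ∈ Set.Icc D.xL D.xR :=
    ⟨(Λ.xL_le_pos _).1.trans hax, hxa.trans (Λ.xL_le_pos _).2⟩
  rcases le_or_gt x D.first with hx | hx
  · obtain rfl := eq_first_of_pos_le (hax.trans hx)
    have hm : !₂[x, D.mid] ∈ D.system.region :=
      mem_iff.2 ⟨lens_mid hX, free_mid (by rcases hx.eq_or_lt with h | h <;> tauto)⟩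
    exact ⟨_, hm, _, mem_strip_left hm hx, rfl⟩
  rcases le_or_gt (D.last : ℝ) x with hx' | hx'
  · obtain rfl := eq_last_of_le_pos (hx'.trans hxa)
    have hm : !₂[x, D.mid] ∈ D.system.region :=
      mem_iff.2 ⟨lens_mid hX, free_mid (by
        rcases hx'.eq_or_lt with h | h <;> tauto)⟩
    exact ⟨_, hm, _, mem_strip_right hm hx', rfl⟩
  -- A pair of adjacent columns around `x` such that the edge continues on the side of `x`.
  obtain ⟨j, h1, h2, hjx, hxj, hl, hr⟩ : ∃ j : ℕ, D.first ≤ j ∧ j < D.last ∧ (j : ℝ) ≤ x ∧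
      x ≤ j + 1 ∧ Λ.pos (Λ.vl a) < j + 1 ∧ (j : ℝ) < Λ.pos (Λ.vr a) := by
    have hpos := Λ.pos_lt a
    rcases x_cases D x with h | h | ⟨j, h1, h2, h⟩ | ⟨j, h1, h2, h, h'⟩
    · linarith
    · linarith
    · subst h
      rcases hxa.eq_or_lt with he | hlt
      · have h3 : D.first < j := by exact_mod_cast hx
        obtain ⟨i, rfl⟩ : ∃ i, j = i + 1 := ⟨j - 1, by omega⟩
        push_cast at *
        exact ⟨i, by omega, by omega, by linarith, le_rfl, by linarith, by linarith⟩
      · exact ⟨j, h1, by exact_mod_cast hx', le_rfl, by linarith, by linarith, hlt⟩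
    · exact ⟨j, h1, h2, h.le, h'.le, by linarith, by linarith⟩
  have e1 := Λ.ev_vl_le h1 hl
  have e2 := Λ.lt_ev_vr h2.le hr
  obtain ⟨k, hk, hla⟩ : ∃ k < D.N j, Λ.lab j k = Sum.inl a ∨ Λ.lab j k = Sum.inr (Λ.vl a) := by
    rcases e1.eq_or_lt with h | h
    · subst h
      obtain ⟨k, hk, h⟩ := Λ.exists_lab_vert _ h1 h2.le
      exact ⟨k, hk, Or.inr h⟩
    · obtain ⟨k, hk, h⟩ := Λ.exists_lab_edge j h1 h2.le a h e2
      exact ⟨k, hk, Or.inl h⟩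
  obtain ⟨k', hk', hra⟩ : ∃ k < D.N (j + 1), Λ.lab (j + 1) k = Sum.inl a ∨
      Λ.lab (j + 1) k = Sum.inr (Λ.vr a) := by
    rcases (show j + 1 ≤ Λ.ev (Λ.vr a) from e2).eq_or_lt with h | h
    · rw [h]
      obtain ⟨k, hk, h⟩ := Λ.exists_lab_vert (Λ.vr a) (by omega) (by omega)
      exact ⟨k, hk, Or.inr h⟩
    · obtain ⟨k, hk, h⟩ := Λ.exists_lab_edge (j + 1) (by omega) h2 a (by omega) h
      exact ⟨k, hk, Or.inl h⟩
  have hc := (Λ.compat_iff j h1 h2 k hk k' hk').2 ⟨a, hla, hra⟩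
  obtain ⟨y, hl, hf, hb⟩ := exists_mem_band h1 h2 hk hk' hc hla hra hjx hxj hax hxa
  obtain ⟨i, hi, hs⟩ := InBand.exists_piece (z := !₂[x, y]) hb
  exact ⟨!₂[x, y], mem_iff.2 ⟨hl, hf⟩, i, hi, by rw [hs]; rfl⟩

/-- The space of a labelled diagram is the Reeb space of an algebraic manifold over the region of
the diagram. -/
theorem exists_circleRegion [Finite E] [T2Space G] [ConnectedSpace G] (Λ : Labelling D G V E) :
    ∃ R : CircleRegion,
      IsCompact R.manifold ∧ IsConnected R.manifold ∧
      IsRealAlgebraicManifold R.poly R.manifold ∧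
      R.proj '' R.manifold = closure R.D ∧
      IsMorseBott R.poly R.manifold R.height ∧
      (R.height '' singularSet R.poly R.manifold R.height).Finite ∧
      Nonempty (ReebSpace (fun p : R.manifold => R.height p) ≃ₜ G) := by
  obtain ⟨r, h1, h2, h3, h4, h5⟩ := exists_map_of_pieces (G := G) D.system.isClosed_region Λ.piece
    (fun z hz => exists_piece hz) (fun z hz i j => piece_agree hz i j)
    (fun z hz w hw i j => piece_sep hz hw i j) (fun i z hz w hw => piece_conv i hz hw) piece_surj
  exact D.isGeneric_system.exists_circleRegion r h1 h2 h3 h4 h5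

end Labelling

/-! ### Heights of the discs around an event -/

/-- Around an event, the discs of the side column with index at most `K` are linked to those of
the event column with the same index, the discs above the `m` strands of the event are linked to
those above the gap of the event, and the discs between the strands are not linked. -/
def HubLink (K m i i' : ℕ) : Prop := (i ≤ K ∧ i' = i) ∨ (K + m ≤ i ∧ i' + m = i + 1)

/-- The gaps of the side column and of the event column that are compatible around an event. -/
def HubCompat (K m k k' : ℕ) : Prop :=
  (k < K ∧ k' = k) ∨ (K ≤ k ∧ k < K + m ∧ k' = K) ∨ (K + m ≤ k ∧ k' + m = k + 1)

theorem hubCompat_iff {K m N M k k' : ℕ} (hK : K + m ≤ N) (hM : M + m = N + 1) (hk : k < N) :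
    HubCompat K m k k' ↔
      ∀ i ≤ N, ∀ i' ≤ M, HubLink K m i i' → (i ≤ k ↔ i' ≤ k') := by
  unfold HubCompat HubLink
  constructor
  · intro h i hi i' hi' hl
    omega
  · intro h
    rcases lt_or_ge k K with h1 | h1
    · have e1 := h k hk.le k (by omega) (Or.inl ⟨h1.le, rfl⟩)
      have e2 := h (k + 1) (by omega) (k + 1) (by omega) (Or.inl ⟨h1, rfl⟩)
      omega
    · rcases lt_or_ge k (K + m) with h2 | h2
      · have e1 := h K (by omega) K (by omega) (Or.inl ⟨le_rfl, rfl⟩)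
        have e2 := h (K + m) hK (K + 1) (by omega) (Or.inr ⟨le_rfl, by omega⟩)
        omega
      · have e1 := h k hk.le (k + 1 - m) (by omega) (Or.inr ⟨h2, by omega⟩)
        have e2 := h (k + 1) (by omega) (k + 2 - m) (by omega) (Or.inr ⟨by omega, by omega⟩)
        omega

/-- The heights `p` of a side column and `q` of an event column. The last clause describes the
overlap of discs at an event with a single strand on one side and none on the other. -/
structure HubStep (K m N M : ℕ) (p q : ℕ → ℝ) : Prop where
  link : ∀ i ≤ N, ∀ i' ≤ M, HubLink K m i i' → |p i - q i'| ≤ 7 / 8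
  far : ∀ i ≤ N, ∀ i' ≤ M, ¬ HubLink K m i i' → 7 / 4 ≤ |p i - q i'|
  room : ∀ k < N, ∀ k' < M, HubCompat K m k k' →
    max (p k) (q k') + 2 ≤ min (p (k + 1)) (q (k' + 1)) ∨
    (m = 1 ∧ k = K ∧ k' = K ∧ q (K + 1) = q K + 3 / 2 ∧ p K + 1 ≤ q K + 3 / 4 ∧
      q K + 3 / 4 + 1 ≤ p (K + 1))

/-- Heights of a column whose discs are disjoint and which reaches from the bottom to the top. -/
structure GoodColumn (Y : ℝ) (N : ℕ) (p : ℕ → ℝ) : Prop where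
  gap : ∀ k < N, p k + 5 / 2 ≤ p (k + 1)
  bottom : -5 / 4 ≤ p 0 ∧ p 0 ≤ 0
  top : Y ≤ p N ∧ p N ≤ Y + 5 / 4

/-- The heights of a column with `m` strands at an event above `K` strands: multiples of `4` up to
the event, shifted by `δ` between its strands, and at distances multiple of `4` from `Y` above it.
The discs between the strands have no link to the event, and `δ` is `0` to its left and `2` to its
right. -/
noncomputable def arm (Y δ : ℝ) (K m N k : ℕ) : ℝ :=
  if k ≤ K then 4 * k else if k < K + m then 4 * k + δ else Y - 4 * (N - k)

section Arm

variable {Y δ : ℝ} {K m N k : ℕ}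

theorem arm_low (h : k ≤ K) : arm Y δ K m N k = 4 * k := if_pos h

theorem arm_mid (h : K < k) (h' : k < K + m) : arm Y δ K m N k = 4 * k + δ := by
  rw [arm, if_neg (by omega), if_pos h']

theorem arm_high (h : K + m ≤ k) (h' : K < k) : arm Y δ K m N k = Y - 4 * (N - k) := by
  rw [arm, if_neg (by omega), if_neg (by omega)]

theorem arm_gap (hm : 1 ≤ m) (hY : 4 * (N : ℝ) + 8 ≤ Y) (hδ : 0 ≤ δ) (hδ' : δ ≤ 2)
    (hk : k < N) : arm Y δ K m N k + 4 ≤ arm Y δ K m N (k + 1) := by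
  have hkr : (k : ℝ) + 1 ≤ N := by exact_mod_cast hk
  rcases lt_or_ge k K with h | h
  · rw [arm_low h.le, arm_low h]
    push_cast
    linarith
  rcases lt_or_ge (k + 1) (K + m) with h' | h'
  · rw [arm_mid (by omega) h']
    rcases h.eq_or_lt with h'' | h''
    · rw [arm_low h''.ge]
      push_cast
      linarith
    · rw [arm_mid h'' (by omega)]
      push_cast
      linarith
  · rw [arm_high h' (by omega)]
    rcases lt_or_ge k (K + m) with h2 | h2
    · have h3 : (N : ℝ) - (k + 1 : ℕ) ≤ N - k - 1 := by push_cast; linarith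
      rcases h.eq_or_lt with h'' | h''
      · rw [arm_low h''.ge]
        linarith
      · rw [arm_mid h'' h2]
        linarith
    · rw [arm_high h2 (by omega)]
      push_cast
      linarith

theorem arm_goodColumn (hm : 1 ≤ m) (hN : K + m ≤ N) (hY : 4 * (N : ℝ) + 8 ≤ Y) (hδ : 0 ≤ δ)
    (hδ' : δ ≤ 2) : GoodColumn Y N (arm Y δ K m N) := by
  refine ⟨fun k hk => ?_, ?_, ?_⟩
  · linarith [arm_gap (K := K) hm hY hδ hδ' hk]
  · rw [arm_low (Nat.zero_le _)]
    norm_num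
  · rw [arm_high hN (by omega)]
    constructor <;> linarith

/-- At an event with strands on both sides, each arm is linked to the event column. -/
theorem arm_hubStep (hm : 1 ≤ m) {n : ℕ} (hY : 4 * ((K + m + n : ℕ) : ℝ) + 8 ≤ Y) (hδ : 0 ≤ δ)
    (hδ' : δ ≤ 2) : HubStep K m (K + m + n) (K + 1 + n) (arm Y δ K m (K + m + n))
      (arm Y 0 K 1 (K + 1 + n)) := by
  have hmr : (1 : ℝ) ≤ m := by exact_mod_cast hm
  have hKr : (0 : ℝ) ≤ K := Nat.cast_nonneg _
  have hnr : (0 : ℝ) ≤ n := Nat.cast_nonneg _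
  have hY' := hY
  push_cast at hY'
  refine ⟨fun i hi i' hi' h => ?_, fun i hi i' hi' h => ?_, fun k hk k' hk' h => Or.inl ?_⟩
  · rcases h with ⟨h1, rfl⟩ | ⟨h1, h2⟩
    · rw [arm_low h1, arm_low h1]
      norm_num
    · rw [arm_high h1 (by omega), arm_high (by omega) (by omega)]
      have h2r : (i' : ℝ) + m = i + 1 := by exact_mod_cast h2
      push_cast
      rw [abs_le]
      constructor <;> linarith
  · unfold HubLink at h
    rw [le_abs]
    rcases lt_or_ge K i with h1 | h1
    · rcases lt_or_ge i (K + m) with h2 | h2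
      · have h2r : (i : ℝ) + 1 ≤ K + m := by exact_mod_cast h2
        rw [arm_mid h1 h2]
        rcases lt_or_ge K i' with h3 | h3
        · rw [arm_high (by omega) h3]
          have h3r : (K : ℝ) + 1 ≤ i' := by exact_mod_cast h3
          right
          push_cast
          linarith
        · rw [arm_low h3]
          have h3r : (i' : ℝ) ≤ K := by exact_mod_cast h3
          have h1r : (K : ℝ) + 1 ≤ i := by exact_mod_cast h1
          left
          linarith
      · rw [arm_high h2 h1]
        have h2r : (K : ℝ) + m ≤ i := by exact_mod_cast h2
        rcases lt_or_ge K i' with h3 | h3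
        · rw [arm_high (by omega) h3]
          push_cast
          rcases (by omega : i' + m + 1 ≤ i + 1 ∨ i + 2 ≤ i' + m) with h4 | h4
          · have h4r : (i' : ℝ) + m + 1 ≤ i + 1 := by exact_mod_cast h4
            left
            linarith
          · have h4r : (i : ℝ) + 2 ≤ i' + m := by exact_mod_cast h4
            right
            linarith
        · rw [arm_low h3]
          have h3r : (i' : ℝ) ≤ K := by exact_mod_cast h3
          left
          push_cast
          linarith
    · rw [arm_low h1]
      have h1r : (i : ℝ) ≤ K := by exact_mod_cast h1
      rcases lt_or_ge K i' with h3 | h3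
      · rw [arm_high (by omega) h3]
        have h3r : (K : ℝ) + 1 ≤ i' := by exact_mod_cast h3
        right
        push_cast
        linarith
      · rw [arm_low h3]
        rcases (by omega : i' + 1 ≤ i ∨ i + 1 ≤ i') with h4 | h4
        · have h4r : (i' : ℝ) + 1 ≤ i := by exact_mod_cast h4
          left
          linarith
        · have h4r : (i : ℝ) + 1 ≤ i' := by exact_mod_cast h4
          right
          linarith
  · have hgap := arm_gap (K := K) hm hY hδ hδ' hk
    have key : max (arm Y δ K m (K + m + n) k) (arm Y 0 K 1 (K + 1 + n) k') =
        arm Y δ K m (K + m + n) k ∧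
        min (arm Y δ K m (K + m + n) (k + 1)) (arm Y 0 K 1 (K + 1 + n) (k' + 1)) =
        arm Y δ K m (K + m + n) (k + 1) := by
      rw [max_eq_left_iff, min_eq_left_iff]
      rcases h with ⟨h1, rfl⟩ | ⟨h1, h2, rfl⟩ | ⟨h1, h2⟩
      · rw [arm_low h1.le, arm_low h1.le, arm_low h1, arm_low h1]
        exact ⟨le_rfl, le_rfl⟩
      · rw [arm_low le_rfl, arm_high (k := k' + 1) (K := k') (m := 1) le_rfl (by omega)]
        have h1r : (k' : ℝ) ≤ k := by exact_mod_cast h1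
        constructor
        · rcases h1.eq_or_lt with h3 | h3
          · rw [arm_low h3.ge]
            linarith
          · rw [arm_mid h3 h2]
            linarith
        · rcases lt_or_ge (k + 1) (k' + m) with h3 | h3
          · have h3r : (k : ℝ) + 1 + 1 ≤ k' + m := by exact_mod_cast h3
            rw [arm_mid (by omega) h3]
            push_cast
            linarith
          · have h4 : k + 1 = k' + m := by omega
            have h4r : (k : ℝ) + 1 = k' + m := by exact_mod_cast h4
            rw [arm_high h3 (by omega)]
            push_cast
            linarith
      · have h2r : (k' : ℝ) + m = k + 1 := by exact_mod_cast h2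
        rw [arm_high h1 (by omega), arm_high (by omega) (by omega),
          arm_high (by omega) (by omega), arm_high (by omega) (by omega)]
        push_cast
        constructor <;> linarith
    rw [key.1, key.2]
    linarith

end Arm

/-- The heights of a column with `N` gaps before a disc is split at an event. -/
noncomputable def base (Y : ℝ) (N k : ℕ) : ℝ := if k < N then 4 * k else Y

/-- The heights after replacing the disc `K` by two discs at distance `ε` above and below it. For
`ε = 3 / 4` the two discs overlap and are linked to the disc `K`, and for `ε = 5 / 4` they are
disjoint. -/
noncomputable def splitHeight (b : ℕ → ℝ) (ε : ℝ) (K k : ℕ) : ℝ :=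
  if k < K then b k else if k = K then b K - ε else if k = K + 1 then b K + ε else b (k - 1)

section Split

variable {Y ε : ℝ} {b : ℕ → ℝ} {K N k : ℕ}

theorem splitHeight_lt (h : k < K) : splitHeight b ε K k = b k := if_pos h

theorem splitHeight_eq : splitHeight b ε K K = b K - ε := by
  rw [splitHeight, if_neg (by omega), if_pos rfl]

theorem splitHeight_succ : splitHeight b ε K (K + 1) = b K + ε := by
  rw [splitHeight, if_neg (by omega), if_neg (by omega), if_pos rfl]

theorem splitHeight_gt (h : K < k) : splitHeight b ε K (k + 1) = b k := by
  rw [splitHeight, if_neg (by omega), if_neg (by omega), if_neg (by omega), Nat.add_sub_cancel]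

theorem base_lt (hY : 4 * (N : ℝ) + 8 ≤ Y) {i k : ℕ} (h : i < k) (hk : k ≤ N) :
    base Y N i + 4 ≤ base Y N k := by
  have hr : (i : ℝ) + 1 ≤ k := by exact_mod_cast h
  have hkr : (k : ℝ) ≤ N := by exact_mod_cast hk
  unfold base
  rw [if_pos (by omega)]
  split_ifs
  · linarith
  · linarith

theorem base_bounds (hY : 4 * (N : ℝ) + 8 ≤ Y) (hk : k ≤ N) : 0 ≤ base Y N k ∧ base Y N k ≤ Y := by
  have hkr : (k : ℝ) ≤ N := by exact_mod_cast hk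
  have h0 : (0 : ℝ) ≤ k := Nat.cast_nonneg _
  unfold base
  split_ifs <;> constructor <;> linarith

theorem base_goodColumn (hN : 1 ≤ N) (hY : 4 * (N : ℝ) + 8 ≤ Y) : GoodColumn Y N (base Y N) := by
  refine ⟨fun k hk => ?_, ?_, ?_⟩
  · linarith [base_lt hY (show k < k + 1 by omega) hk]
  · rw [base, if_pos (by omega)]
    norm_num
  · rw [base, if_neg (by omega)]
    constructor <;> linarith

/-- The indices of a split column. -/
theorem split_cases (K k : ℕ) : k < K ∨ k = K ∨ k = K + 1 ∨ ∃ j, K < j ∧ k = j + 1 := by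
  rcases lt_or_ge (K + 1) k with h | h
  · exact Or.inr (Or.inr (Or.inr ⟨k - 1, by omega, by omega⟩))
  · omega

theorem splitHeight_gap (hY : 4 * (N : ℝ) + 8 ≤ Y) (hK : K ≤ N) (hε' : ε ≤ 5 / 4)
    (hk : k < N + 1) (hkK : k ≠ K) :
    splitHeight (base Y N) ε K k + 5 / 2 ≤ splitHeight (base Y N) ε K (k + 1) := by
  rcases split_cases K k with h | h | h | ⟨j, h, rfl⟩
  · rw [splitHeight_lt h]
    rcases (show k + 1 ≤ K from h).eq_or_lt with h' | h'
    · subst h'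
      rw [splitHeight_eq]
      linarith [base_lt hY (show k < k + 1 by omega) hK]
    · rw [splitHeight_lt h']
      linarith [base_lt hY (show k < k + 1 by omega) (by omega)]
  · exact absurd h hkK
  · subst h
    rw [splitHeight_succ, splitHeight_gt (by omega)]
    linarith [base_lt hY (show K < K + 1 by omega) (by omega)]
  · rw [splitHeight_gt h, splitHeight_gt (by omega)]
    linarith [base_lt hY (show j < j + 1 by omega) (by omega)]

theorem splitHeight_bounds (hN : 1 ≤ N) (hK : K ≤ N) (hε : 0 ≤ ε)
    (hε' : ε ≤ 5 / 4) : (-5 / 4 ≤ splitHeight (base Y N) ε K 0 ∧ splitHeight (base Y N) ε K 0 ≤ 0) ∧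
      Y ≤ splitHeight (base Y N) ε K (N + 1) ∧ splitHeight (base Y N) ε K (N + 1) ≤ Y + 5 / 4 := by
  have h0 : base Y N 0 = 0 := by rw [base, if_pos (by omega)]; norm_num
  have h1 : base Y N N = Y := by rw [base, if_neg (by omega)]
  constructor
  · rcases Nat.eq_zero_or_pos K with rfl | h
    · rw [splitHeight_eq, h0]
      constructor <;> linarith
    · rw [splitHeight_lt h, h0]
      norm_num
  · rcases hK.eq_or_lt with rfl | h
    · rw [splitHeight_succ, h1]
      constructor <;> linarith
    · rw [splitHeight_gt h, h1]
      constructor <;> linarith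

theorem splitHeight_goodColumn (hN : 1 ≤ N) (hY : 4 * (N : ℝ) + 8 ≤ Y) (hK : K ≤ N) :
    GoodColumn Y (N + 1) (splitHeight (base Y N) (5 / 4) K) := by
  have h := splitHeight_bounds (Y := Y) (ε := 5 / 4) hN hK (by norm_num) le_rfl
  refine ⟨fun k hk => ?_, h.1, h.2⟩
  by_cases hkK : k = K
  · subst hkK
    rw [splitHeight_eq, splitHeight_succ]
    linarith
  · exact splitHeight_gap hY hK le_rfl hk hkK

/-- Before a split, the disc `K` is linked to both discs replacing it. -/
theorem base_hubStep (hY : 4 * (N : ℝ) + 8 ≤ Y) (hK : K ≤ N) :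
    HubStep K 0 N (N + 1) (base Y N) (splitHeight (base Y N) (3 / 4) K) := by
  refine ⟨fun i hi i' hi' h => ?_, fun i hi i' hi' h => ?_, fun k hk k' hk' h => Or.inl ?_⟩
  · rcases h with ⟨h1, rfl⟩ | ⟨h1, h2⟩
    · rcases h1.eq_or_lt with rfl | h1
      · rw [splitHeight_eq]
        norm_num [abs_of_nonneg]
      · rw [splitHeight_lt h1]
        norm_num
    · obtain rfl : i' = i + 1 := by omega
      rw [Nat.add_zero] at h1
      rcases h1.eq_or_lt with rfl | h1
      · rw [splitHeight_succ]
        norm_num [abs_of_nonneg]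
      · rw [splitHeight_gt h1]
        norm_num
  · unfold HubLink at h
    rw [le_abs]
    have key : ∀ i', i' ≤ N → i' ≠ i →
        base Y N i + 4 ≤ base Y N i' ∨ base Y N i' + 4 ≤ base Y N i := by
      intro i' hi' hne
      rcases lt_or_gt_of_ne hne with h | h
      · exact Or.inr (base_lt hY h hi)
      · exact Or.inl (base_lt hY h hi')
    rcases split_cases K i' with h1 | h1 | h1 | ⟨j, h1, rfl⟩
    · rw [splitHeight_lt h1]
      rcases key i' (by omega) (by omega) with h | h
      · right; linarith
      · left; linarith
    · subst h1
      rw [splitHeight_eq]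
      rcases key i' hK (by omega) with h | h
      · right; linarith
      · left; linarith
    · subst h1
      rw [splitHeight_succ]
      rcases key K hK (by omega) with h | h
      · right; linarith
      · left; linarith
    · rw [splitHeight_gt h1]
      rcases key j (by omega) (by omega) with h | h
      · right; linarith
      · left; linarith
  · have hgap := base_lt hY (show k < k + 1 by omega) hk
    have key : splitHeight (base Y N) (3 / 4) K k' ≤ base Y N k + 3 / 4 ∧
        base Y N (k + 1) - 3 / 4 ≤ splitHeight (base Y N) (3 / 4) K (k' + 1) := by
      rcases h with ⟨h1, rfl⟩ | ⟨h1, h2, rfl⟩ | ⟨h1, h2⟩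
      · rw [splitHeight_lt h1]
        refine ⟨by linarith, ?_⟩
        rcases (show k' + 1 ≤ K from h1).eq_or_lt with h' | h'
        · subst h'
          rw [splitHeight_eq]
        · rw [splitHeight_lt h']
          linarith
      · omega
      · obtain rfl : k' = k + 1 := by omega
        rw [splitHeight_gt (k := k + 1) (by omega)]
        refine ⟨?_, by linarith⟩
        rcases (show K ≤ k by omega).eq_or_lt with h' | h'
        · subst h'
          rw [splitHeight_succ]
        · rw [splitHeight_gt h']
          linarith
    have h1 : max (base Y N k) (splitHeight (base Y N) (3 / 4) K k') ≤ base Y N k + 3 / 4 :=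
      max_le (by linarith) key.1
    have h2 : base Y N (k + 1) - 3 / 4 ≤
        min (base Y N (k + 1)) (splitHeight (base Y N) (3 / 4) K (k' + 1)) :=
      le_min (by linarith) key.2
    linarith

/-- After a split, the two discs move apart. -/
theorem split_hubStep (hY : 4 * (N : ℝ) + 8 ≤ Y) (hK : K ≤ N) :
    HubStep K 1 (N + 1) (N + 1) (splitHeight (base Y N) (5 / 4) K)
      (splitHeight (base Y N) (3 / 4) K) := by
  have hclose : ∀ i, |splitHeight (base Y N) (5 / 4) K i - splitHeight (base Y N) (3 / 4) K i| ≤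
      1 / 2 := by
    intro i
    rw [abs_le]
    rcases split_cases K i with h | rfl | rfl | ⟨j, h, rfl⟩
    · rw [splitHeight_lt h, splitHeight_lt h]
      norm_num
    · rw [splitHeight_eq, splitHeight_eq]
      constructor <;> linarith
    · rw [splitHeight_succ, splitHeight_succ]
      constructor <;> linarith
    · rw [splitHeight_gt h, splitHeight_gt h]
      norm_num
  have hgap : ∀ k < N + 1, splitHeight (base Y N) (5 / 4) K k + 5 / 2 ≤
      splitHeight (base Y N) (5 / 4) K (k + 1) := by
    intro k hk
    by_cases hkK : k = K
    · subst hkK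
      rw [splitHeight_eq, splitHeight_succ]
      linarith
    · exact splitHeight_gap hY hK le_rfl hk hkK
  have hmono : ∀ i k, i < k → k ≤ N + 1 → splitHeight (base Y N) (5 / 4) K i + 5 / 2 ≤
      splitHeight (base Y N) (5 / 4) K k := by
    intro i k hik
    induction k, hik using Nat.le_induction with
    | base => exact fun hk => hgap i (by omega)
    | succ k hik ih =>
      intro hk
      linarith [ih (by omega), hgap k (by omega)]
  refine ⟨fun i hi i' hi' h => ?_, fun i hi i' hi' h => ?_, fun k hk k' hk' h => ?_⟩
  · obtain rfl : i' = i := by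
      unfold HubLink at h
      omega
    linarith [hclose i']
  · have hne : i ≠ i' := by
      unfold HubLink at h
      omega
    rw [le_abs]
    have h1 := abs_le.1 (hclose i')
    rcases lt_or_gt_of_ne hne with h | h
    · right
      linarith [hmono i i' h hi', h1.1]
    · left
      linarith [hmono i' i h hi, h1.2]
  · obtain rfl : k' = k := by
      unfold HubCompat at h
      omega
    by_cases hkK : k' = K
    · subst hkK
      right
      rw [splitHeight_eq, splitHeight_succ, splitHeight_eq, splitHeight_succ]
      exact ⟨rfl, rfl, rfl, by linarith, by linarith, by linarith⟩
    · left
      have h1 := splitHeight_gap hY hK (show (3 / 4 : ℝ) ≤ 5 / 4 by norm_num) hk hkK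
      have h2 := hgap k' hk
      have h3 := abs_le.1 (hclose k')
      have h4 := abs_le.1 (hclose (k' + 1))
      rcases max_choice (splitHeight (base Y N) (5 / 4) K k') (splitHeight (base Y N) (3 / 4) K k')
        with e | e <;>
      rcases min_choice (splitHeight (base Y N) (5 / 4) K (k' + 1))
        (splitHeight (base Y N) (3 / 4) K (k' + 1)) with e' | e' <;> rw [e, e'] <;> linarith

end Split

/-! ### Labels around an event -/

section Lists

variable {α : Type*} {l₁ mid l₂ : List α}

theorem getElem?_append_three {k : ℕ} {a : α} : (l₁ ++ mid ++ l₂)[k]? = some a ↔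
    (k < l₁.length ∧ l₁[k]? = some a) ∨
    (l₁.length ≤ k ∧ k < l₁.length + mid.length ∧ mid[k - l₁.length]? = some a) ∨
    (l₁.length + mid.length ≤ k ∧ l₂[k - (l₁.length + mid.length)]? = some a) := by
  rw [List.getElem?_append, List.length_append]
  split_ifs with h
  · rw [List.getElem?_append]
    split_ifs with h'
    · constructor
      · exact fun h => Or.inl ⟨h', h⟩
      · rintro (⟨-, h⟩ | ⟨h, -⟩ | ⟨h, -⟩)
        · exact h
        · omega
        · omega
    · constructor
      · exact fun e => Or.inr (Or.inl ⟨by omega, h, e⟩)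
      · rintro (⟨h, -⟩ | ⟨-, -, h⟩ | ⟨h, -⟩)
        · omega
        · exact h
        · omega
  · constructor
    · exact fun e => Or.inr (Or.inr ⟨by omega, e⟩)
    · rintro (⟨h, -⟩ | ⟨-, h, -⟩ | ⟨-, h⟩)
      · omega
      · omega
      · exact h

variable {V E : Type*}

theorem getElem?_map_inl {l : List E} {k : ℕ} {x : E ⊕ V} :
    (l.map Sum.inl)[k]? = some x ↔ ∃ a, x = Sum.inl a ∧ l[k]? = some a := by
  rw [List.getElem?_map, Option.map_eq_some_iff]
  exact ⟨fun ⟨a, h, e⟩ => ⟨a, e.symm, h⟩, fun ⟨a, e, h⟩ => ⟨a, h, e.symm⟩⟩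

/-- The labels of an event column: the edges below, the vertex, and the edges above. -/
def eventLabels (l₁ l₂ : List E) (v : V) : List (E ⊕ V) :=
  l₁.map Sum.inl ++ [Sum.inr v] ++ l₂.map Sum.inl

theorem length_eventLabels (l₁ l₂ : List E) (v : V) :
    (eventLabels l₁ l₂ v).length = l₁.length + 1 + l₂.length := by
  simp only [eventLabels, List.length_append, List.length_map, List.length_singleton]

theorem eventLabels_inl {l₁ l₂ : List E} {v : V} {k : ℕ} {a : E} :
    (eventLabels l₁ l₂ v)[k]? = some (Sum.inl a) ↔ (k < l₁.length ∧ l₁[k]? = some a) ∨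
      (l₁.length < k ∧ l₂[k - (l₁.length + 1)]? = some a) := by
  unfold eventLabels
  rw [getElem?_append_three]
  simp only [List.length_map, List.length_singleton, getElem?_map_inl, Sum.inl.injEq,
    exists_eq_left']
  constructor
  · rintro (h | ⟨h1, h2, h⟩ | ⟨h1, h⟩)
    · exact Or.inl h
    · obtain rfl : k = l₁.length := by omega
      simp at h
    · exact Or.inr ⟨by omega, h⟩
  · rintro (h | ⟨h1, h⟩)
    · exact Or.inl h
    · exact Or.inr (Or.inr ⟨by omega, h⟩)

theorem eventLabels_inr {l₁ l₂ : List E} {v w : V} {k : ℕ} :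
    (eventLabels l₁ l₂ v)[k]? = some (Sum.inr w) ↔ k = l₁.length ∧ w = v := by
  unfold eventLabels
  rw [getElem?_append_three]
  simp only [List.length_map, List.length_singleton, getElem?_map_inl, reduceCtorEq, false_and,
    exists_false, and_false, or_false, false_or]
  constructor
  · rintro ⟨h1, h2, h⟩
    obtain rfl : k = l₁.length := by omega
    simp at h
    exact ⟨rfl, h.symm⟩
  · rintro ⟨rfl, rfl⟩
    exact ⟨le_rfl, by omega, by simp⟩

/-- The compatible gaps of a side column and an event column are those labelled by the same edge, or
by one of the strands of the event and its vertex. -/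
theorem hubCompat_iff_labels {l₁ mid l₂ : List E} {v : V} (hnd : (l₁ ++ mid ++ l₂).Nodup) {k k' : ℕ}
    (hk : k < (l₁ ++ mid ++ l₂).length) :
    HubCompat l₁.length mid.length k k' ↔ ∃ a, (l₁ ++ mid ++ l₂)[k]? = some a ∧
      ((eventLabels l₁ l₂ v)[k']? = some (Sum.inl a) ∨
        (eventLabels l₁ l₂ v)[k']? = some (Sum.inr v) ∧ a ∈ mid) := by
  have hlen : (l₁ ++ mid ++ l₂).length = l₁.length + mid.length + l₂.length := by
    simp [Nat.add_assoc]
  have hk₀ := hk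
  rw [hlen] at hk
  constructor
  · intro h
    refine ⟨(l₁ ++ mid ++ l₂)[k], List.getElem?_eq_getElem hk₀, ?_⟩
    have hget := List.getElem?_eq_getElem hk₀
    generalize (l₁ ++ mid ++ l₂)[k] = a at hget
    rw [getElem?_append_three] at hget
    rw [eventLabels_inl, eventLabels_inr]
    rcases h with ⟨h1, rfl⟩ | ⟨h1, h2, rfl⟩ | ⟨h1, h2⟩
    · rcases hget with h | ⟨h, -⟩ | ⟨h, -⟩
      · exact Or.inl (Or.inl h)
      · omega
      · omega
    · rcases hget with ⟨h, -⟩ | ⟨-, -, h⟩ | ⟨h, -⟩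
      · omega
      · exact Or.inr ⟨⟨rfl, rfl⟩, List.mem_of_getElem? h⟩
      · omega
    · rcases hget with ⟨h, -⟩ | ⟨-, h, -⟩ | ⟨-, h⟩
      · omega
      · omega
      · refine Or.inl (Or.inr ⟨by omega, ?_⟩)
        rwa [show k' - (l₁.length + 1) = k - (l₁.length + mid.length) by omega]
  · rintro ⟨a, ha, h⟩
    rw [eventLabels_inl, eventLabels_inr] at h
    have uniq : ∀ i, (l₁ ++ mid ++ l₂)[i]? = some a → i = k := by
      intro i hi
      obtain ⟨hi', -⟩ := List.getElem?_eq_some_iff.1 hi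
      exact (List.getElem?_inj hi' hnd).1 (hi.trans ha.symm)
    rcases h with (⟨h1, h2⟩ | ⟨h1, h2⟩) | ⟨⟨rfl, -⟩, hmem⟩
    · exact Or.inl ⟨by rw [← uniq k' (getElem?_append_three.2 (Or.inl ⟨h1, h2⟩))]; exact h1,
        uniq k' (getElem?_append_three.2 (Or.inl ⟨h1, h2⟩))⟩
    · have := uniq (k' - (l₁.length + 1) + (l₁.length + mid.length))
        (getElem?_append_three.2 (Or.inr (Or.inr ⟨by omega, by rwa [Nat.add_sub_cancel]⟩)))
      exact Or.inr (Or.inr ⟨by omega, by omega⟩)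
    · obtain ⟨i, hi⟩ := List.getElem?_of_mem hmem
      obtain ⟨hi', -⟩ := List.getElem?_eq_some_iff.1 hi
      have := uniq (l₁.length + i)
        (getElem?_append_three.2 (Or.inr (Or.inl ⟨by omega, by omega,
          by rwa [Nat.add_sub_cancel_left]⟩)))
      exact Or.inr (Or.inl ⟨by omega, by omega, rfl⟩)

end Lists

/-! ### Adjacent columns -/

/-- A column of a labelled diagram: the labels of the gaps from bottom to top and the heights of the
discs. -/
structure Col (V E : Type*) where
  /-- the labels of the gaps -/
  lab : List (E ⊕ V)
  /-- the heights of the discs -/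
  p : ℕ → ℝ

/-- The relations between adjacent columns of a labelled diagram. Discs without link to the other
column have heights congruent to `r`, respectively `r'`, modulo `4`. The vertices in `R`,
respectively `R'`, are at the tip of an overlap of discs, to its right, respectively to its left. -/
structure ColStep {V E : Type*} (vl vr : E → V) (R R' : V → Prop) (r r' : ℝ) (c c' : Col V E) :
    Prop where
  step : ∀ i ≤ c.lab.length, ∀ m ≤ c'.lab.length,
    |c.p i - c'.p m| ≤ 7 / 8 ∨ 7 / 4 ≤ |c.p i - c'.p m|
  bottom_link : |c.p 0 - c'.p 0| ≤ 7 / 8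
  top_link : |c.p c.lab.length - c'.p c'.lab.length| ≤ 7 / 8
  link_right : ∀ i ≤ c.lab.length,
    (∃ m ≤ c'.lab.length, |c.p i - c'.p m| ≤ 7 / 8) ∨ ∃ z : ℤ, c.p i = 4 * z + r
  link_left : ∀ m ≤ c'.lab.length,
    (∃ i ≤ c.lab.length, |c.p i - c'.p m| ≤ 7 / 8) ∨ ∃ z : ℤ, c'.p m = 4 * z + r'
  compat_iff : ∀ k < c.lab.length, ∀ k' < c'.lab.length,
    (∀ i ≤ c.lab.length, ∀ m ≤ c'.lab.length, |c.p i - c'.p m| ≤ 7 / 8 → (i ≤ k ↔ m ≤ k')) ↔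
      ∃ a, (c.lab[k]? = some (Sum.inl a) ∨ c.lab[k]? = some (Sum.inr (vl a))) ∧
        (c'.lab[k']? = some (Sum.inl a) ∨ c'.lab[k']? = some (Sum.inr (vr a)))
  room : ∀ k < c.lab.length, ∀ k' < c'.lab.length,
    (∀ i ≤ c.lab.length, ∀ m ≤ c'.lab.length, |c.p i - c'.p m| ≤ 7 / 8 → (i ≤ k ↔ m ≤ k')) →
    max (c.p k) (c'.p k') + 2 ≤ min (c.p (k + 1)) (c'.p (k' + 1)) ∨
    (c.p (k + 1) = c.p k + 3 / 2 ∧ c'.p k' + 1 ≤ c.p k + 3 / 4 ∧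
      c.p k + 3 / 4 + 1 ≤ c'.p (k' + 1) ∧ ∃ v, c.lab[k]? = some (Sum.inr v) ∧ R v) ∨
    (c'.p (k' + 1) = c'.p k' + 3 / 2 ∧ c.p k + 1 ≤ c'.p k' + 3 / 4 ∧
      c'.p k' + 3 / 4 + 1 ≤ c.p (k + 1) ∧ ∃ v, c'.lab[k']? = some (Sum.inr v) ∧ R' v)

section ColStep

variable {V E : Type*} {vl vr : E → V} {R R' : V → Prop} {r r' : ℝ} {c c' : Col V E}

theorem ColStep.symm (h : ColStep vl vr R R' r r' c c') : ColStep vr vl R' R r' r c' c := by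
  have hc : ∀ k k', (∀ i ≤ c'.lab.length, ∀ m ≤ c.lab.length, |c'.p i - c.p m| ≤ 7 / 8 →
      (i ≤ k ↔ m ≤ k')) ↔ (∀ i ≤ c.lab.length, ∀ m ≤ c'.lab.length, |c.p i - c'.p m| ≤ 7 / 8 →
      (i ≤ k' ↔ m ≤ k)) := by
    intro k k'
    constructor
    · intro h i hi m hm hl
      rw [abs_sub_comm] at hl
      exact (h m hm i hi hl).symm
    · intro h i hi m hm hl
      rw [abs_sub_comm] at hl
      exact (h m hm i hi hl).symm
  refine ⟨fun i hi m hm => ?_, ?_, ?_, fun i hi => ?_, fun i hi => ?_, fun k hk k' hk' => ?_,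
    fun k hk k' hk' hcomp => ?_⟩
  · rw [abs_sub_comm]
    exact h.step m hm i hi
  · rw [abs_sub_comm]
    exact h.bottom_link
  · rw [abs_sub_comm]
    exact h.top_link
  · simp only [abs_sub_comm (c'.p i)]
    exact h.link_left i hi
  · simp only [abs_sub_comm _ (c.p i)]
    exact h.link_right i hi
  · rw [hc, h.compat_iff k' hk' k hk]
    exact exists_congr fun a => and_comm
  · rw [hc] at hcomp
    rw [max_comm, min_comm]
    rcases h.room k' hk' k hk hcomp with e | e | e
    · exact Or.inl e
    · exact Or.inr (Or.inr e)
    · exact Or.inr (Or.inl e)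

theorem HubStep.close_iff {K m N M : ℕ} {p q : ℕ → ℝ} (h : HubStep K m N M p q) {i i' : ℕ}
    (hi : i ≤ N) (hi' : i' ≤ M) : |p i - q i'| ≤ 7 / 8 ↔ HubLink K m i i' := by
  constructor
  · intro hc
    by_contra hn
    linarith [h.far i hi i' hi' hn]
  · exact h.link i hi i' hi'

/-- A side column and an event column are adjacent columns of a labelled diagram. -/
theorem HubStep.colStep {l₁ mid l₂ : List E} {v : V} {p q : ℕ → ℝ}
    (h : HubStep l₁.length mid.length (l₁ ++ mid ++ l₂).length (eventLabels l₁ l₂ v).length p q)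
    (hnd : (l₁ ++ mid ++ l₂).Nodup) (hmid : ∀ a ∈ l₁ ++ mid ++ l₂, vr a = v ↔ a ∈ mid)
    (hr : ∀ i, l₁.length < i → i < l₁.length + mid.length → ∃ z : ℤ, p i = 4 * z + r)
    (htip : mid.length = 1 → q (l₁.length + 1) = q l₁.length + 3 / 2 → R' v) :
    ColStep vl vr R R' r r' ⟨(l₁ ++ mid ++ l₂).map Sum.inl, p⟩ ⟨eventLabels l₁ l₂ v, q⟩ := by
  have hN : ((l₁ ++ mid ++ l₂).map (Sum.inl : E → E ⊕ V)).length = (l₁ ++ mid ++ l₂).length :=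
    List.length_map _
  have hN' : (l₁ ++ mid ++ l₂).length = l₁.length + mid.length + l₂.length := by
    simp [Nat.add_assoc]
  have hM' := length_eventLabels l₁ l₂ v
  set N := (l₁ ++ mid ++ l₂).length
  set M := (eventLabels l₁ l₂ v).length
  have hcompat : ∀ k < N, ∀ k' < M, (∀ i ≤ N, ∀ m ≤ M, |p i - q m| ≤ 7 / 8 → (i ≤ k ↔ m ≤ k')) ↔
      HubCompat l₁.length mid.length k k' := by
    intro k hk k' hk'
    rw [hubCompat_iff (N := N) (M := M) (by omega) (by omega) hk]
    exact forall₂_congr fun i hi => forall₂_congr fun m hm => by rw [h.close_iff hi hm]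
  refine ⟨?_, ?_, ?_, ?_, ?_, ?_, ?_⟩ <;> simp only [hN]
  · intro i hi m hm
    by_cases hl : HubLink l₁.length mid.length i m
    · exact Or.inl (h.link i hi m hm hl)
    · exact Or.inr (h.far i hi m hm hl)
  · exact h.link 0 (Nat.zero_le _) 0 (Nat.zero_le _) (Or.inl ⟨Nat.zero_le _, rfl⟩)
  · exact h.link N le_rfl M le_rfl (Or.inr ⟨by omega, by omega⟩)
  · intro i hi
    rcases le_or_gt i l₁.length with h1 | h1
    · exact Or.inl ⟨i, by omega, h.link i hi i (by omega) (Or.inl ⟨h1, rfl⟩)⟩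
    rcases lt_or_ge i (l₁.length + mid.length) with h2 | h2
    · exact Or.inr (hr i h1 h2)
    · exact Or.inl ⟨i + 1 - mid.length, by omega,
        h.link i hi _ (by omega) (Or.inr ⟨h2, by omega⟩)⟩
  · intro m hm
    left
    rcases le_or_gt m l₁.length with h1 | h1
    · exact ⟨m, by omega, h.link m (by omega) m hm (Or.inl ⟨h1, rfl⟩)⟩
    · exact ⟨m + mid.length - 1, by omega,
        h.link _ (by omega) m hm (Or.inr ⟨by omega, by omega⟩)⟩
  · intro k hk k' hk'
    rw [hcompat k hk k' hk', hubCompat_iff_labels (v := v) hnd hk]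
    refine exists_congr fun a => ?_
    simp only [getElem?_map_inl, Sum.inl.injEq, exists_eq_left', reduceCtorEq, false_and,
      exists_false, or_false]
    refine and_congr_right fun ha => or_congr_right ?_
    have := hmid a (List.mem_of_getElem? ha)
    rw [← this, eventLabels_inr, eventLabels_inr]
    tauto
  · intro k hk k' hk' hc
    rw [hcompat k hk k' hk'] at hc
    rcases h.room k hk k' hk' hc with e | ⟨e0, rfl, rfl, e1, e2, e3⟩
    · exact Or.inl e
    · exact Or.inr (Or.inr ⟨e1, e2, e3, v, eventLabels_inr.2 ⟨rfl, rfl⟩, htip e0 e1⟩)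

theorem GoodColumn.lt {Y : ℝ} {N : ℕ} {p : ℕ → ℝ} (h : GoodColumn Y N p) {i k : ℕ} (hik : i < k)
    (hk : k ≤ N) : p i + 5 / 2 ≤ p k := by
  induction k, hik using Nat.le_induction with
  | base => exact h.gap i (by omega)
  | succ k hik ih => linarith [ih (by omega), h.gap k (by omega)]

/-- Columns with the same strands at nearby heights are adjacent columns of a labelled diagram. -/
theorem colStep_of_close {Y : ℝ} {l : List E} {p q : ℕ → ℝ} (hnd : l.Nodup)
    (hp : GoodColumn Y l.length p) (hq : GoodColumn Y l.length q)
    (hc : ∀ i ≤ l.length, |p i - q i| ≤ 1 / 4) :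
    ColStep vl vr R R' r r' ⟨l.map Sum.inl, p⟩ ⟨l.map Sum.inl, q⟩ := by
  have hN : (l.map (Sum.inl : E → E ⊕ V)).length = l.length := List.length_map _
  have hfar : ∀ i ≤ l.length, ∀ m ≤ l.length, i ≠ m → 7 / 4 ≤ |p i - q m| := by
    intro i hi m hm hne
    rw [le_abs]
    have h1 := abs_le.1 (hc i hi)
    rcases lt_or_gt_of_ne hne with h | h
    · right
      linarith [hq.lt h hm, h1.2]
    · left
      linarith [hq.lt h hi, h1.1]
  have hclose : ∀ i ≤ l.length, ∀ m ≤ l.length, |p i - q m| ≤ 7 / 8 ↔ m = i := by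
    intro i hi m hm
    constructor
    · intro h
      by_contra hne
      linarith [hfar i hi m hm (Ne.symm hne)]
    · rintro rfl
      linarith [hc m hm]
  have hcompat : ∀ k < l.length, ∀ k' < l.length, (∀ i ≤ l.length, ∀ m ≤ l.length,
      |p i - q m| ≤ 7 / 8 → (i ≤ k ↔ m ≤ k')) ↔ k' = k := by
    intro k hk k' hk'
    constructor
    · intro h
      have h1 := h k hk.le k hk.le ((hclose k hk.le k hk.le).2 rfl)
      have h2 := h (k + 1) hk (k + 1) hk ((hclose _ hk _ hk).2 rfl)
      omega
    · rintro rfl i hi m hm hl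
      rw [(hclose i hi m hm).1 hl]
  refine ⟨?_, ?_, ?_, ?_, ?_, ?_, ?_⟩ <;> simp only [hN]
  · intro i hi m hm
    by_cases h : i = m
    · subst h
      left
      linarith [hc i hi]
    · exact Or.inr (hfar i hi m hm h)
  · linarith [hc 0 (Nat.zero_le _)]
  · linarith [hc _ le_rfl]
  · exact fun i hi => Or.inl ⟨i, hi, by linarith [hc i hi]⟩
  · exact fun i hi => Or.inl ⟨i, hi, by linarith [hc i hi]⟩
  · intro k hk k' hk'
    rw [hcompat k hk k' hk']
    simp only [getElem?_map_inl, Sum.inl.injEq, exists_eq_left', reduceCtorEq, false_and,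
      exists_false, or_false]
    constructor
    · rintro rfl
      exact ⟨l[k'], List.getElem?_eq_getElem hk, List.getElem?_eq_getElem hk⟩
    · rintro ⟨a, h1, h2⟩
      exact (List.getElem?_inj hk' hnd).1 (h2.trans h1.symm)
  · intro k hk k' hk' h
    obtain rfl := (hcompat k hk k' hk').1 h
    left
    have h1 := hp.gap k' hk
    have h2 := hq.gap k' hk
    have h3 := abs_le.1 (hc k' hk.le)
    have h4 := abs_le.1 (hc (k' + 1) hk)
    rcases max_choice (p k') (q k') with e | e <;>
      rcases min_choice (p (k' + 1)) (q (k' + 1)) with e' | e' <;> rw [e, e'] <;> linarith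

end ColStep

/-! ### Sweeps -/

/-- A graph drawn in the plane without vertical tangents, recorded by the order of its vertices from
left to right and by the lists, from bottom to top, of the edges met by vertical lines between them.
At each vertex, either there are edges on both sides, or there is only one edge. -/
structure Sweep (V E G : Type*) [TopologicalSpace G] where
  /-- the number of vertices -/
  n : ℕ
  /-- the place of a vertex in the order -/
  ord : V → ℕ
  /-- the vertex at a place -/
  vtx : ℕ → V
  ord_lt : ∀ v, ord v < n
  vtx_ord : ∀ v, vtx (ord v) = v
  ord_vtx : ∀ i < n, ord (vtx i) = i
  /-- the left end point of an edge -/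
  vl : E → V
  /-- the right end point of an edge -/
  vr : E → V
  ord_vl_lt : ∀ a, ord (vl a) < ord (vr a)
  /-- the edges met just before a vertex -/
  st : ℕ → List E
  /-- the edges below a vertex -/
  low : ℕ → List E
  /-- the edges that end at a vertex -/
  inn : ℕ → List E
  /-- the edges that start at a vertex -/
  out : ℕ → List E
  /-- the edges above a vertex -/
  upp : ℕ → List E
  st_eq : ∀ i < n, st i = low i ++ inn i ++ upp i
  st_succ : ∀ i < n, st (i + 1) = low i ++ out i ++ upp i
  nodup : ∀ i ≤ n, (st i).Nodup
  mem_st : ∀ i ≤ n, ∀ a, a ∈ st i ↔ ord (vl a) < i ∧ i ≤ ord (vr a)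
  mem_inn : ∀ i < n, ∀ a, a ∈ inn i ↔ ord (vr a) = i
  mem_out : ∀ i < n, ∀ a, a ∈ out i ↔ ord (vl a) = i
  kind : ∀ i < n, (inn i ≠ [] ∧ out i ≠ []) ∨ (inn i = [] ∧ (out i).length = 1) ∨
    ((inn i).length = 1 ∧ out i = [])
  st_ne : ∀ i, 0 < i → i < n → st i ≠ []
  nonempty_edge : Nonempty E
  /-- the vertices as points -/
  vx : V → G
  /-- the edges as paths -/
  γ : E → ℝ → G
  continuousOn_γ : ∀ a, ContinuousOn (γ a) (Set.Icc 0 1)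
  γ_zero : ∀ a, γ a 0 = vx (vl a)
  γ_one : ∀ a, γ a 1 = vx (vr a)
  γ_inj : ∀ a a', ∀ t ∈ Set.Icc (0 : ℝ) 1, ∀ t' ∈ Set.Icc (0 : ℝ) 1, γ a t = γ a' t' →
    (a = a' ∧ t = t') ∨ ∃ v, (t = 0 ∧ v = vl a ∨ t = 1 ∧ v = vr a) ∧
      (t' = 0 ∧ v = vl a' ∨ t' = 1 ∧ v = vr a')
  γ_surj : ∀ g, ∃ a, ∃ t ∈ Set.Icc (0 : ℝ) 1, γ a t = g

namespace Sweep

variable {V E G : Type*} [TopologicalSpace G] (S : Sweep V E G)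

theorem two_le_n : 2 ≤ S.n := by
  obtain ⟨a⟩ := S.nonempty_edge
  have := S.ord_vl_lt a
  have := S.ord_lt (S.vr a)
  omega

theorem length_st {i : ℕ} (hi : i < S.n) :
    (S.st i).length = (S.low i).length + (S.inn i).length + (S.upp i).length := by
  rw [S.st_eq i hi, List.length_append, List.length_append]

theorem length_st_succ {i : ℕ} (hi : i < S.n) :
    (S.st (i + 1)).length = (S.low i).length + (S.out i).length + (S.upp i).length := by
  rw [S.st_succ i hi, List.length_append, List.length_append]

/-- Heights of the discs of the columns before, at, and after a vertex. -/
structure IsEventHeights (Y : ℝ) (i : ℕ) (pre ev post : ℕ → ℝ) : Prop where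
  pre_good : GoodColumn Y (S.st i).length pre
  post_good : GoodColumn Y (S.st (i + 1)).length post
  ev_gap : ∀ k < (S.low i).length + 1 + (S.upp i).length, ev k + 5 / 2 ≤ ev (k + 1) ∨
    ev (k + 1) = ev k + 3 / 2 ∧ 0 ≤ ev k + 3 / 4 ∧ ev k + 3 / 4 ≤ Y ∧
      ((∀ m ≤ (S.st (i + 1)).length, 1 ≤ |ev k + 3 / 4 - post m|) ∨
        ∀ m ≤ (S.st i).length, 1 ≤ |ev k + 3 / 4 - pre m|)
  ev_bottom : -5 / 4 ≤ ev 0 ∧ ev 0 ≤ 0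
  ev_top : Y ≤ ev ((S.low i).length + 1 + (S.upp i).length) ∧
    ev ((S.low i).length + 1 + (S.upp i).length) ≤ Y + 5 / 4
  step_left : ColStep S.vl S.vr (fun v => S.inn (S.ord v) = []) (fun v => S.out (S.ord v) = []) 0 2
    ⟨(S.st i).map Sum.inl, pre⟩ ⟨eventLabels (S.low i) (S.upp i) (S.vtx i), ev⟩
  step_right : ColStep S.vl S.vr (fun v => S.inn (S.ord v) = []) (fun v => S.out (S.ord v) = []) 0 2
    ⟨eventLabels (S.low i) (S.upp i) (S.vtx i), ev⟩ ⟨(S.st (i + 1)).map Sum.inl, post⟩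
  tip : S.inn i = [] ∨ S.out i = [] →
    ev ((S.low i).length + 1) = ev (S.low i).length + 3 / 2

variable {S} {Y : ℝ} {i : ℕ} {pre ev post : ℕ → ℝ}

theorem colStep_left (hi : i < S.n) (h : HubStep (S.low i).length (S.inn i).length
      ((S.low i).length + (S.inn i).length + (S.upp i).length)
      ((S.low i).length + 1 + (S.upp i).length) pre ev)
    (hr : ∀ k, (S.low i).length < k → k < (S.low i).length + (S.inn i).length →
      ∃ z : ℤ, pre k = 4 * z + 0)
    (htip : (S.inn i).length = 1 → ev ((S.low i).length + 1) = ev (S.low i).length + 3 / 2 →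
      S.out i = []) :
    ColStep S.vl S.vr (fun v => S.inn (S.ord v) = []) (fun v => S.out (S.ord v) = []) 0 2
      ⟨(S.st i).map Sum.inl, pre⟩ ⟨eventLabels (S.low i) (S.upp i) (S.vtx i), ev⟩ := by
  have hnd := S.nodup i hi.le
  have hlen := S.length_st hi
  rw [S.st_eq i hi] at hnd hlen ⊢
  refine HubStep.colStep ?_ hnd (fun a ha => ?_) hr (fun h1 h2 => ?_)
  · rwa [hlen, length_eventLabels]
  · rw [S.mem_inn i hi]
    constructor
    · intro h
      rw [h, S.ord_vtx i hi]
    · intro h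
      rw [← h, S.vtx_ord]
  · rw [S.ord_vtx i hi]
    exact htip h1 h2

theorem colStep_right (hi : i < S.n) (h : HubStep (S.low i).length (S.out i).length
      ((S.low i).length + (S.out i).length + (S.upp i).length)
      ((S.low i).length + 1 + (S.upp i).length) post ev)
    (hr : ∀ k, (S.low i).length < k → k < (S.low i).length + (S.out i).length →
      ∃ z : ℤ, post k = 4 * z + 2)
    (htip : (S.out i).length = 1 → ev ((S.low i).length + 1) = ev (S.low i).length + 3 / 2 →
      S.inn i = []) :
    ColStep S.vl S.vr (fun v => S.inn (S.ord v) = []) (fun v => S.out (S.ord v) = []) 0 2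
      ⟨eventLabels (S.low i) (S.upp i) (S.vtx i), ev⟩ ⟨(S.st (i + 1)).map Sum.inl, post⟩ := by
  have hnd := S.nodup (i + 1) hi
  have hlen := S.length_st_succ hi
  rw [S.st_succ i hi] at hnd hlen ⊢
  refine (HubStep.colStep ?_ hnd (fun a ha => ?_) hr (fun h1 h2 => ?_)).symm
  · rwa [hlen, length_eventLabels]
  · rw [S.mem_out i hi]
    constructor
    · intro h
      rw [h, S.ord_vtx i hi]
    · intro h
      rw [← h, S.vtx_ord]
  · rw [S.ord_vtx i hi]
    exact htip h1 h2

/-- A tip between the discs replacing a disc is at its center, and the further discs are away from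
it. -/
theorem splitHeight_tip {N K : ℕ} (hY : 4 * (N : ℝ) + 8 ≤ Y) (hK : K ≤ N) (m : ℕ) (hm : m ≤ N + 1) :
    1 ≤ |base Y N K - splitHeight (base Y N) (5 / 4) K m| := by
  rw [le_abs]
  rcases split_cases K m with h | h | h | ⟨j, h, rfl⟩
  · rw [splitHeight_lt h]
    left
    linarith [base_lt hY h hK]
  · subst h
    rw [splitHeight_eq]
    left
    linarith
  · subst h
    rw [splitHeight_succ]
    right
    linarith
  · rw [splitHeight_gt h]
    right
    linarith [base_lt hY h (by omega)]

/-- There is room for the discs around a vertex when the columns are high enough. -/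
theorem exists_isEventHeights (hi : 0 < i) (hi' : i + 1 < S.n) (hY : 4 * (((S.low i).length +
      (S.inn i).length + (S.out i).length + (S.upp i).length : ℕ) : ℝ) + 12 ≤ Y) :
    ∃ pre ev post, S.IsEventHeights Y i pre ev post := by
  have hin : i < S.n := by omega
  have hlen := S.length_st hin
  have hlen' := S.length_st_succ hin
  have hne := List.length_pos_iff.2 (S.st_ne i hi hin)
  have hne' := List.length_pos_iff.2 (S.st_ne (i + 1) (by omega) hi')
  set K := (S.low i).length
  set u := (S.upp i).length
  push_cast at hY
  have hKr : (0 : ℝ) ≤ K := Nat.cast_nonneg _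
  have hur : (0 : ℝ) ≤ u := Nat.cast_nonneg _
  have hir : (0 : ℝ) ≤ (S.inn i).length := Nat.cast_nonneg _
  have hor : (0 : ℝ) ≤ (S.out i).length := Nat.cast_nonneg _
  rcases S.kind i hin with ⟨h1, h2⟩ | ⟨h1, h2⟩ | ⟨h1, h2⟩
  · have h1' : 1 ≤ (S.inn i).length := List.length_pos_iff.2 h1
    have h2' : 1 ≤ (S.out i).length := List.length_pos_iff.2 h2
    have hpre := arm_hubStep (K := K) (Y := Y) (δ := 0) h1' (n := u) (by push_cast; linarith)
      le_rfl (by norm_num)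
    have hpost := arm_hubStep (K := K) (Y := Y) (δ := 2) h2' (n := u) (by push_cast; linarith)
      (by norm_num) le_rfl
    have hYN : 4 * ((K + 1 + u : ℕ) : ℝ) + 8 ≤ Y := by push_cast; linarith
    have hgap : ∀ k < K + 1 + u, arm Y 0 K 1 (K + 1 + u) k + 4 ≤ arm Y 0 K 1 (K + 1 + u) (k + 1) :=
      fun k hk => arm_gap le_rfl hYN le_rfl (by norm_num) hk
    have hgood := arm_goodColumn (Y := Y) (δ := 0) (K := K) (m := 1) (N := K + 1 + u) le_rfl
      (by omega) hYN le_rfl (by norm_num)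
    refine ⟨_, _, _, ?_, ?_, fun k hk => ?_, ?_, ?_, colStep_left hin hpre ?_ ?_,
      colStep_right hin hpost ?_ ?_, ?_⟩
    · rw [hlen]
      exact arm_goodColumn h1' (by omega) (by push_cast; linarith) le_rfl (by norm_num)
    · rw [hlen']
      exact arm_goodColumn h2' (by omega) (by push_cast; linarith) (by norm_num) le_rfl
    · left
      linarith [hgap k hk]
    · exact hgood.bottom
    · exact hgood.top
    · intro k h3 h4
      exact ⟨k, by rw [arm_mid h3 h4]; push_cast; rfl⟩
    · intro _ h
      linarith [hgap K (by omega)]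
    · intro k h3 h4
      exact ⟨k, by rw [arm_mid h3 h4]; push_cast; rfl⟩
    · intro _ h
      linarith [hgap K (by omega)]
    · intro h
      exact absurd h (by simp [h1, h2])
  · have h1' : (S.inn i).length = 0 := by rw [h1]; rfl
    rw [h1', Nat.add_zero] at hlen
    rw [h2] at hlen'
    have hYN : 4 * ((K + u : ℕ) : ℝ) + 8 ≤ Y := by push_cast; linarith
    have hN : 1 ≤ K + u := by omega
    have hb := base_bounds (k := K) hYN (by omega)
    have hs := splitHeight_bounds (Y := Y) (ε := 3 / 4) (N := K + u) (K := K) hN (by omega)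
      (by norm_num) (by norm_num)
    have e1 : K + 1 + u = K + u + 1 := by omega
    refine ⟨base Y (K + u), splitHeight (base Y (K + u)) (3 / 4) K,
      splitHeight (base Y (K + u)) (5 / 4) K, ?_, ?_, fun k hk => ?_, hs.1, ?_,
      colStep_left hin ?_ ?_ ?_, colStep_right hin ?_ ?_ ?_, ?_⟩
    · rw [hlen]
      exact base_goodColumn hN hYN
    · rw [hlen', e1]
      exact splitHeight_goodColumn hN hYN (by omega)
    · by_cases hk' : k = K
      · right
        subst hk'
        rw [splitHeight_eq, splitHeight_succ, sub_add_cancel]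
        refine ⟨by ring, hb.1, hb.2, Or.inl fun m hm => ?_⟩
        exact splitHeight_tip hYN (by omega) m (by omega)
      · left
        exact splitHeight_gap hYN (by omega) (by norm_num) (by omega) hk'
    · rw [e1]
      exact hs.2
    · rw [h1', e1]
      exact base_hubStep hYN (by omega)
    · intro k h3 h4
      omega
    · omega
    · rw [h2, e1]
      exact split_hubStep hYN (by omega)
    · intro k h3 h4
      omega
    · exact fun _ _ => h1
    · intro _
      rw [splitHeight_eq, splitHeight_succ]
      ring
  · have h2' : (S.out i).length = 0 := by rw [h2]; rfl
    rw [h2', Nat.add_zero] at hlen'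
    rw [h1] at hlen
    have hYN : 4 * ((K + u : ℕ) : ℝ) + 8 ≤ Y := by push_cast; linarith
    have hN : 1 ≤ K + u := by omega
    have hb := base_bounds (k := K) hYN (by omega)
    have hs := splitHeight_bounds (Y := Y) (ε := 3 / 4) (N := K + u) (K := K) hN (by omega)
      (by norm_num) (by norm_num)
    have e1 : K + 1 + u = K + u + 1 := by omega
    refine ⟨splitHeight (base Y (K + u)) (5 / 4) K, splitHeight (base Y (K + u)) (3 / 4) K,
      base Y (K + u), ?_, ?_, fun k hk => ?_, hs.1, ?_,
      colStep_left hin ?_ ?_ ?_, colStep_right hin ?_ ?_ ?_, ?_⟩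
    · rw [hlen, e1]
      exact splitHeight_goodColumn hN hYN (by omega)
    · rw [hlen']
      exact base_goodColumn hN hYN
    · by_cases hk' : k = K
      · right
        subst hk'
        rw [splitHeight_eq, splitHeight_succ, sub_add_cancel]
        refine ⟨by ring, hb.1, hb.2, Or.inr fun m hm => ?_⟩
        exact splitHeight_tip hYN (by omega) m (by omega)
      · left
        exact splitHeight_gap hYN (by omega) (by norm_num) (by omega) hk'
    · rw [e1]
      exact hs.2
    · rw [h1, e1]
      exact split_hubStep hYN (by omega)
    · intro k h3 h4
      omega
    · exact fun _ _ => h2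
    · rw [h2', e1]
      exact base_hubStep hYN (by omega)
    · intro k h3 h4
      omega
    · omega
    · intro _
      rw [splitHeight_eq, splitHeight_succ]
      ring

/-- The heights of two discs bounding a single strand, in the first and the last column. -/
noncomputable def endHeights (Y : ℝ) (k : ℕ) : ℝ := if k = 0 then -5 / 4 else Y + 5 / 4

theorem endHeights_good (hY : 4 ≤ Y) : GoodColumn Y 1 (endHeights Y) := by
  refine ⟨fun k hk => ?_, ?_, ?_⟩
  · obtain rfl : k = 0 := by omega
    norm_num [endHeights]
    linarith
  · norm_num [endHeights]
  · norm_num [endHeights]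

theorem st_one : ∃ a, S.st 1 = [a] := by
  have hn := S.two_le_n
  have h0 : S.inn 0 = [] := List.eq_nil_iff_forall_not_mem.2 fun a ha => by
    have := (S.mem_inn 0 (by omega) a).1 ha
    have := S.ord_vl_lt a
    omega
  have h1 : S.low 0 ++ S.inn 0 ++ S.upp 0 = [] := by
    rw [← S.st_eq 0 (by omega)]
    exact List.eq_nil_iff_forall_not_mem.2 fun a ha => by
      have := (S.mem_st 0 (by omega) a).1 ha
      omega
  simp only [List.append_eq_nil_iff] at h1
  rcases S.kind 0 (by omega) with ⟨h2, -⟩ | ⟨-, h2⟩ | ⟨h2, -⟩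
  · exact absurd h0 h2
  · rw [S.st_succ 0 (by omega), h1.1.1, h1.2, List.nil_append, List.append_nil]
    exact List.length_eq_one_iff.1 h2
  · rw [h0] at h2
    exact absurd h2 (by simp)

theorem st_last : ∃ a, S.st (S.n - 1) = [a] := by
  have hn := S.two_le_n
  have h0 : S.out (S.n - 1) = [] := List.eq_nil_iff_forall_not_mem.2 fun a ha => by
    have := (S.mem_out (S.n - 1) (by omega) a).1 ha
    have := S.ord_vl_lt a
    have := S.ord_lt (S.vr a)
    omega
  have h1 : S.low (S.n - 1) ++ S.out (S.n - 1) ++ S.upp (S.n - 1) = [] := by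
    rw [← S.st_succ _ (by omega), show S.n - 1 + 1 = S.n by omega]
    exact List.eq_nil_iff_forall_not_mem.2 fun a ha => by
      have := (S.mem_st S.n le_rfl a).1 ha
      have := S.ord_lt (S.vr a)
      omega
  simp only [List.append_eq_nil_iff] at h1
  rcases S.kind (S.n - 1) (by omega) with ⟨-, h2⟩ | ⟨-, h2⟩ | ⟨h2, -⟩
  · exact absurd h0 h2
  · rw [h0] at h2
    exact absurd h2 (by simp)
  · rw [S.st_eq _ (by omega), h1.1.1, h1.2, List.nil_append, List.append_nil]
    exact List.length_eq_one_iff.1 h2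

variable (S) in
/-- Heights of the discs of the columns before, at, and after each vertex. At the first and the last
vertex there are only the columns on one side. -/
structure Heights (Y : ℝ) where
  /-- the heights before a vertex -/
  pre : ℕ → ℕ → ℝ
  /-- the heights at a vertex -/
  ev : ℕ → ℕ → ℝ
  /-- the heights after a vertex -/
  post : ℕ → ℕ → ℝ
  spec : ∀ i, 0 < i → i + 1 < S.n → S.IsEventHeights Y i (pre i) (ev i) (post i)
  twelve_le : 12 ≤ Y
  post_first : post 0 = endHeights Y
  pre_last : pre (S.n - 1) = endHeights Y

variable (S) in
theorem exists_heights : ∃ Y, Nonempty (S.Heights Y) := by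
  have hn := S.two_le_n
  set L : ℕ → ℕ := fun i => (S.low i).length + (S.inn i).length + (S.out i).length +
    (S.upp i).length
  set M := ∑ i ∈ Finset.range S.n, L i
  have h0 : (0 : ℝ) ≤ M := Nat.cast_nonneg _
  refine ⟨4 * M + 12, ?_⟩
  have h : ∀ i, ∃ pre ev post, 0 < i → i + 1 < S.n →
      S.IsEventHeights (4 * M + 12) i pre ev post := by
    intro i
    by_cases hi : 0 < i ∧ i + 1 < S.n
    · have hL : L i ≤ M := Finset.single_le_sum (f := L) (fun _ _ => Nat.zero_le _)
        (Finset.mem_range.2 (by omega))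
      have hLr : (L i : ℝ) ≤ M := by exact_mod_cast hL
      obtain ⟨pre, ev, post, h⟩ := exists_isEventHeights (Y := 4 * M + 12) hi.1 hi.2
        (by linarith [hLr])
      exact ⟨pre, ev, post, fun _ _ => h⟩
    · exact ⟨0, 0, 0, fun h1 h2 => absurd ⟨h1, h2⟩ hi⟩
  choose pre ev post h using h
  refine ⟨fun i => if i = S.n - 1 then endHeights _ else pre i, ev,
    fun i => if i = 0 then endHeights _ else post i, fun i h1 h2 => ?_, by linarith, if_pos rfl,
    if_pos rfl⟩
  rw [if_neg (by omega), if_neg (by omega)]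
  exact h i h1 h2

namespace Heights

variable (H : S.Heights Y)

theorem pre_good {i : ℕ} (h : 0 < i) (h' : i < S.n) :
    GoodColumn Y (S.st i).length (H.pre i) := by
  have hY := H.twelve_le
  rcases (show i + 1 ≤ S.n from h').eq_or_lt with h2 | h2
  · obtain rfl : i = S.n - 1 := by omega
    obtain ⟨a, ha⟩ := S.st_last
    rw [H.pre_last, ha]
    exact endHeights_good (by linarith)
  · exact (H.spec i h h2).pre_good

theorem post_good {i : ℕ} (h : i + 1 < S.n) :
    GoodColumn Y (S.st (i + 1)).length (H.post i) := by
  have hY := H.twelve_le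
  rcases Nat.eq_zero_or_pos i with rfl | h2
  · obtain ⟨a, ha⟩ := S.st_one
    rw [H.post_first, ha]
    exact endHeights_good (by linarith)
  · exact (H.spec i h2 h).post_good

end Heights

end Sweep

namespace Sweep

variable {V E G : Type*} [TopologicalSpace G] {S : Sweep V E G} {Y : ℝ}

/-! ### The diagram of a sweep -/

/-- The number of columns from one vertex to the next one; it is large enough for the interpolation
of the heights to have steps of at most `1 / 4`. -/
noncomputable def period (Y : ℝ) : ℕ := ⌈4 * (Y + 5 / 2)⌉₊ + 4

theorem four_le_period : 4 ≤ period Y := Nat.le_add_left _ _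

theorem le_period : 4 * (Y + 5 / 2) + 4 ≤ period Y := by
  unfold period
  push_cast
  linarith [Nat.le_ceil (4 * (Y + 5 / 2))]

namespace Heights

variable (H : S.Heights Y)

/-- The column at the place `t` after the column before the `i`-th vertex. Between the column after
a vertex and the column before the next vertex the heights are interpolated. -/
noncomputable def colAt (i t : ℕ) : Col V E :=
  if t = 0 then ⟨(S.st i).map Sum.inl, H.pre i⟩
  else if t = 1 then ⟨eventLabels (S.low i) (S.upp i) (S.vtx i), H.ev i⟩
  else ⟨(S.st (i + 1)).map Sum.inl, fun k =>
    H.post i k + ((t : ℝ) - 2) / ((period Y : ℝ) - 2) * (H.pre (i + 1) k - H.post i k)⟩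

/-- The columns of a sweep. -/
noncomputable def col (j : ℕ) : Col V E := H.colAt (j / period Y) (j % period Y)

theorem colAt_zero (i : ℕ) : H.colAt i 0 = ⟨(S.st i).map Sum.inl, H.pre i⟩ := if_pos rfl

theorem colAt_one (i : ℕ) :
    H.colAt i 1 = ⟨eventLabels (S.low i) (S.upp i) (S.vtx i), H.ev i⟩ := by
  rw [colAt, if_neg one_ne_zero, if_pos rfl]

theorem colAt_of_two_le {i t : ℕ} (ht : 2 ≤ t) : H.colAt i t =
    ⟨(S.st (i + 1)).map Sum.inl, fun k =>
      H.post i k + ((t : ℝ) - 2) / ((period Y : ℝ) - 2) * (H.pre (i + 1) k - H.post i k)⟩ := by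
  rw [colAt, if_neg (by omega), if_neg (by omega)]

theorem colAt_two (i : ℕ) : H.colAt i 2 = ⟨(S.st (i + 1)).map Sum.inl, H.post i⟩ := by
  rw [H.colAt_of_two_le le_rfl]
  simp

theorem colAt_period (i : ℕ) : H.colAt i (period Y) = H.colAt (i + 1) 0 := by
  have h := four_le_period (Y := Y)
  have hr : (4 : ℝ) ≤ period Y := by exact_mod_cast h
  rw [H.colAt_of_two_le (by omega), H.colAt_zero, div_self (by linarith)]
  simp

theorem col_mul_add {i t : ℕ} (ht : t ≤ period Y) : H.col (i * period Y + t) = H.colAt i t := by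
  have h := four_le_period (Y := Y)
  have key : ∀ i t, t < period Y → H.col (i * period Y + t) = H.colAt i t := by
    intro i t ht
    rw [col, Nat.mul_comm, Nat.mul_add_div (by omega), Nat.mul_add_mod, Nat.mod_eq_of_lt ht,
      Nat.div_eq_of_lt ht, Nat.add_zero]
  rcases ht.eq_or_lt with rfl | h
  · rw [colAt_period, ← key (i + 1) 0 (by omega), Nat.add_zero, Nat.add_mul, Nat.one_mul]
  · exact key i t h

theorem exists_eq_mul_add {j : ℕ} (h : 2 ≤ j) (h' : j < (S.n - 1) * period Y) :
    ∃ i t, j = i * period Y + t ∧ t < period Y ∧ (i = 0 → 2 ≤ t) ∧ i + 1 < S.n := by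
  have hW := four_le_period (Y := Y)
  have h1 : j / period Y < S.n - 1 := Nat.div_lt_of_lt_mul (by rwa [Nat.mul_comm])
  refine ⟨j / period Y, j % period Y, ?_, Nat.mod_lt _ (by omega), fun h0 => ?_,
    Nat.lt_sub_iff_add_lt.1 h1⟩
  · rw [Nat.mul_comm]
    exact (Nat.div_add_mod _ _).symm
  · have := Nat.div_add_mod j (period Y)
    rw [h0, Nat.mul_zero, Nat.zero_add] at this
    omega

theorem abs_pre_sub_post {i : ℕ} (hi : i + 1 < S.n) {k : ℕ} (hk : k ≤ (S.st (i + 1)).length) :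
    |H.pre (i + 1) k - H.post i k| ≤ Y + 5 / 2 := by
  have key : ∀ p, GoodColumn Y (S.st (i + 1)).length p → -5 / 4 ≤ p k ∧ p k ≤ Y + 5 / 4 := by
    intro p hp
    constructor
    · rcases Nat.eq_zero_or_pos k with rfl | h
      · exact hp.bottom.1
      · linarith [hp.lt h hk, hp.bottom.1]
    · rcases hk.eq_or_lt with rfl | h
      · exact hp.top.2
      · linarith [hp.lt h le_rfl, hp.top.2]
  have h1 := key _ (H.pre_good (Nat.succ_pos i) hi)
  have h2 := key _ (H.post_good hi)
  rw [abs_le]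
  constructor <;> linarith [h1.1, h1.2, h2.1, h2.2]

theorem colAt_good {i t : ℕ} (hi : i + 1 < S.n) (ht : 2 ≤ t) (ht' : t ≤ period Y) :
    GoodColumn Y (S.st (i + 1)).length (H.colAt i t).p := by
  have hW := four_le_period (Y := Y)
  have h1 := H.pre_good (Nat.succ_pos i) hi
  have h2 := H.post_good hi
  have hWr : (4 : ℝ) ≤ period Y := by exact_mod_cast hW
  have htr : (2 : ℝ) ≤ t := by exact_mod_cast ht
  have htr' : (t : ℝ) ≤ period Y := by exact_mod_cast ht'
  have hc : 0 ≤ ((t : ℝ) - 2) / ((period Y : ℝ) - 2) := div_nonneg (by linarith) (by linarith)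
  have hc' : ((t : ℝ) - 2) / ((period Y : ℝ) - 2) ≤ 1 := by
    rw [div_le_one (by linarith)]
    linarith
  rw [H.colAt_of_two_le ht]
  generalize ((t : ℝ) - 2) / ((period Y : ℝ) - 2) = c at hc hc'
  refine ⟨fun k hk => ?_, ⟨?_, ?_⟩, ?_, ?_⟩
  · nlinarith [h1.gap k hk, h2.gap k hk]
  · nlinarith [h1.bottom.1, h2.bottom.1]
  · nlinarith [h1.bottom.2, h2.bottom.2]
  · nlinarith [h1.top.1, h2.top.1]
  · nlinarith [h1.top.2, h2.top.2]

theorem colAt_step {i t : ℕ} (hi : i + 1 < S.n) (ht : t < period Y) (h0 : i = 0 → 2 ≤ t) :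
    ColStep S.vl S.vr (fun v => S.inn (S.ord v) = []) (fun v => S.out (S.ord v) = []) 0 2
      (H.colAt i t) (H.colAt i (t + 1)) := by
  rcases (by omega : t = 0 ∨ t = 1 ∨ 2 ≤ t) with rfl | rfl | h
  · rw [colAt_zero, colAt_one]
    exact (H.spec i (by omega) hi).step_left
  · rw [colAt_one, colAt_two]
    exact (H.spec i (by omega) hi).step_right
  · have hg := H.colAt_good hi h ht.le
    have hg' := H.colAt_good hi (show 2 ≤ t + 1 by omega) ht
    rw [H.colAt_of_two_le h] at hg ⊢
    rw [H.colAt_of_two_le (by omega)] at hg' ⊢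
    refine colStep_of_close (S.nodup _ hi.le) hg hg' fun k hk => ?_
    have h1 := H.abs_pre_sub_post hi hk
    have hWp := le_period (Y := Y)
    have hY := H.twelve_le
    have e : H.post i k + ((t : ℝ) - 2) / ((period Y : ℝ) - 2) * (H.pre (i + 1) k - H.post i k) -
        (H.post i k + (((t + 1 : ℕ) : ℝ) - 2) / ((period Y : ℝ) - 2) *
          (H.pre (i + 1) k - H.post i k)) =
        -((H.pre (i + 1) k - H.post i k) / ((period Y : ℝ) - 2)) := by
      push_cast
      ring
    rw [e, abs_neg, abs_div, abs_of_pos (by linarith : (0 : ℝ) < (period Y : ℝ) - 2),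
      div_le_iff₀ (by linarith)]
    linarith

theorem col_step {j : ℕ} (h : 2 ≤ j) (h' : j < (S.n - 1) * period Y) :
    ColStep S.vl S.vr (fun v => S.inn (S.ord v) = []) (fun v => S.out (S.ord v) = []) 0 2
      (H.col j) (H.col (j + 1)) := by
  obtain ⟨i, t, rfl, ht, h0, hi⟩ := exists_eq_mul_add h h'
  rw [Nat.add_assoc, H.col_mul_add ht.le, H.col_mul_add ht]
  exact H.colAt_step hi ht h0

/-- A column has the strands between two vertices, or it is the column of a vertex. -/
theorem col_cases {j : ℕ} (h : 2 ≤ j) (h' : j ≤ (S.n - 1) * period Y) :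
    (∃ i, i + 1 < S.n ∧ i * period Y + 2 ≤ j ∧ j ≤ (i + 1) * period Y ∧
      (H.col j).lab = (S.st (i + 1)).map Sum.inl ∧
      GoodColumn Y (S.st (i + 1)).length (H.col j).p) ∨
    ∃ i, 0 < i ∧ i + 1 < S.n ∧ j = i * period Y + 1 ∧
      H.col j = ⟨eventLabels (S.low i) (S.upp i) (S.vtx i), H.ev i⟩ := by
  have hW := four_le_period (Y := Y)
  have key : ∃ i t, j = i * period Y + t ∧ t ≤ period Y ∧ 1 ≤ t ∧ (i = 0 → 2 ≤ t) ∧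
      i + 1 < S.n := by
    have hn := S.two_le_n
    have shift : ∀ i, 0 < i → i * period Y = (i - 1) * period Y + period Y := by
      intro i hi
      obtain ⟨m, rfl⟩ : ∃ m, i = m + 1 := ⟨i - 1, by omega⟩
      rw [Nat.add_mul, Nat.one_mul, Nat.add_sub_cancel]
    rcases h'.eq_or_lt with h1 | h1
    · exact ⟨S.n - 1 - 1, period Y, by rw [h1, shift _ (by omega)], le_rfl, by omega,
        fun _ => by omega, by omega⟩
    · obtain ⟨i, t, h2, h3, h4, h5⟩ := exists_eq_mul_add h h1
      rcases Nat.eq_zero_or_pos t with rfl | ht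
      · exact ⟨i - 1, period Y, by rw [h2, shift i (by omega), Nat.add_zero], le_rfl, by omega,
          fun _ => by omega, by omega⟩
      · exact ⟨i, t, h2, h3.le, ht, h4, h5⟩
  obtain ⟨i, t, rfl, ht, h1, h0, hi⟩ := key
  rw [H.col_mul_add ht]
  rcases (by omega : t = 1 ∨ 2 ≤ t) with rfl | h
  · exact Or.inr ⟨i, by omega, hi, rfl, H.colAt_one i⟩
  · refine Or.inl ⟨i, hi, by omega, ?_, ?_, H.colAt_good hi h ht⟩
    · rw [Nat.add_mul]
      omega
    · rw [H.colAt_of_two_le h]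

/-- The diagram of a sweep. -/
noncomputable def diagram : Diagram where
  first := 2
  last := (S.n - 1) * period Y
  Y := Y
  N j := (H.col j).lab.length
  p j := (H.col j).p
  first_le_last := by
    have h1 := four_le_period (Y := Y)
    have h2 := S.two_le_n
    nlinarith [Nat.sub_add_cancel (show 1 ≤ S.n by omega)]
  four_le_Y := by linarith [H.twelve_le]
  gap j h1 h2 k hk := by
    rcases H.col_cases h1 h2 with ⟨i, -, -, -, hl, hg⟩ | ⟨i, h3, h4, -, hc⟩
    · rw [hl, List.length_map] at hk
      exact Or.inl (hg.gap k hk)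
    · rw [hc] at hk ⊢
      rw [length_eventLabels] at hk
      exact ((H.spec i h3 h4).ev_gap k hk).imp_right fun h => h.1
  bottom j h1 h2 := by
    rcases H.col_cases h1 h2 with ⟨i, -, -, -, hl, hg⟩ | ⟨i, h3, h4, -, hc⟩
    · exact hg.bottom
    · rw [hc]
      exact (H.spec i h3 h4).ev_bottom
  top j h1 h2 := by
    rcases H.col_cases h1 h2 with ⟨i, -, -, -, hl, hg⟩ | ⟨i, h3, h4, -, hc⟩
    · rw [hl, List.length_map]
      exact hg.top
    · rw [hc, length_eventLabels]
      exact (H.spec i h3 h4).ev_top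
  step j h1 h2 := (H.col_step h1 h2).step
  bottom_link j h1 h2 := (H.col_step h1 h2).bottom_link
  top_link j h1 h2 := (H.col_step h1 h2).top_link
  link_right j h1 h2 i hi := by
    simpa only [add_zero] using (H.col_step h1 h2).link_right i hi
  link_left j h1 h2 := (H.col_step h1 h2).link_left
  tip j h1 h2 k hk h := by
    rcases H.col_cases h1 h2 with ⟨i, -, -, -, hl, hg⟩ | ⟨i, h3, h4, rfl, hc⟩
    · rw [hl, List.length_map] at hk
      linarith [hg.gap k hk]
    · have hW := four_le_period (Y := Y)
      have hnext : H.col (i * period Y + 1 + 1) = ⟨(S.st (i + 1)).map Sum.inl, H.post i⟩ := by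
        rw [Nat.add_assoc, H.col_mul_add (by omega), H.colAt_two]
      have hprev : H.col (i * period Y + 1 - 1) = ⟨(S.st i).map Sum.inl, H.pre i⟩ := by
        rw [Nat.add_sub_cancel, ← Nat.add_zero (i * period Y), H.col_mul_add (by omega),
          H.colAt_zero]
      rw [hnext, hprev, hc]
      rw [hc] at hk h
      rw [length_eventLabels] at hk
      simp only [List.length_map]
      rcases (H.spec i h3 h4).ev_gap k hk with e | e
      · simp only at h
        linarith
      · exact e.2
  first_col := by
    have hW := four_le_period (Y := Y)
    have h : H.col 2 = H.colAt 0 2 := by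
      have := H.col_mul_add (i := 0) (show 2 ≤ period Y by omega)
      rwa [Nat.zero_mul, Nat.zero_add] at this
    obtain ⟨a, ha⟩ := S.st_one
    rw [h, H.colAt_two, Nat.zero_add, ha, H.post_first]
    simp [endHeights]
  last_col := by
    have h := H.col_mul_add (i := S.n - 1) (Nat.zero_le (period Y))
    rw [Nat.add_zero] at h
    obtain ⟨a, ha⟩ := S.st_last
    rw [h, H.colAt_zero, ha, H.pre_last]
    simp [endHeights]

end Heights

end Sweep

namespace Sweep

variable {V E G : Type*} [TopologicalSpace G] {S : Sweep V E G} {Y : ℝ}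

/-! ### The labelling of the diagram of a sweep -/

theorem eq_of_ord_eq {v w : V} (h : S.ord v = S.ord w) : v = w := by
  rw [← S.vtx_ord v, h, S.vtx_ord]

theorem nodup_eventLabels {i : ℕ} (hi : i < S.n) :
    (eventLabels (S.low i) (S.upp i) (S.vtx i)).Nodup := by
  have h := S.nodup i hi.le
  rw [S.st_eq i hi] at h
  have h' : (S.low i ++ S.upp i).Nodup := h.sublist
    (List.append_sublist_append_right _ |>.2 (List.sublist_append_left _ _))
  rw [List.nodup_append] at h'
  have hinj : Function.Injective (Sum.inl : E → E ⊕ V) := Sum.inl_injective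
  unfold eventLabels
  rw [List.nodup_append, List.nodup_append]
  refine ⟨⟨h'.1.map hinj, List.nodup_singleton _, ?_⟩, h'.2.1.map hinj, ?_⟩
  · simp
  · simp only [List.mem_append, List.mem_map, List.mem_singleton]
    rintro _ (⟨a, ha, rfl⟩ | rfl) _ ⟨b, hb, rfl⟩ h
    · exact h'.2.2 a ha b hb (hinj h)
    · exact absurd h (by simp)

variable (S) in
/-- The horizontal position of a vertex: its column, or the tip of its overlap of discs if it has
only one edge, or a corner of the lens if it is the first or the last vertex. -/
noncomputable def position (xL xR : ℝ) (Y : ℝ) (v : V) : ℝ :=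
  open scoped Classical in
  if S.ord v = 0 then xL else if S.ord v = S.n - 1 then xR
  else if S.inn (S.ord v) = [] then ((S.ord v * period Y + 1 : ℕ) : ℝ) + Real.sqrt 7 / 4
  else if S.out (S.ord v) = [] then ((S.ord v * period Y + 1 : ℕ) : ℝ) - Real.sqrt 7 / 4
  else ((S.ord v * period Y + 1 : ℕ) : ℝ)

namespace Heights

variable (H : S.Heights Y)

/-- The horizontal position of a vertex in the diagram of a sweep. -/
noncomputable def pos (v : V) : ℝ := S.position H.diagram.xL H.diagram.xR Y v

variable {H}

theorem pos_zero {v : V} (h : S.ord v = 0) : H.pos v = H.diagram.xL := if_pos h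

theorem pos_last {v : V} (h : S.ord v = S.n - 1) : H.pos v = H.diagram.xR := by
  have := S.two_le_n
  rw [pos, position, if_neg (by omega), if_pos h]

theorem pos_of_inn {v : V} (h : S.ord v ≠ 0) (h' : S.ord v ≠ S.n - 1) (hi : S.inn (S.ord v) = []) :
    H.pos v = ((S.ord v * period Y + 1 : ℕ) : ℝ) + Real.sqrt 7 / 4 := by
  rw [pos, position, if_neg h, if_neg h', if_pos hi]

theorem inn_ne_nil {v : V} (ho : S.out (S.ord v) = []) : S.inn (S.ord v) ≠ [] := by
  intro h
  rcases S.kind _ (S.ord_lt v) with ⟨h1, -⟩ | ⟨-, h1⟩ | ⟨h1, -⟩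
  · exact h1 h
  · exact absurd h1 (by simp [ho])
  · exact absurd h1 (by simp [h])

theorem pos_of_out {v : V} (h : S.ord v ≠ 0) (h' : S.ord v ≠ S.n - 1) (ho : S.out (S.ord v) = []) :
    H.pos v = ((S.ord v * period Y + 1 : ℕ) : ℝ) - Real.sqrt 7 / 4 := by
  rw [pos, position, if_neg h, if_neg h', if_neg (inn_ne_nil ho), if_pos ho]

theorem pos_of_core {v : V} (h : S.ord v ≠ 0) (h' : S.ord v ≠ S.n - 1) (hi : S.inn (S.ord v) ≠ [])
    (ho : S.out (S.ord v) ≠ []) : H.pos v = ((S.ord v * period Y + 1 : ℕ) : ℝ) := by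
  rw [pos, position, if_neg h, if_neg h', if_neg hi, if_neg ho]

theorem pos_le {v : V} (h' : S.ord v ≠ S.n - 1) : H.pos v ≤ (S.ord v * period Y + 1 : ℕ) + 1 := by
  have hb := Diagram.sqrt_seven_bounds
  by_cases h : S.ord v = 0
  · have := H.diagram.xL_lt
    have e : (H.diagram.first : ℝ) = (2 : ℕ) := rfl
    rw [pos_zero h, h]
    rw [e] at this
    push_cast at this ⊢
    linarith
  by_cases hi : S.inn (S.ord v) = []
  · rw [pos_of_inn h h' hi]
    linarith
  by_cases ho : S.out (S.ord v) = []
  · rw [pos_of_out h h' ho]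
    linarith
  · rw [pos_of_core h h' hi ho]
    linarith

theorem le_pos {v : V} (h : S.ord v ≠ 0) : ((S.ord v * period Y + 1 : ℕ) : ℝ) - 1 ≤ H.pos v := by
  have hb := Diagram.sqrt_seven_bounds
  by_cases h' : S.ord v = S.n - 1
  · have := H.diagram.lt_xR
    have e : (H.diagram.last : ℝ) = ((S.n - 1) * period Y : ℕ) := rfl
    rw [pos_last h', h']
    rw [e] at this
    rw [Nat.cast_add, Nat.cast_one]
    linarith
  by_cases hi : S.inn (S.ord v) = []
  · rw [pos_of_inn h h' hi]
    linarith
  by_cases ho : S.out (S.ord v) = []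
  · rw [pos_of_out h h' ho]
    linarith
  · rw [pos_of_core h h' hi ho]
    linarith

theorem pos_lt (a : E) : H.pos (S.vl a) < H.pos (S.vr a) := by
  have h1 := S.ord_vl_lt a
  have h2 := S.ord_lt (S.vr a)
  have h3 := pos_le (H := H) (v := S.vl a) (by omega)
  have h4 := le_pos (H := H) (v := S.vr a) (by omega)
  have hW : (4 : ℝ) ≤ period Y := by exact_mod_cast four_le_period (Y := Y)
  have h5 : ((S.ord (S.vl a) : ℝ) + 1) * period Y ≤ S.ord (S.vr a) * period Y :=
    mul_le_mul_of_nonneg_right (by exact_mod_cast h1) (by linarith)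
  push_cast at h3 h4
  linarith

/-- The labels of the gaps of the diagram of a sweep. -/
noncomputable def lab (H : S.Heights Y) (j k : ℕ) : E ⊕ V :=
  ((H.col j).lab[k]?).getD (Sum.inr (S.vtx 0))

theorem lab_eq_iff {j k : ℕ} (hk : k < (H.col j).lab.length) {x : E ⊕ V} :
    H.lab j k = x ↔ (H.col j).lab[k]? = some x := by
  rw [lab, List.getElem?_eq_getElem hk, Option.getD_some, Option.some_inj]

theorem mul_period_add_one_lt {i i' : ℕ} :
    i * period Y + 1 < i' * period Y + 1 ↔ i < i' := by
  have hW := four_le_period (Y := Y)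
  rw [Nat.add_lt_add_iff_right]
  exact Nat.mul_lt_mul_right (by omega)

theorem le_of_mul_period_add_two_le {i i' : ℕ}
    (h : i' * period Y + 2 ≤ (i + 1) * period Y) : i' ≤ i := by
  have hW := four_le_period (Y := Y)
  have : i' < i + 1 := (Nat.mul_lt_mul_right (show 0 < period Y by omega)).1 (by omega)
  omega

theorem nodup_lab {j : ℕ} (h1 : 2 ≤ j) (h2 : j ≤ (S.n - 1) * period Y) :
    (H.col j).lab.Nodup := by
  rcases H.col_cases h1 h2 with ⟨i, hi, -, -, hl, -⟩ | ⟨i, -, hi, -, hc⟩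
  · rw [hl]
    exact (S.nodup _ hi.le).map Sum.inl_injective
  · rw [hc]
    exact nodup_eventLabels (by omega)

theorem mem_low_or_upp {i : ℕ} {a : E} (hi : i < S.n) (h : a ∈ S.low i ∨ a ∈ S.upp i) :
    S.ord (S.vl a) < i ∧ i < S.ord (S.vr a) := by
  have h1 : a ∈ S.st i := by
    rw [S.st_eq i hi, List.mem_append, List.mem_append]
    tauto
  have h2 : a ∈ S.st (i + 1) := by
    rw [S.st_succ i hi, List.mem_append, List.mem_append]
    tauto
  exact ⟨((S.mem_st i hi.le a).1 h1).1, ((S.mem_st (i + 1) hi a).1 h2).2⟩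

theorem lab_edge_time {j k : ℕ} (h1 : 2 ≤ j) (h2 : j ≤ (S.n - 1) * period Y) {a : E}
    (h : (H.col j).lab[k]? = some (Sum.inl a)) :
    S.ord (S.vl a) * period Y + 1 < j ∧ j < S.ord (S.vr a) * period Y + 1 := by
  rcases H.col_cases h1 h2 with ⟨i, hi, h3, h4, hl, -⟩ | ⟨i, -, hi, rfl, hc⟩
  · rw [hl, getElem?_map_inl] at h
    obtain ⟨a', ha, h⟩ := h
    obtain rfl := Sum.inl_injective ha
    have h5 := (S.mem_st (i + 1) hi.le a).1 (List.mem_of_getElem? h)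
    have h6 : S.ord (S.vl a) * period Y ≤ i * period Y := Nat.mul_le_mul_right _ (by omega)
    have h7 : (i + 1) * period Y ≤ S.ord (S.vr a) * period Y := Nat.mul_le_mul_right _ h5.2
    omega
  · rw [hc, eventLabels_inl] at h
    rw [mul_period_add_one_lt, mul_period_add_one_lt]
    exact mem_low_or_upp (by omega) (h.imp (fun h => List.mem_of_getElem? h.2)
      fun h => List.mem_of_getElem? h.2)

theorem lab_vert_time {j k : ℕ} (h1 : 2 ≤ j) (h2 : j ≤ (S.n - 1) * period Y) {v : V}
    (h : (H.col j).lab[k]? = some (Sum.inr v)) : S.ord v * period Y + 1 = j := by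
  rcases H.col_cases h1 h2 with ⟨i, hi, h3, h4, hl, -⟩ | ⟨i, -, hi, rfl, hc⟩
  · rw [hl, getElem?_map_inl] at h
    obtain ⟨a', ha, h⟩ := h
    exact absurd ha (by simp)
  · rw [hc, eventLabels_inr] at h
    rw [h.2, S.ord_vtx i (by omega)]

theorem exists_lab_edge {j : ℕ} (h1 : 2 ≤ j) (h2 : j ≤ (S.n - 1) * period Y) {a : E}
    (h3 : S.ord (S.vl a) * period Y + 1 < j) (h4 : j < S.ord (S.vr a) * period Y + 1) :
    Sum.inl a ∈ (H.col j).lab := by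
  rcases H.col_cases h1 h2 with ⟨i, hi, h5, h6, hl, -⟩ | ⟨i, -, hi, rfl, hc⟩
  · rw [hl, List.mem_map]
    refine ⟨a, (S.mem_st (i + 1) hi.le a).2 ⟨?_, ?_⟩, rfl⟩
    · have := le_of_mul_period_add_two_le (Y := Y)
        (show S.ord (S.vl a) * period Y + 2 ≤ (i + 1) * period Y by omega)
      omega
    · have := (mul_period_add_one_lt (Y := Y) (i := i) (i' := S.ord (S.vr a))).1 (by omega)
      omega
  · rw [mul_period_add_one_lt] at h3 h4
    have h5 : a ∈ S.st i := (S.mem_st i (by omega) a).2 ⟨h3, h4.le⟩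
    have h6 : a ∉ S.inn i := by
      rw [S.mem_inn i (by omega)]
      omega
    rw [S.st_eq i (by omega), List.mem_append, List.mem_append] at h5
    rw [hc]
    unfold eventLabels
    simp only [List.mem_append, List.mem_map, Sum.inl.injEq, exists_eq_right]
    tauto

theorem ord_bounds {v : V} (h1 : 2 ≤ S.ord v * period Y + 1)
    (h2 : S.ord v * period Y + 1 ≤ (S.n - 1) * period Y) : 0 < S.ord v ∧ S.ord v + 1 < S.n := by
  have hW := four_le_period (Y := Y)
  have hn := S.two_le_n
  have h3 : S.ord v < S.n - 1 := (Nat.mul_lt_mul_right (show 0 < period Y by omega)).1 (by omega)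
  refine ⟨Nat.pos_of_ne_zero fun h => ?_, by omega⟩
  rw [h] at h1
  omega

theorem col_ord {v : V} : H.col (S.ord v * period Y + 1) =
    ⟨eventLabels (S.low (S.ord v)) (S.upp (S.ord v)) v, H.ev (S.ord v)⟩ := by
  have hW := four_le_period (Y := Y)
  rw [H.col_mul_add (by omega), H.colAt_one, S.vtx_ord]

theorem eq_of_inn_nil {v : V} (h : S.inn (S.ord v) = []) {a a' : E}
    (ha : v = S.vl a ∨ v = S.vr a) (ha' : v = S.vl a' ∨ v = S.vr a') : a = a' := by
  have key : ∀ a, (v = S.vl a ∨ v = S.vr a) → a ∈ S.out (S.ord v) := by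
    rintro a (h1 | h1)
    · rw [S.mem_out _ (S.ord_lt v), h1]
    · have := (S.mem_inn _ (S.ord_lt v) a).2 (by rw [h1])
      rw [h] at this
      exact absurd this (by simp)
  rcases S.kind _ (S.ord_lt v) with ⟨h1, -⟩ | ⟨-, h1⟩ | ⟨h1, -⟩
  · exact absurd h h1
  · obtain ⟨b, hb⟩ := List.length_eq_one_iff.1 h1
    rw [hb] at key
    rw [List.mem_singleton.1 (key a ha), List.mem_singleton.1 (key a' ha')]
  · exact absurd h1 (by simp [h])

theorem eq_of_out_nil {v : V} (h : S.out (S.ord v) = []) {a a' : E}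
    (ha : v = S.vl a ∨ v = S.vr a) (ha' : v = S.vl a' ∨ v = S.vr a') : a = a' := by
  have key : ∀ a, (v = S.vl a ∨ v = S.vr a) → a ∈ S.inn (S.ord v) := by
    rintro a (h1 | h1)
    · have := (S.mem_out _ (S.ord_lt v) a).2 (by rw [h1])
      rw [h] at this
      exact absurd this (by simp)
    · rw [S.mem_inn _ (S.ord_lt v), h1]
  rcases S.kind _ (S.ord_lt v) with ⟨-, h1⟩ | ⟨-, h1⟩ | ⟨h1, -⟩
  · exact absurd h h1
  · exact absurd h1 (by simp [h])
  · obtain ⟨b, hb⟩ := List.length_eq_one_iff.1 h1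
    rw [hb] at key
    rw [List.mem_singleton.1 (key a ha), List.mem_singleton.1 (key a' ha')]

theorem vr_ne_of_inn_nil {v : V} (h : S.inn (S.ord v) = []) (a : E) : S.vr a ≠ v := by
  intro h1
  have := (S.mem_inn _ (S.ord_lt v) a).2 (by rw [h1])
  rw [h] at this
  exact absurd this (by simp)

theorem vl_ne_of_out_nil {v : V} (h : S.out (S.ord v) = []) (a : E) : S.vl a ≠ v := by
  intro h1
  have := (S.mem_out _ (S.ord_lt v) a).2 (by rw [h1])
  rw [h] at this
  exact absurd this (by simp)

theorem inn_zero : S.inn 0 = [] := List.eq_nil_iff_forall_not_mem.2 fun a ha => by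
  have := (S.mem_inn 0 (by have := S.two_le_n; omega) a).1 ha
  have := S.ord_vl_lt a
  omega

theorem out_last : S.out (S.n - 1) = [] := List.eq_nil_iff_forall_not_mem.2 fun a ha => by
  have := (S.mem_out (S.n - 1) (by have := S.two_le_n; omega) a).1 ha
  have := S.ord_vl_lt a
  have := S.ord_lt (S.vr a)
  omega

theorem pos_spec (v : V) :
    (2 ≤ S.ord v * period Y + 1 ∧ S.ord v * period Y + 1 ≤ (S.n - 1) * period Y ∧
      H.pos v = (S.ord v * period Y + 1 : ℕ)) ∨
    (∀ a a', (v = S.vl a ∨ v = S.vr a) → (v = S.vl a' ∨ v = S.vr a') → a = a') ∧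
    ((2 ≤ S.ord v * period Y + 1 ∧ S.ord v * period Y + 1 < (S.n - 1) * period Y ∧
        H.pos v = (S.ord v * period Y + 1 : ℕ) + Real.sqrt 7 / 4 ∧ (∀ a, S.vr a ≠ v) ∧
        H.ev (S.ord v) ((S.low (S.ord v)).length + 1) =
          H.ev (S.ord v) (S.low (S.ord v)).length + 3 / 2) ∨
      (2 < S.ord v * period Y + 1 ∧ S.ord v * period Y + 1 ≤ (S.n - 1) * period Y ∧
        H.pos v = (S.ord v * period Y + 1 : ℕ) - Real.sqrt 7 / 4 ∧ (∀ a, S.vl a ≠ v) ∧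
        H.ev (S.ord v) ((S.low (S.ord v)).length + 1) =
          H.ev (S.ord v) (S.low (S.ord v)).length + 3 / 2) ∨
      (S.ord v * period Y + 1 < 2 ∧ H.pos v = H.diagram.xL ∧ ∀ a, S.vr a ≠ v) ∨
      ((S.n - 1) * period Y < S.ord v * period Y + 1 ∧ H.pos v = H.diagram.xR ∧
        ∀ a, S.vl a ≠ v)) := by
  have hW := four_le_period (Y := Y)
  have hv := S.ord_lt v
  by_cases h : S.ord v = 0
  · have hi : S.inn (S.ord v) = [] := by
      rw [h]
      exact inn_zero
    refine Or.inr ⟨fun a a' => eq_of_inn_nil hi, Or.inr (Or.inr (Or.inl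
      ⟨by rw [h]; omega, pos_zero h, vr_ne_of_inn_nil hi⟩))⟩
  by_cases h' : S.ord v = S.n - 1
  · have ho : S.out (S.ord v) = [] := by
      rw [h']
      exact out_last
    refine Or.inr ⟨fun a a' => eq_of_out_nil ho, Or.inr (Or.inr (Or.inr
      ⟨by rw [h']; omega, pos_last h', vl_ne_of_out_nil ho⟩))⟩
  have h1 : 1 * period Y ≤ S.ord v * period Y := Nat.mul_le_mul_right _ (by omega)
  have h2 : (S.ord v + 1) * period Y ≤ (S.n - 1) * period Y := Nat.mul_le_mul_right _ (by omega)
  rw [Nat.add_mul] at h2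
  have hs := H.spec (S.ord v) (by omega) (by omega)
  by_cases hi : S.inn (S.ord v) = []
  · exact Or.inr ⟨fun a a' => eq_of_inn_nil hi, Or.inl ⟨by omega, by omega, pos_of_inn h h' hi,
      vr_ne_of_inn_nil hi, hs.tip (Or.inl hi)⟩⟩
  by_cases ho : S.out (S.ord v) = []
  · exact Or.inr ⟨fun a a' => eq_of_out_nil ho, Or.inr (Or.inl ⟨by omega, by omega,
      pos_of_out h h' ho, vl_ne_of_out_nil ho, hs.tip (Or.inr ho)⟩)⟩
  · exact Or.inl ⟨by omega, by omega, pos_of_core h h' hi ho⟩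

/-- The edge `a` as a path parametrized by the horizontal coordinate. -/
noncomputable def path (H : S.Heights Y) (a : E) (x : ℝ) : G :=
  S.γ a ((x - H.pos (S.vl a)) / (H.pos (S.vr a) - H.pos (S.vl a)))

theorem param_mem (a : E) {x : ℝ} (hx : x ∈ Set.Icc (H.pos (S.vl a)) (H.pos (S.vr a))) :
    (x - H.pos (S.vl a)) / (H.pos (S.vr a) - H.pos (S.vl a)) ∈ Set.Icc (0 : ℝ) 1 := by
  have h := pos_lt (H := H) a
  constructor
  · exact div_nonneg (by linarith [hx.1]) (by linarith)
  · rw [div_le_one (by linarith)]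
    linarith [hx.2]

theorem param_eq_zero {a : E} {x : ℝ}
    (h : (x - H.pos (S.vl a)) / (H.pos (S.vr a) - H.pos (S.vl a)) = 0) : x = H.pos (S.vl a) := by
  have h' := pos_lt (H := H) a
  rw [div_eq_zero_iff] at h
  rcases h with h | h <;> linarith

theorem param_eq_one {a : E} {x : ℝ}
    (h : (x - H.pos (S.vl a)) / (H.pos (S.vr a) - H.pos (S.vl a)) = 1) : x = H.pos (S.vr a) := by
  have h' := pos_lt (H := H) a
  rw [div_eq_one_iff_eq (by linarith)] at h
  linarith

/-- The labelling of the diagram of a sweep. -/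
noncomputable def labelling (H : S.Heights Y) : Labelling H.diagram G V E where
  vl := S.vl
  vr := S.vr
  pos := H.pos
  ev v := S.ord v * period Y + 1
  vx := S.vx
  s := H.path
  continuousOn_s a := (S.continuousOn_γ a).comp (by fun_prop) fun x hx => param_mem a hx
  s_left a := by
    rw [path, sub_self, zero_div, S.γ_zero]
  s_right a := by
    have h := pos_lt (H := H) a
    rw [path, div_self (by linarith), S.γ_one]
  s_inj a a' x x' hx hx' h := by
    rcases S.γ_inj a a' _ (param_mem a hx) _ (param_mem a' hx') h with ⟨rfl, h1⟩ | ⟨v, h1, h2⟩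
    · have h2 := pos_lt (H := H) a
      rw [div_left_inj' (by linarith)] at h1
      exact ⟨by linarith, Or.inl rfl⟩
    · have e1 : x = H.pos v ∧ (v = S.vl a ∨ v = S.vr a) := by
        rcases h1 with ⟨h1, rfl⟩ | ⟨h1, rfl⟩
        · exact ⟨param_eq_zero h1, Or.inl rfl⟩
        · exact ⟨param_eq_one h1, Or.inr rfl⟩
      have e2 : x' = H.pos v ∧ (v = S.vl a' ∨ v = S.vr a') := by
        rcases h2 with ⟨h2, rfl⟩ | ⟨h2, rfl⟩
        · exact ⟨param_eq_zero h2, Or.inl rfl⟩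
        · exact ⟨param_eq_one h2, Or.inr rfl⟩
      exact ⟨e1.1.trans e2.1.symm, Or.inr ⟨v, e1.1, e1.2, e2.2⟩⟩
  s_surj g := by
    obtain ⟨a, t, ht, rfl⟩ := S.γ_surj g
    have h := pos_lt (H := H) a
    refine ⟨a, H.pos (S.vl a) + t * (H.pos (S.vr a) - H.pos (S.vl a)), ⟨?_, ?_⟩, ?_⟩
    · nlinarith [ht.1]
    · nlinarith [ht.2]
    · rw [path, add_sub_cancel_left, mul_div_assoc, div_self (by linarith), mul_one]
  exists_edge v := by
    have hv := S.ord_lt v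
    have key : ∀ l : List E, l ≠ [] → ∃ a, a ∈ l := fun l hl => List.exists_mem_of_ne_nil l hl
    rcases S.kind _ hv with ⟨h1, -⟩ | ⟨-, h1⟩ | ⟨h1, -⟩
    · obtain ⟨a, ha⟩ := key _ h1
      exact ⟨a, Or.inr (eq_of_ord_eq ((S.mem_inn _ hv a).1 ha)).symm⟩
    · obtain ⟨a, ha⟩ := key _ (List.ne_nil_of_length_pos (by rw [h1]; exact one_pos))
      exact ⟨a, Or.inl (eq_of_ord_eq ((S.mem_out _ hv a).1 ha)).symm⟩
    · obtain ⟨a, ha⟩ := key _ (List.ne_nil_of_length_pos (by rw [h1]; exact one_pos))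
      exact ⟨a, Or.inr (eq_of_ord_eq ((S.mem_inn _ hv a).1 ha)).symm⟩
  ev_inj v w h := by
    have hW := four_le_period (Y := Y)
    exact eq_of_ord_eq (Nat.eq_of_mul_eq_mul_right (show 0 < period Y by omega) (by simpa using h))
  ev_ne v w h := by
    have hW := four_le_period (Y := Y)
    rcases le_or_gt (S.ord v) (S.ord w) with h1 | h1
    · have := Nat.mul_le_mul_right (period Y) h1
      omega
    · have := Nat.mul_le_mul_right (period Y) (show S.ord w + 1 ≤ S.ord v from h1)
      rw [Nat.add_mul] at this
      omega
  pos_lt := pos_lt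
  lab := H.lab
  edge_time j h1 h2 k hk a h := lab_edge_time h1 h2 ((lab_eq_iff hk).1 h)
  vert_time j h1 h2 k hk v h := lab_vert_time h1 h2 ((lab_eq_iff hk).1 h)
  lab_inj j h1 h2 k hk k' hk' h := by
    rw [lab_eq_iff hk] at h
    exact (List.getElem?_inj hk (nodup_lab h1 h2)).1 (h.trans ((lab_eq_iff hk').1 rfl).symm)
  exists_lab_edge j h1 h2 a h3 h4 := by
    obtain ⟨k, hk⟩ := List.getElem?_of_mem (exists_lab_edge (H := H) h1 h2 h3 h4)
    obtain ⟨hk', -⟩ := List.getElem?_eq_some_iff.1 hk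
    exact ⟨k, hk', (lab_eq_iff hk').2 hk⟩
  exists_lab_vert v h1 h2 := by
    have hk : (S.low (S.ord v)).length < (H.col (S.ord v * period Y + 1)).lab.length := by
      rw [col_ord, length_eventLabels]
      omega
    refine ⟨_, hk, (lab_eq_iff hk).2 ?_⟩
    rw [col_ord, eventLabels_inr]
    exact ⟨rfl, rfl⟩
  compat_iff j h1 h2 k hk k' hk' := by
    simp only [lab_eq_iff hk, lab_eq_iff hk']
    exact (H.col_step h1 h2).compat_iff k hk k' hk'
  first_lt_last := by
    have h1 := four_le_period (Y := Y)
    have h2 := S.two_le_n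
    have : 1 * period Y ≤ (S.n - 1) * period Y := Nat.mul_le_mul_right _ (by omega)
    exact show 2 < (S.n - 1) * period Y by omega
  e₀ := S.st_one.choose
  e₁ := S.st_last.choose
  lab_first := by
    have hW := four_le_period (Y := Y)
    have h : H.col 2 = H.colAt 0 2 := by
      have := H.col_mul_add (i := 0) (show 2 ≤ period Y by omega)
      rwa [Nat.zero_mul, Nat.zero_add] at this
    have h2 : (H.col 2).lab = [Sum.inl S.st_one.choose] := by
      have h3 := S.st_one.choose_spec
      generalize S.st_one.choose = a at h3
      rw [h, H.colAt_two, Nat.zero_add, h3]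
      rfl
    have hk : 0 < (H.col 2).lab.length := by
      rw [h2]
      exact one_pos
    exact (lab_eq_iff hk).2 (by rw [h2]; rfl)
  lab_last := by
    have h := H.col_mul_add (i := S.n - 1) (Nat.zero_le (period Y))
    rw [Nat.add_zero] at h
    have h2 : (H.col ((S.n - 1) * period Y)).lab = [Sum.inl S.st_last.choose] := by
      have h3 := S.st_last.choose_spec
      generalize S.st_last.choose = a at h3
      rw [h, H.colAt_zero, h3]
      rfl
    have hk : 0 < (H.col ((S.n - 1) * period Y)).lab.length := by
      rw [h2]
      exact one_pos
    exact (lab_eq_iff hk).2 (by rw [h2]; rfl)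
  eq_first a h := by
    have hW := four_le_period (Y := Y)
    have hn := S.two_le_n
    have h1 := S.ord_vl_lt a
    have h0 : S.ord (S.vl a) = 0 := by
      by_contra h0
      have := Nat.mul_le_mul_right (period Y) (Nat.pos_of_ne_zero h0)
      have h' : S.ord (S.vl a) * period Y + 1 < 2 := h
      omega
    have h2 := (S.mem_st 1 (by omega) a).2 ⟨by omega, by omega⟩
    rw [S.st_one.choose_spec] at h2
    exact List.mem_singleton.1 h2
  eq_last a h := by
    have hn := S.two_le_n
    have h1 := S.ord_vl_lt a
    have h3 := S.ord_lt (S.vr a)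
    have h0 : S.n - 1 ≤ S.ord (S.vr a) := by
      by_contra h0
      have hW := four_le_period (Y := Y)
      have := Nat.mul_le_mul_right (period Y) (show S.ord (S.vr a) + 1 ≤ S.n - 1 by omega)
      rw [Nat.add_mul] at this
      have h' : (S.n - 1) * period Y < S.ord (S.vr a) * period Y + 1 := h
      omega
    have h2 := (S.mem_st (S.n - 1) (by omega) a).2 ⟨by omega, by omega⟩
    rw [S.st_last.choose_spec] at h2
    exact List.mem_singleton.1 h2
  pos_spec v := by
    have tip : H.ev (S.ord v) ((S.low (S.ord v)).length + 1) =
        H.ev (S.ord v) (S.low (S.ord v)).length + 3 / 2 →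
        ∀ k < (H.col (S.ord v * period Y + 1)).lab.length,
          H.lab (S.ord v * period Y + 1) k = Sum.inr v →
          (H.col (S.ord v * period Y + 1)).p (k + 1) =
            (H.col (S.ord v * period Y + 1)).p k + 3 / 2 := by
      intro h k hk hl
      rw [lab_eq_iff hk, col_ord, eventLabels_inr] at hl
      rw [col_ord, hl.1]
      exact h
    rcases pos_spec (H := H) v with h | ⟨h, ⟨h1, h2, h3, h4, h5⟩ | ⟨h1, h2, h3, h4, h5⟩ | h'⟩
    · exact Or.inl h
    · exact Or.inr ⟨h, Or.inl ⟨h1, h2, h3, h4, tip h5⟩⟩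
    · exact Or.inr ⟨h, Or.inr (Or.inl ⟨h1, h2, h3, h4, tip h5⟩)⟩
    · exact Or.inr ⟨h, Or.inr (Or.inr h')⟩
  room j h1 h2 k hk k' hk' h := by
    rcases (H.col_step h1 h2).room k hk k' hk' h with e | ⟨e1, e2, e3, v, hv, e4⟩ |
      ⟨e1, e2, e3, v, hv, e4⟩
    · exact Or.inl e
    · refine Or.inr (Or.inl ⟨e1, e2, e3, v, (lab_eq_iff hk).2 hv, ?_⟩)
      have hj := lab_vert_time h1 h2.le hv
      subst hj
      have hb := ord_bounds h1 h2.le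
      exact pos_of_inn (by omega) (by omega) e4
    · refine Or.inr (Or.inr ⟨e1, e2, e3, v, (lab_eq_iff hk').2 hv, ?_⟩)
      have hj := lab_vert_time (Nat.le_succ_of_le h1) h2 hv
      have hb := ord_bounds (v := v) (by rw [hj]; exact Nat.le_succ_of_le h1) (by rw [hj]; exact h2)
      rw [show j + 1 = S.ord v * period Y + 1 from hj.symm]
      exact pos_of_out (by omega) (by omega) e4

end Heights

/-- A graph with a sweep is the Reeb graph of a region bounded by circles. -/
theorem exists_circleRegion [T2Space G] [ConnectedSpace G] [Finite E] (S : Sweep V E G) :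
    ∃ R : CircleRegion,
      IsCompact R.manifold ∧ IsConnected R.manifold ∧
      IsRealAlgebraicManifold R.poly R.manifold ∧
      R.proj '' R.manifold = closure R.D ∧
      IsMorseBott R.poly R.manifold R.height ∧
      (R.height '' singularSet R.poly R.manifold R.height).Finite ∧
      Nonempty (ReebSpace (fun p : R.manifold => R.height p) ≃ₜ G) := by
  obtain ⟨Y, ⟨H⟩⟩ := S.exists_heights
  exact H.labelling.exists_circleRegion

end Sweep

/-! ### Drawings without vertical tangents -/

section Filter

variable {α : Type*}

open scoped Classical in
/-- A list sorted by `f` is cut at the value `y`. -/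
theorem filter_lt_append_eq_append_gt (f : α → ℝ) (y : ℝ) {l : List α}
    (h : l.Pairwise fun a b => f a ≤ f b) :
    l.filter (fun a => f a < y) ++ l.filter (fun a => f a = y) ++ l.filter (fun a => y < f a) =
      l := by
  induction l with
  | nil => rfl
  | cons a l ih =>
    rw [List.pairwise_cons] at h
    have ih := ih h.2
    rcases lt_trichotomy (f a) y with h1 | h1 | h1
    · simpa [List.filter_cons, h1, h1.ne, h1.le, not_lt.2 h1.le] using ih
    · have h2 : l.filter (fun b => f b < y) = [] := by
        rw [List.filter_eq_nil_iff]
        intro b hb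
        simpa [← h1] using h.1 b hb
      rw [h2] at ih
      simpa [List.filter_cons, h1, h2] using ih
    · have h2 : l.filter (fun b => f b < y) = [] := by
        rw [List.filter_eq_nil_iff]
        intro b hb
        simpa using h1.le.trans (h.1 b hb)
      have h3 : l.filter (fun b => f b = y) = [] := by
        rw [List.filter_eq_nil_iff]
        intro b hb
        simpa using (h1.trans_le (h.1 b hb)).ne'
      rw [h2, h3] at ih
      simpa [List.filter_cons, h1, h1.ne', not_lt.2 h1.le, h2, h3] using ih

/-- A set in a finite type is listed in the increasing order of a function injective on it. -/
theorem exists_sorted_list [Finite α] (s : Set α) (f : α → ℝ) (hf : Set.InjOn f s) :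
    ∃ l : List α, (∀ a, a ∈ l ↔ a ∈ s) ∧ l.Pairwise fun a b => f a < f b := by
  classical
  let t := s.toFinite.toFinset
  have ht : ∀ a, a ∈ t ↔ a ∈ s := fun a => s.toFinite.mem_toFinset
  have h1 := t.toList.pairwise_insertionSort (fun a b => f a ≤ f b)
  have h2 : (t.toList.insertionSort (fun a b => f a ≤ f b)).Nodup :=
    (List.perm_insertionSort _ _).nodup_iff.2 t.nodup_toList
  have hmem : ∀ a, a ∈ t.toList.insertionSort (fun a b => f a ≤ f b) ↔ a ∈ s := fun a => by
    rw [List.mem_insertionSort, Finset.mem_toList, ht]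
  refine ⟨_, hmem, ?_⟩
  refine (h1.and h2).imp_of_mem fun {a b} ha hb h => lt_of_le_of_ne h.1 fun e => h.2 ?_
  exact hf ((hmem a).1 ha) ((hmem b).1 hb) e

end Filter

/-- A graph drawn in the plane such that its edges are graphs of continuous functions of the first
coordinate. At each vertex, either there are edges on both sides, or there is only one edge. -/
structure Drawing (V E G : Type*) [TopologicalSpace G] where
  /-- the first coordinate -/
  X : G → ℝ
  /-- the second coordinate -/
  Y : G → ℝ
  continuous_Y : Continuous Y
  inj : ∀ g g', X g = X g' → Y g = Y g' → g = g'
  /-- the vertices as points -/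
  vx : V → G
  vx_inj : Function.Injective vx
  /-- the left end point of an edge -/
  vl : E → V
  /-- the right end point of an edge -/
  vr : E → V
  X_lt : ∀ a, X (vx (vl a)) < X (vx (vr a))
  /-- the edges as paths parametrized by the first coordinate -/
  κ : E → ℝ → G
  continuousOn_κ : ∀ a, ContinuousOn (κ a) (Set.Icc (X (vx (vl a))) (X (vx (vr a))))
  X_κ : ∀ a, ∀ x ∈ Set.Icc (X (vx (vl a))) (X (vx (vr a))), X (κ a x) = x
  κ_left : ∀ a, κ a (X (vx (vl a))) = vx (vl a)
  κ_right : ∀ a, κ a (X (vx (vr a))) = vx (vr a)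
  eq_end : ∀ a, ∀ x ∈ Set.Icc (X (vx (vl a))) (X (vx (vr a))), ∀ v, κ a x = vx v →
    v = vl a ∨ v = vr a
  exists_vertex : ∀ a b, a ≠ b → ∀ x ∈ Set.Icc (X (vx (vl a))) (X (vx (vr a))),
    ∀ x' ∈ Set.Icc (X (vx (vl b))) (X (vx (vr b))), κ a x = κ b x' → ∃ v, κ a x = vx v
  surj : ∀ g, ∃ a, ∃ x ∈ Set.Icc (X (vx (vl a))) (X (vx (vr a))), κ a x = g
  both_or_one : ∀ v, ((∃ a, vr a = v) ∧ ∃ a, vl a = v) ∨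
    ∀ a b, (v = vl a ∨ v = vr a) → (v = vl b ∨ v = vr b) → a = b

namespace Drawing

variable {V E G : Type*} [TopologicalSpace G] (D : Drawing V E G)

/-- The interval over which an edge is drawn. -/
def dom (a : E) : Set ℝ := Set.Icc (D.X (D.vx (D.vl a))) (D.X (D.vx (D.vr a)))

/-- The height of an edge over a point. -/
def ht (a : E) (x : ℝ) : ℝ := D.Y (D.κ a x)

theorem continuousOn_ht (a : E) : ContinuousOn (D.ht a) (D.dom a) :=
  D.continuous_Y.comp_continuousOn (D.continuousOn_κ a)

theorem X_mem_dom (a : E) : D.X (D.vx (D.vl a)) ∈ D.dom a ∧ D.X (D.vx (D.vr a)) ∈ D.dom a :=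
  ⟨⟨le_rfl, (D.X_lt a).le⟩, (D.X_lt a).le, le_rfl⟩

theorem ht_left (a : E) : D.ht a (D.X (D.vx (D.vl a))) = D.Y (D.vx (D.vl a)) := by
  rw [ht, D.κ_left]

theorem ht_right (a : E) : D.ht a (D.X (D.vx (D.vr a))) = D.Y (D.vx (D.vr a)) := by
  rw [ht, D.κ_right]

theorem eq_end_of_ht_eq {a : E} {v : V} (h : D.X (D.vx v) ∈ D.dom a)
    (h' : D.ht a (D.X (D.vx v)) = D.Y (D.vx v)) : v = D.vl a ∨ v = D.vr a :=
  D.eq_end a _ h v (D.inj _ _ (D.X_κ a _ h) h')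

/-- Edges do not meet over interior points of their intervals. -/
theorem ht_ne {a b : E} (hab : a ≠ b) {x : ℝ}
    (h : x ∈ Set.Ioo (D.X (D.vx (D.vl a))) (D.X (D.vx (D.vr a)))) (h' : x ∈ D.dom b) :
    D.ht a x ≠ D.ht b x := by
  intro e
  have ha := Set.Ioo_subset_Icc_self h
  obtain ⟨v, hv⟩ := D.exists_vertex a b hab x ha x h'
    (D.inj _ _ ((D.X_κ a x ha).trans (D.X_κ b x h').symm) e)
  have hx := D.X_κ a x ha
  rw [hv] at hx
  rcases D.eq_end a x ha v hv with rfl | rfl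
  · exact h.1.ne hx
  · exact h.2.ne hx.symm

/-- The edge `a` is below the edge `b` over some point. -/
def Below (a b : E) : Prop := a ≠ b ∧ ∃ x ∈ D.dom a ∩ D.dom b, D.ht a x < D.ht b x

variable {D}

/-- An edge below another one over some point is not above it over any point: in between, they would
meet in the interior of an edge. -/
theorem Below.le {a b : E} (h : D.Below a b) {x : ℝ} (hx : x ∈ D.dom a ∩ D.dom b) :
    D.ht a x ≤ D.ht b x := by
  obtain ⟨hab, x₀, hx₀, h⟩ := h
  by_contra! hlt
  have hsub : Set.uIcc x₀ x ⊆ D.dom a ∩ D.dom b := by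
    rw [dom, dom, Set.Icc_inter_Icc]
    rw [dom, dom, Set.Icc_inter_Icc] at hx hx₀
    exact Set.uIcc_subset_Icc hx₀ hx
  have hc : ContinuousOn (fun z => D.ht b z - D.ht a z) (Set.uIcc x₀ x) :=
    ((D.continuousOn_ht b).mono (hsub.trans Set.inter_subset_right)).sub
      ((D.continuousOn_ht a).mono (hsub.trans Set.inter_subset_left))
  obtain ⟨z, hz, hz0⟩ := intermediate_value_uIcc hc
    (show (0 : ℝ) ∈ _ from Set.mem_uIcc.2 (Or.inr ⟨by linarith, by linarith⟩))
  have hz1 : z ≠ x₀ := by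
    rintro rfl
    simp only at hz0
    linarith
  have hz2 : z ≠ x := by
    rintro rfl
    simp only at hz0
    linarith
  refine D.ht_ne hab ?_ (hsub hz).2 (by linarith : D.ht a z = D.ht b z)
  rcases Set.mem_uIcc.1 hz with ⟨h1, h2⟩ | ⟨h1, h2⟩
  · exact ⟨hx₀.1.1.trans_lt (lt_of_le_of_ne h1 hz1.symm), (lt_of_le_of_ne h2 hz2).trans_le hx.1.2⟩
  · exact ⟨hx.1.1.trans_lt (lt_of_le_of_ne h1 hz2.symm), (lt_of_le_of_ne h2 hz1).trans_le hx₀.1.2⟩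

/-- The edges starting at a vertex are listed from bottom to top, in the order of their heights just
to the right of the vertex. -/
theorem exists_out [Finite E] (v : V) :
    ∃ l : List E, (∀ a, a ∈ l ↔ D.vl a = v) ∧ l.Pairwise D.Below := by
  have : ∃ z, D.X (D.vx v) < z ∧ ∀ a, D.vl a = v → z < D.X (D.vx (D.vr a)) := by
    have h1 : ∀ᶠ z in 𝓝[>] D.X (D.vx v), ∀ a, D.vl a = v → z < D.X (D.vx (D.vr a)) := by
      rw [Filter.eventually_all]
      intro a
      by_cases ha : D.vl a = v
      · subst ha
        filter_upwards [mem_nhdsWithin_of_mem_nhds (Iio_mem_nhds (D.X_lt a))] with z hz _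
        exact hz
      · exact Filter.Eventually.of_forall fun z h => absurd h ha
    obtain ⟨z, hz, hz'⟩ := (h1.and self_mem_nhdsWithin).exists
    exact ⟨z, hz', hz⟩
  obtain ⟨z, hz, hz'⟩ := this
  have hmem : ∀ a, D.vl a = v → z ∈ Set.Ioo (D.X (D.vx (D.vl a))) (D.X (D.vx (D.vr a))) :=
    fun a ha => ⟨by rwa [ha], hz' a ha⟩
  obtain ⟨l, hl, hl'⟩ := exists_sorted_list {a | D.vl a = v} (fun a => D.ht a z)
    fun a ha b hb h => by
      by_contra hab
      exact D.ht_ne hab (hmem a ha) (Set.Ioo_subset_Icc_self (hmem b hb)) h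
  refine ⟨l, hl, hl'.imp_of_mem fun {a b} ha hb h => ⟨?_, z, ⟨?_, ?_⟩, h⟩⟩
  · rintro rfl
    exact h.false
  · exact Set.Ioo_subset_Icc_self (hmem a ((hl a).1 ha))
  · exact Set.Ioo_subset_Icc_self (hmem b ((hl b).1 hb))

/-- The lexicographic order of the vertices. -/
theorem exists_ord [Finite V] (D : Drawing V E G) : ∃ (n : ℕ) (φ : V ≃ Fin n), ∀ v w, φ v < φ w ↔
    toLex (D.X (D.vx v), D.Y (D.vx v)) < toLex (D.X (D.vx w), D.Y (D.vx w)) := by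
  classical
  have := Fintype.ofFinite V
  have hinj : Function.Injective fun v => toLex (D.X (D.vx v), D.Y (D.vx v)) := by
    intro v w h
    have h' := Prod.ext_iff.1 (toLex.injective h)
    exact D.vx_inj (D.inj _ _ h'.1 h'.2)
  let _ : LinearOrder V := LinearOrder.lift' _ hinj
  refine ⟨Fintype.card V, (Fintype.orderIsoFinOfCardEq V rfl).symm.toEquiv, fun v w => ?_⟩
  exact (Fintype.orderIsoFinOfCardEq V rfl).symm.lt_iff_lt

/-- A numbering of the vertices of a drawing in lexicographic order, and lists of the edges starting
at each vertex from bottom to top. Vertices on the same vertical line are passed from bottom to top,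
as if the line were slightly tilted. -/
structure Ordered (D : Drawing V E G) where
  /-- the number of vertices -/
  n : ℕ
  /-- the order of the vertices -/
  φ : V ≃ Fin n
  lt_iff : ∀ v w, φ v < φ w ↔
    toLex (D.X (D.vx v), D.Y (D.vx v)) < toLex (D.X (D.vx w), D.Y (D.vx w))
  /-- some vertex -/
  v₀ : V
  /-- the edges starting at a vertex -/
  out : V → List E
  mem_out : ∀ v a, a ∈ out v ↔ D.vl a = v
  pairwise_out : ∀ v, (out v).Pairwise D.Below

namespace Ordered

variable (O : D.Ordered)

/-- The place of a vertex. -/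
def ord (v : V) : ℕ := O.φ v

/-- The vertex at a place. -/
def vtx (i : ℕ) : V := if h : i < O.n then O.φ.symm ⟨i, h⟩ else O.v₀

theorem ord_lt (v : V) : O.ord v < O.n := (O.φ v).isLt

theorem vtx_ord (v : V) : O.vtx (O.ord v) = v := by
  rw [vtx, dif_pos (O.ord_lt v)]
  exact O.φ.symm_apply_apply v

theorem ord_vtx {i : ℕ} (h : i < O.n) : O.ord (O.vtx i) = i := by
  rw [vtx, dif_pos h, ord, O.φ.apply_symm_apply]

theorem ord_lt_iff {v w : V} : O.ord v < O.ord w ↔ D.X (D.vx v) < D.X (D.vx w) ∨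
    D.X (D.vx v) = D.X (D.vx w) ∧ D.Y (D.vx v) < D.Y (D.vx w) := by
  rw [← Prod.Lex.toLex_lt_toLex (x := (D.X (D.vx v), D.Y (D.vx v)))
    (y := (D.X (D.vx w), D.Y (D.vx w))), ← O.lt_iff]
  exact Fin.lt_def.symm

theorem ord_vl_lt (a : E) : O.ord (D.vl a) < O.ord (D.vr a) := O.ord_lt_iff.2 (Or.inl (D.X_lt a))

theorem X_le {v w : V} (h : O.ord v ≤ O.ord w) : D.X (D.vx v) ≤ D.X (D.vx w) := by
  by_contra! h'
  exact absurd (O.ord_lt_iff.2 (Or.inl h')) (by omega)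

open scoped Classical in
/-- The edges of a list below a vertex. -/
noncomputable def low (v : V) (l : List E) : List E :=
  l.filter fun a => D.ht a (D.X (D.vx v)) < D.Y (D.vx v)

open scoped Classical in
/-- The edges of a list through a vertex. -/
noncomputable def inn (v : V) (l : List E) : List E :=
  l.filter fun a => D.ht a (D.X (D.vx v)) = D.Y (D.vx v)

open scoped Classical in
/-- The edges of a list above a vertex. -/
noncomputable def upp (v : V) (l : List E) : List E :=
  l.filter fun a => D.Y (D.vx v) < D.ht a (D.X (D.vx v))

/-- The edges met just before the vertex at place `i`, from bottom to top. -/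
noncomputable def st : ℕ → List E
  | 0 => []
  | i + 1 => low (D := D) (O.vtx i) (st i) ++ O.out (O.vtx i) ++ upp (D := D) (O.vtx i) (st i)

variable {O}

theorem mem_low {v : V} {l : List E} {a : E} : a ∈ low (D := D) v l ↔
    a ∈ l ∧ D.ht a (D.X (D.vx v)) < D.Y (D.vx v) := by
  simp [low]

theorem mem_inn {v : V} {l : List E} {a : E} : a ∈ inn (D := D) v l ↔
    a ∈ l ∧ D.ht a (D.X (D.vx v)) = D.Y (D.vx v) := by
  simp [inn]

theorem mem_upp {v : V} {l : List E} {a : E} : a ∈ upp (D := D) v l ↔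
    a ∈ l ∧ D.Y (D.vx v) < D.ht a (D.X (D.vx v)) := by
  simp [upp]

theorem vtx_mem_dom {i : ℕ} (hi : i < O.n) {a : E} (h : O.ord (D.vl a) < i)
    (h' : i ≤ O.ord (D.vr a)) :
    D.X (D.vx (O.vtx i)) ∈ D.dom a := by
  rw [← O.ord_vtx hi] at h h'
  exact ⟨O.X_le h.le, O.X_le h'⟩

theorem ht_eq_iff {i : ℕ} (hi : i < O.n) {a : E} (h : O.ord (D.vl a) < i)
    (h' : i ≤ O.ord (D.vr a)) :
    D.ht a (D.X (D.vx (O.vtx i))) = D.Y (D.vx (O.vtx i)) ↔ O.ord (D.vr a) = i := by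
  constructor
  · intro e
    rcases D.eq_end_of_ht_eq (vtx_mem_dom hi h h') e with e | e
    · rw [← e, O.ord_vtx hi] at h
      omega
    · rw [← e, O.ord_vtx hi]
  · intro e
    rw [← e, O.vtx_ord, D.ht_right]

theorem st_spec {i : ℕ} (hi : i ≤ O.n) :
    (∀ a, a ∈ O.st i ↔ O.ord (D.vl a) < i ∧ i ≤ O.ord (D.vr a)) ∧ (O.st i).Pairwise D.Below := by
  induction i with
  | zero => exact ⟨fun a => by simp [st], List.Pairwise.nil⟩
  | succ i ih =>
    have hin : i < O.n := hi
    obtain ⟨hm, hp⟩ := ih hin.le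
    have hdom : ∀ a ∈ O.st i, D.X (D.vx (O.vtx i)) ∈ D.dom a := fun a ha =>
      vtx_mem_dom hin ((hm a).1 ha).1 ((hm a).1 ha).2
    have hout : ∀ a ∈ O.out (O.vtx i), D.X (D.vx (O.vtx i)) ∈ D.dom a ∧
        D.ht a (D.X (D.vx (O.vtx i))) = D.Y (D.vx (O.vtx i)) := fun a ha => by
      rw [← (O.mem_out _ a).1 ha]
      exact ⟨(D.X_mem_dom a).1, D.ht_left a⟩
    constructor
    · intro a
      rw [st, List.mem_append, List.mem_append, mem_low, mem_upp, O.mem_out]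
      have hord : D.vl a = O.vtx i ↔ O.ord (D.vl a) = i := by
        constructor
        · intro h
          rw [h, O.ord_vtx hin]
        · intro h
          rw [← h, O.vtx_ord]
      rw [hord]
      have hlt := O.ord_vl_lt a
      constructor
      · rintro ((⟨h1, h2⟩ | h1) | ⟨h1, h2⟩)
        · have h3 := (hm a).1 h1
          have := (ht_eq_iff hin h3.1 h3.2).not.1 h2.ne
          omega
        · omega
        · have h3 := (hm a).1 h1
          have := (ht_eq_iff hin h3.1 h3.2).not.1 h2.ne'
          omega
      · rintro ⟨h1, h2⟩
        rcases (show O.ord (D.vl a) ≤ i by omega).eq_or_lt with h3 | h3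
        · exact Or.inl (Or.inr h3)
        · have h4 := (ht_eq_iff hin h3 (by omega)).not.2 (by omega)
          have h5 := (hm a).2 ⟨h3, by omega⟩
          rcases lt_or_gt_of_ne h4 with h | h
          · exact Or.inl (Or.inl ⟨h5, h⟩)
          · exact Or.inr ⟨h5, h⟩
    · rw [st, List.pairwise_append, List.pairwise_append]
      refine ⟨⟨hp.filter _, O.pairwise_out _, fun a ha b hb => ?_⟩, hp.filter _,
        fun a ha b hb => ?_⟩
      · rw [mem_low] at ha
        obtain ⟨h1, h2⟩ := hout b hb
        rw [← h2] at ha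
        exact ⟨fun h => (h ▸ ha.2).ne rfl, _, ⟨hdom a ha.1, h1⟩, ha.2⟩
      · rw [mem_upp] at hb
        rw [List.mem_append, mem_low] at ha
        have h1 : D.X (D.vx (O.vtx i)) ∈ D.dom a ∧
            D.ht a (D.X (D.vx (O.vtx i))) ≤ D.Y (D.vx (O.vtx i)) := by
          rcases ha with ha | ha
          · exact ⟨hdom a ha.1, ha.2.le⟩
          · exact ⟨(hout a ha).1, (hout a ha).2.le⟩
        have h2 := h1.2.trans_lt hb.2
        exact ⟨fun h => (h ▸ h2).ne rfl, _, ⟨h1.1, hdom b hb.1⟩, h2⟩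

theorem st_eq {i : ℕ} (hi : i < O.n) : O.st i = low (D := D) (O.vtx i) (O.st i) ++
    inn (D := D) (O.vtx i) (O.st i) ++ upp (D := D) (O.vtx i) (O.st i) := by
  obtain ⟨hm, hp⟩ := st_spec (O := O) hi.le
  refine (filter_lt_append_eq_append_gt (fun a => D.ht a (D.X (D.vx (O.vtx i)))) _ ?_).symm
  refine hp.imp_of_mem fun {a b} ha hb h => h.le ⟨?_, ?_⟩
  · exact vtx_mem_dom hi ((hm a).1 ha).1 ((hm a).1 ha).2
  · exact vtx_mem_dom hi ((hm b).1 hb).1 ((hm b).1 hb).2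

theorem nodup_st {i : ℕ} (hi : i ≤ O.n) : (O.st i).Nodup :=
  (st_spec hi).2.imp fun h => h.1

theorem mem_inn_iff {i : ℕ} (hi : i < O.n) (a : E) :
    a ∈ inn (D := D) (O.vtx i) (O.st i) ↔ O.ord (D.vr a) = i := by
  rw [mem_inn, (st_spec hi.le).1]
  have hlt := O.ord_vl_lt a
  constructor
  · rintro ⟨h, h'⟩
    exact (ht_eq_iff hi h.1 h.2).1 h'
  · intro h
    exact ⟨⟨by omega, h.ge⟩, (ht_eq_iff hi (by omega) h.ge).2 h⟩

theorem mem_out_iff {i : ℕ} (hi : i < O.n) (a : E) :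
    a ∈ O.out (O.vtx i) ↔ O.ord (D.vl a) = i := by
  rw [O.mem_out]
  constructor
  · intro h
    rw [h, O.ord_vtx hi]
  · intro h
    rw [← h, O.vtx_ord]

theorem exists_incident (v : V) : ∃ a, v = D.vl a ∨ v = D.vr a := by
  obtain ⟨a, x, hx, h⟩ := D.surj (D.vx v)
  exact ⟨a, D.eq_end a x hx v h⟩

theorem kind {i : ℕ} (hi : i < O.n) :
    (inn (D := D) (O.vtx i) (O.st i) ≠ [] ∧ O.out (O.vtx i) ≠ []) ∨
    (inn (D := D) (O.vtx i) (O.st i) = [] ∧ (O.out (O.vtx i)).length = 1) ∨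
    ((inn (D := D) (O.vtx i) (O.st i)).length = 1 ∧ O.out (O.vtx i) = []) := by
  have hI : ∀ a, a ∈ inn (D := D) (O.vtx i) (O.st i) ↔ D.vr a = O.vtx i := fun a => by
    rw [mem_inn_iff hi]
    constructor
    · intro h
      rw [← h, O.vtx_ord]
    · intro h
      rw [h, O.ord_vtx hi]
  have hone : ∀ (l : List E) a, l.Nodup → (∀ b, b ∈ l ↔ b = a) → l.length = 1 := by
    intro l a hl h
    rcases l with - | ⟨b, t⟩
    · exact absurd ((h a).2 rfl) (by simp)
    · rw [List.nodup_cons] at hl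
      obtain rfl := (h b).1 (by simp)
      have ht : t = [] := List.eq_nil_iff_forall_not_mem.2 fun c hc => by
        obtain rfl := (h c).1 (List.mem_cons_of_mem _ hc)
        exact hl.1 hc
      rw [ht]
      rfl
  have hnI : (inn (D := D) (O.vtx i) (O.st i)).Nodup := (nodup_st hi.le).filter _
  have hnO : (O.out (O.vtx i)).Nodup := (O.pairwise_out _).imp fun h => h.1
  rcases D.both_or_one (O.vtx i) with ⟨⟨a, ha⟩, b, hb⟩ | h
  · exact Or.inl ⟨List.ne_nil_of_mem ((hI a).2 ha), List.ne_nil_of_mem ((O.mem_out _ b).2 hb)⟩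
  · obtain ⟨a, ha⟩ := exists_incident (D := D) (O.vtx i)
    have hlt : D.vl a ≠ D.vr a := fun e => (D.X_lt a).ne (by rw [e])
    rcases ha with ha | ha
    · refine Or.inr (Or.inl ⟨List.eq_nil_iff_forall_not_mem.2 fun b hb => ?_,
        hone _ a hnO fun b => ?_⟩)
      · rw [hI] at hb
        obtain rfl := h a b (Or.inl ha) (Or.inr hb.symm)
        exact hlt (ha.symm.trans hb.symm)
      · rw [O.mem_out]
        exact ⟨fun hb => h b a (Or.inl hb.symm) (Or.inl ha), fun hb => by rw [hb, ha]⟩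
    · refine Or.inr (Or.inr ⟨hone _ a hnI fun b => ?_,
        List.eq_nil_iff_forall_not_mem.2 fun b hb => ?_⟩)
      · rw [hI]
        exact ⟨fun hb => h b a (Or.inr hb.symm) (Or.inr ha), fun hb => by rw [hb, ha]⟩
      · rw [O.mem_out] at hb
        obtain rfl := h a b (Or.inr ha) (Or.inl hb.symm)
        exact hlt (hb.trans ha)

theorem isClosed_image [T2Space G] (D : Drawing V E G) (a : E) : IsClosed (D.κ a '' D.dom a) :=
  (isCompact_Icc.image_of_continuousOn (D.continuousOn_κ a)).isClosed

/-- A vertical line between the first and the last vertex of a connected graph meets an edge: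
otherwise the edges to its left and those to its right form disjoint non-empty closed sets. -/
theorem st_ne_nil [Finite E] [T2Space G] [ConnectedSpace G] {i : ℕ} (h0 : 0 < i) (hi : i < O.n) :
    O.st i ≠ [] := by
  intro h
  have hm := (st_spec (O := O) hi.le).1
  rw [h] at hm
  have hor : ∀ a, O.ord (D.vr a) < i ∨ i ≤ O.ord (D.vl a) := fun a => by
    have := (hm a).not.1 (by simp)
    omega
  set A : Set G := ⋃ a ∈ {a | O.ord (D.vr a) < i}, D.κ a '' D.dom a
  set B : Set G := ⋃ a ∈ {a | i ≤ O.ord (D.vl a)}, D.κ a '' D.dom a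
  have hA : IsClosed A := (Set.toFinite _).isClosed_biUnion fun a _ => isClosed_image D a
  have hB : IsClosed B := (Set.toFinite _).isClosed_biUnion fun a _ => isClosed_image D a
  have hAB : Aᶜ = B := by
    ext g
    simp only [A, B, Set.mem_compl_iff, Set.mem_iUnion, exists_prop, Set.mem_image]
    constructor
    · intro hg
      obtain ⟨a, x, hx, rfl⟩ := D.surj g
      rcases hor a with ha | ha
      · exact absurd ⟨a, ha, x, hx, rfl⟩ hg
      · exact ⟨a, ha, x, hx, rfl⟩
    · rintro ⟨b, hb, x, hx, rfl⟩ ⟨a, ha, x', hx', e⟩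
      have ha' : O.ord (D.vr a) < i := ha
      have hb' : i ≤ O.ord (D.vl b) := hb
      have h1 := O.ord_vl_lt a
      have h2 := O.ord_vl_lt b
      obtain ⟨v, hv⟩ := D.exists_vertex a b (by rintro rfl; omega) x' hx' x hx e
      rcases D.eq_end a x' hx' v hv with rfl | rfl <;>
        rcases D.eq_end b x hx _ (e ▸ hv) with h3 | h3 <;>
          have h4 := congrArg O.ord h3 <;> omega
  have hAe : A.Nonempty := by
    obtain ⟨a, ha⟩ := exists_incident (D := D) (O.vtx 0)
    have h1 := O.ord_vtx (show 0 < O.n by omega)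
    have h2 := O.ord_vl_lt a
    refine ⟨D.κ a _, Set.mem_biUnion (?_ : O.ord (D.vr a) < i)
      (Set.mem_image_of_mem _ (D.X_mem_dom a).1)⟩
    rcases ha with ha | ha <;> rw [ha] at h1 <;> rcases hor a with h3 | h3 <;> omega
  have hBe : B.Nonempty := by
    obtain ⟨a, ha⟩ := exists_incident (D := D) (O.vtx i)
    have h1 := O.ord_vtx hi
    have h2 := O.ord_vl_lt a
    refine ⟨D.κ a _, Set.mem_biUnion (?_ : i ≤ O.ord (D.vl a))
      (Set.mem_image_of_mem _ (D.X_mem_dom a).1)⟩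
    rcases ha with ha | ha <;> rw [ha] at h1 <;> rcases hor a with h3 | h3 <;> omega
  have hcl : IsClopen A := ⟨hA, by rw [← isClosed_compl_iff, hAB]; exact hB⟩
  rcases isClopen_iff.1 hcl with h1 | h1
  · exact hAe.ne_empty h1
  · rw [← hAB, h1, Set.compl_univ] at hBe
    exact hBe.ne_empty rfl

/-- The point of an edge at a proportion `t` of its width. -/
theorem param_mem (a : E) {t : ℝ} (ht : t ∈ Set.Icc (0 : ℝ) 1) :
    D.X (D.vx (D.vl a)) + t * (D.X (D.vx (D.vr a)) - D.X (D.vx (D.vl a))) ∈ D.dom a := by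
  have h := D.X_lt a
  constructor <;> nlinarith [ht.1, ht.2]

theorem param_end {a : E} {t : ℝ} (ht : t ∈ Set.Icc (0 : ℝ) 1) {v : V}
    (hv : D.κ a (D.X (D.vx (D.vl a)) + t * (D.X (D.vx (D.vr a)) - D.X (D.vx (D.vl a)))) = D.vx v) :
    t = 0 ∧ v = D.vl a ∨ t = 1 ∧ v = D.vr a := by
  have h := D.X_lt a
  have hx := D.X_κ a _ (param_mem a ht)
  rw [hv] at hx
  rcases D.eq_end a _ (param_mem a ht) v hv with rfl | rfl
  · refine Or.inl ⟨?_, rfl⟩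
    have : t * (D.X (D.vx (D.vr a)) - D.X (D.vx (D.vl a))) = 0 := by linarith
    rcases mul_eq_zero.1 this with h1 | h1
    · exact h1
    · linarith
  · refine Or.inr ⟨?_, rfl⟩
    have : (t - 1) * (D.X (D.vx (D.vr a)) - D.X (D.vx (D.vl a))) = 0 := by linarith
    rcases mul_eq_zero.1 this with h1 | h1 <;> linarith

/-- The sweep of a drawing. -/
noncomputable def sweep [Finite E] [Nonempty E] [T2Space G] [ConnectedSpace G] (O : D.Ordered) :
    Sweep V E G where
  n := O.n
  ord := O.ord
  vtx := O.vtx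
  ord_lt := O.ord_lt
  vtx_ord := O.vtx_ord
  ord_vtx _ := O.ord_vtx
  vl := D.vl
  vr := D.vr
  ord_vl_lt := O.ord_vl_lt
  st := O.st
  low i := low (D := D) (O.vtx i) (O.st i)
  inn i := inn (D := D) (O.vtx i) (O.st i)
  out i := O.out (O.vtx i)
  upp i := upp (D := D) (O.vtx i) (O.st i)
  st_eq _ := st_eq
  st_succ _ _ := rfl
  nodup _ := nodup_st
  mem_st _ h := (st_spec h).1
  mem_inn _ := mem_inn_iff
  mem_out _ := mem_out_iff
  kind _ := kind
  st_ne _ := st_ne_nil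
  nonempty_edge := inferInstance
  vx := D.vx
  γ a t := D.κ a (D.X (D.vx (D.vl a)) + t * (D.X (D.vx (D.vr a)) - D.X (D.vx (D.vl a))))
  continuousOn_γ a := (D.continuousOn_κ a).comp (by fun_prop) fun _ => param_mem a
  γ_zero a := by rw [zero_mul, add_zero, D.κ_left]
  γ_one a := by rw [one_mul, add_sub_cancel, D.κ_right]
  γ_inj a a' t ht t' ht' h := by
    by_cases haa : a = a'
    · subst haa
      have h1 := D.X_κ a _ (param_mem a ht)
      rw [h, D.X_κ a _ (param_mem a ht')] at h1
      have h2 : (t' - t) * (D.X (D.vx (D.vr a)) - D.X (D.vx (D.vl a))) = 0 := by linarith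
      have h3 := D.X_lt a
      rcases mul_eq_zero.1 h2 with h4 | h4
      · exact Or.inl ⟨rfl, by linarith⟩
      · linarith
    · obtain ⟨v, hv⟩ := D.exists_vertex a a' haa _ (param_mem a ht) _ (param_mem a' ht') h
      exact Or.inr ⟨v, param_end ht hv, param_end ht' (h ▸ hv)⟩
  γ_surj g := by
    obtain ⟨a, x, hx, rfl⟩ := D.surj g
    have h := D.X_lt a
    refine ⟨a, (x - D.X (D.vx (D.vl a))) / (D.X (D.vx (D.vr a)) - D.X (D.vx (D.vl a))),
      ⟨?_, ?_⟩, ?_⟩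
    · exact div_nonneg (by linarith [hx.1]) (by linarith)
    · rw [div_le_one (by linarith)]
      linarith [hx.2]
    · rw [div_mul_cancel₀ _ (by linarith), add_sub_cancel]

end Ordered

theorem exists_ordered [Finite V] [Finite E] [Nonempty E] (D : Drawing V E G) :
    Nonempty D.Ordered := by
  obtain ⟨n, φ, h⟩ := D.exists_ord
  choose out h1 h2 using D.exists_out
  obtain ⟨a⟩ := ‹Nonempty E›
  exact ⟨⟨n, φ, h, D.vl a, out, h1, h2⟩⟩

end Drawing

/-! ### The drawing of a graph -/

section Monotone

/-- Strict monotonicity extends from an open interval to its closure. -/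
theorem strictMonoOn_Icc_of_Ioo {f : ℝ → ℝ} {a b : ℝ} (hc : ContinuousOn f (Set.Icc a b))
    (h : StrictMonoOn f (Set.Ioo a b)) : StrictMonoOn f (Set.Icc a b) := by
  have h1 : ∀ x ∈ Set.Icc a b, ∀ u ∈ Set.Ioo a b, x < u → f x < f u := by
    intro x hx u hu hxu
    obtain ⟨w, hw, hw'⟩ := exists_between hxu
    refine lt_of_le_of_lt ?_ (h ⟨hx.1.trans_lt hw, hw'.trans hu.2⟩ hu hw')
    have hsub : Set.Ioo x w ⊆ Set.Icc a b := fun y hy =>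
      ⟨hx.1.trans hy.1.le, (hy.2.trans (hw'.trans hu.2)).le⟩
    refine ContinuousWithinAt.closure_le (s := Set.Ioo x w)
      (by rw [closure_Ioo hw.ne]; exact ⟨le_rfl, hw.le⟩)
      ((hc x hx).mono hsub) continuousWithinAt_const fun y hy => ?_
    exact (h ⟨hx.1.trans_lt hy.1, hy.2.trans (hw'.trans hu.2)⟩
      ⟨hx.1.trans_lt hw, hw'.trans hu.2⟩ hy.2).le
  have h2 : ∀ u ∈ Set.Ioo a b, ∀ y ∈ Set.Icc a b, u < y → f u < f y := by
    intro u hu y hy huy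
    obtain ⟨w, hw, hw'⟩ := exists_between huy
    refine lt_of_lt_of_le (h hu ⟨hu.1.trans hw, hw'.trans_le hy.2⟩ hw) ?_
    have hsub : Set.Ioo w y ⊆ Set.Icc a b := fun z hz =>
      ⟨(hu.1.trans (hw.trans hz.1)).le, hz.2.le.trans hy.2⟩
    refine ContinuousWithinAt.closure_le (s := Set.Ioo w y)
      (by rw [closure_Ioo hw'.ne]; exact ⟨hw'.le, le_rfl⟩)
      continuousWithinAt_const ((hc y hy).mono hsub) fun z hz => ?_
    exact (h ⟨hu.1.trans hw, hw'.trans_le hy.2⟩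
      ⟨hu.1.trans (hw.trans hz.1), hz.2.trans_le hy.2⟩ hz.1).le
  intro x hx y hy hxy
  obtain ⟨u, hu, hu'⟩ := exists_between hxy
  have hu₀ : u ∈ Set.Ioo a b := ⟨hx.1.trans_lt hu, hu'.trans_le hy.2⟩
  exact (h1 x hx u hu₀ hu).trans (h2 u hu₀ y hy hu')

/-- The inverse of a continuous injective function on a compact set is continuous. -/
theorem continuousOn_of_leftInverse {α β : Type*} [TopologicalSpace α] [TopologicalSpace β]
    [T2Space β] {K : Set α} (hK : IsCompact K) {f : α → β} (hc : ContinuousOn f K)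
    (hi : Set.InjOn f K) {g : β → α} (hg : ∀ x ∈ K, g (f x) = x) : ContinuousOn g (f '' K) := by
  have : CompactSpace K := isCompact_iff_compactSpace.1 hK
  have hemb := (continuousOn_iff_continuous_domRestrict.1 hc).isClosedEmbedding
    (Set.injOn_iff_injective.1 hi)
  rw [continuousOn_iff_continuous_domRestrict]
  have hmem : ∀ y : f '' K, g y ∈ K := by
    rintro ⟨_, x, hx, rfl⟩
    rw [hg x hx]
    exact hx
  have h : Continuous fun y : f '' K => (⟨g y, hmem y⟩ : K) := by
    rw [hemb.isInducing.continuous_iff]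
    refine continuous_subtype_val.congr ?_
    rintro ⟨_, x, hx, rfl⟩
    exact congrArg f (hg x hx).symm
  exact continuous_subtype_val.comp h

end Monotone

section Edges

variable {G : Type*} [TopologicalSpace G] [CWComplex (Set.univ : Set G)]

/-- The closed edges. -/
def closedEdge (i : Edge G) : Set G := RelCWComplex.closedCell (C := (Set.univ : Set G)) 1 i

/-- The characteristic map of an edge, on an interval. -/
def edgeMap (i : Edge G) (t : ℝ) : G := RelCWComplex.map (C := (Set.univ : Set G)) 1 i fun _ => t

theorem norm_const_fin_one (u : Fin 1 → ℝ) : ‖u‖ = |u 0| := by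
  rw [Pi.norm_def]
  simp

theorem const_mem_closedBall {t : ℝ} :
    (fun _ => t : Fin 1 → ℝ) ∈ Metric.closedBall (0 : Fin 1 → ℝ) 1 ↔ t ∈ Set.Icc (-1 : ℝ) 1 := by
  rw [mem_closedBall_zero_iff, norm_const_fin_one, abs_le]
  rfl

theorem const_mem_ball {t : ℝ} :
    (fun _ => t : Fin 1 → ℝ) ∈ Metric.ball (0 : Fin 1 → ℝ) 1 ↔ t ∈ Set.Ioo (-1 : ℝ) 1 := by
  rw [mem_ball_zero_iff, norm_const_fin_one, abs_lt]
  rfl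

theorem continuousOn_edgeMap (i : Edge G) : ContinuousOn (edgeMap i) (Set.Icc (-1) 1) :=
  (RelCWComplex.continuousOn (C := (Set.univ : Set G)) 1 i).comp (by fun_prop) fun _ ht =>
    const_mem_closedBall.2 ht

theorem image_edgeMap (i : Edge G) : edgeMap i '' Set.Icc (-1) 1 = closedEdge i := by
  ext g
  constructor
  · rintro ⟨t, ht, rfl⟩
    exact ⟨_, const_mem_closedBall.2 ht, rfl⟩
  · rintro ⟨u, hu, rfl⟩
    have hu' : u = fun _ => u 0 := by
      ext k
      rw [Subsingleton.elim k 0]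
    rw [hu'] at hu ⊢
    exact ⟨u 0, const_mem_closedBall.1 hu, rfl⟩

theorem edgeMap_mem_openCell {i : Edge G} {t : ℝ} (ht : t ∈ Set.Ioo (-1 : ℝ) 1) :
    edgeMap i t ∈ RelCWComplex.openCell (C := (Set.univ : Set G)) 1 i :=
  ⟨_, const_mem_ball.2 ht, rfl⟩

theorem vertexPoint_eq (v : Vert G) :
    vertexPoint v = RelCWComplex.map (C := (Set.univ : Set G)) 0 v ![] :=
  congrArg (RelCWComplex.map (C := (Set.univ : Set G)) 0 v) (Subsingleton.elim 0 ![])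

theorem vertexPoint_injective : Function.Injective (vertexPoint (G := G)) := by
  intro v w h
  rw [vertexPoint_eq, vertexPoint_eq] at h
  exact RelCWComplex.injective_map_zero (C := (Set.univ : Set G)) h

theorem mem_cellFrontier_iff {i : Edge G} {g : G} :
    g ∈ RelCWComplex.cellFrontier (C := (Set.univ : Set G)) 1 i ↔
      g = edgeMap i (-1) ∨ g = edgeMap i 1 := by
  rw [RelCWComplex.cellFrontier_one_eq, Set.image_pair]
  exact Iff.rfl

theorem exists_vertexPoint_eq {i : Edge G} {g : G}
    (h : g ∈ RelCWComplex.cellFrontier (C := (Set.univ : Set G)) 1 i) : ∃ v, vertexPoint v = g := by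
  obtain ⟨x, y, hxy⟩ := CWComplex.exists_cellFrontier_one_eq (C := (Set.univ : Set G)) i
  have h' : g ∈ RelCWComplex.closedCell (C := (Set.univ : Set G)) 0 x ∪
      RelCWComplex.closedCell (C := (Set.univ : Set G)) 0 y := hxy ▸ h
  rw [RelCWComplex.closedCell_zero_eq_singleton, RelCWComplex.closedCell_zero_eq_singleton] at h'
  rcases h' with h' | h'
  · exact ⟨x, (vertexPoint_eq x).trans h'.symm⟩
  · exact ⟨y, (vertexPoint_eq y).trans h'.symm⟩

theorem mem_closedEdge {i : Edge G} {g : G} (h : g ∈ closedEdge i) :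
    g ∈ RelCWComplex.cellFrontier (C := (Set.univ : Set G)) 1 i ∨
      g ∈ RelCWComplex.openCell (C := (Set.univ : Set G)) 1 i := by
  rw [closedEdge, ← RelCWComplex.cellFrontier_union_openCell_eq_closedCell] at h
  exact h

theorem vertexPoint_notMem_openCell (v : Vert G) (i : Edge G) :
    vertexPoint v ∉ RelCWComplex.openCell (C := (Set.univ : Set G)) 1 i := by
  intro h
  have h' : vertexPoint v ∈ RelCWComplex.openCell (C := (Set.univ : Set G)) 0 v :=
    RelCWComplex.map_zero_mem_openCell 0 v
  refine Set.disjoint_left.1 (RelCWComplex.disjoint_openCell_of_ne (C := (Set.univ : Set G))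
    (i := v) (j := i) ?_) h' h
  simp

theorem exists_vertexPoint_of_mem {a b : Edge G} (hab : a ≠ b) {g : G} (ha : g ∈ closedEdge a)
    (hb : g ∈ closedEdge b) : ∃ v, g = vertexPoint v := by
  rcases mem_closedEdge ha with h1 | h1
  · obtain ⟨v, hv⟩ := exists_vertexPoint_eq h1
    exact ⟨v, hv.symm⟩
  rcases mem_closedEdge hb with h2 | h2
  · obtain ⟨v, hv⟩ := exists_vertexPoint_eq h2
    exact ⟨v, hv.symm⟩
  · refine absurd h2 (Set.disjoint_left.1 (RelCWComplex.disjoint_openCell_of_ne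
      (C := (Set.univ : Set G)) (i := a) (j := b) ?_) h1)
    simpa using hab

theorem isClosed_closedEdge [T2Space G] (i : Edge G) : IsClosed (closedEdge i) :=
  RelCWComplex.isClosed_closedCell

/-- The closed edges cover a graph: they form a closed set whose complement, a finite set of
vertices, is closed as well. -/
theorem exists_mem_closedEdge [T2Space G] (hG : IsGraph G) (g : G) : ∃ i, g ∈ closedEdge i := by
  have := hG.connected
  have := hG.finite_edge
  have := hG.finite_vert
  set A : Set G := ⋃ i, closedEdge i
  have hA : IsClosed A := isClosed_iUnion_of_finite isClosed_closedEdge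
  have hsub : Aᶜ ⊆ Set.range vertexPoint := by
    intro g hg
    have h : g ∈ ⋃ (n : ℕ) (j : RelCWComplex.cell (Set.univ : Set G) n),
        RelCWComplex.openCell (C := (Set.univ : Set G)) n j := by
      rw [CWComplex.iUnion_openCell_eq_complex]
      trivial
    simp only [Set.mem_iUnion] at h
    obtain ⟨n, j, h⟩ := h
    match n, j, h with
    | 0, j, h =>
      rw [RelCWComplex.openCell_zero_eq_singleton] at h
      exact ⟨j, (vertexPoint_eq j).trans h.symm⟩
    | 1, j, h =>
      exact absurd (Set.mem_iUnion.2 ⟨j, RelCWComplex.openCell_subset_closedCell 1 j h⟩) hg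
    | n + 2, j, h => exact ((hG.no_higher_cell (n + 2) (by omega)).false j).elim
  have hA' : IsClosed Aᶜ := ((Set.finite_range vertexPoint).subset hsub).isClosed
  have hcl : IsClopen A := ⟨hA, isClosed_compl_iff.1 hA'⟩
  obtain ⟨i⟩ := hG.exists_edge
  rcases isClopen_iff.1 hcl with h | h
  · have h1 : edgeMap i 0 ∈ A := Set.mem_iUnion.2 ⟨i, by
      rw [← image_edgeMap]
      exact Set.mem_image_of_mem _ (by norm_num)⟩
    rw [h] at h1
    exact h1.elim
  · have h1 : g ∈ A := by
      rw [h]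
      trivial
    exact Set.mem_iUnion.1 h1

/-- An edge on whose interior a continuous function is injective is parametrized by this function,
between two vertices. -/
theorem exists_section (i : Edge G) {X : G → ℝ} (hX : Continuous X)
    (hinj : Set.InjOn X (RelCWComplex.openCell (C := (Set.univ : Set G)) 1 i))
    (hi : Set.InjOn (RelCWComplex.map (C := (Set.univ : Set G)) 1 i) (Metric.closedBall 0 1)) :
    ∃ (l r : Vert G) (κ : ℝ → G), X (vertexPoint l) < X (vertexPoint r) ∧
      ContinuousOn κ (Set.Icc (X (vertexPoint l)) (X (vertexPoint r))) ∧
      (∀ x ∈ Set.Icc (X (vertexPoint l)) (X (vertexPoint r)), X (κ x) = x ∧ κ x ∈ closedEdge i) ∧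
      (∀ g ∈ closedEdge i, X g ∈ Set.Icc (X (vertexPoint l)) (X (vertexPoint r)) ∧ κ (X g) = g) ∧
      (∀ v, vertexPoint v ∈ closedEdge i ↔ v = l ∨ v = r) := by
  have hm : Set.InjOn (edgeMap i) (Set.Icc (-1) 1) := by
    intro t ht t' ht' h
    exact congrFun (hi (const_mem_closedBall.2 ht) (const_mem_closedBall.2 ht') h) 0
  have hinj' : Set.InjOn (fun t => X (edgeMap i t)) (Set.Ioo (-1) 1) := by
    intro t ht t' ht' h
    exact hm (Set.Ioo_subset_Icc_self ht) (Set.Ioo_subset_Icc_self ht')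
      (hinj (edgeMap_mem_openCell ht) (edgeMap_mem_openCell ht') h)
  have hcont : ContinuousOn (fun t => X (edgeMap i t)) (Set.Icc (-1) 1) :=
    hX.comp_continuousOn (continuousOn_edgeMap i)
  -- The edge is oriented so that the function increases.
  obtain ⟨q, hq, hqi, hqf⟩ : ∃ q : ℝ → G, StrictMonoOn (fun t => X (q t)) (Set.Icc (-1) 1) ∧
      q '' Set.Icc (-1) 1 = closedEdge i ∧ ∀ g,
        g ∈ RelCWComplex.cellFrontier (C := (Set.univ : Set G)) 1 i ↔ g = q (-1) ∨ g = q 1 := by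
    rcases (hcont.mono Set.Ioo_subset_Icc_self).strictMonoOn_of_injOn_Ioo (by norm_num)
      hinj' with h | h
    · exact ⟨edgeMap i, strictMonoOn_Icc_of_Ioo hcont h, image_edgeMap i,
        fun g => mem_cellFrontier_iff⟩
    · have h1 : StrictMonoOn (fun t => X (edgeMap i (-t))) (Set.Icc (-1) 1) := by
        refine strictMonoOn_Icc_of_Ioo (hcont.comp (by fun_prop) fun t ht => ?_)
          fun t ht t' ht' hlt => ?_
        · exact ⟨by linarith [ht.2], by linarith [ht.1]⟩
        · exact h ⟨by linarith [ht'.2], by linarith [ht'.1]⟩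
            ⟨by linarith [ht.2], by linarith [ht.1]⟩ (neg_lt_neg hlt)
      refine ⟨fun t => edgeMap i (-t), h1, ?_, fun g => ?_⟩
      · rw [← image_edgeMap, ← Set.image_image (edgeMap i) (fun t => -t), Set.image_neg_eq_neg,
          Set.neg_Icc, neg_neg]
      · rw [mem_cellFrontier_iff]
        simp only [neg_neg]
        exact or_comm
  obtain ⟨l, hl⟩ := exists_vertexPoint_eq ((hqf (q (-1))).2 (Or.inl rfl))
  obtain ⟨r, hr⟩ := exists_vertexPoint_eq ((hqf (q 1)).2 (Or.inr rfl))
  have hm1 : (-1 : ℝ) ∈ Set.Icc (-1 : ℝ) 1 := by norm_num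
  have h1 : (1 : ℝ) ∈ Set.Icc (-1 : ℝ) 1 := by norm_num
  have hXi : Set.InjOn X (closedEdge i) := by
    rw [← hqi]
    rintro _ ⟨t, ht, rfl⟩ _ ⟨t', ht', rfl⟩ h
    rw [hq.injOn ht ht' h]
  have hcomp : IsCompact (closedEdge i) := by
    rw [← image_edgeMap]
    exact isCompact_Icc.image_of_continuousOn (continuousOn_edgeMap i)
  have hconn : IsPreconnected (closedEdge i) := by
    rw [← image_edgeMap]
    exact isPreconnected_Icc.image _ (continuousOn_edgeMap i)
  have hsub : ∀ g ∈ closedEdge i, X g ∈ Set.Icc (X (vertexPoint l)) (X (vertexPoint r)) := by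
    rw [← hqi, hl, hr]
    rintro _ ⟨t, ht, rfl⟩
    exact ⟨hq.monotoneOn hm1 ht ht.1, hq.monotoneOn ht h1 ht.2⟩
  have himg : X '' closedEdge i = Set.Icc (X (vertexPoint l)) (X (vertexPoint r)) := by
    refine Set.Subset.antisymm (Set.image_subset_iff.2 hsub) ?_
    refine (hconn.image X hX.continuousOn).Icc_subset ?_ ?_
    · rw [hl, ← hqi]
      exact Set.mem_image_of_mem _ (Set.mem_image_of_mem _ hm1)
    · rw [hr, ← hqi]
      exact Set.mem_image_of_mem _ (Set.mem_image_of_mem _ h1)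
  have hne : Nonempty G := ⟨vertexPoint l⟩
  have hinv : ∀ g ∈ closedEdge i, Function.invFunOn X (closedEdge i) (X g) = g := fun g hg =>
    hXi.leftInvOn_invFunOn hg
  refine ⟨l, r, Function.invFunOn X (closedEdge i), ?_, ?_, fun x hx => ?_,
    fun g hg => ⟨hsub g hg, hinv g hg⟩,
    fun v => ?_⟩
  · rw [hl, hr]
    exact hq hm1 h1 (by norm_num)
  · rw [← himg]
    exact continuousOn_of_leftInverse hcomp hX.continuousOn hXi hinv
  · rw [← himg] at hx
    obtain ⟨g, hg, rfl⟩ := hx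
    rw [hinv g hg]
    exact ⟨rfl, hg⟩
  · constructor
    · intro h
      rcases mem_closedEdge h with h | h
      · rw [hqf, ← hl, ← hr] at h
        exact h.imp (fun h => vertexPoint_injective h) fun h => vertexPoint_injective h
      · exact absurd h (vertexPoint_notMem_openCell v i)
    · rintro (rfl | rfl)
      · rw [hl, ← hqi]
        exact Set.mem_image_of_mem _ hm1
      · rw [hr, ← hqi]
        exact Set.mem_image_of_mem _ h1

/-- Near a vertex, the graph consists of edges containing it. -/
theorem eventually_closedEdge [T2Space G] (hG : IsGraph G) (v : Vert G) :
    ∀ᶠ g in 𝓝 (vertexPoint v), ∀ i, g ∈ closedEdge i → vertexPoint v ∈ closedEdge i := by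
  have := hG.finite_edge
  rw [Filter.eventually_all]
  intro i
  by_cases h : vertexPoint v ∈ closedEdge i
  · exact Filter.Eventually.of_forall fun _ _ => h
  · filter_upwards [(isClosed_closedEdge i).isOpen_compl.mem_nhds h] with g hg hg'
    exact absurd hg' hg

/-- An M-generic embedding is a drawing: genericity makes the edges graphs of functions, and
M-genericity makes the edges at a vertex of degree at least `2` leave on both sides. -/
theorem exists_drawing [T2Space G] (hG : IsGraph G) {e : G → EuclideanSpace ℝ (Fin 2)}
    (he : IsPiecewiseSmoothEmbedding e) (hgen : IsMGeneric e) :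
    Nonempty (Drawing (Vert G) (Edge G) G) := by
  have hfin := hG.finite_edge
  have hec := he.isEmbedding.continuous
  have hX : Continuous fun g => proj21 (e g) := by
    unfold proj21
    fun_prop
  have hinj : ∀ i, Set.InjOn (fun g => proj21 (e g))
      (RelCWComplex.openCell (C := (Set.univ : Set G)) 1 i) := fun i =>
    Set.injOn_iff_injective.2 (hgen.generic i).2.injective
  choose vl vr κ hlt hκ hκX hκe hend using fun i => exists_section i hX (hinj i) (hG.closed_edge i)
  have hleft : ∀ a, κ a (proj21 (e (vertexPoint (vl a)))) = vertexPoint (vl a) := fun a =>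
    (hκe a _ ((hend a _).2 (Or.inl rfl))).2
  have hright : ∀ a, κ a (proj21 (e (vertexPoint (vr a)))) = vertexPoint (vr a) := fun a =>
    (hκe a _ ((hend a _).2 (Or.inr rfl))).2
  refine ⟨{
    X := fun g => proj21 (e g)
    Y := fun g => e g 1
    continuous_Y := by fun_prop
    inj := fun g g' h h' => he.isEmbedding.injective (by
      ext k
      fin_cases k
      · exact h
      · exact h')
    vx := vertexPoint
    vx_inj := vertexPoint_injective
    vl := vl
    vr := vr
    X_lt := hlt
    κ := κ
    continuousOn_κ := hκ
    X_κ := fun a x hx => (hκX a x hx).1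
    κ_left := hleft
    κ_right := hright
    eq_end := fun a x hx v h => (hend a v).1 (h ▸ (hκX a x hx).2)
    exists_vertex := fun a b hab x hx x' hx' h =>
      exists_vertexPoint_of_mem hab (hκX a x hx).2 (h ▸ (hκX b x' hx').2)
    surj := fun g => by
      obtain ⟨a, ha⟩ := exists_mem_closedEdge hG g
      exact ⟨a, _, hκe a g ha⟩
    both_or_one := fun v => ?_ }⟩
  rcases le_or_gt 2 (degree v) with hd | hd
  · left
    have hint := hgen.interior v hd _ (eventually_closedEdge hG v)
    constructor
    · by_contra! hno
      have hsub : (fun p => proj21 (e p)) ''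
          {g | ∀ i, g ∈ closedEdge i → vertexPoint v ∈ closedEdge i} ⊆
          Set.Ici (proj21 (e (vertexPoint v))) := by
        rintro _ ⟨g, hg, rfl⟩
        obtain ⟨a, ha⟩ := exists_mem_closedEdge hG g
        rcases (hend a v).1 (hg a ha) with h | h
        · rw [h]
          exact (hκe a g ha).1.1
        · exact absurd h.symm (hno a)
      have := interior_mono hsub hint
      rw [interior_Ici] at this
      exact lt_irrefl _ (Set.mem_Ioi.1 this)
    · by_contra! hno
      have hsub : (fun p => proj21 (e p)) ''
          {g | ∀ i, g ∈ closedEdge i → vertexPoint v ∈ closedEdge i} ⊆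
          Set.Iic (proj21 (e (vertexPoint v))) := by
        rintro _ ⟨g, hg, rfl⟩
        obtain ⟨a, ha⟩ := exists_mem_closedEdge hG g
        rcases (hend a v).1 (hg a ha) with h | h
        · exact absurd h.symm (hno a)
        · rw [h]
          exact (hκe a g ha).1.2
      have := interior_mono hsub hint
      rw [interior_Iic] at this
      exact lt_irrefl _ (Set.mem_Iio.1 this)
  · right
    intro a b ha hb
    exact (Set.ncard_le_one (Set.toFinite _)).1 (Nat.lt_succ_iff.1 hd) a ((hend a v).2 ha) b
      ((hend b v).2 hb)

end Edges

end ReebPlanar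

theorem theorem1 {G : Type*} [TopologicalSpace G] [T2Space G]
    [Topology.CWComplex (Set.univ : Set G)] (hG : ReebPlanar.IsGraph G)
    (e : G → EuclideanSpace ℝ (Fin 2)) (he : ReebPlanar.IsPiecewiseSmoothEmbedding e)
    (hgen : ReebPlanar.IsMGeneric e) :
    ∃ R : ReebPlanar.CircleRegion,
      IsCompact R.manifold ∧ IsConnected R.manifold ∧
      ReebPlanar.IsRealAlgebraicManifold R.poly R.manifold ∧
      R.proj '' R.manifold = closure R.D ∧
      ReebPlanar.IsMorseBott R.poly R.manifold R.height ∧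
      (R.height '' ReebPlanar.singularSet R.poly R.manifold R.height).Finite ∧
      Nonempty (ReebPlanar.ReebSpace (fun p : R.manifold => R.height p) ≃ₜ G) := by
  have := hG.finite_vert
  have := hG.finite_edge
  have := hG.exists_edge
  have := hG.connected
  obtain ⟨D⟩ := ReebPlanar.exists_drawing hG he hgen
  obtain ⟨O⟩ := D.exists_ordered
  exact O.sweep.exists_circleRegion
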